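/- Let $n\ge 3$, let $M$ be a closed (compact, boundaryless) smooth $n$-dimensional manifold and let $\bar g$ be a smooth Riemannian metric on $M$ with $\mathrm{Ric}_{\bar g}=(n-1)\lambda\,\bar g$ for a real constant $\lambda\neq 0$. For a metric $g$ let $S_g=\mathrm{Ric}_g-\frac{R_g}{2(n-1)}g$ be its Schouten tensor and let $\sigma_k(g)$ be the $k$-th elementary symmetric function of the eigenvalues of $g^{-1}S_g$ (with $\sigma_0=1$). Let $k,l,p,q$ be integers with $0\le l<k\le n$ and $0\le p,q\le n$, put $\alpha=2(k-l)$, $\beta=n-2(p-q)$, and let $$\mathcal H_{\bar g}(g)=\Big[\int_M\frac{\sigma_p(g)}{\sigma_q(g)}\,dv_g\Big]^{\alpha}\Big[\int_M\frac{\sigma_k(g)}{\sigma_l(g)}\,dv_{\bar g}\Big]^{\beta}.$$ Let $h$ be a smooth symmetric 2-tensor field on $M$ of the form $h=\mathring h+\frac1n(\mathrm{tr}_{\bar g}h)\,\bar g$, where $\mathring h$ is a smooth symmetric 2-tensor field with $\mathrm{tr}_{\bar g}\mathring h=0$ and $\delta_{\bar g}\mathring h=0$, where $(\delta_{\bar g}\mathring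 h)_i=\nabla^j\mathring h_{ij}$. Write $u=\mathrm{tr}_{\bar g}h$, $\bar u=\mathrm{Vol}_{\bar g}^{-1}\int_M u\,dv_{\bar g}$, and let $\Delta_E\mathring h=\Delta_{\bar g}\mathring h+2\,\mathrm{Rm}_{\bar g}\mathring h$ be the Einstein operator, where $\Delta_{\bar g}$ is the connection Laplacian $\bar g^{ab}\nabla_a\nabla_b$, $(\mathrm{Rm}_{\bar g}\mathring h)_{jk}=R_{ijkl}\mathring h^{il}$, and the sign convention is $R_{jk}=\bar g^{il}R_{ijkl}$ for the Ricci tensor. Then $\mathcal H_{\bar g}(\bar g)\neq 0$, the function $t\mapsto\mathcal H_{\bar g}(\bar g+th)$ is $C^2$ near $t=0$, and its second derivative $D^2\mathcal H_{\bar g}(\bar g)(h,h)$ at $t=0$ satisfies $$\begin{aligned} \mathcal H_{\bar g}(\bar g)^{-1}\,\mathrm{Vol}_{\bar g}\,D^2\mathcal H_{\bar g}(\bar g)(h,h) ={}&-\frac{\alpha\left[\beta(k+l)+2(p^2-q^2)-n\right]}{2n(n-1)(n-2)^2\lambda^2}\int_M|\Delta_E\mathring h|^2\,dv_{\bar g}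 +\frac{\alpha}{4(n-1)\lambda}\int_M\mathring h\cdot\Delta_E\mathring h\,dv_{\bar g}\\ &-\frac{\alpha\left[2(p-q)(q-l)+nl\right]}{n^4\lambda^2}\int_M\left[(\Delta_{\bar g}u)^2-n\lambda|\nabla u|^2\right]dv_{\bar g}\\ &-\frac{\alpha\beta(\alpha+\beta)}{4n^3\lambda}\int_M\left[|\nabla u|^2-n\lambda(u-\bar u)^2\right]dv_{\bar g}. \end{aligned}$$ -/

import Mathlib

open MeasureTheory
open scoped Manifold ContDiff

noncomputable section

namespace QuotientCurvature

/-- The model space `ℝⁿ`, with its Euclidean norm and its Lebesgue measure. -/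
abbrev Rn (n : ℕ) : Type := EuclideanSpace ℝ (Fin n)

/-! ### Riemannian geometry of matrix-valued functions on `ℝⁿ`

In this section `G : ℝⁿ → Mat` is the component matrix `g_{ij}` of a Riemannian metric in a
coordinate system and `T : ℝⁿ → Mat` the component matrix of a symmetric 2-tensor. All objects
depend only on the germs of `G` and `T` at the point where they are evaluated. -/

namespace Coord

variable {n : ℕ}

/-- The `i`-th partial derivative of `f` at `y`. -/
def pd (i : Fin n) (f : Rn n → ℝ) (y : Rn n) : ℝ :=
  fderiv ℝ f y (EuclideanSpace.single i 1)

/-- The Christoffel symbols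
`Γ^m_{ij} = ½ g^{ma} (∂_i g_{ja} + ∂_j g_{ia} - ∂_a g_{ij})`. -/
def christoffel (G : Rn n → Matrix (Fin n) (Fin n) ℝ) (m i j : Fin n) (y : Rn n) : ℝ :=
  (1 / 2) * ∑ a, (G y)⁻¹ m a *
    (pd i (fun z => G z j a) y + pd j (fun z => G z i a) y - pd a (fun z => G z i j) y)

/-- The components `R_{ijk}^m` of the curvature: `R(∂_i, ∂_j) ∂_k = R_{ijk}^m ∂_m`, where
`R(X, Y) Z = ∇_X ∇_Y Z - ∇_Y ∇_X Z - ∇_{[X, Y]} Z`. -/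
def riemannUp (G : Rn n → Matrix (Fin n) (Fin n) ℝ) (i j k m : Fin n) (y : Rn n) : ℝ :=
  pd i (christoffel G m j k) y - pd j (christoffel G m i k) y
    + ∑ a, (christoffel G m i a y * christoffel G a j k y
      - christoffel G m j a y * christoffel G a i k y)

/-- `R_{ijkl} = g_{ml} R_{ijk}^m`. -/
def riemann (G : Rn n → Matrix (Fin n) (Fin n) ℝ) (i j k l : Fin n) (y : Rn n) : ℝ :=
  ∑ m, G y m l * riemannUp G i j k m y

/-- The Ricci tensor `R_{jk} = g^{il} R_{ijkl}`. -/
def ricci (G : Rn n → Matrix (Fin n) (Fin n) ℝ) (y : Rn n) : Matrix (Fin n) (Fin n) ℝ :=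
  Matrix.of fun j k => ∑ i, ∑ l, (G y)⁻¹ i l * riemann G i j k l y

/-- The trace `g^{ij} T_{ij}`. -/
def trace (G T : Rn n → Matrix (Fin n) (Fin n) ℝ) (y : Rn n) : ℝ :=
  ∑ i, ∑ j, (G y)⁻¹ i j * T y i j

/-- The scalar curvature. -/
def scalar (G : Rn n → Matrix (Fin n) (Fin n) ℝ) (y : Rn n) : ℝ :=
  trace G (ricci G) y

/-- The Schouten tensor, normalized as `S_{ij} = R_{ij} - R / (2 (n - 1)) g_{ij}`. -/
def schouten (G : Rn n → Matrix (Fin n) (Fin n) ℝ) (y : Rn n) : Matrix (Fin n) (Fin n) ℝ :=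
  ricci G y - (scalar G y / (2 * ((n : ℝ) - 1))) • G y

/-- The generalized Kronecker delta: `1` (resp. `-1`) if the `i_a` are distinct and `(j_a)` is an
even (resp. odd) permutation of `(i_a)`, and `0` otherwise. -/
def kroneckerDelta {k : ℕ} (i j : Fin k → Fin n) : ℝ :=
  open scoped Classical in
  if Function.Injective i then
    ∑ s : Equiv.Perm (Fin k), if j = i ∘ s then ((Equiv.Perm.sign s : ℤ) : ℝ) else 0
  else 0

/-- The `k`-th elementary symmetric function of (the eigenvalues of) the matrix `W = (W^i_j)`:
`(1 / k!) δ^{j_1 ⋯ j_k}_{i_1 ⋯ i_k} W^{i_1}_{j_1} ⋯ W^{i_k}_{j_k}`. -/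
def elemSymm (k : ℕ) (W : Matrix (Fin n) (Fin n) ℝ) : ℝ :=
  (1 / (k.factorial : ℝ)) *
    ∑ i : Fin k → Fin n, ∑ j : Fin k → Fin n, kroneckerDelta i j * ∏ a, W (i a) (j a)

/-- The `σ_k`-curvature: `elemSymm k` of `S^i_j = g^{im} S_{mj}`. -/
def sigma (k : ℕ) (G : Rn n → Matrix (Fin n) (Fin n) ℝ) (y : Rn n) : ℝ :=
  elemSymm k ((G y)⁻¹ * schouten G y)

/-- The Laplace-Beltrami operator `Δ u = g^{ij} (∂_i ∂_j u - Γ^a_{ij} ∂_a u)`. -/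
def laplacian (G : Rn n → Matrix (Fin n) (Fin n) ℝ) (u : Rn n → ℝ) (y : Rn n) : ℝ :=
  ∑ i, ∑ j, (G y)⁻¹ i j * (pd i (pd j u) y - ∑ a, christoffel G a i j y * pd a u y)

/-- `|∇ u|² = g^{ij} ∂_i u ∂_j u`. -/
def gradSq (G : Rn n → Matrix (Fin n) (Fin n) ℝ) (u : Rn n → ℝ) (y : Rn n) : ℝ :=
  ∑ i, ∑ j, (G y)⁻¹ i j * (pd i u y * pd j u y)

/-- The covariant derivative `∇_a T_{ij}`. -/
def covDeriv (G T : Rn n → Matrix (Fin n) (Fin n) ℝ) (a i j : Fin n) (y : Rn n) : ℝ :=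
  pd a (fun z => T z i j) y
    - ∑ m, (christoffel G m a i y * T y m j + christoffel G m a j y * T y i m)

/-- The second covariant derivative `∇_b ∇_a T_{ij} = (∇∇T)(∂_b, ∂_a, ∂_i, ∂_j)`. -/
def covDeriv2 (G T : Rn n → Matrix (Fin n) (Fin n) ℝ) (b a i j : Fin n) (y : Rn n) : ℝ :=
  pd b (covDeriv G T a i j) y
    - ∑ m, (christoffel G m b a y * covDeriv G T m i j y
      + christoffel G m b i y * covDeriv G T a m j y
      + christoffel G m b j y * covDeriv G T a i m y)

/-- The divergence `(δ T)_i = g^{ja} ∇_a T_{ij}`. -/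
def divergence (G T : Rn n → Matrix (Fin n) (Fin n) ℝ) (i : Fin n) (y : Rn n) : ℝ :=
  ∑ j, ∑ a, (G y)⁻¹ j a * covDeriv G T a i j y

/-- The action of the curvature on 2-tensors, `(Rm T)_{jk} = R_{ijkl} T^{il}`
(so that `Rm g = Ric`). -/
def curvAction (G T : Rn n → Matrix (Fin n) (Fin n) ℝ) (y : Rn n) (j k : Fin n) : ℝ :=
  ∑ i, ∑ l, riemann G i j k l y *
    ∑ a, ∑ b, (G y)⁻¹ i a * (G y)⁻¹ l b * T y a b

/-- The Einstein operator `Δ_E T = g^{ba} ∇_b ∇_a T + 2 Rm T` on 2-tensors. -/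
def einsteinOp (G T : Rn n → Matrix (Fin n) (Fin n) ℝ) (y : Rn n) :
    Matrix (Fin n) (Fin n) ℝ :=
  Matrix.of fun i j =>
    (∑ b, ∑ a, (G y)⁻¹ b a * covDeriv2 G T b a i j y) + 2 * curvAction G T y i j

/-- The inner product of 2-tensors, `g^{ia} g^{jb} T_{ij} U_{ab}`. -/
def tensorInner (G T U : Rn n → Matrix (Fin n) (Fin n) ℝ) (y : Rn n) : ℝ :=
  ∑ i, ∑ j, ∑ a, ∑ b, (G y)⁻¹ i a * (G y)⁻¹ j b * T y i j * U y a b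

end Coord

/-! ### Tensor fields on a manifold -/

section Manifold

variable {n : ℕ} {M : Type*} [TopologicalSpace M] [ChartedSpace (Rn n) M]

variable (n M) in
/-- (Not necessarily smooth) sections of the bundle of bilinear forms on the tangent spaces. -/
abbrev TensorField : Type _ :=
  Π x : M, TangentSpace (𝓡 n) x →L[ℝ] TangentSpace (𝓡 n) x →L[ℝ] ℝ

/-- `T` is a smooth symmetric 2-tensor field, i.e. `T ∈ S₂(M)`. -/
structure IsSmoothSymm [IsManifold (𝓡 n) ∞ M] (T : TensorField n M) : Prop where
  symm : ∀ (x : M) (v w : TangentSpace (𝓡 n) x), T x v w = T x w v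
  smooth : ContMDiff (𝓡 n) ((𝓡 n).prod 𝓘(ℝ, Rn n →L[ℝ] Rn n →L[ℝ] ℝ)) ∞
    (fun x ↦ Bundle.TotalSpace.mk' (Rn n →L[ℝ] Rn n →L[ℝ] ℝ)
      (E := fun x : M ↦ TangentSpace (𝓡 n) x →L[ℝ] TangentSpace (𝓡 n) x →L[ℝ] ℝ) x (T x))

/-- The components `T(∂_i, ∂_j)` of `T` in the chart centered at `c`, as a function on `ℝⁿ`
(meaningful on the target of the chart). -/
def comp (T : TensorField n M) (c : M) (y : Rn n) : Matrix (Fin n) (Fin n) ℝ :=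
  Matrix.of fun i j =>
    T ((chartAt (Rn n) c).symm y)
      (mfderiv (𝓡 n) (𝓡 n) (chartAt (Rn n) c).symm y (EuclideanSpace.single i (1 : ℝ)))
      (mfderiv (𝓡 n) (𝓡 n) (chartAt (Rn n) c).symm y (EuclideanSpace.single j (1 : ℝ)))

/-- A function on `M` read in the chart centered at `c`. -/
def read (u : M → ℝ) (c : M) (y : Rn n) : ℝ :=
  u ((chartAt (Rn n) c).symm y)

/-! Coordinate-invariant scalars are evaluated at `x` in the chart centered at `x`. -/

/-- The trace `tr_g T`. -/
def tr (g T : TensorField n M) (x : M) : ℝ :=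
  Coord.trace (comp g x) (comp T x) (chartAt (Rn n) x x)

/-- The `σ_k`-curvature of `g`. -/
def sigma (k : ℕ) (g : TensorField n M) (x : M) : ℝ :=
  Coord.sigma k (comp g x) (chartAt (Rn n) x x)

/-- The Laplace-Beltrami operator `Δ_g u`. -/
def laplacian (g : TensorField n M) (u : M → ℝ) (x : M) : ℝ :=
  Coord.laplacian (comp g x) (read u x) (chartAt (Rn n) x x)

/-- `|∇ u|²_g`. -/
def gradSq (g : TensorField n M) (u : M → ℝ) (x : M) : ℝ :=
  Coord.gradSq (comp g x) (read u x) (chartAt (Rn n) x x)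

/-- `T · Δ_E T`. -/
def innerEinsteinOp (g T : TensorField n M) (x : M) : ℝ :=
  Coord.tensorInner (comp g x) (comp T x) (Coord.einsteinOp (comp g x) (comp T x))
    (chartAt (Rn n) x x)

/-- `|Δ_E T|²`. -/
def normSqEinsteinOp (g T : TensorField n M) (x : M) : ℝ :=
  Coord.tensorInner (comp g x) (Coord.einsteinOp (comp g x) (comp T x))
    (Coord.einsteinOp (comp g x) (comp T x)) (chartAt (Rn n) x x)

/-- `Ric_g = (n - 1) lam g`, in every chart of the atlas. -/
def IsEinstein (g : TensorField n M) (lam : ℝ) : Prop :=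
  ∀ c : M, ∀ y ∈ (chartAt (Rn n) c).target,
    Coord.ricci (comp g c) y = (((n : ℝ) - 1) * lam) • comp g c y

/-- `T ∈ S₂^TT(M)`: a smooth symmetric 2-tensor field with `δ_g T = 0` and `tr_g T = 0`. -/
structure IsTT [IsManifold (𝓡 n) ∞ M] (g T : TensorField n M) : Prop where
  smoothSymm : IsSmoothSymm T
  divergence_eq_zero : ∀ c : M, ∀ y ∈ (chartAt (Rn n) c).target, ∀ i,
    Coord.divergence (comp g c) (comp T c) i y = 0
  trace_eq_zero : ∀ x : M, tr g T x = 0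

variable (n M) in
/-- A smooth partition of unity subordinate to the domains of the charts. -/
def chartPartition [IsManifold (𝓡 n) ∞ M] [CompactSpace M] [T2Space M] :
    SmoothPartitionOfUnity M (𝓡 n) M Set.univ :=
  (SmoothPartitionOfUnity.exists_isSubordinate_chartAt_source (𝓡 n) M).choose

/-- The Riemannian volume measure `dv_g`: in the chart centered at `c` it is
`√(det g_{ij}) dy`, and these local measures are glued with a partition of unity. -/
def volumeMeasure [IsManifold (𝓡 n) ∞ M] [CompactSpace M] [T2Space M] [MeasurableSpace M]
    (g : TensorField n M) : Measure M :=
  Measure.sum fun c : M =>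
    ((((volume : Measure (Rn n)).restrict (chartAt (Rn n) c).target).withDensity
      fun y => ENNReal.ofReal (Real.sqrt (comp g c y).det)).map
        (chartAt (Rn n) c).symm).withDensity
          fun x => ENNReal.ofReal (chartPartition n M c x)

/-- The functional
`H_{g₀}(g) = (∫ σ_p(g) / σ_q(g) dv_g)^{2(k-l)} (∫ σ_k(g) / σ_l(g) dv_{g₀})^{n-2(p-q)}`. -/
def functionalH [IsManifold (𝓡 n) ∞ M] [CompactSpace M] [T2Space M] [MeasurableSpace M]
    (k l p q : ℕ) (g₀ g : TensorField n M) : ℝ :=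
  (∫ x, sigma p g x / sigma q g x ∂(volumeMeasure g)) ^ (2 * ((k : ℤ) - l)) *
    (∫ x, sigma k g x / sigma l g x ∂(volumeMeasure g₀)) ^ ((n : ℤ) - 2 * ((p : ℤ) - q))

end Manifold

end QuotientCurvature

end

/-! Put $c=(n-1)\lambda$, $v=u/n$ and $g_t=\bar g+th$, so that $h=\mathring h+v\bar g$. At $t=0$ the
endomorphism $W_t=g_t^{-1}S_{g_t}$ is $c_0=(n-2)\lambda/2$ times the identity. Expanding the
generating polynomial $\det(1+xW_t)$ at such a point shows that the 2-jet of $\sigma_k$ involves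
only $\mathrm{tr}\,W'$, $\mathrm{tr}\,W'^2$ and $\mathrm{tr}\,W''$
(`Coord.deriv_deriv_elemSymm_umbilic`). Since $\mathrm{tr}\,W_t$ is a constant multiple of the
scalar curvature $R$ for all small $t$, these reduce to $R'$, $R''$ and the squared norm of the
trace-free part of the derivative of the Ricci endomorphism
(`Coord.IsEinsteinLine.hasRelJet_sigma`).

The first-order data come from $\mathrm{Ric}'=-\frac12\Delta_E\mathring h+c\,\mathring
h-\frac{n-2}2\mathrm{Hess}\,v-\frac12(\Delta v)\bar g$ (`Coord.hasMDerivAt_ricci`). This is computed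
at the centre of normal coordinates and carried to arbitrary coordinates by the transformation laws
of the connection and the curvature.

The second variation of the curvature is never computed pointwise. Only $\int R''$ is needed, and
$R'+\langle\mathrm{Ric},h\rangle$ is a divergence for every metric $g_t$ near $\bar g$;
differentiating the vanishing of its $dv_{g_t}$-integral yields $\int R''$
(`IsEinsteinVariation.integral_scalarSecondDeriv`). In the same way, the Einstein tensor being
divergence-free gives $\int\langle\mathrm{Ric}-\frac R2g,\mathrm{Hess}_gf\rangle\,dv_g=0$ for every
metric, and this identity is differentiated at $\bar g$
(`IsEinsteinVariation.integral_hess_pairing`). In the direction $\mathring h$ with $f=v$ it gives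
$\int\langle\Delta_E\mathring h,\mathrm{Hess}\,v\rangle=0$; in the direction $h$ with $f=v$ it then
gives Bochner's formula $\int|\mathrm{Hess}\,v|^2=\int(\Delta v)^2-c\int|\nabla v|^2$. Thus neither
commuting $\Delta_E$ with the divergence nor a separate Bochner argument is required.

The analytic input is the divergence theorem for the glued measure (`integral_trace_formDeriv`), the
density of $dv_{g_t}$ with respect to $dv_{\bar g}$ (`integral_volumeMeasure_eq`), and
differentiation under the integral sign, made uniform by compactness
(`IsSmoothFamily.hasDerivAt_integral`).

Finally, jets are recorded relative to the value of the function (`HasRelJet`), so that products,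
quotients and integer powers need no bookkeeping of constants, whatever the sign of $\lambda$. With
$m$ the mean of $v$, the relative first derivatives of the two integrals are $\frac\beta2m$ and
$-\frac\alpha2m$. They cancel in $\alpha b_1+\beta b_2$, and their squares leave
$-\frac14\alpha\beta(\alpha+\beta)m^2$, which is the source of the $\bar u$ term. The remaining
terms are matched by `secondVariation_identity`, where the contributions of $\int|\mathring h|^2$
cancel. -/

noncomputable section

namespace QuotientCurvature

namespace Coord

variable {n : ℕ}

/-! ### Calculus of partial derivatives and of matrix-valued functions -/

section Smooth

variable {E : Type*} [NormedAddCommGroup E] [NormedSpace ℝ E]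

/-- The entries of the matrix-valued function `A` are smooth at `y`. -/
def MSm (A : E → Matrix (Fin n) (Fin n) ℝ) (y : E) : Prop :=
  ∀ i j, ContDiffAt ℝ ∞ (fun z => A z i j) y

theorem MSm.add {A B : E → Matrix (Fin n) (Fin n) ℝ} {y : E} (hA : MSm A y) (hB : MSm B y) :
    MSm (fun z => A z + B z) y := fun i j => (hA i j).add (hB i j)

theorem MSm.sub {A B : E → Matrix (Fin n) (Fin n) ℝ} {y : E} (hA : MSm A y) (hB : MSm B y) :
    MSm (fun z => A z - B z) y := fun i j => (hA i j).sub (hB i j)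

theorem MSm.transpose {A : E → Matrix (Fin n) (Fin n) ℝ} {y : E} (hA : MSm A y) :
    MSm (fun z => (A z).transpose) y := fun i j => hA j i

theorem MSm.const (A : Matrix (Fin n) (Fin n) ℝ) (y : E) : MSm (fun _ => A) y :=
  fun _ _ => contDiffAt_const

theorem MSm.mul {A B : E → Matrix (Fin n) (Fin n) ℝ} {y : E} (hA : MSm A y) (hB : MSm B y) :
    MSm (fun z => A z * B z) y := fun i j => by
  simp only [Matrix.mul_apply]
  exact ContDiffAt.sum fun k _ => (hA i k).mul (hB k j)

theorem MSm.smul {f : E → ℝ} {A : E → Matrix (Fin n) (Fin n) ℝ} {y : E}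
    (hf : ContDiffAt ℝ ∞ f y) (hA : MSm A y) : MSm (fun z => f z • A z) y := fun i j => by
  simp only [Matrix.smul_apply, smul_eq_mul]
  exact hf.mul (hA i j)

theorem MSm.sum {ι : Type*} {s : Finset ι} {A : ι → E → Matrix (Fin n) (Fin n) ℝ} {y : E}
    (hA : ∀ k ∈ s, MSm (A k) y) : MSm (fun z => ∑ k ∈ s, A k z) y := fun i j => by
  simp only [Matrix.sum_apply]
  exact ContDiffAt.sum fun k hk => hA k hk i j

theorem MSm.det {A : E → Matrix (Fin n) (Fin n) ℝ} {y : E} (hA : MSm A y) :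
    ContDiffAt ℝ ∞ (fun z => (A z).det) y := by
  simp only [Matrix.det_apply']
  exact ContDiffAt.sum fun s _ => contDiffAt_const.mul (contDiffAt_prod fun i _ => hA _ _)

/-- Cramer's rule: an entry of the inverse is a determinant of entries divided by $\det A$. -/
theorem MSm.inv {A : E → Matrix (Fin n) (Fin n) ℝ} {y : E} (hA : MSm A y)
    (hd : (A y).det ≠ 0) : MSm (fun z => (A z)⁻¹) y := fun i j => by
  simp only [Matrix.inv_def, Matrix.smul_apply, smul_eq_mul, Ring.inverse_eq_inv',
    Matrix.adjugate_apply]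
  refine (hA.det.inv hd).mul (MSm.det fun a b => ?_)
  by_cases h : a = j
  · subst h; simpa using contDiffAt_const
  · simpa [Matrix.updateRow_ne h] using hA a b

theorem MSm.congr {A B : E → Matrix (Fin n) (Fin n) ℝ} {y : E} (hA : MSm A y)
    (h : B =ᶠ[nhds y] A) : MSm B y := fun i j =>
  (hA i j).congr_of_eventuallyEq (h.mono fun z hz => by simp only [hz])

theorem MSm.comp {E' : Type*} [NormedAddCommGroup E'] [NormedSpace ℝ E']
    {A : E → Matrix (Fin n) (Fin n) ℝ} {f : E' → E} {z : E'} (hA : MSm A (f z))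
    (hf : ContDiffAt ℝ ∞ f z) : MSm (fun w => A (f w)) z := fun i j =>
  (hA i j).comp z hf

end Smooth

theorem contDiffAt_pd {f : Rn n → ℝ} {y : Rn n} (hf : ContDiffAt ℝ ∞ f y) (i : Fin n) :
    ContDiffAt ℝ ∞ (pd i f) y :=
  (hf.fderiv_right (m := ∞) (by simp)).clm_apply contDiffAt_const

theorem diff_of_smooth {E : Type*} [NormedAddCommGroup E] [NormedSpace ℝ E]
    {f : E → ℝ} {y : E} (hf : ContDiffAt ℝ ∞ f y) : DifferentiableAt ℝ f y :=
  hf.differentiableAt (by simp)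

theorem pd_congr {f g : Rn n → ℝ} {y : Rn n} (h : f =ᶠ[nhds y] g) (i : Fin n) :
    pd i f y = pd i g y := by
  rw [pd, pd, h.fderiv_eq]

theorem pd_congr_eventually {f g : Rn n → ℝ} {y : Rn n} (h : f =ᶠ[nhds y] g) (i : Fin n) :
    pd i f =ᶠ[nhds y] pd i g :=
  h.eventuallyEq_nhds.mono fun _ hz => pd_congr hz i

theorem pd_add {f g : Rn n → ℝ} {y : Rn n} (hf : ContDiffAt ℝ ∞ f y) (hg : ContDiffAt ℝ ∞ g y)
    (i : Fin n) : pd i (fun z => f z + g z) y = pd i f y + pd i g y := by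
  simp [pd, fderiv_fun_add (diff_of_smooth hf) (diff_of_smooth hg)]

theorem pd_sub {f g : Rn n → ℝ} {y : Rn n} (hf : ContDiffAt ℝ ∞ f y) (hg : ContDiffAt ℝ ∞ g y)
    (i : Fin n) : pd i (fun z => f z - g z) y = pd i f y - pd i g y := by
  simp [pd, fderiv_fun_sub (diff_of_smooth hf) (diff_of_smooth hg)]

theorem pd_mul {f g : Rn n → ℝ} {y : Rn n} (hf : ContDiffAt ℝ ∞ f y) (hg : ContDiffAt ℝ ∞ g y)
    (i : Fin n) : pd i (fun z => f z * g z) y = pd i f y * g y + f y * pd i g y := by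
  simp [pd, fderiv_fun_mul (diff_of_smooth hf) (diff_of_smooth hg)]
  ring

theorem pd_const (c : ℝ) (y : Rn n) (i : Fin n) : pd i (fun _ => c) y = 0 := by
  simp [pd]

theorem pd_const_mul {f : Rn n → ℝ} {y : Rn n} (c : ℝ) (hf : ContDiffAt ℝ ∞ f y)
    (i : Fin n) : pd i (fun z => c * f z) y = c * pd i f y := by
  rw [pd_mul contDiffAt_const hf, pd_const]; ring

theorem pd_sum {ι : Type*} {s : Finset ι} {f : ι → Rn n → ℝ} {y : Rn n}
    (hf : ∀ k ∈ s, ContDiffAt ℝ ∞ (f k) y) (i : Fin n) :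
    pd i (fun z => ∑ k ∈ s, f k z) y = ∑ k ∈ s, pd i (f k) y := by
  simp [pd, fderiv_fun_sum fun k hk => diff_of_smooth (hf k hk)]

theorem two_le_smooth : (2 : WithTop ℕ∞) ≤ ∞ :=
  show ((2 : ℕ∞) : WithTop ℕ∞) ≤ ((⊤ : ℕ∞) : WithTop ℕ∞) from WithTop.coe_le_coe.2 le_top

theorem pd_comm {f : Rn n → ℝ} {y : Rn n} (hf : ContDiffAt ℝ ∞ f y) (i j : Fin n) :
    pd i (pd j f) y = pd j (pd i f) y := by
  have h1 : IsSymmSndFDerivAt ℝ f y := hf.isSymmSndFDerivAt (by simpa using two_le_smooth)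
  have hd : DifferentiableAt ℝ (fderiv ℝ f) y :=
    (hf.fderiv_right (m := ∞) (by simp)).differentiableAt (by simp)
  have key : ∀ a b : Fin n, pd a (pd b f) y =
      fderiv ℝ (fderiv ℝ f) y (EuclideanSpace.single a 1) (EuclideanSpace.single b 1) := by
    intro a b
    have : pd b f = fun z => fderiv ℝ f z (EuclideanSpace.single b 1) := rfl
    rw [pd, this, fderiv_clm_apply hd (differentiableAt_const _)]
    simp
  rw [key, key]
  exact h1 _ _

/-- The Jacobian matrix `∂_i ψ^a`. -/
def jac (ψ : Rn n → Rn n) (z : Rn n) : Matrix (Fin n) (Fin n) ℝ :=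
  Matrix.of fun a i => pd i (fun w => ψ w a) z

theorem contDiffAt_coord {ψ : Rn n → Rn n} {z : Rn n} (hψ : ContDiffAt ℝ ∞ ψ z) (a : Fin n) :
    ContDiffAt ℝ ∞ (fun w => ψ w a) z :=
  (contDiffAt_piLp 2).1 hψ a

theorem fderiv_single {ψ : Rn n → Rn n} {z : Rn n} (hψ : ContDiffAt ℝ ∞ ψ z) (i : Fin n) :
    fderiv ℝ ψ z (EuclideanSpace.single i 1)
      = ∑ a, jac ψ z a i • EuclideanSpace.single a (1 : ℝ) := by
  have hd : DifferentiableAt ℝ ψ z := hψ.differentiableAt (by simp)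
  ext b
  have : pd i (fun w => ψ w b) z = (fderiv ℝ ψ z (EuclideanSpace.single i 1)) b := by
    have h := ((EuclideanSpace.proj b : Rn n →L[ℝ] ℝ).hasFDerivAt.comp z hd.hasFDerivAt).fderiv
    have h2 : (⇑(EuclideanSpace.proj b : Rn n →L[ℝ] ℝ) ∘ ψ) = fun w => ψ w b := rfl
    rw [h2] at h
    rw [pd, h]; rfl
  rw [← this]
  simp [jac, Pi.single_apply]

theorem pd_comp {f : Rn n → ℝ} {ψ : Rn n → Rn n} {z : Rn n} (hf : ContDiffAt ℝ ∞ f (ψ z))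
    (hψ : ContDiffAt ℝ ∞ ψ z) (i : Fin n) :
    pd i (fun w => f (ψ w)) z = ∑ a, jac ψ z a i * pd a f (ψ z) := by
  have h := fderiv_comp z (diff_of_smooth hf) (hψ.differentiableAt (by simp))
  have h2 : (fun w => f (ψ w)) = f ∘ ψ := rfl
  rw [pd, h2, h, ContinuousLinearMap.comp_apply, fderiv_single hψ]
  simp [pd]

/-- The entrywise partial derivative of a matrix-valued function. -/
def mpd (i : Fin n) (A : Rn n → Matrix (Fin n) (Fin n) ℝ) (y : Rn n) :
    Matrix (Fin n) (Fin n) ℝ :=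
  Matrix.of fun a b => pd i (fun z => A z a b) y

theorem mpd_apply (i : Fin n) (A : Rn n → Matrix (Fin n) (Fin n) ℝ) (y : Rn n) (a b : Fin n) :
    mpd i A y a b = pd i (fun z => A z a b) y := rfl

section Matrix

variable {A B : Rn n → Matrix (Fin n) (Fin n) ℝ} {y : Rn n}

theorem MSm.mpd (hA : MSm A y) (i : Fin n) : MSm (mpd i A) y := fun a b =>
  contDiffAt_pd (hA a b) i

theorem mpd_congr (h : A =ᶠ[nhds y] B) (i : Fin n) : mpd i A y = mpd i B y := by
  ext a b
  exact pd_congr (h.mono fun z hz => by simp only [hz]) i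

theorem mpd_congr_on {U : Set (Rn n)} (hU : IsOpen U) (h : ∀ z ∈ U, A z = B z) (hy : y ∈ U)
    (i : Fin n) : mpd i A y = mpd i B y :=
  mpd_congr (Filter.eventuallyEq_of_mem (hU.mem_nhds hy) h) i

theorem mpd_add (hA : MSm A y) (hB : MSm B y) (i : Fin n) :
    mpd i (fun z => A z + B z) y = mpd i A y + mpd i B y := by
  ext a b; exact pd_add (hA a b) (hB a b) i

theorem mpd_sub (hA : MSm A y) (hB : MSm B y) (i : Fin n) :
    mpd i (fun z => A z - B z) y = mpd i A y - mpd i B y := by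
  ext a b; exact pd_sub (hA a b) (hB a b) i

theorem mpd_mul (hA : MSm A y) (hB : MSm B y) (i : Fin n) :
    mpd i (fun z => A z * B z) y = mpd i A y * B y + A y * mpd i B y := by
  ext a b
  simp only [mpd_apply, Matrix.add_apply, Matrix.mul_apply]
  rw [pd_sum fun k _ => (hA a k).mul (hB k b), ← Finset.sum_add_distrib]
  exact Finset.sum_congr rfl fun k _ => pd_mul (hA a k) (hB k b) i

theorem mpd_smul {f : Rn n → ℝ} (hf : ContDiffAt ℝ ∞ f y) (hA : MSm A y) (i : Fin n) :
    mpd i (fun z => f z • A z) y = pd i f y • A y + f y • mpd i A y := by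
  ext a b; exact pd_mul hf (hA a b) i

theorem mpd_sum {ι : Type*} {s : Finset ι} {A : ι → Rn n → Matrix (Fin n) (Fin n) ℝ}
    (hA : ∀ k ∈ s, MSm (A k) y) (i : Fin n) :
    mpd i (fun z => ∑ k ∈ s, A k z) y = ∑ k ∈ s, mpd i (A k) y := by
  ext a b
  simp only [mpd_apply, Matrix.sum_apply]
  exact pd_sum (fun k hk => hA k hk a b) i

theorem mpd_transpose (i : Fin n) :
    mpd i (fun z => (A z).transpose) y = (mpd i A y).transpose := rfl

theorem mpd_const (C : Matrix (Fin n) (Fin n) ℝ) (i : Fin n) : mpd i (fun _ => C) y = 0 := by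
  ext a b; exact pd_const _ y i

theorem mpd_comm (hA : MSm A y) (i j : Fin n) : mpd i (mpd j A) y = mpd j (mpd i A) y := by
  ext a b; exact pd_comm (hA a b) i j

theorem mpd_comp {ψ : Rn n → Rn n} {z : Rn n} (hA : MSm A (ψ z)) (hψ : ContDiffAt ℝ ∞ ψ z)
    (i : Fin n) : mpd i (fun w => A (ψ w)) z = ∑ a, jac ψ z a i • mpd a A (ψ z) := by
  ext a b
  simp only [mpd_apply, Matrix.sum_apply, Matrix.smul_apply, smul_eq_mul]
  exact pd_comp (hA a b) hψ i

/-- Differentiate $A^{-1}A=1$, which holds on a neighbourhood because the determinant stays nonzero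
there. -/
theorem mpd_inv (hA : MSm A y) (hd : (A y).det ≠ 0) (i : Fin n) :
    mpd i (fun z => (A z)⁻¹) y = -((A y)⁻¹ * mpd i A y * (A y)⁻¹) := by
  have hne : ∀ᶠ z in nhds y, (A z).det ≠ 0 :=
    hA.det.continuousAt.eventually_ne hd
  have h1 : mpd i (fun z => (A z)⁻¹ * A z) y = 0 := by
    rw [mpd_congr (B := fun _ => 1) (hne.mono fun z hz =>
      Matrix.nonsing_inv_mul _ (isUnit_iff_ne_zero.2 hz)), mpd_const]
  rw [mpd_mul (hA.inv hd) hA] at h1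
  have hu := isUnit_iff_ne_zero.2 hd
  calc mpd i (fun z => (A z)⁻¹) y
      = (mpd i (fun z => (A z)⁻¹) y * A y) * (A y)⁻¹ := by
        rw [Matrix.mul_assoc, Matrix.mul_nonsing_inv _ hu, Matrix.mul_one]
    _ = _ := by rw [eq_neg_of_add_eq_zero_left h1, Matrix.neg_mul]

theorem MSm.jac {ψ : Rn n → Rn n} {z : Rn n} (hψ : ContDiffAt ℝ ∞ ψ z) : MSm (jac ψ) z :=
  fun a i => contDiffAt_pd (contDiffAt_coord hψ a) i

end Matrix

end Coord

namespace Coord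

variable {n : ℕ}

/-! ### Metrics, the Levi-Civita connection and its curvature as matrices -/

/-- `G` is the component matrix of a smooth Riemannian metric on the open set `U`. -/
structure IsMetricOn (G : Rn n → Matrix (Fin n) (Fin n) ℝ) (U : Set (Rn n)) : Prop where
  smooth : ∀ z ∈ U, MSm G z
  posDef : ∀ z ∈ U, (G z).PosDef

section

variable {G : Rn n → Matrix (Fin n) (Fin n) ℝ} {U : Set (Rn n)} {y : Rn n}

theorem IsMetricOn.det_pos (hG : IsMetricOn G U) (hy : y ∈ U) : 0 < (G y).det :=
  (hG.posDef y hy).det_pos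

theorem IsMetricOn.det_ne (hG : IsMetricOn G U) (hy : y ∈ U) : (G y).det ≠ 0 :=
  (hG.det_pos hy).ne'

theorem IsMetricOn.isUnit (hG : IsMetricOn G U) (hy : y ∈ U) : IsUnit (G y).det :=
  isUnit_iff_ne_zero.2 (hG.det_ne hy)

theorem IsMetricOn.transpose (hG : IsMetricOn G U) (hy : y ∈ U) : (G y).transpose = G y := by
  simpa using (hG.posDef y hy).isHermitian.eq

theorem IsMetricOn.symm (hG : IsMetricOn G U) (hy : y ∈ U) (i j : Fin n) : G y i j = G y j i :=
  congrFun (congrFun (hG.transpose hy).symm i) j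

theorem IsMetricOn.inv_transpose (hG : IsMetricOn G U) (hy : y ∈ U) :
    ((G y)⁻¹).transpose = (G y)⁻¹ := by
  rw [Matrix.transpose_nonsing_inv, hG.transpose hy]

theorem IsMetricOn.inv_symm (hG : IsMetricOn G U) (hy : y ∈ U) (i j : Fin n) :
    (G y)⁻¹ i j = (G y)⁻¹ j i :=
  congrFun (congrFun (hG.inv_transpose hy).symm i) j

theorem IsMetricOn.smooth_inv (hG : IsMetricOn G U) (hy : y ∈ U) : MSm (fun z => (G z)⁻¹) y :=
  (hG.smooth y hy).inv (hG.det_ne hy)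

/-- The connection matrices `(Γ_i)^m_j`. -/
def chr (G : Rn n → Matrix (Fin n) (Fin n) ℝ) (i : Fin n) (y : Rn n) :
    Matrix (Fin n) (Fin n) ℝ :=
  Matrix.of fun m j => christoffel G m i j y

theorem contDiffAt_christoffel (h : MSm G y) (hd : (G y).det ≠ 0) (m i j : Fin n) :
    ContDiffAt ℝ ∞ (christoffel G m i j) y := by
  unfold christoffel
  refine contDiffAt_const.mul (ContDiffAt.sum fun a _ => (h.inv hd m a).mul ?_)
  exact ((contDiffAt_pd (h j a) i).add (contDiffAt_pd (h i a) j)).sub (contDiffAt_pd (h i j) a)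

theorem MSm.chr (h : MSm G y) (hd : (G y).det ≠ 0) (i : Fin n) : MSm (chr G i) y :=
  fun m j => contDiffAt_christoffel h hd m i j

theorem IsMetricOn.smooth_chr (hG : IsMetricOn G U) (hy : y ∈ U) (i : Fin n) : MSm (chr G i) y :=
  (hG.smooth y hy).chr (hG.det_ne hy) i

theorem IsMetricOn.pd_symm (hG : IsMetricOn G U) (hU : IsOpen U) (hy : y ∈ U) (a i j : Fin n) :
    pd a (fun z => G z i j) y = pd a (fun z => G z j i) y :=
  pd_congr (Filter.eventuallyEq_of_mem (hU.mem_nhds hy) fun _ hz => hG.symm hz i j) a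

theorem christoffel_symm (hG : IsMetricOn G U) (hU : IsOpen U) (hy : y ∈ U) (m i j : Fin n) :
    christoffel G m i j y = christoffel G m j i y := by
  unfold christoffel
  congr 1
  refine Finset.sum_congr rfl fun a _ => ?_
  rw [hG.pd_symm hU hy a i j]; ring

/-- The Koszul formula. -/
theorem sum_metric_christoffel (hG : IsMetricOn G U) (hy : y ∈ U) (a i j : Fin n) :
    ∑ m, G y a m * christoffel G m i j y = (1 / 2) *
      (pd i (fun z => G z j a) y + pd j (fun z => G z i a) y - pd a (fun z => G z i j) y) := by
  set v : Fin n → ℝ := fun a =>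
    pd i (fun z => G z j a) y + pd j (fun z => G z i a) y - pd a (fun z => G z i j) y
  have h1 : (fun m => christoffel G m i j y) = (1 / 2 : ℝ) • (((G y)⁻¹).mulVec v) := by
    ext m; simp [christoffel, Matrix.mulVec, dotProduct, v]
  have h2 : (G y).mulVec (fun m => christoffel G m i j y) = (1 / 2 : ℝ) • v := by
    rw [h1, Matrix.mulVec_smul, Matrix.mulVec_mulVec, Matrix.mul_nonsing_inv _ (hG.isUnit hy),
      Matrix.one_mulVec]
  exact congrFun h2 a

/-- The Levi-Civita connection is compatible with the metric. -/
theorem mpd_metric (hG : IsMetricOn G U) (hU : IsOpen U) (hy : y ∈ U) (i : Fin n) :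
    mpd i G y = (chr G i y).transpose * G y + G y * chr G i y := by
  ext j k
  have h1 := sum_metric_christoffel hG hy j i k
  have h2 := sum_metric_christoffel hG hy k i j
  simp only [mpd_apply, Matrix.add_apply, Matrix.mul_apply, Matrix.transpose_apply, chr,
    Matrix.of_apply]
  rw [h1, Finset.sum_congr rfl fun m _ => show christoffel G m i j y * G y m k =
    G y k m * christoffel G m i j y by rw [hG.symm hy m k, mul_comm], h2,
    hG.pd_symm hU hy i k j, hG.pd_symm hU hy k i j, hG.pd_symm hU hy j i k,
    hG.pd_symm hU hy k j i]
  ring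

/-- A symmetric connection that is compatible with the metric is the Levi-Civita connection. -/
theorem christoffel_unique (hG : IsMetricOn G U) (hy : y ∈ U)
    (Γ : Fin n → Matrix (Fin n) (Fin n) ℝ) (hs : ∀ m i j, Γ i m j = Γ j m i)
    (hc : ∀ i, mpd i G y = (Γ i).transpose * G y + G y * Γ i) (i : Fin n) :
    chr G i y = Γ i := by
  ext m j
  have hp : ∀ i j k, pd i (fun z => G z j k) y =
      ∑ s, G y k s * Γ i s j + ∑ s, G y j s * Γ i s k := by
    intro i j k
    have := congrFun (congrFun (hc i) j) k
    simp only [mpd_apply, Matrix.add_apply, Matrix.mul_apply, Matrix.transpose_apply] at this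
    rw [this]
    congr 1
    exact Finset.sum_congr rfl fun s _ => by rw [hG.symm hy s k, mul_comm]
  -- Of the six connection terms produced by compatibility, four cancel by symmetry in the lower
  -- indices and the other two coincide.
  have key : ∀ a, pd i (fun z => G z j a) y + pd j (fun z => G z i a) y
      - pd a (fun z => G z i j) y = 2 * (G y).mulVec (fun s => Γ i s j) a := by
    intro a
    have e1 : ∀ s, Γ j s i = Γ i s j := fun s => hs s j i
    have e2 : ∀ s, Γ a s i = Γ i s a := fun s => hs s a i
    have e3 : ∀ s, Γ a s j = Γ j s a := fun s => hs s a j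
    simp only [hp, Matrix.mulVec, dotProduct, e1, e2, e3]
    ring
  have : christoffel G m i j y = ((G y)⁻¹.mulVec ((G y).mulVec fun s => Γ i s j)) m := by
    simp only [christoffel, key]
    rw [Matrix.mulVec, dotProduct, Finset.mul_sum]
    exact Finset.sum_congr rfl fun a _ => by ring
  rw [Matrix.mulVec_mulVec, Matrix.nonsing_inv_mul _ (hG.isUnit hy), Matrix.one_mulVec] at this
  exact this

/-- The curvature matrices `(F_{ij})^m_k = R_{ijk}^m`. -/
def curvF (G : Rn n → Matrix (Fin n) (Fin n) ℝ) (i j : Fin n) (y : Rn n) :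
    Matrix (Fin n) (Fin n) ℝ :=
  mpd i (chr G j) y - mpd j (chr G i) y + (chr G i y * chr G j y - chr G j y * chr G i y)

theorem riemannUp_eq (G : Rn n → Matrix (Fin n) (Fin n) ℝ) (i j k m : Fin n) (y : Rn n) :
    riemannUp G i j k m y = curvF G i j y m k := by
  simp only [riemannUp, curvF, Matrix.add_apply, Matrix.sub_apply, Matrix.mul_apply,
    Finset.sum_sub_distrib]
  rfl

theorem MSm.curvF (h : MSm G y) (hd : (G y).det ≠ 0) (i j : Fin n) : MSm (curvF G i j) y :=
  (((h.chr hd j).mpd i).sub ((h.chr hd i).mpd j)).add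
    (((h.chr hd i).mul (h.chr hd j)).sub ((h.chr hd j).mul (h.chr hd i)))

theorem curvF_antisymm (G : Rn n → Matrix (Fin n) (Fin n) ℝ) (i j : Fin n) (y : Rn n) :
    curvF G i j y = -curvF G j i y := by
  simp only [curvF]; abel

theorem riemann_eq (G : Rn n → Matrix (Fin n) (Fin n) ℝ) (i j k l : Fin n) (y : Rn n) :
    riemann G i j k l y = ((G y).transpose * curvF G i j y) l k := by
  simp only [riemann, Matrix.mul_apply, riemannUp_eq, Matrix.transpose_apply]

/-- Raising and lowering the last index cancel, so the action is a partial trace of a product of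
endomorphisms. In this form the change of coordinates is a conjugation. -/
theorem curvAction_eq (hG : IsMetricOn G U) (hy : y ∈ U) (T : Rn n → Matrix (Fin n) (Fin n) ℝ)
    (j k : Fin n) :
    curvAction G T y j k = ∑ i, ((G y)⁻¹ * T y * curvF G i j y) i k := by
  refine Finset.sum_congr rfl fun i _ => ?_
  have h1 : ∀ l, ∑ a, ∑ b, (G y)⁻¹ i a * (G y)⁻¹ l b * T y a b =
      ((G y)⁻¹ * T y * (G y)⁻¹) i l := by
    intro l
    simp only [Matrix.mul_apply, Finset.sum_mul]
    rw [Finset.sum_comm]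
    refine Finset.sum_congr rfl fun b _ => Finset.sum_congr rfl fun a _ => ?_
    rw [hG.inv_symm hy l b]; ring
  have h2 : (G y)⁻¹ * T y * curvF G i j y =
      ((G y)⁻¹ * T y * (G y)⁻¹) * ((G y).transpose * curvF G i j y) := by
    rw [hG.transpose hy, Matrix.mul_assoc ((G y)⁻¹ * T y), ← Matrix.mul_assoc (G y)⁻¹ (G y),
      Matrix.nonsing_inv_mul _ (hG.isUnit hy), Matrix.one_mul]
  rw [h2, Matrix.mul_apply]
  refine Finset.sum_congr rfl fun l _ => ?_
  rw [h1, riemann_eq, mul_comm]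

/-- The metric cancels in the contraction. Only the values of $G$ at the point matter here, so the
set `U` need not be open; it is later taken to be a single point. -/
theorem ricci_eq (hG : IsMetricOn G U) (hy : y ∈ U) (j k : Fin n) :
    ricci G y j k = ∑ i, curvF G i j y i k := by
  simp only [ricci, Matrix.of_apply]
  refine Finset.sum_congr rfl fun i _ => ?_
  have : curvF G i j y = (G y)⁻¹ * ((G y).transpose * curvF G i j y) := by
    rw [hG.transpose hy, ← Matrix.mul_assoc, Matrix.nonsing_inv_mul _ (hG.isUnit hy),
      Matrix.one_mul]
  rw [this, Matrix.mul_apply]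
  exact Finset.sum_congr rfl fun l _ => by rw [riemann_eq]

theorem IsMetricOn.smooth_ricci (hG : IsMetricOn G U) (hU : IsOpen U) (hy : y ∈ U) :
    MSm (ricci G) y := fun j k => by
  have h : ContDiffAt ℝ ∞ (fun z => ∑ i, curvF G i j z i k) y :=
    ContDiffAt.sum fun i _ => (hG.smooth y hy).curvF (hG.det_ne hy) i j i k
  exact h.congr_of_eventuallyEq
    (Filter.eventuallyEq_of_mem (hU.mem_nhds hy) fun _ hz => ricci_eq hG hz j k)

theorem trace_eq (hG : IsMetricOn G U) (hy : y ∈ U) (T : Rn n → Matrix (Fin n) (Fin n) ℝ) :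
    trace G T y = ((G y)⁻¹ * T y).trace := by
  simp only [trace, Matrix.trace, Matrix.diag, Matrix.mul_apply]
  rw [Finset.sum_comm]
  exact Finset.sum_congr rfl fun j _ => Finset.sum_congr rfl fun i _ => by
    rw [hG.inv_symm hy i j]

/-- No symmetry of the tensors is assumed, whence the transpose on the first factor. -/
theorem tensorInner_eq (hG : IsMetricOn G U) (hy : y ∈ U)
    (A B : Rn n → Matrix (Fin n) (Fin n) ℝ) :
    tensorInner G A B y = ((G y)⁻¹ * (A y).transpose * (G y)⁻¹ * B y).trace := by
  simp only [tensorInner, Matrix.trace, Matrix.diag, Matrix.mul_apply, Finset.sum_mul,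
    Matrix.transpose_apply]
  calc _ = ∑ i, ∑ b, ∑ a, ∑ j, (G y)⁻¹ i a * (G y)⁻¹ j b * A y i j * B y a b := by
        refine Finset.sum_congr rfl fun i _ => ?_
        rw [Finset.sum_comm, Finset.sum_congr rfl fun a _ => Finset.sum_comm, Finset.sum_comm]
    _ = _ := by
        rw [Finset.sum_comm]
        refine Finset.sum_congr rfl fun b _ => ?_
        rw [Finset.sum_comm]
        refine Finset.sum_congr rfl fun a _ => Finset.sum_congr rfl fun i _ =>
          Finset.sum_congr rfl fun j _ => ?_
        rw [hG.inv_symm hy j b]; ring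

/-- The covariant derivative of a 1-form: `(∇θ)_{ab} = ∂_a θ_b - Γ^m_{ab} θ_m`. -/
def formDeriv (G : Rn n → Matrix (Fin n) (Fin n) ℝ) (θ : Fin n → Rn n → ℝ) (y : Rn n) :
    Matrix (Fin n) (Fin n) ℝ :=
  Matrix.of fun a b => pd a (θ b) y - ∑ m, christoffel G m a b y * θ m y

/-- The Hessian of a function. -/
def hess (G : Rn n → Matrix (Fin n) (Fin n) ℝ) (u : Rn n → ℝ) : Rn n → Matrix (Fin n) (Fin n) ℝ :=
  formDeriv G fun i => pd i u

theorem laplacian_eq (G : Rn n → Matrix (Fin n) (Fin n) ℝ) (u : Rn n → ℝ) (y : Rn n) :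
    laplacian G u y = trace G (hess G u) y := rfl

theorem covDeriv_eq (T : Rn n → Matrix (Fin n) (Fin n) ℝ) (a i j : Fin n) (y : Rn n) :
    covDeriv G T a i j y =
      (mpd a T y - ((chr G a y).transpose * T y + T y * chr G a y)) i j := by
  simp only [covDeriv, Matrix.sub_apply, Matrix.add_apply, Matrix.mul_apply,
    Matrix.transpose_apply, mpd_apply, chr, Matrix.of_apply, ← Finset.sum_add_distrib]
  congr 1
  exact Finset.sum_congr rfl fun m _ => by ring

/-- `∇_a T` as a matrix. -/
def covD (G T : Rn n → Matrix (Fin n) (Fin n) ℝ) (a : Fin n) (y : Rn n) :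
    Matrix (Fin n) (Fin n) ℝ :=
  mpd a T y - ((chr G a y).transpose * T y + T y * chr G a y)

/-- `∇_b ∇_a T` as a matrix. -/
def covD2 (G T : Rn n → Matrix (Fin n) (Fin n) ℝ) (b a : Fin n) (y : Rn n) :
    Matrix (Fin n) (Fin n) ℝ :=
  covD G (covD G T a) b y - ∑ m, christoffel G m b a y • covD G T m y

theorem covDeriv_eq_covD (T : Rn n → Matrix (Fin n) (Fin n) ℝ) (a i j : Fin n) :
    covDeriv G T a i j = fun y => covD G T a y i j :=
  funext fun y => covDeriv_eq T a i j y

theorem covDeriv2_eq (T : Rn n → Matrix (Fin n) (Fin n) ℝ) (b a i j : Fin n) (y : Rn n) :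
    covDeriv2 G T b a i j y = covD2 G T b a y i j := by
  simp only [covDeriv2, covDeriv_eq_covD, covD2, Matrix.sub_apply, Matrix.sum_apply,
    Matrix.smul_apply, smul_eq_mul]
  rw [show covD G (covD G T a) b y = mpd b (covD G T a) y
    - ((chr G b y).transpose * covD G T a y + covD G T a y * chr G b y) from rfl]
  simp only [Matrix.sub_apply, Matrix.add_apply, Matrix.mul_apply, Matrix.transpose_apply,
    mpd_apply, chr, Matrix.of_apply, Finset.sum_add_distrib]
  rw [Finset.sum_congr rfl fun m _ => mul_comm (christoffel G m b j y) (covD G T a y i m)]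
  ring

theorem einsteinOp_eq (hG : IsMetricOn G U) (hy : y ∈ U)
    (T : Rn n → Matrix (Fin n) (Fin n) ℝ) :
    einsteinOp G T y = (∑ b, ∑ a, (G y)⁻¹ b a • covD2 G T b a y) +
      (2 : ℝ) • Matrix.of fun j k => ∑ i, ((G y)⁻¹ * T y * curvF G i j y) i k := by
  ext j k
  simp only [einsteinOp, Matrix.of_apply, Matrix.add_apply, Matrix.smul_apply, Matrix.sum_apply,
    smul_eq_mul, covDeriv2_eq, curvAction_eq hG hy]

theorem divergence_eq (T : Rn n → Matrix (Fin n) (Fin n) ℝ) (i : Fin n) (y : Rn n) :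
    divergence G T i y = ∑ j, ∑ a, (G y)⁻¹ j a * covD G T a y i j := by
  simp only [divergence, covDeriv_eq_covD]

end

end Coord

namespace Coord

variable {n : ℕ}

/-! ### Behaviour under changes of coordinates -/

/-- `ψ` is smooth with invertible Jacobian matrix on the open set `U`, and maps it to the open
set `V`. -/
structure IsCoordChange (ψ : Rn n → Rn n) (U V : Set (Rn n)) : Prop where
  isOpen_source : IsOpen U
  isOpen_target : IsOpen V
  mapsTo : ∀ z ∈ U, ψ z ∈ V
  smooth : ∀ z ∈ U, ContDiffAt ℝ ∞ ψ z
  det_ne : ∀ z ∈ U, (jac ψ z).det ≠ 0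

/-- `T'` is the pull-back of the 2-tensor `T` under `ψ`. -/
def IsPullback (ψ : Rn n → Rn n) (U : Set (Rn n)) (T' T : Rn n → Matrix (Fin n) (Fin n) ℝ) :
    Prop :=
  ∀ z ∈ U, T' z = (jac ψ z).transpose * T (ψ z) * jac ψ z

/-- `θ'` is the pull-back of the 1-form `θ` under `ψ`. -/
def IsFormPullback (ψ : Rn n → Rn n) (U : Set (Rn n)) (θ' θ : Fin n → Rn n → ℝ) : Prop :=
  ∀ z ∈ U, ∀ i, θ' i z = ∑ a, jac ψ z a i * θ a (ψ z)

/-- The pull-back of the connection matrices. -/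
def pullChr (G : Rn n → Matrix (Fin n) (Fin n) ℝ) (ψ : Rn n → Rn n) (i : Fin n) (z : Rn n) :
    Matrix (Fin n) (Fin n) ℝ :=
  ∑ a, jac ψ z a i • chr G a (ψ z)

section

variable {G G' T T' : Rn n → Matrix (Fin n) (Fin n) ℝ} {ψ : Rn n → Rn n} {U V : Set (Rn n)}
  {z : Rn n}

theorem IsCoordChange.isUnit (hψ : IsCoordChange ψ U V) (hz : z ∈ U) :
    IsUnit (jac ψ z).det := isUnit_iff_ne_zero.2 (hψ.det_ne z hz)

theorem IsCoordChange.inv_mul (hψ : IsCoordChange ψ U V) (hz : z ∈ U) :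
    (jac ψ z)⁻¹ * jac ψ z = 1 := Matrix.nonsing_inv_mul _ (hψ.isUnit hz)

theorem IsCoordChange.mul_inv (hψ : IsCoordChange ψ U V) (hz : z ∈ U) :
    jac ψ z * (jac ψ z)⁻¹ = 1 := Matrix.mul_nonsing_inv _ (hψ.isUnit hz)

theorem IsCoordChange.smooth_jac (hψ : IsCoordChange ψ U V) (hz : z ∈ U) : MSm (jac ψ) z :=
  MSm.jac (hψ.smooth z hz)

theorem IsPullback.inv (hP : IsPullback ψ U G' G) (hz : z ∈ U) :
    (G' z)⁻¹ = (jac ψ z)⁻¹ * (G (ψ z))⁻¹ * ((jac ψ z)⁻¹).transpose := by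
  rw [hP z hz, Matrix.mul_inv_rev, Matrix.mul_inv_rev, Matrix.transpose_nonsing_inv,
    Matrix.mul_assoc]

/-- Raising an index turns the congruence $J^TTJ$ into a conjugation. Traces and elementary
symmetric functions are invariant for this reason. -/
theorem IsPullback.inv_mul (hψ : IsCoordChange ψ U V) (hP : IsPullback ψ U G' G)
    (hT : IsPullback ψ U T' T) (hz : z ∈ U) :
    (G' z)⁻¹ * T' z = (jac ψ z)⁻¹ * ((G (ψ z))⁻¹ * T (ψ z)) * jac ψ z := by
  have h : ((jac ψ z)⁻¹).transpose * (jac ψ z).transpose = 1 := by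
    rw [← Matrix.transpose_mul, hψ.mul_inv hz, Matrix.transpose_one]
  rw [hP.inv hz, hT z hz]
  calc _ = (jac ψ z)⁻¹ * (G (ψ z))⁻¹ * (((jac ψ z)⁻¹).transpose * (jac ψ z).transpose)
        * T (ψ z) * jac ψ z := by simp only [Matrix.mul_assoc]
    _ = _ := by rw [h, Matrix.mul_one]; simp only [Matrix.mul_assoc]

theorem IsPullback.transpose (hT : IsPullback ψ U T' T) :
    IsPullback ψ U (fun z => (T' z).transpose) (fun z => (T z).transpose) := fun z hz => by
  simp [hT z hz, Matrix.mul_assoc]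

theorem IsPullback.isMetricOn (hψ : IsCoordChange ψ U V) (hG : IsMetricOn G V)
    (hP : IsPullback ψ U G' G) : IsMetricOn G' U where
  smooth z hz := by
    have h : MSm (fun z => (jac ψ z).transpose * G (ψ z) * jac ψ z) z :=
      ((hψ.smooth_jac hz).transpose.mul ((hG.smooth _ (hψ.mapsTo z hz)).comp (hψ.smooth z hz))).mul
        (hψ.smooth_jac hz)
    exact h.congr (Filter.eventuallyEq_of_mem (hψ.isOpen_source.mem_nhds hz) hP)
  posDef z hz := by
    rw [hP z hz]
    have := (hG.posDef _ (hψ.mapsTo z hz)).conjTranspose_mul_mul_same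
      (B := jac ψ z) (Matrix.mulVec_injective_of_isUnit
        ((Matrix.isUnit_iff_isUnit_det _).2 (hψ.isUnit hz)))
    simpa using this

/-- `∂_i (Jᵀ T(ψ) J)` for a matrix-valued function. -/
theorem mpd_pullback (hψ : IsCoordChange ψ U V) (hT : ∀ w ∈ V, MSm T w)
    (hP : IsPullback ψ U T' T) (hz : z ∈ U) (i : Fin n) :
    mpd i T' z = (mpd i (jac ψ) z).transpose * T (ψ z) * jac ψ z
      + (jac ψ z).transpose * (∑ a, jac ψ z a i • mpd a T (ψ z)) * jac ψ z
      + (jac ψ z).transpose * T (ψ z) * mpd i (jac ψ) z := by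
  have hJ := hψ.smooth_jac hz
  have hTz := hT _ (hψ.mapsTo z hz)
  have hTc : MSm (fun w => T (ψ w)) z := hTz.comp (hψ.smooth z hz)
  rw [mpd_congr_on hψ.isOpen_source hP hz, mpd_mul (hJ.transpose.mul hTc) hJ,
    mpd_mul hJ.transpose hTc, mpd_transpose, mpd_comp hTz (hψ.smooth z hz), Matrix.add_mul]

/-- The transformation law of the connection. -/
theorem jac_mul_chr (hψ : IsCoordChange ψ U V) (hG : IsMetricOn G V) (hP : IsPullback ψ U G' G)
    (hz : z ∈ U) (i : Fin n) :
    jac ψ z * chr G' i z = mpd i (jac ψ) z + pullChr G ψ i z * jac ψ z := by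
  have hG' := hP.isMetricOn hψ hG
  set J := jac ψ z with hJ
  have hpz := hψ.mapsTo z hz
  set X : Fin n → Matrix (Fin n) (Fin n) ℝ := fun i => mpd i (jac ψ) z + pullChr G ψ i z * J
    with hX
  have hX' : ∀ i, J * (J⁻¹ * X i) = X i := fun i => by
    rw [← Matrix.mul_assoc, hψ.mul_inv hz, Matrix.one_mul]
  have hXs : ∀ s i j, X i s j = X j s i := by
    intro s i j
    simp only [hX, Matrix.add_apply, Matrix.mul_apply, pullChr, Matrix.sum_apply,
      Matrix.smul_apply, smul_eq_mul, Finset.sum_mul, mpd_apply]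
    congr 1
    · exact pd_comm (contDiffAt_coord (hψ.smooth z hz) s) i j
    · rw [Finset.sum_comm]
      refine Finset.sum_congr rfl fun a _ => Finset.sum_congr rfl fun b _ => ?_
      simp only [chr, Matrix.of_apply]
      rw [christoffel_symm hG hψ.isOpen_target hpz s a b]; ring
  -- The candidate $J^{-1}(\partial_iJ+\Gamma_iJ)$ is symmetric in its lower indices and compatible
  -- with the pulled-back metric. Uniqueness of the Levi-Civita connection identifies it, without
  -- expanding the Christoffel symbols.
  have := christoffel_unique hG' hz (fun i => J⁻¹ * X i)
    (fun m i j => by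
      simp only [Matrix.mul_apply]
      exact Finset.sum_congr rfl fun s _ => by rw [hXs s i j])
    (fun i => by
      have h1 : (J⁻¹ * X i).transpose * G' z = (X i).transpose * G (ψ z) * J := by
        rw [hP z hz, ← hJ]
        calc _ = (J * (J⁻¹ * X i)).transpose * G (ψ z) * J := by
              rw [Matrix.transpose_mul J]; simp only [Matrix.mul_assoc]
          _ = _ := by rw [hX']
      have h2 : G' z * (J⁻¹ * X i) = J.transpose * G (ψ z) * X i := by
        rw [hP z hz, ← hJ, Matrix.mul_assoc _ J, hX']
      have h3 : ∑ a, J a i • mpd a G (ψ z) =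
          (pullChr G ψ i z).transpose * G (ψ z) + G (ψ z) * pullChr G ψ i z := by
        simp only [pullChr, Matrix.transpose_sum, Matrix.sum_mul, Matrix.mul_sum,
          ← Finset.sum_add_distrib]
        refine Finset.sum_congr rfl fun a _ => ?_
        rw [mpd_metric hG hψ.isOpen_target hpz]
        simp [smul_add, hJ]
      rw [h1, h2, mpd_pullback hψ hG.smooth hP hz, ← hJ, h3]
      simp only [hX, Matrix.transpose_add, Matrix.transpose_mul]
      noncomm_ring) i
  rw [this, hX']

theorem chr_pullback (hψ : IsCoordChange ψ U V) (hG : IsMetricOn G V) (hP : IsPullback ψ U G' G)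
    (hz : z ∈ U) (i : Fin n) :
    chr G' i z = (jac ψ z)⁻¹ * (mpd i (jac ψ) z + pullChr G ψ i z * jac ψ z) := by
  rw [← jac_mul_chr hψ hG hP hz, ← Matrix.mul_assoc, hψ.inv_mul hz, Matrix.one_mul]

theorem smooth_pullChr (hψ : IsCoordChange ψ U V) (hG : IsMetricOn G V) (hz : z ∈ U)
    (i : Fin n) : MSm (pullChr G ψ i) z :=
  MSm.sum fun a _ => MSm.smul (hψ.smooth_jac hz a i)
    ((hG.smooth_chr (hψ.mapsTo z hz) a).comp (hψ.smooth z hz))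

theorem mpd_pullChr (hψ : IsCoordChange ψ U V) (hG : IsMetricOn G V) (hz : z ∈ U)
    (i j : Fin n) : mpd i (pullChr G ψ j) z = ∑ a, (pd i (fun w => jac ψ w a j) z • chr G a (ψ z)
      + jac ψ z a j • ∑ c, jac ψ z c i • mpd c (chr G a) (ψ z)) := by
  have hc : ∀ a, MSm (chr G a) (ψ z) := fun a => hG.smooth_chr (hψ.mapsTo z hz) a
  have hc' : ∀ a, MSm (fun w => chr G a (ψ w)) z := fun a => (hc a).comp (hψ.smooth z hz)
  have := mpd_sum (s := Finset.univ) (A := fun a w => jac ψ w a j • chr G a (ψ w)) (y := z)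
    (fun a _ => MSm.smul (hψ.smooth_jac hz a j) (hc' a)) i
  refine this.trans (Finset.sum_congr rfl fun a _ => ?_)
  rw [mpd_smul (hψ.smooth_jac hz a j) (hc' a), mpd_comp (hc a) (hψ.smooth z hz)]

/-- The transformation law of the curvature. -/
theorem jac_mul_curvF (hψ : IsCoordChange ψ U V) (hG : IsMetricOn G V)
    (hP : IsPullback ψ U G' G) (hz : z ∈ U) (i j : Fin n) :
    jac ψ z * curvF G' i j z =
      (∑ a, ∑ b, (jac ψ z a i * jac ψ z b j) • curvF G a b (ψ z)) * jac ψ z := by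
  have hG' := hP.isMetricOn hψ hG
  have hJ := hψ.smooth_jac hz
  -- This is the derivative of the transformation law of the connection. Antisymmetrizing in $i,j$
  -- removes the second derivatives of the Jacobian.
  have key : ∀ i j, mpd i (jac ψ) z * chr G' j z + jac ψ z * mpd i (chr G' j) z =
      mpd i (mpd j (jac ψ)) z + (mpd i (pullChr G ψ j) z * jac ψ z
        + pullChr G ψ j z * mpd i (jac ψ) z) := by
    intro i j
    have h := mpd_congr_on hψ.isOpen_source (fun w hw => jac_mul_chr hψ hG hP hw j) hz i
    rw [mpd_mul hJ (hG'.smooth_chr hz j), mpd_add (hJ.mpd j) ((smooth_pullChr hψ hG hz j).mul hJ),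
      mpd_mul (smooth_pullChr hψ hG hz j) hJ] at h
    exact h
  -- The curvature of the pulled-back connection matrices is the pull-back of the curvature: the
  -- derivatives of the Jacobian entries are symmetric in $i,j$ and drop out.
  have hB : mpd i (pullChr G ψ j) z - mpd j (pullChr G ψ i) z
      + (pullChr G ψ i z * pullChr G ψ j z - pullChr G ψ j z * pullChr G ψ i z) =
      ∑ a, ∑ b, (jac ψ z a i * jac ψ z b j) • curvF G a b (ψ z) := by
    have hs : ∀ a, pd i (fun w => jac ψ w a j) z = pd j (fun w => jac ψ w a i) z := fun a =>
      pd_comm (contDiffAt_coord (hψ.smooth z hz) a) i j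
    have e1 : ∑ a, jac ψ z a j • ∑ c, jac ψ z c i • mpd c (chr G a) (ψ z) =
        ∑ a, ∑ b, (jac ψ z a i * jac ψ z b j) • mpd a (chr G b) (ψ z) := by
      simp only [Finset.smul_sum, smul_smul]
      rw [Finset.sum_comm]
      exact Finset.sum_congr rfl fun a _ => Finset.sum_congr rfl fun b _ => by rw [mul_comm]
    have e2 : ∑ a, jac ψ z a i • ∑ c, jac ψ z c j • mpd c (chr G a) (ψ z) =
        ∑ a, ∑ b, (jac ψ z a i * jac ψ z b j) • mpd b (chr G a) (ψ z) := by
      simp only [Finset.smul_sum, smul_smul]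
    have e3 : pullChr G ψ i z * pullChr G ψ j z =
        ∑ a, ∑ b, (jac ψ z a i * jac ψ z b j) • (chr G a (ψ z) * chr G b (ψ z)) := by
      simp only [pullChr, Matrix.sum_mul, Matrix.mul_sum, Matrix.smul_mul, Matrix.mul_smul,
        Finset.smul_sum, smul_smul]
      rw [Finset.sum_comm]
      exact Finset.sum_congr rfl fun a _ => Finset.sum_congr rfl fun b _ => by rw [mul_comm]
    have e4 : pullChr G ψ j z * pullChr G ψ i z =
        ∑ a, ∑ b, (jac ψ z a i * jac ψ z b j) • (chr G b (ψ z) * chr G a (ψ z)) := by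
      simp only [pullChr, Matrix.sum_mul, Matrix.mul_sum, Matrix.smul_mul, Matrix.mul_smul,
        Finset.smul_sum, smul_smul]
    rw [mpd_pullChr hψ hG hz, mpd_pullChr hψ hG hz, Finset.sum_add_distrib,
      Finset.sum_add_distrib, e1, e2, e3, e4]
    simp only [hs, curvF, smul_add, smul_sub, Finset.sum_add_distrib, Finset.sum_sub_distrib]
    abel
  have k1 := key i j
  have k2 := key j i
  rw [mpd_comm hJ j i] at k2
  have c1 := jac_mul_chr hψ hG hP hz i
  have c2 := jac_mul_chr hψ hG hP hz j
  rw [← hB, curvF]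
  set J := jac ψ z
  have d1 : J * chr G' i z * chr G' j z =
      mpd i (jac ψ) z * chr G' j z + pullChr G ψ i z * (J * chr G' j z) := by
    rw [c1, Matrix.add_mul, Matrix.mul_assoc]
  have d2 : J * chr G' j z * chr G' i z =
      mpd j (jac ψ) z * chr G' i z + pullChr G ψ j z * (J * chr G' i z) := by
    rw [c2, Matrix.add_mul, Matrix.mul_assoc]
  have k1' := eq_sub_of_add_eq' k1
  have k2' := eq_sub_of_add_eq' k2
  calc J * (mpd i (chr G' j) z - mpd j (chr G' i) z
        + (chr G' i z * chr G' j z - chr G' j z * chr G' i z))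
      = J * mpd i (chr G' j) z - J * mpd j (chr G' i) z
        + ((J * chr G' i z) * chr G' j z - (J * chr G' j z) * chr G' i z) := by noncomm_ring
    _ = J * mpd i (chr G' j) z - J * mpd j (chr G' i) z
        + (mpd i (jac ψ) z * chr G' j z + pullChr G ψ i z * (J * chr G' j z)
          - (mpd j (jac ψ) z * chr G' i z + pullChr G ψ j z * (J * chr G' i z))) := by
        rw [d1, d2]
    _ = _ := by rw [k1', k2', c1, c2]; noncomm_ring

end

end Coord

/-! ### Transformation laws of curvature contractions and covariant derivatives -/

namespace Coord

variable {n : ℕ}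

section

variable {G G' T T' : Rn n → Matrix (Fin n) (Fin n) ℝ} {ψ : Rn n → Rn n} {U V : Set (Rn n)}
  {z : Rn n}

/-- From $G^{-1}=J\,G'^{-1}J^T$. The values lie in an arbitrary module so that the same contraction
serves for second covariant derivatives, which are matrices, and for divergences and gradients,
which are numbers. -/
theorem IsPullback.sum_inv_smul {W : Type*} [AddCommGroup W] [Module ℝ W]
    (hψ : IsCoordChange ψ U V) (hP : IsPullback ψ U G' G) (hz : z ∈ U) (X : Fin n → Fin n → W) :
    ∑ i, ∑ j, (G' z)⁻¹ i j • ∑ a, ∑ b, (jac ψ z a i * jac ψ z b j) • X a b =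
      ∑ a, ∑ b, (G (ψ z))⁻¹ a b • X a b := by
  have h : ∀ a b, (G (ψ z))⁻¹ a b = ∑ i, ∑ j, (G' z)⁻¹ i j * (jac ψ z a i * jac ψ z b j) := by
    intro a b
    have h1 : (G (ψ z))⁻¹ = jac ψ z * (G' z)⁻¹ * (jac ψ z).transpose := by
      have h2 : ((jac ψ z)⁻¹).transpose * (jac ψ z).transpose = 1 := by
        rw [← Matrix.transpose_mul, hψ.mul_inv hz, Matrix.transpose_one]
      rw [hP.inv hz]
      calc _ = (jac ψ z * (jac ψ z)⁻¹) * (G (ψ z))⁻¹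
            * (((jac ψ z)⁻¹).transpose * (jac ψ z).transpose) := by
            rw [hψ.mul_inv hz, h2, Matrix.one_mul, Matrix.mul_one]
        _ = _ := by simp only [Matrix.mul_assoc]
    rw [h1]
    simp only [Matrix.mul_apply, Finset.sum_mul, Matrix.transpose_apply]
    rw [Finset.sum_comm]
    exact Finset.sum_congr rfl fun i _ => Finset.sum_congr rfl fun j _ => by ring
  simp only [h, Finset.sum_smul, Finset.smul_sum, smul_smul]
  rw [Finset.sum_congr rfl fun i _ => Finset.sum_comm, Finset.sum_comm]
  refine Finset.sum_congr rfl fun a _ => ?_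
  rw [Finset.sum_congr rfl fun i _ => Finset.sum_comm, Finset.sum_comm]

/-- The summed index occurs once in $J$ and once in $J^{-1}$, and the two cancel. The Ricci tensor
and the curvature action are both contractions of this type. -/
theorem sum_conj_apply (hψ : IsCoordChange ψ U V) (hz : z ∈ U)
    (X : Fin n → Fin n → Matrix (Fin n) (Fin n) ℝ) (j k : Fin n) :
    ∑ i, ((jac ψ z)⁻¹ * (∑ a, ∑ b, (jac ψ z a i * jac ψ z b j) • X a b) * jac ψ z) i k =
      ((jac ψ z).transpose * (Matrix.of fun b t => ∑ a, X a b a t) * jac ψ z) j k := by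
  have h1 : ∀ i, ((jac ψ z)⁻¹ * (∑ a, ∑ b, (jac ψ z a i * jac ψ z b j) • X a b) * jac ψ z) i k =
      ∑ a, ∑ s, (jac ψ z a i * (jac ψ z)⁻¹ i s) * ((∑ b, jac ψ z b j • X a b) * jac ψ z) s k := by
    intro i
    have : (∑ a, ∑ b, (jac ψ z a i * jac ψ z b j) • X a b) =
        ∑ a, jac ψ z a i • ∑ b, jac ψ z b j • X a b := by
      simp only [Finset.smul_sum, smul_smul]
    rw [this, Matrix.mul_assoc, Matrix.sum_mul, Matrix.mul_sum, Matrix.sum_apply]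
    refine Finset.sum_congr rfl fun a _ => ?_
    rw [Matrix.smul_mul, Matrix.mul_smul, Matrix.smul_apply, Matrix.mul_apply, smul_eq_mul,
      Finset.mul_sum]
    exact Finset.sum_congr rfl fun s _ => by ring
  have h2 : ∀ a s, ∑ i, jac ψ z a i * (jac ψ z)⁻¹ i s = if a = s then 1 else 0 := by
    intro a s
    have := congrFun (congrFun (hψ.mul_inv hz) a) s
    rwa [Matrix.mul_apply, Matrix.one_apply] at this
  simp only [h1]
  rw [Finset.sum_comm, Finset.sum_congr rfl fun a _ => Finset.sum_comm]
  simp only [← Finset.sum_mul, h2, ite_mul, one_mul, zero_mul, Finset.sum_ite_eq,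
    Finset.mem_univ, if_true]
  simp only [Matrix.mul_apply, Matrix.sum_apply, Matrix.smul_apply, smul_eq_mul,
    Matrix.transpose_apply, Matrix.of_apply, Finset.mul_sum, Finset.sum_mul]
  rw [Finset.sum_comm]
  refine Finset.sum_congr rfl fun t _ => ?_
  rw [Finset.sum_comm]

theorem curvF_pullback (hψ : IsCoordChange ψ U V) (hG : IsMetricOn G V)
    (hP : IsPullback ψ U G' G) (hz : z ∈ U) (i j : Fin n) :
    curvF G' i j z = (jac ψ z)⁻¹ *
      (∑ a, ∑ b, (jac ψ z a i * jac ψ z b j) • curvF G a b (ψ z)) * jac ψ z := by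
  rw [Matrix.mul_assoc, ← jac_mul_curvF hψ hG hP hz, ← Matrix.mul_assoc, hψ.inv_mul hz,
    Matrix.one_mul]

theorem ricci_pullback (hψ : IsCoordChange ψ U V) (hG : IsMetricOn G V)
    (hP : IsPullback ψ U G' G) : IsPullback ψ U (ricci G') (ricci G) := by
  intro z hz
  ext j k
  rw [ricci_eq (hP.isMetricOn hψ hG) hz]
  simp only [curvF_pullback hψ hG hP hz]
  rw [sum_conj_apply hψ hz]
  have h : (Matrix.of fun b t => ∑ a, curvF G a b (ψ z) a t) = ricci G (ψ z) := by
    ext b t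
    rw [ricci_eq hG (hψ.mapsTo z hz), Matrix.of_apply]
  rw [h]

theorem curvAction_pullback (hψ : IsCoordChange ψ U V) (hG : IsMetricOn G V)
    (hP : IsPullback ψ U G' G) (hT : IsPullback ψ U T' T) :
    IsPullback ψ U (fun z => Matrix.of fun j k => curvAction G' T' z j k)
      (fun z => Matrix.of fun j k => curvAction G T z j k) := by
  intro z hz
  ext j k
  beta_reduce
  rw [Matrix.of_apply, curvAction_eq (hP.isMetricOn hψ hG) hz]
  have : ∀ i, (G' z)⁻¹ * T' z * curvF G' i j z = (jac ψ z)⁻¹ *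
      (∑ a, ∑ b, (jac ψ z a i * jac ψ z b j) •
        ((G (ψ z))⁻¹ * T (ψ z) * curvF G a b (ψ z))) * jac ψ z := by
    intro i
    rw [hP.inv_mul hψ hT hz, curvF_pullback hψ hG hP hz]
    simp only [← Matrix.mul_smul, ← Matrix.mul_sum]
    calc _ = (jac ψ z)⁻¹ * ((G (ψ z))⁻¹ * T (ψ z)) * (jac ψ z * (jac ψ z)⁻¹) *
          (∑ a, ∑ b, (jac ψ z a i * jac ψ z b j) • curvF G a b (ψ z)) * jac ψ z := by
          simp only [Matrix.mul_assoc]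
      _ = _ := by rw [hψ.mul_inv hz, Matrix.mul_one]; simp only [Matrix.mul_assoc]
  simp only [this]
  rw [sum_conj_apply hψ hz]
  have h : (Matrix.of fun b t => ∑ a, ((G (ψ z))⁻¹ * T (ψ z) * curvF G a b (ψ z)) a t) =
      Matrix.of fun j k => curvAction G T (ψ z) j k := by
    ext b t
    rw [Matrix.of_apply, Matrix.of_apply, curvAction_eq hG (hψ.mapsTo z hz)]
  rw [h]

theorem IsMetricOn.smooth_covD (hG : IsMetricOn G V) (hT : ∀ w ∈ V, MSm T w) (hz : z ∈ V)
    (a : Fin n) : MSm (covD G T a) z :=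
  ((hT z hz).mpd a).sub (((hG.smooth_chr hz a).transpose.mul (hT z hz)).add
    ((hT z hz).mul (hG.smooth_chr hz a)))

/-- The derivatives of $J$ coming from the product rule cancel against the inhomogeneous term in the
transformation law of the connection. -/
theorem covD_pullback (hψ : IsCoordChange ψ U V) (hG : IsMetricOn G V)
    (hP : IsPullback ψ U G' G) (hTs : ∀ w ∈ V, MSm T w) (hT : IsPullback ψ U T' T) (hz : z ∈ U)
    (i : Fin n) : covD G' T' i z =
      ∑ a, jac ψ z a i • ((jac ψ z).transpose * covD G T a (ψ z) * jac ψ z) := by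
  have c := jac_mul_chr hψ hG hP hz i
  set J := jac ψ z
  have h1 : T' z * chr G' i z = J.transpose * T (ψ z) * (J * chr G' i z) := by
    rw [hT z hz, Matrix.mul_assoc]
  have h2 : (chr G' i z).transpose * T' z = (J * chr G' i z).transpose * T (ψ z) * J := by
    rw [hT z hz, Matrix.transpose_mul]; simp only [J, Matrix.mul_assoc]
  have h3 : ∑ a, J a i • (J.transpose * covD G T a (ψ z) * J) = J.transpose *
      ((∑ a, J a i • mpd a T (ψ z)) - ((pullChr G ψ i z).transpose * T (ψ z)
        + T (ψ z) * pullChr G ψ i z)) * J := by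
    simp only [pullChr, covD, Matrix.transpose_sum, Matrix.sum_mul, Matrix.mul_sum,
      ← Finset.sum_add_distrib, ← Finset.sum_sub_distrib, Matrix.transpose_smul]
    refine Finset.sum_congr rfl fun a _ => ?_
    simp only [J, Matrix.smul_mul, Matrix.mul_smul, Matrix.mul_sub, Matrix.sub_mul,
      Matrix.mul_add, Matrix.add_mul, smul_sub, smul_add]
  rw [h3, covD, mpd_pullback hψ hTs hT hz, h1, h2, c, Matrix.transpose_add, Matrix.transpose_mul]
  noncomm_ring

theorem covD_sum_smul {ι : Type*} {s : Finset ι} {f : ι → Rn n → ℝ}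
    {A : ι → Rn n → Matrix (Fin n) (Fin n) ℝ} (hf : ∀ k ∈ s, ContDiffAt ℝ ∞ (f k) z)
    (hA : ∀ k ∈ s, MSm (A k) z) (i : Fin n) :
    covD G (fun w => ∑ k ∈ s, f k w • A k w) i z =
      ∑ k ∈ s, (pd i (f k) z • A k z + f k z • covD G (A k) i z) := by
  have := mpd_sum (s := s) (A := fun k w => f k w • A k w) (y := z)
    (fun k hk => MSm.smul (hf k hk) (hA k hk)) i
  rw [covD, this]
  simp only [Matrix.mul_sum, Matrix.sum_mul, ← Finset.sum_add_distrib, ← Finset.sum_sub_distrib]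
  refine Finset.sum_congr rfl fun k hk => ?_
  rw [mpd_smul (hf k hk) (hA k hk), covD, Matrix.mul_smul, Matrix.smul_mul, smul_sub, smul_add]
  abel

theorem covD_congr_on {S : Rn n → Matrix (Fin n) (Fin n) ℝ} (hU : IsOpen U)
    (h : ∀ w ∈ U, T w = S w) (hz : z ∈ U) (i : Fin n) : covD G T i z = covD G S i z := by
  rw [covD, covD, mpd_congr_on hU h hz, h z hz]

/-- For fixed $a$ the matrices $\nabla_aT$ are treated as a 2-tensor, to which the first-order law
applies. What remains is the derivative of the Jacobian factor in the index $a$, and it is absorbed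
by the Christoffel correction in that index. -/
theorem covD2_pullback (hψ : IsCoordChange ψ U V) (hG : IsMetricOn G V)
    (hP : IsPullback ψ U G' G) (hTs : ∀ w ∈ V, MSm T w) (hT : IsPullback ψ U T' T) (hz : z ∈ U)
    (i j : Fin n) : covD2 G' T' i j z = ∑ b, ∑ a, (jac ψ z b i * jac ψ z a j) •
      ((jac ψ z).transpose * covD2 G T b a (ψ z) * jac ψ z) := by
  have hJ := hψ.smooth_jac hz
  set S' : Fin n → Rn n → Matrix (Fin n) (Fin n) ℝ := fun a w =>
    (jac ψ w).transpose * covD G T a (ψ w) * jac ψ w with hS'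
  have hS's : ∀ a, MSm (S' a) z := fun a =>
    (hJ.transpose.mul ((hG.smooth_covD hTs (hψ.mapsTo z hz) a).comp (hψ.smooth z hz))).mul hJ
  have hSp : ∀ a, IsPullback ψ U (S' a) (covD G T a) := fun a w _ => rfl
  have h1 : covD G' (covD G' T' j) i z = ∑ a, (pd i (fun w => jac ψ w a j) z • S' a z +
      jac ψ z a j • covD G' (S' a) i z) := by
    rw [covD_congr_on hψ.isOpen_source (fun w hw => covD_pullback hψ hG hP hTs hT hw j) hz]
    exact covD_sum_smul (fun a _ => hJ a j) (fun a _ => hS's a) i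
  have h2 : ∀ a, covD G' (S' a) i z = ∑ b, jac ψ z b i •
      ((jac ψ z).transpose * covD G (covD G T a) b (ψ z) * jac ψ z) := fun a =>
    covD_pullback hψ hG hP (fun w hw => hG.smooth_covD hTs hw a) (hSp a) hz i
  have h3 : ∑ m, christoffel G' m i j z • covD G' T' m z =
      ∑ a, (mpd i (jac ψ) z + pullChr G ψ i z * jac ψ z) a j • S' a z := by
    rw [← jac_mul_chr hψ hG hP hz]
    simp only [covD_pullback hψ hG hP hTs hT hz, Finset.smul_sum, smul_smul, Matrix.mul_apply,
      Finset.sum_smul]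
    rw [Finset.sum_comm]
    refine Finset.sum_congr rfl fun a _ => Finset.sum_congr rfl fun m _ => ?_
    rw [mul_comm]; rfl
  have h4 : ∑ a, (pullChr G ψ i z * jac ψ z) a j • S' a z =
      ∑ b, ∑ a, (jac ψ z b i * jac ψ z a j) •
        ((jac ψ z).transpose * (∑ m, christoffel G m b a (ψ z) • covD G T m (ψ z))
          * jac ψ z) := by
    simp only [Matrix.mul_apply, pullChr, Matrix.sum_apply, Matrix.smul_apply, smul_eq_mul, chr,
      Matrix.of_apply, Finset.sum_smul, Finset.smul_sum, Finset.sum_mul, Matrix.mul_sum,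
      Matrix.mul_smul, Matrix.smul_mul, smul_smul]
    rw [Finset.sum_comm, Finset.sum_congr rfl fun a _ => Finset.sum_comm, Finset.sum_comm]
    refine Finset.sum_congr rfl fun b _ => Finset.sum_congr rfl fun a _ =>
      Finset.sum_congr rfl fun m _ => ?_
    congr 1; ring
  rw [covD2, h1, h3]
  simp only [Matrix.add_apply, add_smul, Finset.sum_add_distrib]
  rw [h4]
  simp only [mpd_apply, h2, covD2, Matrix.mul_sub, Matrix.sub_mul, smul_sub,
    Finset.sum_sub_distrib, Finset.smul_sum, smul_smul]
  rw [add_sub_add_left_eq_sub]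
  congr 1
  rw [Finset.sum_comm]
  exact Finset.sum_congr rfl fun b _ => Finset.sum_congr rfl fun a _ => by rw [mul_comm]

theorem einsteinOp_pullback (hψ : IsCoordChange ψ U V) (hG : IsMetricOn G V)
    (hP : IsPullback ψ U G' G) (hTs : ∀ w ∈ V, MSm T w) (hT : IsPullback ψ U T' T) :
    IsPullback ψ U (einsteinOp G' T') (einsteinOp G T) := by
  have key : ∀ (G T : Rn n → Matrix (Fin n) (Fin n) ℝ) (z : Rn n), einsteinOp G T z =
      (∑ b, ∑ a, (G z)⁻¹ b a • covD2 G T b a z)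
        + (2 : ℝ) • Matrix.of fun j k => curvAction G T z j k := by
    intro G T z
    ext j k
    simp only [einsteinOp, Matrix.of_apply, Matrix.add_apply, Matrix.smul_apply,
      Matrix.sum_apply, smul_eq_mul, covDeriv2_eq]
  intro z hz
  have h := curvAction_pullback hψ hG hP hT z hz
  beta_reduce at h
  rw [key, key, h]
  simp only [covD2_pullback hψ hG hP hTs hT hz]
  rw [hP.sum_inv_smul hψ hz fun b a => (jac ψ z).transpose * covD2 G T b a (ψ z) * jac ψ z]
  simp only [Matrix.mul_add, Matrix.add_mul, Matrix.mul_sum, Matrix.sum_mul, Matrix.mul_smul,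
    Matrix.smul_mul]

/-- As for 2-tensors, the second derivatives of `ψ` are cancelled by the inhomogeneous term of the
connection. Applied to a gradient this is the tensoriality of the Hessian. -/
theorem formDeriv_pullback {θ θ' : Fin n → Rn n → ℝ} (hψ : IsCoordChange ψ U V)
    (hG : IsMetricOn G V) (hP : IsPullback ψ U G' G)
    (hθs : ∀ w ∈ V, ∀ i, ContDiffAt ℝ ∞ (θ i) w) (hθ : IsFormPullback ψ U θ' θ) :
    IsPullback ψ U (formDeriv G' θ') (formDeriv G θ) := by
  intro z hz
  have hpz := hψ.mapsTo z hz
  ext i j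
  have hJ := hψ.smooth_jac hz
  have hc : ∀ a, ContDiffAt ℝ ∞ (fun w => θ a (ψ w)) z := fun a =>
    (hθs _ hpz a).comp z (hψ.smooth z hz)
  have h1 : pd i (θ' j) z = ∑ a, (pd i (fun w => jac ψ w a j) z * θ a (ψ z)
      + jac ψ z a j * ∑ b, jac ψ z b i * pd b (θ a) (ψ z)) := by
    rw [pd_congr (Filter.eventuallyEq_of_mem (hψ.isOpen_source.mem_nhds hz)
      fun w hw => hθ w hw j), pd_sum fun a _ =>
        (hJ a j).mul (hc a)]
    refine Finset.sum_congr rfl fun a _ => ?_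
    rw [pd_mul (hJ a j) (hc a),
      pd_comp (hθs _ hpz a) (hψ.smooth z hz)]
  have h3 : ∑ m, christoffel G' m i j z * θ' m z =
      ∑ a, (mpd i (jac ψ) z + pullChr G ψ i z * jac ψ z) a j * θ a (ψ z) := by
    rw [← jac_mul_chr hψ hG hP hz]
    simp only [hθ z hz, Finset.mul_sum, Matrix.mul_apply, Finset.sum_mul]
    rw [Finset.sum_comm]
    refine Finset.sum_congr rfl fun a _ => Finset.sum_congr rfl fun m _ => ?_
    simp only [chr, Matrix.of_apply]; ring
  have h4 : ∑ a, (pullChr G ψ i z * jac ψ z) a j * θ a (ψ z) =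
      ∑ b, ∑ a, (jac ψ z b i * jac ψ z a j) * ∑ m, christoffel G m b a (ψ z) * θ m (ψ z) := by
    simp only [Matrix.mul_apply, pullChr, Matrix.sum_apply, Matrix.smul_apply, smul_eq_mul, chr,
      Matrix.of_apply, Finset.sum_mul, Finset.mul_sum]
    rw [Finset.sum_comm, Finset.sum_congr rfl fun a _ => Finset.sum_comm, Finset.sum_comm]
    refine Finset.sum_congr rfl fun b _ => Finset.sum_congr rfl fun a _ =>
      Finset.sum_congr rfl fun m _ => ?_
    ring
  have h5 : ((jac ψ z).transpose * formDeriv G θ (ψ z) * jac ψ z) i j =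
      ∑ b, ∑ a, (jac ψ z b i * jac ψ z a j) * formDeriv G θ (ψ z) b a := by
    simp only [Matrix.mul_apply, Matrix.transpose_apply, Finset.sum_mul]
    rw [Finset.sum_comm]
    exact Finset.sum_congr rfl fun b _ => Finset.sum_congr rfl fun a _ => by ring
  rw [h5]
  simp only [formDeriv, Matrix.of_apply, h1, h3, Matrix.add_apply, add_mul,
    Finset.sum_add_distrib, h4, mpd_apply, mul_sub, Finset.sum_sub_distrib]
  rw [add_sub_add_left_eq_sub]
  congr 1
  simp only [Finset.mul_sum]
  rw [Finset.sum_comm]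
  exact Finset.sum_congr rfl fun b _ => Finset.sum_congr rfl fun a _ => by ring

theorem grad_pullback {u u' : Rn n → ℝ} (hψ : IsCoordChange ψ U V)
    (hus : ∀ w ∈ V, ContDiffAt ℝ ∞ u w) (hu : ∀ z ∈ U, u' z = u (ψ z)) :
    IsFormPullback ψ U (fun i => pd i u') (fun i => pd i u) := fun z hz i => by
  beta_reduce
  rw [pd_congr (Filter.eventuallyEq_of_mem (hψ.isOpen_source.mem_nhds hz) hu),
    pd_comp (hus _ (hψ.mapsTo z hz)) (hψ.smooth z hz)]

theorem hess_pullback {u u' : Rn n → ℝ} (hψ : IsCoordChange ψ U V)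
    (hG : IsMetricOn G V) (hP : IsPullback ψ U G' G)
    (hus : ∀ w ∈ V, ContDiffAt ℝ ∞ u w) (hu : ∀ z ∈ U, u' z = u (ψ z)) :
    IsPullback ψ U (hess G' u') (hess G u) :=
  formDeriv_pullback hψ hG hP (fun w hw i => contDiffAt_pd (hus w hw) i)
    (grad_pullback hψ hus hu)

theorem divergence_pullback (hψ : IsCoordChange ψ U V) (hG : IsMetricOn G V)
    (hP : IsPullback ψ U G' G) (hTs : ∀ w ∈ V, MSm T w) (hT : IsPullback ψ U T' T) :
    IsFormPullback ψ U (divergence G' T') (divergence G T) := by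
  intro z hz i
  have hG' := hP.isMetricOn hψ hG
  have h1 : ∀ j a, covD G' T' a z i j = ∑ c, ∑ b, (jac ψ z c j * jac ψ z b a) •
      ∑ s, jac ψ z s i * covD G T b (ψ z) s c := by
    intro j a
    rw [covD_pullback hψ hG hP hTs hT hz]
    simp only [Matrix.sum_apply, Matrix.smul_apply, Matrix.mul_apply, Matrix.transpose_apply,
      smul_eq_mul, Finset.mul_sum, Finset.sum_mul]
    rw [Finset.sum_comm]
    exact Finset.sum_congr rfl fun c _ => Finset.sum_congr rfl fun b _ =>
      Finset.sum_congr rfl fun s _ => by ring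
  have := hP.sum_inv_smul hψ hz fun c b => ∑ s, jac ψ z s i * covD G T b (ψ z) s c
  rw [divergence_eq]
  simp only [h1]
  simp only [← smul_eq_mul (a := (G' z)⁻¹ _ _)]
  rw [this]
  simp only [divergence_eq, smul_eq_mul, Finset.mul_sum]
  rw [Finset.sum_congr rfl fun a _ => Finset.sum_comm, Finset.sum_comm]
  exact Finset.sum_congr rfl fun c _ => Finset.sum_congr rfl fun b _ =>
      Finset.sum_congr rfl fun s _ => by ring

theorem trace_pullback (hψ : IsCoordChange ψ U V) (hG : IsMetricOn G V)
    (hP : IsPullback ψ U G' G) (hT : IsPullback ψ U T' T) (hz : z ∈ U) :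
    trace G' T' z = trace G T (ψ z) := by
  rw [trace_eq (hP.isMetricOn hψ hG) hz, trace_eq hG (hψ.mapsTo z hz), hP.inv_mul hψ hT hz,
    Matrix.trace_mul_comm, ← Matrix.mul_assoc, hψ.mul_inv hz, Matrix.one_mul]

theorem tensorInner_pullback {S S' : Rn n → Matrix (Fin n) (Fin n) ℝ} (hψ : IsCoordChange ψ U V)
    (hG : IsMetricOn G V) (hP : IsPullback ψ U G' G) (hT : IsPullback ψ U T' T)
    (hS : IsPullback ψ U S' S) (hz : z ∈ U) :
    tensorInner G' T' S' z = tensorInner G T S (ψ z) := by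
  rw [tensorInner_eq (hP.isMetricOn hψ hG) hz, tensorInner_eq hG (hψ.mapsTo z hz),
    Matrix.mul_assoc, hP.inv_mul hψ hT.transpose hz, hP.inv_mul hψ hS hz]
  calc _ = ((jac ψ z)⁻¹ * (((G (ψ z))⁻¹ * (T (ψ z)).transpose) * (jac ψ z * (jac ψ z)⁻¹) *
        ((G (ψ z))⁻¹ * S (ψ z)) * jac ψ z)).trace := by simp only [Matrix.mul_assoc]
    _ = _ := by
        rw [hψ.mul_inv hz, Matrix.mul_one, Matrix.trace_mul_comm, Matrix.mul_assoc _ (jac ψ z),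
          hψ.mul_inv hz, Matrix.mul_one]
        simp only [Matrix.mul_assoc]

theorem gradSq_pullback {u u' : Rn n → ℝ} (hψ : IsCoordChange ψ U V)
    (hP : IsPullback ψ U G' G) (hus : ∀ w ∈ V, ContDiffAt ℝ ∞ u w)
    (hu : ∀ z ∈ U, u' z = u (ψ z)) (hz : z ∈ U) : gradSq G' u' z = gradSq G u (ψ z) := by
  have := hP.sum_inv_smul hψ hz fun a b => pd a u (ψ z) * pd b u (ψ z)
  simp only [smul_eq_mul] at this
  rw [gradSq, gradSq, ← this]
  refine Finset.sum_congr rfl fun i _ => Finset.sum_congr rfl fun j _ => ?_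
  have hg : ∀ i, pd i u' z = ∑ a, jac ψ z a i * pd a u (ψ z) := grad_pullback hψ hus hu z hz
  rw [hg i, hg j, Finset.sum_mul_sum]
  congr 1
  exact Finset.sum_congr rfl fun a _ => Finset.sum_congr rfl fun b _ => by ring

theorem scalar_pullback (hψ : IsCoordChange ψ U V) (hG : IsMetricOn G V)
    (hP : IsPullback ψ U G' G) (hz : z ∈ U) : scalar G' z = scalar G (ψ z) :=
  trace_pullback hψ hG hP (ricci_pullback hψ hG hP) hz

theorem schouten_pullback (hψ : IsCoordChange ψ U V) (hG : IsMetricOn G V)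
    (hP : IsPullback ψ U G' G) : IsPullback ψ U (schouten G') (schouten G) := fun z hz => by
  rw [schouten, schouten, ricci_pullback hψ hG hP z hz, scalar_pullback hψ hG hP hz, hP z hz]
  simp only [Matrix.mul_sub, Matrix.sub_mul, Matrix.mul_smul, Matrix.smul_mul]

end

end Coord

namespace Coord

variable {n : ℕ}

/-! ### Normal coordinates -/

theorem contDiffAt_coordinate (j : Fin n) (z : Rn n) :
    ContDiffAt ℝ ∞ (fun w : Rn n => w j) z :=
  contDiffAt_coord contDiffAt_id j

theorem pd_coordinate (i j : Fin n) (z : Rn n) :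
    pd i (fun w : Rn n => w j) z = if i = j then 1 else 0 := by
  have h := (EuclideanSpace.proj j : Rn n →L[ℝ] ℝ).fderiv (x := z)
  have h2 : (⇑(EuclideanSpace.proj j : Rn n →L[ℝ] ℝ)) = fun w : Rn n => w j := rfl
  rw [h2] at h
  rw [pd, h]
  simp [eq_comm]

/-- Write $A=C^TC$ and take $B=C^{-1}$: this is the linear change to an orthonormal frame. -/
theorem exists_transpose_mul_mul_eq_one {A : Matrix (Fin n) (Fin n) ℝ} (hA : A.PosDef) :
    ∃ B : Matrix (Fin n) (Fin n) ℝ, B.det ≠ 0 ∧ B.transpose * A * B = 1 := by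
  obtain ⟨C, rfl⟩ : ∃ C : Matrix (Fin n) (Fin n) ℝ, A = star C * C := by
    open scoped MatrixOrder in
    exact CStarAlgebra.nonneg_iff_eq_star_mul_self.1 (Matrix.nonneg_iff_posSemidef.2 hA.posSemidef)
  have hd : IsUnit C.det := isUnit_iff_ne_zero.2 fun h => hA.det_pos.ne' (by
    rw [Matrix.det_mul, h, mul_zero])
  refine ⟨C⁻¹, (Matrix.isUnit_nonsing_inv_det _ hd).ne_zero, ?_⟩
  rw [Matrix.star_eq_conjTranspose, Matrix.conjTranspose_eq_transpose_of_trivial]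
  calc _ = (C * C⁻¹).transpose * (C * C⁻¹) := by
        rw [Matrix.transpose_mul]; simp only [Matrix.mul_assoc]
    _ = 1 := by rw [Matrix.mul_nonsing_inv _ hd]; simp

/-- The metric `G` is the identity and its connection vanishes at the point `p`. -/
structure IsNormalAt (G : Rn n → Matrix (Fin n) (Fin n) ℝ) (U : Set (Rn n)) (p : Rn n) :
    Prop where
  isOpen : IsOpen U
  mem : p ∈ U
  metric : IsMetricOn G U
  eq_one : G p = 1
  chr_eq_zero : ∀ i, chr G i p = 0

/-- Take $\psi(z)=y+Az-\frac12\Gamma_y(Az,Az)$ with $A^TG(y)A=1$. The linear part normalizes the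
metric. The quadratic part satisfies $\partial J=-\Gamma(A\cdot,A\cdot)$ at the origin, which
cancels the connection term in the transformation law. Two jets of information suffice, so no
geodesics are needed. -/
theorem exists_normal {G : Rn n → Matrix (Fin n) (Fin n) ℝ} {V : Set (Rn n)} (hV : IsOpen V)
    (hG : IsMetricOn G V) {y : Rn n} (hy : y ∈ V) :
    ∃ (ψ : Rn n → Rn n) (U : Set (Rn n)), IsCoordChange ψ U V ∧ ψ 0 = y ∧
      ∀ G', IsPullback ψ U G' G → IsNormalAt G' U 0 := by
  obtain ⟨A, hAd, hA⟩ := exists_transpose_mul_mul_eq_one (hG.posDef y hy)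
  set Q : Fin n → Fin n → Fin n → ℝ := fun a i j =>
    ∑ b, ∑ c, christoffel G a b c y * A b i * A c j with hQ
  have hQs : ∀ a i j, Q a i j = Q a j i := by
    intro a i j
    simp only [hQ]
    rw [Finset.sum_comm]
    refine Finset.sum_congr rfl fun b _ => Finset.sum_congr rfl fun c _ => ?_
    rw [christoffel_symm hG hV hy a c b]; ring
  set f : Fin n → Rn n → ℝ := fun a z =>
    y a + ∑ i, A a i * z i - (1 / 2) * ∑ i, ∑ j, Q a i j * (z i * z j) with hf
  set ψ : Rn n → Rn n := fun z => WithLp.toLp 2 fun a => f a z with hψ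
  have hc := fun (j : Fin n) (z : Rn n) => contDiffAt_coordinate j z
  have s1 : ∀ a z, ContDiffAt ℝ ∞ (fun z : Rn n => ∑ i, A a i * z i) z := fun a z =>
    ContDiffAt.sum fun i _ => contDiffAt_const.mul (hc i z)
  have s2 : ∀ a z, ContDiffAt ℝ ∞ (fun z : Rn n => ∑ i, ∑ j, Q a i j * (z i * z j)) z :=
    fun a z => ContDiffAt.sum fun i _ => ContDiffAt.sum fun j _ =>
      contDiffAt_const.mul ((hc i z).mul (hc j z))
  have hfs : ∀ a z, ContDiffAt ℝ ∞ (f a) z := fun a z =>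
    (contDiffAt_const.add (s1 a z)).sub (contDiffAt_const.mul (s2 a z))
  have hψs : ∀ z, ContDiffAt ℝ ∞ ψ z := fun z => (contDiffAt_piLp 2).2 fun a => hfs a z
  have hpd : ∀ a i z, pd i (f a) z = A a i - ∑ j, Q a i j * z j := by
    intro a i z
    have e1 : pd i (fun z : Rn n => ∑ i, A a i * z i) z = A a i := by
      rw [pd_sum fun j _ => contDiffAt_const.mul (hc j z)]
      simp [pd_const_mul _ (hc _ z), pd_coordinate]
    have e2 : pd i (fun z : Rn n => ∑ i, ∑ j, Q a i j * (z i * z j)) z =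
        2 * ∑ j, Q a i j * z j := by
      rw [pd_sum fun k _ => ContDiffAt.sum fun j _ =>
        contDiffAt_const.mul ((hc k z).mul (hc j z))]
      have : ∀ k, pd i (fun z : Rn n => ∑ j, Q a k j * (z k * z j)) z =
          ∑ j, ((if i = k then Q a k j * z j else 0) + if i = j then Q a k j * z k else 0) := by
        intro k
        rw [pd_sum fun j _ => contDiffAt_const.mul ((hc k z).mul (hc j z))]
        refine Finset.sum_congr rfl fun j _ => ?_
        rw [pd_const_mul _ ((hc k z).mul (hc j z)), pd_mul (hc k z) (hc j z), pd_coordinate,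
          pd_coordinate]
        split_ifs <;> ring
      simp only [this, Finset.sum_add_distrib, Finset.sum_ite_eq, Finset.mem_univ, if_true]
      rw [Finset.sum_comm]
      simp only [Finset.sum_ite_eq, Finset.mem_univ, if_true, hQs a _ i]
      ring
    have h1 : ContDiffAt ℝ ∞ (fun z : Rn n => y a + ∑ i, A a i * z i) z :=
      contDiffAt_const.add (s1 a z)
    simp only [hf]
    rw [pd_sub h1 (contDiffAt_const.mul (s2 a z)), pd_add contDiffAt_const (s1 a z),
      pd_const_mul _ (s2 a z), pd_const, e1, e2]
    ring
  have hjac : ∀ z a i, jac ψ z a i = A a i - ∑ j, Q a i j * z j := fun z a i => hpd a i z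
  have hjac0 : jac ψ 0 = A := by ext a i; simp [hjac]
  have hψ0 : ψ 0 = y := by ext a; simp [hψ, hf]
  have hdc : Continuous fun z => (jac ψ z).det := by
    refine Continuous.matrix_det ?_
    refine continuous_matrix fun a i => ?_
    simp only [hjac]
    fun_prop
  have hψc : Continuous ψ := continuous_iff_continuousAt.2 fun z => (hψs z).continuousAt
  -- The quadratic map need not be a global diffeomorphism; restricting to the open set where its
  -- Jacobian is invertible is enough.
  refine ⟨ψ, {z | (jac ψ z).det ≠ 0} ∩ ψ ⁻¹' V, ⟨?_, hV, fun z hz => hz.2, fun z _ => hψs z,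
    fun z hz => hz.1⟩, hψ0, ?_⟩
  · exact (isOpen_ne.preimage hdc).inter (hV.preimage hψc)
  · intro G' hP
    have hcc : IsCoordChange ψ ({z | (jac ψ z).det ≠ 0} ∩ ψ ⁻¹' V) V :=
      ⟨(isOpen_ne.preimage hdc).inter (hV.preimage hψc), hV, fun z hz => hz.2, fun z _ => hψs z,
        fun z hz => hz.1⟩
    have h0 : (0 : Rn n) ∈ ({z | (jac ψ z).det ≠ 0} ∩ ψ ⁻¹' V) :=
      ⟨by simpa [hjac0] using hAd, by simpa [hψ0] using hy⟩
    refine ⟨hcc.isOpen_source, h0, hP.isMetricOn hcc hG, ?_, fun i => ?_⟩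
    · rw [hP 0 h0, hjac0, hψ0, hA]
    · rw [chr_pullback hcc hG hP h0]
      have : mpd i (jac ψ) 0 + pullChr G ψ i 0 * jac ψ 0 = 0 := by
        ext m j
        have e1 : mpd i (jac ψ) 0 m j = -Q m j i := by
          rw [mpd_apply]
          have : (fun z => jac ψ z m j) = fun z => A m j - ∑ k, Q m j k * z k := by
            ext z; exact hjac z m j
          rw [this, pd_sub contDiffAt_const (ContDiffAt.sum fun k _ =>
            contDiffAt_const.mul (hc k 0)), pd_const, pd_sum fun k _ =>
            contDiffAt_const.mul (hc k 0)]
          simp [pd_const_mul _ (hc _ 0), pd_coordinate]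
        have e2 : (pullChr G ψ i 0 * jac ψ 0) m j = Q m i j := by
          simp only [pullChr, hjac0, hψ0, Matrix.mul_apply, Matrix.sum_apply, Matrix.smul_apply,
            smul_eq_mul, chr, Matrix.of_apply, hQ, Finset.sum_mul]
          rw [Finset.sum_comm]
          exact Finset.sum_congr rfl fun a _ => Finset.sum_congr rfl fun b _ => by ring
        rw [Matrix.add_apply, e1, e2, hQs]; simp
      rw [this, Matrix.mul_zero]

end Coord

namespace Coord

variable {n : ℕ}

/-! ### Pointwise identities -/

section

variable {G T : Rn n → Matrix (Fin n) (Fin n) ℝ} {U : Set (Rn n)} {p : Rn n}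

/-- The curvature endomorphisms are skew-symmetric. -/
theorem curvF_transpose (hU : IsOpen U) (hG : IsMetricOn G U) (hp : p ∈ U) (i j : Fin n) :
    (curvF G i j p).transpose * G p + G p * curvF G i j p = 0 := by
  have hGs := hG.smooth p hp
  have hc := fun i => hG.smooth_chr hp i
  -- Metric compatibility is differentiated once more; the symmetry of the second derivatives of $G$
  -- then gives the skewness of the curvature.
  have key : ∀ i j, mpd i (mpd j G) p = (mpd i (chr G j) p).transpose * G p
      + (chr G j p).transpose * ((chr G i p).transpose * G p + G p * chr G i p)
      + (((chr G i p).transpose * G p + G p * chr G i p) * chr G j p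
        + G p * mpd i (chr G j) p) := by
    intro i j
    rw [mpd_congr_on hU (fun z hz => mpd_metric hG hU hz j) hp i,
      mpd_add ((hc j).transpose.mul hGs) (hGs.mul (hc j)), mpd_mul (hc j).transpose hGs,
      mpd_mul hGs (hc j), mpd_metric hG hU hp i, mpd_transpose]
  have h1 := key i j
  rw [mpd_comm hGs i j, key j i] at h1
  rw [← sub_eq_zero] at h1
  rw [← neg_eq_zero, ← h1, curvF]
  simp only [Matrix.transpose_add, Matrix.transpose_sub, Matrix.transpose_mul]
  noncomm_ring

namespace IsNormalAt

variable (h : IsNormalAt G U p)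

include h

theorem christoffel_eq_zero (m i j : Fin n) : christoffel G m i j p = 0 :=
  congrFun (congrFun (h.chr_eq_zero i) m) j

theorem inv_eq_one : (G p)⁻¹ = 1 := by rw [h.eq_one, inv_one]

theorem mpd_metric_eq_zero (i : Fin n) : mpd i G p = 0 := by
  rw [mpd_metric h.metric h.isOpen h.mem, h.chr_eq_zero]; simp

theorem mpd_inv_eq_zero (i : Fin n) : mpd i (fun z => (G z)⁻¹) p = 0 := by
  rw [mpd_inv (h.metric.smooth p h.mem) (h.metric.det_ne h.mem), h.mpd_metric_eq_zero]; simp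

theorem pd_inv_eq_zero (i a b : Fin n) : pd i (fun z => (G z)⁻¹ a b) p = 0 :=
  congrFun (congrFun (h.mpd_inv_eq_zero i) a) b

theorem smooth : MSm G p := h.metric.smooth p h.mem

theorem smooth_inv : MSm (fun z => (G z)⁻¹) p := h.metric.smooth_inv h.mem

theorem smooth_chr (i : Fin n) : MSm (chr G i) p := h.metric.smooth_chr h.mem i

theorem smooth_curvF (i j : Fin n) : MSm (curvF G i j) p :=
  h.smooth.curvF (h.metric.det_ne h.mem) i j

theorem curvF_eq (i j : Fin n) :
    curvF G i j p = mpd i (chr G j) p - mpd j (chr G i) p := by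
  rw [curvF, h.chr_eq_zero, h.chr_eq_zero]; simp

theorem covD_eq (a : Fin n) : covD G T a p = mpd a T p := by
  rw [covD, h.chr_eq_zero]; simp

theorem covD2_eq_mpd (b a : Fin n) : covD2 G T b a p = mpd b (covD G T a) p := by
  rw [covD2, h.covD_eq]; simp [h.christoffel_eq_zero]

/-- The Christoffel symbols vanish at the centre but their derivatives do not; those are the only
correction that survives. -/
theorem covD2_eq (hT : MSm T p) (b a : Fin n) : covD2 G T b a p = mpd b (mpd a T) p
    - ((mpd b (chr G a) p).transpose * T p + T p * mpd b (chr G a) p) := by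
  have hc := h.smooth_chr a
  rw [h.covD2_eq_mpd]
  refine (mpd_sub (hT.mpd a) ((hc.transpose.mul hT).add (hT.mul hc)) b).trans ?_
  rw [mpd_add (hc.transpose.mul hT) (hT.mul hc), mpd_mul hc.transpose hT, mpd_mul hT hc,
    mpd_transpose, h.chr_eq_zero]
  simp

theorem formDeriv_eq (θ : Fin n → Rn n → ℝ) (a b : Fin n) :
    formDeriv G θ p a b = pd a (θ b) p := by
  simp [formDeriv, h.christoffel_eq_zero]

theorem hess_eq (u : Rn n → ℝ) (a b : Fin n) : hess G u p a b = pd a (pd b u) p :=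
  h.formDeriv_eq _ a b

theorem trace_eq : trace G T p = ∑ i, T p i i := by
  simp [trace, h.inv_eq_one, Matrix.one_apply]

theorem tensorInner_eq (S : Rn n → Matrix (Fin n) (Fin n) ℝ) :
    tensorInner G T S p = ∑ i, ∑ j, T p i j * S p i j := by
  simp [tensorInner, h.inv_eq_one, Matrix.one_apply]

theorem divergence_eq (i : Fin n) : divergence G T i p = ∑ j, pd j (fun z => T z i j) p := by
  simp [Coord.divergence_eq, h.inv_eq_one, h.covD_eq, Matrix.one_apply, mpd_apply]

/-- The inverse metric has vanishing first derivatives at the centre, so the derivative passes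
through the contraction. -/
theorem pd_divergence (hT : ∀ w ∈ U, MSm T w) (b i : Fin n) :
    pd b (divergence G T i) p = ∑ j, covD2 G T b j p i j := by
  have hs : ∀ a, MSm (covD G T a) p := fun a => h.metric.smooth_covD hT h.mem a
  have : divergence G T i = fun z => ∑ j, ∑ a, (G z)⁻¹ j a * covD G T a z i j :=
    funext fun z => Coord.divergence_eq T i z
  rw [this, pd_sum fun j _ => ContDiffAt.sum fun a _ => (h.smooth_inv j a).mul (hs a i j)]
  refine Finset.sum_congr rfl fun j _ => ?_
  rw [pd_sum fun a _ => (h.smooth_inv j a).mul (hs a i j),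
    Finset.sum_congr rfl fun a _ => pd_mul (h.smooth_inv j a) (hs a i j) b]
  simp [h.pd_inv_eq_zero, h.inv_eq_one, Matrix.one_apply, h.covD2_eq_mpd, mpd_apply]

theorem pd_trace (hT : MSm T p) (b : Fin n) :
    pd b (trace G T) p = ∑ j, pd b (fun z => T z j j) p := by
  have : trace G T = fun z => ∑ i, ∑ j, (G z)⁻¹ i j * T z i j := rfl
  rw [this, pd_sum fun j _ => ContDiffAt.sum fun a _ => (h.smooth_inv j a).mul (hT j a)]
  refine Finset.sum_congr rfl fun j _ => ?_
  rw [pd_sum fun a _ => (h.smooth_inv j a).mul (hT j a),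
    Finset.sum_congr rfl fun a _ => pd_mul (h.smooth_inv j a) (hT j a) b]
  simp [h.pd_inv_eq_zero, h.inv_eq_one, Matrix.one_apply]

end IsNormalAt

/-- The trace commutes with covariant differentiation. -/
theorem mpd_inv_metric (hU : IsOpen U) (hG : IsMetricOn G U) (hp : p ∈ U) (a : Fin n) :
    mpd a (fun z => (G z)⁻¹) p
      = -((G p)⁻¹ * (chr G a p).transpose + chr G a p * (G p)⁻¹) := by
  rw [mpd_inv (hG.smooth p hp) (hG.det_ne hp), mpd_metric hG hU hp, Matrix.mul_add,
    Matrix.add_mul]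
  congr 2
  · rw [Matrix.mul_assoc, Matrix.mul_assoc, Matrix.mul_nonsing_inv _ (hG.isUnit hp),
      Matrix.mul_one]
  · rw [← Matrix.mul_assoc, Matrix.nonsing_inv_mul _ (hG.isUnit hp), Matrix.one_mul]

theorem pd_trace (hU : IsOpen U) (hG : IsMetricOn G U) (hp : p ∈ U) (hT : MSm T p)
    (a : Fin n) : pd a (trace G T) p = trace G (covD G T a) p := by
  have hi := hG.smooth_inv hp
  have h1 : pd a (trace G T) p = (mpd a (fun z => (G z)⁻¹ * T z) p).trace := by
    rw [pd_congr (Filter.eventuallyEq_of_mem (hU.mem_nhds hp) fun z hz => trace_eq hG hz T)]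
    simp only [Matrix.trace, Matrix.diag]
    rw [pd_sum fun i _ => (hi.mul hT) i i]
    rfl
  rw [h1, mpd_mul hi hT, trace_eq hG hp, covD, mpd_inv_metric hU hG hp]
  simp only [Matrix.mul_sub, Matrix.mul_add, Matrix.neg_mul, Matrix.add_mul, Matrix.trace_add,
    Matrix.trace_sub, Matrix.trace_neg]
  rw [show (chr G a p * (G p)⁻¹ * T p).trace = ((G p)⁻¹ * (T p * chr G a p)).trace by
    rw [Matrix.mul_assoc, Matrix.trace_mul_comm, Matrix.mul_assoc], Matrix.mul_assoc]
  ring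

namespace IsNormalAt

variable (h : IsNormalAt G U p)

include h

theorem pd_pd_trace (hT : ∀ w ∈ U, MSm T w) (b a : Fin n) :
    pd b (pd a (trace G T)) p = ∑ j, covD2 G T b a p j j := by
  rw [pd_congr (Filter.eventuallyEq_of_mem (h.isOpen.mem_nhds h.mem) fun z hz =>
    Coord.pd_trace h.isOpen h.metric hz (hT z hz) a),
    h.pd_trace (h.metric.smooth_covD hT h.mem a)]
  simp only [h.covD2_eq_mpd, mpd_apply]

/-- The second Bianchi identity. -/
theorem bianchi (a b c : Fin n) : mpd c (curvF G a b) p + mpd a (curvF G b c) p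
    + mpd b (curvF G c a) p = 0 := by
  have key : ∀ a b c, mpd c (curvF G a b) p
      = mpd c (mpd a (chr G b)) p - mpd c (mpd b (chr G a)) p := by
    intro a b c
    have hA := h.smooth_chr a
    have hB := h.smooth_chr b
    refine (mpd_add ((hB.mpd a).sub (hA.mpd b)) ((hA.mul hB).sub (hB.mul hA)) c).trans ?_
    rw [mpd_sub (hB.mpd a) (hA.mpd b), mpd_sub (hA.mul hB) (hB.mul hA), mpd_mul hA hB,
      mpd_mul hB hA, h.chr_eq_zero, h.chr_eq_zero]
    simp
  rw [key, key, key, mpd_comm (h.smooth_chr b) c a, mpd_comm (h.smooth_chr a) c b,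
    mpd_comm (h.smooth_chr c) a b]
  abel

/-- Skewness holds on a whole neighbourhood, so it may be differentiated; at the centre the
derivative of the metric drops out. -/
theorem mpd_curvF_transpose (l i j m k : Fin n) :
    mpd l (curvF G i j) p m k = -mpd l (curvF G i j) p k m := by
  have hF := h.smooth_curvF i j
  have h1 : mpd l (fun z => (curvF G i j z).transpose * G z + G z * curvF G i j z) p = 0 := by
    rw [mpd_congr_on (B := fun _ => 0) h.isOpen
      (fun z hz => curvF_transpose h.isOpen h.metric hz i j) h.mem, mpd_const]
  rw [mpd_add (hF.transpose.mul h.smooth) (h.smooth.mul hF), mpd_mul hF.transpose h.smooth,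
    mpd_mul h.smooth hF, h.mpd_metric_eq_zero, h.eq_one, mpd_transpose] at h1
  have h2 := congrFun (congrFun h1 m) k
  simp only [Matrix.mul_one, Matrix.mul_zero, add_zero, Matrix.zero_mul, zero_add,
    Matrix.one_mul, Matrix.add_apply, Matrix.transpose_apply, Matrix.zero_apply] at h2
  linarith

theorem mpd_curvF_antisymm (l i j m k : Fin n) :
    mpd l (curvF G i j) p m k = -mpd l (curvF G j i) p m k := by
  have : curvF G i j = fun z => (0 : Matrix (Fin n) (Fin n) ℝ) - curvF G j i z := by
    funext z; rw [curvF_antisymm]; simp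
  rw [this, mpd_sub (MSm.const 0 p) (h.smooth_curvF j i), mpd_const]
  simp

theorem pd_ricci (l j k : Fin n) :
    pd l (fun z => ricci G z j k) p = ∑ i, mpd l (curvF G i j) p i k := by
  rw [pd_congr (Filter.eventuallyEq_of_mem (h.isOpen.mem_nhds h.mem) fun z hz =>
    ricci_eq h.metric hz j k), pd_sum fun i _ => h.smooth_curvF i j i k]
  rfl

/-- The contracted second Bianchi identity. -/
theorem contracted_bianchi (j : Fin n) :
    2 * ∑ k, pd k (fun z => ricci G z j k) p = ∑ k, pd j (fun z => ricci G z k k) p := by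
  simp only [h.pd_ricci]
  have h0 : ∑ k, ∑ i, (mpd k (curvF G i j) p i k + mpd i (curvF G j k) p i k
      + mpd j (curvF G k i) p i k) = 0 :=
    Finset.sum_eq_zero fun k _ => Finset.sum_eq_zero fun i _ =>
      congrFun (congrFun (h.bianchi i j k) i) k
  -- One sign comes from each of the two antisymmetries of the curvature, and they cancel.
  have h2 : ∑ k, ∑ i, mpd i (curvF G j k) p i k = ∑ k, ∑ i, mpd k (curvF G i j) p i k := by
    rw [Finset.sum_comm]
    refine Finset.sum_congr rfl fun k _ => Finset.sum_congr rfl fun i _ => ?_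
    rw [h.mpd_curvF_antisymm, h.mpd_curvF_transpose, neg_neg]
  have h3 : ∑ k, ∑ i, mpd j (curvF G k i) p i k = -∑ k, ∑ i, mpd j (curvF G i k) p i k := by
    rw [← Finset.sum_neg_distrib]
    refine Finset.sum_congr rfl fun k _ => ?_
    rw [← Finset.sum_neg_distrib]
    exact Finset.sum_congr rfl fun i _ => h.mpd_curvF_antisymm _ _ _ _ _
  simp only [Finset.sum_add_distrib, h2, h3] at h0
  linarith

theorem divergence_einsteinTensor (i : Fin n) :
    divergence G (fun z => ricci G z - (scalar G z / 2) • G z) i p = 0 := by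
  have hR : MSm (ricci G) p := h.metric.smooth_ricci h.isOpen h.mem
  have hs : ContDiffAt ℝ ∞ (fun z => scalar G z) p := by
    have : scalar G = fun z => ∑ i, ∑ j, (G z)⁻¹ i j * ricci G z i j := rfl
    simp only [this]
    exact ContDiffAt.sum fun i _ => ContDiffAt.sum fun j _ => (h.smooth_inv i j).mul (hR i j)
  have hs2 : ContDiffAt ℝ ∞ (fun z => scalar G z / 2) p := hs.div_const 2
  have e : ∀ j, pd j (fun z => scalar G z / 2) p = pd j (scalar G) p / 2 := by
    intro j
    have : (fun z => scalar G z / 2) = fun z => (1 / 2 : ℝ) * scalar G z := by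
      funext z; ring
    rw [this, pd_const_mul _ hs]; ring
  rw [h.divergence_eq]
  have hj : ∀ j, pd j (fun z => (ricci G z - (scalar G z / 2) • G z) i j) p =
      pd j (fun z => ricci G z i j) p - pd j (scalar G) p / 2 * G p i j := by
    intro j
    have := congrFun (congrFun (mpd_sub hR (MSm.smul hs2 h.smooth) j) i) j
    rw [mpd_smul hs2 h.smooth, h.mpd_metric_eq_zero, smul_zero, add_zero, e] at this
    exact this
  simp only [hj, Finset.sum_sub_distrib, h.eq_one, Matrix.one_apply, mul_ite, mul_one, mul_zero,
    Finset.sum_ite_eq, Finset.mem_univ, if_true]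
  have hsc : pd i (scalar G) p = ∑ k, pd i (fun z => ricci G z k k) p := h.pd_trace hR i
  rw [hsc]
  linarith [h.contracted_bianchi i]

end IsNormalAt

end

end Coord

namespace Coord

variable {n : ℕ}

/-! ### Curves of matrices -/

/-- The curve of matrices `A` has the entrywise derivative `A'` at `t`. -/
def HasMDerivAt (A : ℝ → Matrix (Fin n) (Fin n) ℝ) (A' : Matrix (Fin n) (Fin n) ℝ) (t : ℝ) :
    Prop := ∀ i j, HasDerivAt (fun s => A s i j) (A' i j) t

section Curves

variable {A B : ℝ → Matrix (Fin n) (Fin n) ℝ} {A' B' : Matrix (Fin n) (Fin n) ℝ} {t : ℝ}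

theorem HasMDerivAt.const (C : Matrix (Fin n) (Fin n) ℝ) (t : ℝ) :
    HasMDerivAt (fun _ => C) 0 t := fun i j => hasDerivAt_const t (C i j)

theorem HasMDerivAt.add (hA : HasMDerivAt A A' t) (hB : HasMDerivAt B B' t) :
    HasMDerivAt (fun s => A s + B s) (A' + B') t := fun i j => (hA i j).add (hB i j)

theorem HasMDerivAt.sub (hA : HasMDerivAt A A' t) (hB : HasMDerivAt B B' t) :
    HasMDerivAt (fun s => A s - B s) (A' - B') t := fun i j => (hA i j).sub (hB i j)

theorem HasMDerivAt.mul (hA : HasMDerivAt A A' t) (hB : HasMDerivAt B B' t) :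
    HasMDerivAt (fun s => A s * B s) (A' * B t + A t * B') t := fun i j => by
  simp only [Matrix.mul_apply, Matrix.add_apply, ← Finset.sum_add_distrib]
  exact HasDerivAt.fun_sum fun k _ => (hA i k).mul (hB k j)

theorem HasMDerivAt.smul {f : ℝ → ℝ} {f' : ℝ} (hf : HasDerivAt f f' t)
    (hA : HasMDerivAt A A' t) :
    HasMDerivAt (fun s => f s • A s) (f' • A t + f t • A') t := fun i j => hf.mul (hA i j)

theorem HasMDerivAt.trace (hA : HasMDerivAt A A' t) :
    HasDerivAt (fun s => (A s).trace) A'.trace t :=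
  HasDerivAt.fun_sum fun i _ => hA i i

theorem HasMDerivAt.congr (hA : HasMDerivAt A A' t) (h : B =ᶠ[nhds t] A) :
    HasMDerivAt B A' t := fun i j =>
  (hA i j).congr_of_eventuallyEq (h.mono fun s hs => by simp only [hs])

theorem HasMDerivAt.unique (hA : HasMDerivAt A A' t) (hB : HasMDerivAt A B' t) : A' = B' := by
  ext i j; exact (hA i j).unique (hB i j)

theorem HasMDerivAt.line (C D : Matrix (Fin n) (Fin n) ℝ) (t : ℝ) :
    HasMDerivAt (fun s => C + s • D) D t := fun i j => by
  simpa using ((hasDerivAt_id t).mul_const (D i j)).const_add (C i j)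

theorem MSm.hasMDerivAt (hA : MSm A t) :
    HasMDerivAt A (Matrix.of fun i j => deriv (fun s => A s i j) t) t := fun i j =>
  ((hA i j).differentiableAt (by simp)).hasDerivAt

theorem MSm.line (C D : Matrix (Fin n) (Fin n) ℝ) (t : ℝ) : MSm (fun s : ℝ => C + s • D) t :=
  (MSm.const C t).add (MSm.smul contDiffAt_id (MSm.const D t))

/-- Smoothness is assumed so that the inverse is known to be differentiable; the value of its
derivative is then forced by $(A^{-1}A)'=0$. -/
theorem HasMDerivAt.inv (hs : MSm A t) (hd : (A t).det ≠ 0) (hA : HasMDerivAt A A' t) :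
    HasMDerivAt (fun s => (A s)⁻¹) (-((A t)⁻¹ * A' * (A t)⁻¹)) t := by
  have hu := isUnit_iff_ne_zero.2 hd
  have hi := (hs.inv hd).hasMDerivAt
  set D := Matrix.of fun i j => deriv (fun s => (A s)⁻¹ i j) t
  have h1 : HasMDerivAt (fun s => (A s)⁻¹ * A s) 0 t :=
    (HasMDerivAt.const 1 t).congr ((hs.det.continuousAt.eventually_ne hd).mono fun s h =>
      Matrix.nonsing_inv_mul _ (isUnit_iff_ne_zero.2 h))
  have h2 := (hi.mul hA).unique h1
  have h3 : D = -((A t)⁻¹ * A' * (A t)⁻¹) := by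
    calc D = (D * A t) * (A t)⁻¹ := by
          rw [Matrix.mul_assoc, Matrix.mul_nonsing_inv _ hu, Matrix.mul_one]
      _ = _ := by rw [eq_neg_of_add_eq_zero_left h2, Matrix.neg_mul]
  rwa [h3] at hi

/-- Jacobi's formula. -/
theorem HasMDerivAt.det (hA : HasMDerivAt A A' t) :
    HasDerivAt (fun s => (A s).det) ((A t).adjugate * A').trace t := by
  simp only [Matrix.det_apply']
  have h1 : ∀ σ : Equiv.Perm (Fin n), HasDerivAt (fun s => ∏ i, A s (σ i) i)
      (∑ j, (∏ i ∈ Finset.univ.erase j, A t (σ i) i) • A' (σ j) j) t := fun σ =>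
    HasDerivAt.fun_finsetProd fun i _ => hA (σ i) i
  have h2 := HasDerivAt.fun_sum (u := Finset.univ) fun (σ : Equiv.Perm (Fin n)) _ =>
    (h1 σ).const_mul ((Equiv.Perm.sign σ : ℤ) : ℝ)
  refine h2.congr_deriv ?_
  -- By Cramer's rule each diagonal entry is the determinant of $A$ with one column replaced by its
  -- derivative, which is what the product rule in the Leibniz expansion produces.
  have h3 : ∀ j, ((A t).adjugate * A') j j = ((A t).updateCol j (fun i => A' i j)).det := by
    intro j
    have := congrFun (Matrix.cramer_eq_adjugate_mulVec (A t) (fun i => A' i j)) j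
    rw [Matrix.cramer_apply] at this
    rw [this]; rfl
  simp only [Matrix.trace, Matrix.diag, h3, Matrix.det_apply', Finset.mul_sum]
  rw [Finset.sum_comm]
  refine Finset.sum_congr rfl fun j _ => Finset.sum_congr rfl fun σ _ => ?_
  rw [← Finset.prod_erase_mul _ _ (Finset.mem_univ j), Matrix.updateCol_self, smul_eq_mul]
  congr 2
  exact Finset.prod_congr rfl fun i hi => (Matrix.updateCol_ne (Finset.ne_of_mem_erase hi)).symm

end Curves

/-! ### The first variation of the curvature -/

section

variable {G T : Rn n → Matrix (Fin n) (Fin n) ℝ} {U : Set (Rn n)} {p : Rn n}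

theorem covD_transpose (hT : ∀ w ∈ U, (T w).transpose = T w) (hU : IsOpen U) (hp : p ∈ U)
    (a : Fin n) : (covD G T a p).transpose = covD G T a p := by
  have h1 : (mpd a T p).transpose = mpd a T p := by
    rw [← mpd_transpose]; exact mpd_congr_on hU hT hp a
  rw [covD, Matrix.transpose_sub, Matrix.transpose_add, Matrix.transpose_mul,
    Matrix.transpose_mul, Matrix.transpose_transpose, h1, hT p hp, add_comm (T p * _)]

theorem covD2_transpose (hT : ∀ w ∈ U, (T w).transpose = T w) (hU : IsOpen U) (hp : p ∈ U)
    (b a : Fin n) : (covD2 G T b a p).transpose = covD2 G T b a p := by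
  rw [covD2, Matrix.transpose_sub, Matrix.transpose_sum,
    covD_transpose (fun w hw => covD_transpose hT hU hw a) hU hp]
  simp only [Matrix.transpose_smul, covD_transpose hT hU hp]

theorem covD2_symm (hT : ∀ w ∈ U, (T w).transpose = T w) (hU : IsOpen U) (hp : p ∈ U)
    (b a i j : Fin n) : covD2 G T b a p i j = covD2 G T b a p j i :=
  congrFun (congrFun (covD2_transpose hT hU hp b a).symm i) j

/-- `∇_i Γ'^m_{jk}`, where `Γ'` is the first variation of the Christoffel symbols at the centre of
normal coordinates. -/
def chrVar (G T : Rn n → Matrix (Fin n) (Fin n) ℝ) (p : Rn n) (i j k m : Fin n) : ℝ :=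
  (1 / 2) * (covD2 G T i j p k m + covD2 G T i k p j m - covD2 G T i m p j k)

/-- The Christoffel symbols of the first kind. -/
def chrLow (G : Rn n → Matrix (Fin n) (Fin n) ℝ) (a j k : Fin n) (z : Rn n) : ℝ :=
  pd j (fun w => G w k a) z + pd k (fun w => G w j a) z - pd a (fun w => G w j k) z

theorem contDiffAt_chrLow (hT : MSm T p) (a j k : Fin n) : ContDiffAt ℝ ∞ (chrLow T a j k) p :=
  ((contDiffAt_pd (hT k a) j).add (contDiffAt_pd (hT j a) k)).sub (contDiffAt_pd (hT j k) a)

theorem pd_chrLow (hT : MSm T p) (i a j k : Fin n) : pd i (chrLow T a j k) p =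
    pd i (pd j fun w => T w k a) p + pd i (pd k fun w => T w j a) p
      - pd i (pd a fun w => T w j k) p := by
  have h1 := contDiffAt_pd (hT k a) j
  have h2 := contDiffAt_pd (hT j a) k
  rw [show chrLow T a j k = fun z => (pd j (fun w => T w k a) z + pd k (fun w => T w j a) z)
    - pd a (fun w => T w j k) z from rfl, pd_sub (h1.add h2) (contDiffAt_pd (hT j k) a),
    pd_add h1 h2]

theorem chrLow_line (hG : MSm G p) (hT : MSm T p) (t : ℝ) (a j k : Fin n) :
    chrLow (fun z => G z + t • T z) a j k p = chrLow G a j k p + t * chrLow T a j k p := by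
  have : ∀ i a b, pd i (fun w => (G w + t • T w) a b) p =
      pd i (fun w => G w a b) p + t * pd i (fun w => T w a b) p := fun i a b => by
    rw [← pd_const_mul t (hT a b)]
    exact pd_add (hG a b) (contDiffAt_const.mul (hT a b)) i
  simp only [chrLow, this]; ring

theorem MSm.line_field (hG : MSm G p) (hT : MSm T p) (t : ℝ) :
    MSm (fun z => G z + t • T z) p :=
  hG.add (MSm.smul contDiffAt_const hT)

/-- This is the shape of the summands in `pd_christoffel_line`. The first term carries two factors
of $t$ and does not contribute to the derivative at $0$. -/
theorem hasDerivAt_inv_line_term (A : Matrix (Fin n) (Fin n) ℝ) (m a : Fin n) (c κ κ' : ℝ) (M : Matrix (Fin n) (Fin n) ℝ) :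
    HasDerivAt (fun t : ℝ => -(((1 + t • A)⁻¹ * (t • M) * (1 + t • A)⁻¹) m a) * (t * c)
      + (1 + t • A)⁻¹ m a * (κ + t * κ')) (-(A m a * κ) + (1 : Matrix _ _ ℝ) m a * κ') 0 := by
  have hinv : HasMDerivAt (fun t : ℝ => (1 + t • A)⁻¹) (-A) 0 := by
    simpa using (HasMDerivAt.line 1 (A) 0).inv (MSm.line 1 (A) 0) (by simp)
  have hM : HasMDerivAt (fun t : ℝ => t • M) M 0 := by
    simpa using HasMDerivAt.line 0 M 0
  have h1 := ((hinv.mul hM).mul hinv m a).fun_neg.fun_mul ((hasDerivAt_id (0 : ℝ)).mul_const c)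
  have h2 := (hinv m a).fun_mul (((hasDerivAt_id (0 : ℝ)).mul_const κ').const_add κ)
  refine (h1.fun_add h2).congr_deriv ?_
  simp

namespace IsNormalAt

variable (h : IsNormalAt G U p) (hT : ∀ w ∈ U, MSm T w)

include h

theorem chrLow_eq_zero (a j k : Fin n) : chrLow G a j k p = 0 := by
  have := fun i a b => congrFun (congrFun (h.mpd_metric_eq_zero i) a) b
  simp only [mpd_apply, Matrix.zero_apply] at this
  simp [chrLow, this]

/-- At the centre the first derivatives of $G$ vanish, which leaves a formula exact in $t$. The
$t$-derivative can then be taken directly, with no interchange of derivatives in $t$ and in space.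
-/
theorem pd_christoffel_line (hT : ∀ w ∈ U, MSm T w) {t : ℝ} (ht : (1 + t • T p).det ≠ 0)
    (i m j k : Fin n) :
    pd i (christoffel (fun z => G z + t • T z) m j k) p = (1 / 2) * ∑ a,
      (-(((1 + t • T p)⁻¹ * (t • mpd i T p) * (1 + t • T p)⁻¹) m a) * (t * chrLow T a j k p)
        + (1 + t • T p)⁻¹ m a * (pd i (chrLow G a j k) p + t * pd i (chrLow T a j k) p)) := by
  have hTp := hT p h.mem
  have hGt := MSm.line_field h.smooth hTp t
  have hd : ((fun z => G z + t • T z) p).det ≠ 0 := by simpa [h.eq_one] using ht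
  have hi := hGt.inv hd
  have h1 : christoffel (fun z => G z + t • T z) m j k = fun z => (1 / 2) *
      ∑ a, (G z + t • T z)⁻¹ m a * chrLow (fun z => G z + t • T z) a j k z := rfl
  have hs : ∀ a, ContDiffAt ℝ ∞ (fun z => (G z + t • T z)⁻¹ m a *
      chrLow (fun z => G z + t • T z) a j k z) p := fun a =>
    (hi m a).mul (contDiffAt_chrLow hGt a j k)
  rw [h1, pd_const_mul _ (ContDiffAt.sum fun a _ => hs a), pd_sum fun a _ => hs a]
  congr 1
  refine Finset.sum_congr rfl fun a _ => ?_
  rw [pd_mul (hi m a) (contDiffAt_chrLow hGt a j k), chrLow_line h.smooth hTp, h.chrLow_eq_zero,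
    zero_add]
  have h2 : pd i (fun z => (G z + t • T z)⁻¹ m a) p =
      -(((1 + t • T p)⁻¹ * (t • mpd i T p) * (1 + t • T p)⁻¹) m a) := by
    have h3 := congrFun (congrFun (mpd_inv hGt hd i) m) a
    have h4 : mpd i (fun z => G z + t • T z) p = t • mpd i T p := by
      rw [mpd_add h.smooth (MSm.smul contDiffAt_const hTp), h.mpd_metric_eq_zero,
        mpd_smul contDiffAt_const hTp, pd_const]
      simp
    rw [h4, h.eq_one] at h3
    exact h3
  have h5 : pd i (chrLow (fun z => G z + t • T z) a j k) p =
      pd i (chrLow G a j k) p + t * pd i (chrLow T a j k) p := by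
    rw [pd_congr (Filter.eventuallyEq_of_mem (h.isOpen.mem_nhds h.mem) fun z hz =>
      chrLow_line (h.metric.smooth z hz) (hT z hz) t a j k),
      pd_add (contDiffAt_chrLow h.smooth a j k)
        (contDiffAt_const.mul (contDiffAt_chrLow hTp a j k)),
      pd_const_mul _ (contDiffAt_chrLow hTp a j k)]
  beta_reduce
  rw [h2, h5, h.eq_one]

include hT

/-- The first variation of the derivatives of the Christoffel symbols. -/
theorem hasDerivAt_pd_christoffel (hTs : ∀ w ∈ U, (T w).transpose = T w) (i m j k : Fin n) :
    HasDerivAt (fun t : ℝ => pd i (christoffel (fun z => G z + t • T z) m j k) p)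
      (chrVar G T p i j k m) 0 := by
  have hTp := hT p h.mem
  have hdet : ∀ᶠ t : ℝ in nhds 0, (1 + t • T p).det ≠ 0 :=
    (MSm.line 1 (T p) 0).det.continuousAt.eventually_ne (by simp)
  have h1 := (HasDerivAt.fun_sum (u := Finset.univ) fun a _ => hasDerivAt_inv_line_term (T p) m a
    (chrLow T a j k p) (pd i (chrLow G a j k) p) (pd i (chrLow T a j k) p)
    (mpd i T p)).const_mul (1 / 2 : ℝ)
  have h2 := h1.congr_of_eventuallyEq (hdet.mono fun t ht => h.pd_christoffel_line hT ht i m j k)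
  refine h2.congr_deriv ?_
  -- The exact formula at $t=0$: differentiating the inverse metric gives nothing at the centre.
  have hG0 : ∀ i a j k, pd i (christoffel G a j k) p = (1 / 2) * pd i (chrLow G a j k) p := by
    intro i a j k
    have := h.pd_christoffel_line hT (t := 0) (by simp) i a j k
    simpa [Matrix.one_apply] using this
  have hsG : ∀ i a j k, pd i (christoffel G a j k) p = pd i (christoffel G a k j) p := by
    intro i a j k
    exact pd_congr (Filter.eventuallyEq_of_mem (h.isOpen.mem_nhds h.mem) fun z hz =>
      christoffel_symm h.metric h.isOpen hz a j k) i
  have hsT : ∀ i j, T p i j = T p j i := fun i j =>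
    congrFun (congrFun (hTs p h.mem).symm i) j
  have hsT2 : ∀ a b i j, pd a (pd b fun z => T z i j) p = pd a (pd b fun z => T z j i) p := by
    intro a b i j
    refine pd_congr (pd_congr_eventually (Filter.eventuallyEq_of_mem (h.isOpen.mem_nhds h.mem)
      fun z hz => ?_) b) a
    exact congrFun (congrFun (hTs z hz).symm i) j
  have hN : ∀ b a i j, covD2 G T b a p i j = pd b (pd a fun z => T z i j) p
      - (∑ s, pd b (christoffel G s a i) p * T p s j
        + ∑ s, pd b (christoffel G s a j) p * T p s i) := by
    intro b a i j
    rw [h.covD2_eq hTp]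
    simp only [Matrix.sub_apply, Matrix.add_apply, Matrix.mul_apply, Matrix.transpose_apply,
      mpd_apply]
    congr 2
    exact Finset.sum_congr rfl fun s _ => by rw [hsT i s, mul_comm]; rfl
  simp only [Finset.sum_add_distrib, Finset.sum_neg_distrib, Matrix.one_apply, ite_mul, one_mul,
    zero_mul, Finset.sum_ite_eq, Finset.mem_univ, if_true]
  -- The variation of the inverse metric pairs $T$ with derivatives of the Christoffel symbols of
  -- $G$; these are precisely the terms that turn second partial derivatives of $T$ into covariant
  -- ones.
  have e1 : ∑ a, T p m a * pd i (chrLow G a j k) p =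
      2 * ∑ s, pd i (christoffel G s j k) p * T p s m := by
    rw [Finset.mul_sum]
    exact Finset.sum_congr rfl fun s _ => by rw [hG0, hsT m s]; ring
  rw [e1, pd_chrLow hTp, chrVar, hN, hN, hN]
  simp only [hsG i _ k j, hsG i _ m j, hsG i _ m k]
  ring

/-- Both factors vanish at $t=0$. Hence the quadratic terms of the curvature do not contribute to
its first variation at the centre. -/
theorem hasDerivAt_christoffel_mul (m i a k j b : Fin n) :
    HasDerivAt (fun t : ℝ => christoffel (fun z => G z + t • T z) m i a p
      * christoffel (fun z => G z + t • T z) k j b p) 0 0 := by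
  have hTp := hT p h.mem
  have key : ∀ m i a, ∃ c, HasDerivAt
      (fun t : ℝ => christoffel (fun z => G z + t • T z) m i a p) c 0 := by
    intro m i a
    have h1 : (fun t : ℝ => christoffel (fun z => G z + t • T z) m i a p) =
        fun t : ℝ => (1 / 2) * ∑ s, (1 + t • T p)⁻¹ m s * (t * chrLow T s i a p) := by
      funext t
      have : christoffel (fun z => G z + t • T z) m i a p = (1 / 2) *
        ∑ s, (G p + t • T p)⁻¹ m s * chrLow (fun z => G z + t • T z) s i a p := rfl
      rw [this]
      simp only [chrLow_line h.smooth hTp, h.chrLow_eq_zero, zero_add, h.eq_one]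
    rw [h1]
    have hinv := (HasMDerivAt.line 1 (T p) 0).inv (MSm.line 1 (T p) 0) (by simp)
    exact ⟨_, (HasDerivAt.fun_sum fun s _ => (hinv m s).mul
      ((hasDerivAt_id (0 : ℝ)).mul_const (chrLow T s i a p))).const_mul _⟩
  obtain ⟨c, hc⟩ := key m i a
  obtain ⟨d, hd⟩ := key k j b
  have h0 : ∀ m i a, christoffel (fun z => G z + (0 : ℝ) • T z) m i a p = 0 := by
    intro m i a
    simpa using h.christoffel_eq_zero m i a
  have := hc.fun_mul hd
  rw [h0, h0] at this
  simpa using this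

theorem hasDerivAt_curvF (hTs : ∀ w ∈ U, (T w).transpose = T w) (i j m k : Fin n) :
    HasDerivAt (fun t : ℝ => curvF (fun z => G z + t • T z) i j p m k)
      (chrVar G T p i j k m - chrVar G T p j i k m) 0 := by
  have h1 := ((h.hasDerivAt_pd_christoffel hT hTs i m j k).fun_sub
    (h.hasDerivAt_pd_christoffel hT hTs j m i k)).fun_add
    (HasDerivAt.fun_sum (u := Finset.univ) fun a _ =>
      (h.hasDerivAt_christoffel_mul hT m i a a j k).fun_sub
        (h.hasDerivAt_christoffel_mul hT m j a a i k))
  simp only [sub_zero, Finset.sum_const_zero, add_zero] at h1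
  refine h1.congr_of_eventuallyEq (Filter.Eventually.of_forall fun t => ?_)
  exact (riemannUp_eq _ i j k m p).symm

/-- The first variation of the Ricci tensor at the centre of normal coordinates. -/
theorem hasDerivAt_ricci (hTs : ∀ w ∈ U, (T w).transpose = T w)
    (hpos : ∀ᶠ t : ℝ in nhds 0, (G p + t • T p).PosDef) (j k : Fin n) :
    HasDerivAt (fun t : ℝ => ricci (fun z => G z + t • T z) p j k)
      ((1 / 2) * ∑ i, (covD2 G T i j p k i + covD2 G T i k p j i - covD2 G T i i p j k
        - covD2 G T j k p i i)) 0 := by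
  have h1 := (HasDerivAt.fun_sum (u := Finset.univ) fun i _ =>
    h.hasDerivAt_curvF hT hTs i j i k).congr_of_eventuallyEq
      (f₁ := fun t : ℝ => ricci (fun z => G z + t • T z) p j k) (hpos.mono fun t ht => by
        -- Positivity of $G+tT$ is known only at the centre, and that is enough for the contraction
        -- formula of the Ricci tensor.
        have hm : IsMetricOn (fun z => G z + t • T z) {p} :=
          ⟨fun z hz => by
            rw [Set.mem_singleton_iff.1 hz]; exact MSm.line_field h.smooth (hT p h.mem) t,
          fun z hz => by rw [Set.mem_singleton_iff.1 hz]; exact ht⟩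
        exact ricci_eq hm rfl j k)
  refine h1.congr_deriv ?_
  rw [Finset.mul_sum]
  refine Finset.sum_congr rfl fun i _ => ?_
  rw [chrVar, chrVar, covD2_symm hTs h.isOpen h.mem j i i k]
  ring

/-- The first variation of the scalar curvature at the centre of normal coordinates. -/
theorem hasDerivAt_scalar (hTs : ∀ w ∈ U, (T w).transpose = T w)
    (hpos : ∀ᶠ t : ℝ in nhds 0, (G p + t • T p).PosDef) :
    HasDerivAt (fun t : ℝ => scalar (fun z => G z + t • T z) p)
      (trace G (formDeriv G fun i z => divergence G T i z - pd i (trace G T) z) p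
        - tensorInner G (ricci G) T p) 0 := by
  have hTp := hT p h.mem
  have hinv : HasMDerivAt (fun t : ℝ => (1 + t • T p)⁻¹) (-(T p)) 0 := by
    simpa using (HasMDerivAt.line 1 (T p) 0).inv (MSm.line 1 (T p) 0) (by simp)
  have h1 := HasDerivAt.fun_sum (u := Finset.univ) fun i _ =>
    HasDerivAt.fun_sum (u := Finset.univ) fun j _ =>
      (hinv i j).fun_mul (h.hasDerivAt_ricci hT hTs hpos i j)
  have h2 : (fun t : ℝ => scalar (fun z => G z + t • T z) p) = fun t : ℝ =>
      ∑ i, ∑ j, (1 + t • T p)⁻¹ i j * ricci (fun z => G z + t • T z) p i j := by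
    funext t
    rw [← h.eq_one]; rfl
  rw [h2]
  refine h1.congr_deriv ?_
  have hd : ∀ i, ContDiffAt ℝ ∞ (divergence G T i) p := by
    intro i
    have : divergence G T i = fun z => ∑ j, ∑ a, (G z)⁻¹ j a * covD G T a z i j :=
      funext fun z => Coord.divergence_eq T i z
    rw [this]
    exact ContDiffAt.sum fun j _ => ContDiffAt.sum fun a _ =>
      (h.smooth_inv j a).mul (h.metric.smooth_covD hT h.mem a i j)
  have ht : ContDiffAt ℝ ∞ (trace G T) p := by
    have : trace G T = fun z => ∑ i, ∑ j, (G z)⁻¹ i j * T z i j := rfl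
    rw [this]
    exact ContDiffAt.sum fun j _ => ContDiffAt.sum fun a _ => (h.smooth_inv j a).mul (hTp j a)
  have e1 : trace G (formDeriv G fun i z => divergence G T i z - pd i (trace G T) z) p =
      ∑ i, ∑ j, (covD2 G T i j p i j - covD2 G T i i p j j) := by
    rw [h.trace_eq]
    refine Finset.sum_congr rfl fun i _ => ?_
    rw [h.formDeriv_eq, pd_sub (hd i) (contDiffAt_pd ht i), h.pd_divergence hT,
      h.pd_pd_trace hT, ← Finset.sum_sub_distrib]
  rw [e1, h.tensorInner_eq]
  have hs := covD2_symm (G := G) hTs h.isOpen h.mem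
  have e2 : ∑ i, ∑ j, ((1 : Matrix (Fin n) (Fin n) ℝ) i j * ((1 / 2) * ∑ s,
      (covD2 G T s i p j s + covD2 G T s j p i s - covD2 G T s s p i j - covD2 G T i j p s s)))
      = ∑ i, ∑ j, (covD2 G T i j p i j - covD2 G T i i p j j) := by
    simp only [Matrix.one_apply, ite_mul, one_mul, zero_mul, Finset.sum_ite_eq, Finset.mem_univ,
      if_true]
    -- After tracing, the four double sums collapse to two by exchanging summation indices and by
    -- the symmetry of $T$.
    have e3 : ∑ i, ∑ s, covD2 G T s s p i i = ∑ i, ∑ s, covD2 G T i i p s s := Finset.sum_comm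
    have e4 : ∑ i, ∑ s, covD2 G T s i p i s = ∑ i, ∑ s, covD2 G T i s p i s := by
      rw [Finset.sum_comm]
      exact Finset.sum_congr rfl fun i _ => Finset.sum_congr rfl fun s _ => hs _ _ _ _
    simp only [← Finset.mul_sum, Finset.sum_add_distrib, Finset.sum_sub_distrib, e3, e4]
    ring
  rw [← e2, ← Finset.sum_sub_distrib]
  refine Finset.sum_congr rfl fun i _ => ?_
  rw [← Finset.sum_sub_distrib]
  refine Finset.sum_congr rfl fun j _ => ?_
  simp
  ring

end IsNormalAt

end

end Coord

/-! ### First variations in arbitrary coordinates -/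

namespace Coord

variable {n : ℕ}

section

variable {G T : Rn n → Matrix (Fin n) (Fin n) ℝ} {U V : Set (Rn n)} {p y : Rn n}

theorem IsMetricOn.smooth_trace (hG : IsMetricOn G V) (hy : y ∈ V) (hT : MSm T y) :
    ContDiffAt ℝ ∞ (trace G T) y := by
  have : trace G T = fun z => ∑ i, ∑ j, (G z)⁻¹ i j * T z i j := rfl
  rw [this]
  exact ContDiffAt.sum fun j _ => ContDiffAt.sum fun a _ =>
    (hG.smooth_inv hy j a).mul (hT j a)

theorem IsMetricOn.smooth_scalar (hG : IsMetricOn G V) (hV : IsOpen V) (hy : y ∈ V) :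
    ContDiffAt ℝ ∞ (scalar G) y := hG.smooth_trace hy (hG.smooth_ricci hV hy)

theorem IsMetricOn.smooth_divergence (hG : IsMetricOn G V) (hT : ∀ w ∈ V, MSm T w) (hy : y ∈ V)
    (i : Fin n) : ContDiffAt ℝ ∞ (divergence G T i) y := by
  have : divergence G T i = fun z => ∑ j, ∑ a, (G z)⁻¹ j a * covD G T a z i j :=
    funext fun z => divergence_eq T i z
  rw [this]
  exact ContDiffAt.sum fun j _ => ContDiffAt.sum fun a _ =>
    (hG.smooth_inv hy j a).mul (hG.smooth_covD hT hy a i j)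

theorem IsMetricOn.smooth_formDeriv (hG : IsMetricOn G V) {θ : Fin n → Rn n → ℝ} (hy : y ∈ V)
    (hθ : ∀ i, ContDiffAt ℝ ∞ (θ i) y) : MSm (formDeriv G θ) y := fun a b =>
  (contDiffAt_pd (hθ b) a).sub (ContDiffAt.sum fun m _ =>
    (hG.smooth_chr hy a m b).mul (hθ m))

/-- The pull-back of a 2-tensor. -/
def pull (ψ : Rn n → Rn n) (T : Rn n → Matrix (Fin n) (Fin n) ℝ) (z : Rn n) :
    Matrix (Fin n) (Fin n) ℝ :=
  (jac ψ z).transpose * T (ψ z) * jac ψ z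

theorem isPullback_pull (ψ : Rn n → Rn n) (U : Set (Rn n))
    (T : Rn n → Matrix (Fin n) (Fin n) ℝ) : IsPullback ψ U (pull ψ T) T := fun _ _ => rfl

/-- Pulling back is linear, so a single coordinate change, normal for $G$ alone, serves the whole
line of metrics. -/
theorem isPullback_pull_line (ψ : Rn n → Rn n) (U : Set (Rn n))
    (G T : Rn n → Matrix (Fin n) (Fin n) ℝ) (t : ℝ) :
    IsPullback ψ U (fun z => pull ψ G z + t • pull ψ T z) (fun z => G z + t • T z) :=
  fun z _ => by simp only [pull, Matrix.mul_add, Matrix.add_mul, Matrix.mul_smul, Matrix.smul_mul]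

theorem IsPullback.smooth {ψ : Rn n → Rn n} {T' : Rn n → Matrix (Fin n) (Fin n) ℝ}
    (hP : IsPullback ψ U T' T) (hψ : IsCoordChange ψ U V) (hT : ∀ w ∈ V, MSm T w) {z : Rn n}
    (hz : z ∈ U) : MSm T' z := by
  have h : MSm (fun z => (jac ψ z).transpose * T (ψ z) * jac ψ z) z :=
    ((hψ.smooth_jac hz).transpose.mul ((hT _ (hψ.mapsTo z hz)).comp (hψ.smooth z hz))).mul
      (hψ.smooth_jac hz)
  exact h.congr (Filter.eventuallyEq_of_mem (hψ.isOpen_source.mem_nhds hz) hP)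

theorem IsPullback.symm {ψ : Rn n → Rn n} {T' : Rn n → Matrix (Fin n) (Fin n) ℝ}
    (hP : IsPullback ψ U T' T) (hψ : IsCoordChange ψ U V)
    (hT : ∀ w ∈ V, (T w).transpose = T w) {z : Rn n} (hz : z ∈ U) :
    (T' z).transpose = T' z := by
  have h := hP.transpose z hz
  beta_reduce at h
  rw [h, hP z hz, hT _ (hψ.mapsTo z hz)]

theorem IsFormPullback.eq_zero {ψ : Rn n → Rn n} {θ θ' : Fin n → Rn n → ℝ}
    (hP : IsFormPullback ψ U θ' θ) (hψ : IsCoordChange ψ U V) {z : Rn n} (hz : z ∈ U)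
    (h : ∀ i, θ' i z = 0) (i : Fin n) : θ i (ψ z) = 0 := by
  have h1 : Matrix.vecMul (fun a => θ a (ψ z)) (jac ψ z) = 0 := by
    ext i
    rw [Matrix.vecMul, dotProduct, Pi.zero_apply, ← h i, hP z hz]
    exact Finset.sum_congr rfl fun a _ => mul_comm _ _
  have h2 : Matrix.vecMul (Matrix.vecMul (fun a => θ a (ψ z)) (jac ψ z)) (jac ψ z)⁻¹ = 0 := by
    rw [h1, Matrix.zero_vecMul]
  rw [Matrix.vecMul_vecMul, hψ.mul_inv hz, Matrix.vecMul_one] at h2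
  exact congrFun h2 i

/-- The Einstein tensor is divergence-free. -/
theorem divergence_einsteinTensor (hV : IsOpen V) (hG : IsMetricOn G V) (hy : y ∈ V)
    (i : Fin n) :
    divergence G (fun z => ricci G z - (scalar G z / 2) • G z) i y = 0 := by
  obtain ⟨ψ, U, hψ, rfl, hn⟩ := exists_normal hV hG hy
  have hP := isPullback_pull ψ U G
  have h := hn _ hP
  have hT : IsPullback ψ U (fun z => ricci (pull ψ G) z - (scalar (pull ψ G) z / 2) • pull ψ G z)
      (fun z => ricci G z - (scalar G z / 2) • G z) := fun z hz => by
    simp only [ricci_pullback hψ hG hP z hz, scalar_pullback hψ hG hP hz, hP z hz,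
      Matrix.mul_sub, Matrix.sub_mul, Matrix.mul_smul, Matrix.smul_mul]
  refine (divergence_pullback hψ hG hP (fun w hw => ?_) hT).eq_zero hψ h.mem
    (fun i => h.divergence_einsteinTensor i) i
  exact (hG.smooth_ricci hV hw).sub
    (MSm.smul ((hG.smooth_scalar hV hw).div_const 2) (hG.smooth w hw))

/-- The first variation of the scalar curvature. -/
theorem hasDerivAt_scalar (hV : IsOpen V) (hG : IsMetricOn G V) (hT : ∀ w ∈ V, MSm T w)
    (hTs : ∀ w ∈ V, (T w).transpose = T w)
    (hpos : ∀ᶠ t : ℝ in nhds 0, IsMetricOn (fun z => G z + t • T z) V) (hy : y ∈ V) :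
    HasDerivAt (fun t : ℝ => scalar (fun z => G z + t • T z) y)
      (trace G (formDeriv G fun i z => divergence G T i z - pd i (trace G T) z) y
        - tensorInner G (ricci G) T y) 0 := by
  obtain ⟨ψ, U, hψ, rfl, hn⟩ := exists_normal hV hG hy
  have hP := isPullback_pull ψ U G
  have hPT := isPullback_pull ψ U T
  have h := hn _ hP
  have hpos' : ∀ᶠ t : ℝ in nhds 0, (pull ψ G 0 + t • pull ψ T 0).PosDef :=
    hpos.mono fun t ht => ((isPullback_pull_line ψ U G T t).isMetricOn hψ ht).posDef 0 h.mem
  have h1 := h.hasDerivAt_scalar (fun w hw => hPT.smooth hψ hT hw)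
    (fun w hw => hPT.symm hψ hTs hw) hpos'
  have h2 := h1.congr_of_eventuallyEq (hpos.mono fun t ht =>
    (scalar_pullback hψ ht (isPullback_pull_line ψ U G T t) h.mem).symm)
  have hθ : IsFormPullback ψ U
      (fun i z => divergence (pull ψ G) (pull ψ T) i z - pd i (trace (pull ψ G) (pull ψ T)) z)
      (fun i z => divergence G T i z - pd i (trace G T) z) := fun z hz i => by
    have e1 := divergence_pullback hψ hG hP hT hPT z hz i
    have e2 : pd i (trace (pull ψ G) (pull ψ T)) z = ∑ a, jac ψ z a i * pd a (trace G T) (ψ z) :=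
      grad_pullback hψ (fun w hw => hG.smooth_trace hw (hT w hw))
      (fun w hw => trace_pullback hψ hG hP hPT hw) z hz i
    simp only [e1, e2, mul_sub, Finset.sum_sub_distrib]
  refine h2.congr_deriv ?_
  rw [trace_pullback hψ hG hP (formDeriv_pullback hψ hG hP (fun w hw i =>
    (hG.smooth_divergence hT hw i).sub
      (contDiffAt_pd (hG.smooth_trace hw (hT w hw)) i)) hθ) h.mem,
    tensorInner_pullback hψ hG hP (ricci_pullback hψ hG hP) hPT h.mem]

end

/-! ### Linearized Ricci curvature at an Einstein metric -/

section Einstein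

variable {G T T₀ : Rn n → Matrix (Fin n) (Fin n) ℝ} {U V : Set (Rn n)} {p y : Rn n}

namespace IsNormalAt

variable (h : IsNormalAt G U p)

include h

theorem curvAction_eq (j k : Fin n) :
    curvAction G T p j k = ∑ i, ∑ m, T p i m * curvF G i j p m k := by
  rw [Coord.curvAction_eq h.metric h.mem, h.inv_eq_one]
  simp [Matrix.mul_apply]

theorem einsteinOp_eq (j k : Fin n) :
    einsteinOp G T p j k = ∑ i, covD2 G T i i p j k + 2 * curvAction G T p j k := by
  simp [einsteinOp, h.inv_eq_one, Matrix.one_apply, covDeriv2_eq]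

theorem curvF_skew (i j m k : Fin n) : curvF G i j p m k = -curvF G i j p k m := by
  have := congrFun (congrFun (curvF_transpose h.isOpen h.metric h.mem i j) m) k
  rw [h.eq_one] at this
  simp only [Matrix.mul_one, Matrix.one_mul, Matrix.add_apply, Matrix.transpose_apply,
    Matrix.zero_apply] at this
  linarith

/-- The pair symmetry of the curvature tensor. -/
theorem curvF_pair (i j m k : Fin n) : curvF G i j p m k = curvF G m k p i j := by
  have h0 : MSm (fun _ : Rn n => (0 : Matrix (Fin n) (Fin n) ℝ)) p := MSm.const 0 p
  have hG0 : ∀ i a j k, pd i (christoffel G a j k) p = (1 / 2) * pd i (chrLow G a j k) p := by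
    intro i a j k
    have := h.pd_christoffel_line (T := fun _ => 0) (fun w _ => MSm.const 0 w) (t := 0)
      (by simp) i a j k
    simpa [Matrix.one_apply] using this
  have hs : ∀ a b i j, pd a (pd b fun z => G z i j) p = pd a (pd b fun z => G z j i) p :=
    fun a b i j => pd_congr (pd_congr_eventually (Filter.eventuallyEq_of_mem
      (h.isOpen.mem_nhds h.mem) fun z hz => h.metric.symm hz i j) b) a
  -- In normal coordinates the curvature is linear in the second derivatives of the metric, and the
  -- pair symmetry can be read off from this expression.
  have hF : ∀ i j m k, curvF G i j p m k = (1 / 2) * (pd i (pd k fun z => G z j m) p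
      - pd i (pd m fun z => G z j k) p - pd j (pd k fun z => G z i m) p
      + pd j (pd m fun z => G z i k) p) := by
    intro i j m k
    have e : curvF G i j p m k = pd i (christoffel G m j k) p - pd j (christoffel G m i k) p := by
      rw [h.curvF_eq]; rfl
    rw [e, hG0, hG0, pd_chrLow h.smooth, pd_chrLow h.smooth, pd_comm (h.smooth k m) i j]
    ring
  rw [hF, hF, pd_comm (h.smooth j m) i k, pd_comm (h.smooth j k) i m,
    pd_comm (h.smooth i m) j k, pd_comm (h.smooth i k) j m, hs k i j m, hs m i j k,
    hs k j i m, hs m j i k]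
  ring

theorem curvAction_symm (hTs : (T p).transpose = T p) (j k : Fin n) :
    curvAction G T p j k = curvAction G T p k j := by
  rw [h.curvAction_eq, h.curvAction_eq, Finset.sum_comm]
  refine Finset.sum_congr rfl fun i _ => Finset.sum_congr rfl fun m _ => ?_
  rw [h.curvF_pair, show T p m i = T p i m from congrFun (congrFun hTs i) m]

/-- Commuting covariant derivatives. -/
theorem sum_covD2_comm (hT : MSm T p) (hTs : (T p).transpose = T p) (j k : Fin n) :
    ∑ i, covD2 G T i j p k i = ∑ i, covD2 G T j i p k i - curvAction G T p j k
      + ∑ m, T p k m * ricci G p j m := by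
  have h1 : ∀ i, covD2 G T i j p k i = covD2 G T j i p k i
      - (∑ m, T p i m * curvF G i j p m k + ∑ m, T p k m * curvF G i j p m i) := by
    intro i
    rw [h.covD2_eq hT, h.covD2_eq hT, mpd_comm hT i j, h.curvF_eq]
    simp only [Matrix.sub_apply, Matrix.add_apply, Matrix.mul_apply, Matrix.transpose_apply,
      mul_sub, Finset.sum_sub_distrib]
    have : ∀ (M : Matrix (Fin n) (Fin n) ℝ), ∑ m, M m k * T p m i = ∑ m, T p i m * M m k :=
      fun M => Finset.sum_congr rfl fun m _ => by
        rw [mul_comm, show T p m i = T p i m from congrFun (congrFun hTs i) m]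
    rw [this, this]
    ring
  simp only [h1, Finset.sum_sub_distrib, Finset.sum_add_distrib]
  rw [h.curvAction_eq]
  have h2 : ∑ i, ∑ m, T p k m * curvF G i j p m i = -∑ m, T p k m * ricci G p j m := by
    rw [Finset.sum_comm, ← Finset.sum_neg_distrib]
    refine Finset.sum_congr rfl fun m _ => ?_
    rw [ricci_eq h.metric h.mem, Finset.mul_sum, ← Finset.sum_neg_distrib]
    exact Finset.sum_congr rfl fun i _ => by rw [h.curvF_skew]; ring
  rw [h2]; ring

/-- The metric is parallel, so a conformal part only contributes the second derivatives of its
factor. -/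
theorem covD2_add_smul_metric {v : Rn n → ℝ} (hT₀ : ∀ w ∈ U, MSm T₀ w)
    (hv : ∀ w ∈ U, ContDiffAt ℝ ∞ v w) (hT : ∀ w ∈ U, T w = T₀ w + v w • G w) (b a : Fin n) :
    covD2 G T b a p = covD2 G T₀ b a p + pd b (pd a v) p • (1 : Matrix (Fin n) (Fin n) ℝ) := by
  have h1 : ∀ w ∈ U, covD G T a w = covD G T₀ a w + pd a v w • G w := by
    intro w hw
    rw [covD_congr_on h.isOpen hT hw, covD, mpd_add (hT₀ w hw)
      (MSm.smul (hv w hw) (h.metric.smooth w hw)), mpd_smul (hv w hw) (h.metric.smooth w hw),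
      mpd_metric h.metric h.isOpen hw, covD]
    simp only [Matrix.mul_add, Matrix.add_mul, Matrix.mul_smul, Matrix.smul_mul, smul_add]
    abel
  rw [h.covD2_eq_mpd, h.covD2_eq_mpd, mpd_congr_on h.isOpen h1 h.mem,
    mpd_add (h.metric.smooth_covD hT₀ h.mem a)
      (MSm.smul (contDiffAt_pd (hv p h.mem) a) h.smooth),
    mpd_smul (contDiffAt_pd (hv p h.mem) a) h.smooth, h.mpd_metric_eq_zero, h.eq_one]
  simp

/-- In the general first variation, commuting derivatives turns the two mixed terms into derivatives
of the divergence, which vanish, plus curvature terms. Those combine with the rough Laplacian into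
$-\frac12\Delta_E$, and the Einstein condition supplies $c\,T_0$. The conformal part gives the
Hessian and the Laplacian. -/
theorem hasMDerivAt_ricci {v : Rn n → ℝ} {c : ℝ} (hE : ∀ w ∈ U, ricci G w = c • G w)
    (hT₀ : ∀ w ∈ U, MSm T₀ w) (hTs : ∀ w ∈ U, (T₀ w).transpose = T₀ w)
    (htr : ∀ w ∈ U, trace G T₀ w = 0) (hdiv : ∀ w ∈ U, ∀ i, divergence G T₀ i w = 0)
    (hv : ∀ w ∈ U, ContDiffAt ℝ ∞ v w) (hT : ∀ w ∈ U, T w = T₀ w + v w • G w)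
    (hpos : ∀ᶠ t : ℝ in nhds 0, (G p + t • T p).PosDef) :
    HasMDerivAt (fun t : ℝ => ricci (fun z => G z + t • T z) p)
      (-(1 / 2 : ℝ) • einsteinOp G T₀ p + c • T₀ p - (((n : ℝ) - 2) / 2) • hess G v p
        - (laplacian G v p / 2) • G p) 0 := by
  intro j k
  have hTsm : ∀ w ∈ U, MSm T w := fun w hw =>
    ((hT₀ w hw).add (MSm.smul (hv w hw) (h.metric.smooth w hw))).congr
      (Filter.eventuallyEq_of_mem (h.isOpen.mem_nhds hw) hT)
  have hTsym : ∀ w ∈ U, (T w).transpose = T w := fun w hw => by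
    rw [hT w hw, Matrix.transpose_add, Matrix.transpose_smul, hTs w hw, h.metric.transpose hw]
  refine (h.hasDerivAt_ricci hTsm hTsym hpos j k).congr_deriv ?_
  simp only [h.covD2_add_smul_metric hT₀ hv hT]
  have hs := covD2_symm (G := G) hTs h.isOpen h.mem
  have hvc : pd j (pd k v) p = pd k (pd j v) p := pd_comm (hv p h.mem) j k
  have hdiv0 : ∀ b i, ∑ s, covD2 G T₀ b s p i s = 0 := by
    intro b i
    rw [← h.pd_divergence hT₀, pd_congr (g := fun _ => 0) (Filter.eventuallyEq_of_mem
      (h.isOpen.mem_nhds h.mem) fun z hz => hdiv z hz i), pd_const]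
  have htr0 : ∑ s, covD2 G T₀ j k p s s = 0 := by
    rw [← h.pd_pd_trace hT₀, pd_congr (g := fun _ => 0) (pd_congr_eventually (g := fun _ => 0)
      (Filter.eventuallyEq_of_mem (h.isOpen.mem_nhds h.mem) fun z hz => htr z hz) k |>.trans
      (Filter.Eventually.of_forall fun z => pd_const 0 z k)), pd_const]
  have hR : ∀ j k, ∑ m, T₀ p k m * ricci G p j m = c * T₀ p k j := by
    intro j k
    rw [hE p h.mem, h.eq_one]
    simp [Matrix.one_apply, mul_comm]
  have hsT : T₀ p k j = T₀ p j k := congrFun (congrFun (hTs p h.mem) j) k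
  have c1 := h.sum_covD2_comm (hT₀ p h.mem) (hTs p h.mem) j k
  have c2 := h.sum_covD2_comm (hT₀ p h.mem) (hTs p h.mem) k j
  rw [hdiv0, hR] at c1 c2
  rw [h.curvAction_symm (hTs p h.mem) k j] at c2
  have hlap : laplacian G v p = ∑ i, pd i (pd i v) p := by
    rw [laplacian_eq, h.trace_eq]
    exact Finset.sum_congr rfl fun i _ => h.hess_eq v i i
  simp only [Matrix.add_apply, Matrix.sub_apply, Matrix.smul_apply, smul_eq_mul,
    Finset.sum_add_distrib, Finset.sum_sub_distrib, c1, c2, htr0, h.einsteinOp_eq, h.hess_eq,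
    hlap, h.eq_one, Matrix.one_apply, mul_ite, mul_one, mul_zero, Finset.sum_ite_eq,
    Finset.mem_univ, if_true, Finset.sum_const, Finset.card_univ,
    Fintype.card_fin, nsmul_eq_mul, hsT, hvc]
  split_ifs <;> simp <;> ring

end IsNormalAt

/-- The first variation of the Ricci tensor at an Einstein metric. -/
theorem hasMDerivAt_ricci {v : Rn n → ℝ} {c : ℝ} (hV : IsOpen V) (hG : IsMetricOn G V)
    (hE : ∀ w ∈ V, ricci G w = c • G w)
    (hT₀ : ∀ w ∈ V, MSm T₀ w) (hTs : ∀ w ∈ V, (T₀ w).transpose = T₀ w)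
    (htr : ∀ w ∈ V, trace G T₀ w = 0) (hdiv : ∀ w ∈ V, ∀ i, divergence G T₀ i w = 0)
    (hv : ∀ w ∈ V, ContDiffAt ℝ ∞ v w) (hT : ∀ w ∈ V, T w = T₀ w + v w • G w)
    (hpos : ∀ᶠ t : ℝ in nhds 0, IsMetricOn (fun z => G z + t • T z) V) (hy : y ∈ V) :
    HasMDerivAt (fun t : ℝ => ricci (fun z => G z + t • T z) y)
      (-(1 / 2 : ℝ) • einsteinOp G T₀ y + c • T₀ y - (((n : ℝ) - 2) / 2) • hess G v y
        - (laplacian G v y / 2) • G y) 0 := by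
  obtain ⟨ψ, U, hψ, rfl, hn⟩ := exists_normal hV hG hy
  have hP := isPullback_pull ψ U G
  have hPT := isPullback_pull ψ U T₀
  have h := hn _ hP
  have hpos' : ∀ᶠ t : ℝ in nhds 0, (pull ψ G 0 + t • pull ψ T 0).PosDef :=
    hpos.mono fun t ht => ((isPullback_pull_line ψ U G T t).isMetricOn hψ ht).posDef 0 h.mem
  have hEp : ∀ w ∈ U, ricci (pull ψ G) w = c • pull ψ G w := fun w hw => by
    rw [ricci_pullback hψ hG hP w hw, hE _ (hψ.mapsTo w hw), pull, Matrix.mul_smul,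
      Matrix.smul_mul]
  have hdivp : ∀ w ∈ U, ∀ i, divergence (pull ψ G) (pull ψ T₀) i w = 0 := fun w hw i => by
    rw [divergence_pullback hψ hG hP hT₀ hPT w hw i]
    exact Finset.sum_eq_zero fun a _ => by rw [hdiv _ (hψ.mapsTo w hw), mul_zero]
  have hvp : ∀ w ∈ U, ContDiffAt ℝ ∞ (fun z => v (ψ z)) w := fun w hw =>
    (hv _ (hψ.mapsTo w hw)).comp w (hψ.smooth w hw)
  have hTp : ∀ w ∈ U, pull ψ T w = pull ψ T₀ w + v (ψ w) • pull ψ G w := fun w hw => by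
    simp only [pull, hT _ (hψ.mapsTo w hw), Matrix.mul_add, Matrix.add_mul, Matrix.mul_smul,
      Matrix.smul_mul]
  have h1 := h.hasMDerivAt_ricci hEp (fun w hw => hPT.smooth hψ hT₀ hw)
    (fun w hw => hPT.symm hψ hTs hw)
    (fun w hw => by rw [trace_pullback hψ hG hP hPT hw, htr _ (hψ.mapsTo w hw)])
    hdivp hvp hTp hpos'
  have hH := hess_pullback (u' := fun z => v (ψ z)) hψ hG hP hv (fun _ _ => rfl)
  have hL : laplacian (pull ψ G) (fun z => v (ψ z)) 0 = laplacian G v (ψ 0) := by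
    rw [laplacian_eq, laplacian_eq, trace_pullback hψ hG hP hH h.mem]
  rw [einsteinOp_pullback hψ hG hP hT₀ hPT 0 h.mem, hH 0 h.mem, hL] at h1
  -- At the point, the Ricci tensors of the pulled-back line are congruent, by a matrix independent
  -- of $t$, to those of the original line. The congruence can therefore be undone after
  -- differentiating.
  have h2 := h1.congr (B := fun t : ℝ => (jac ψ 0).transpose *
    ricci (fun z => G z + t • T z) (ψ 0) * jac ψ 0) (hpos.mono fun t ht =>
    (ricci_pullback hψ ht (isPullback_pull_line ψ U G T t) 0 h.mem).symm)
  have h3 := ((HasMDerivAt.const ((jac ψ 0)⁻¹).transpose 0).mul h2).mul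
    (HasMDerivAt.const (jac ψ 0)⁻¹ 0)
  have hcancel : ∀ M : Matrix (Fin n) (Fin n) ℝ, ((jac ψ 0)⁻¹).transpose *
      ((jac ψ 0).transpose * M * jac ψ 0) * (jac ψ 0)⁻¹ = M := by
    intro M
    have e : ((jac ψ 0)⁻¹).transpose * (jac ψ 0).transpose = 1 := by
      rw [← Matrix.transpose_mul, hψ.mul_inv h.mem, Matrix.transpose_one]
    calc _ = (((jac ψ 0)⁻¹).transpose * (jac ψ 0).transpose) * M * (jac ψ 0 * (jac ψ 0)⁻¹) := by
          simp only [Matrix.mul_assoc]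
      _ = M := by rw [e, hψ.mul_inv h.mem, Matrix.one_mul, Matrix.mul_one]
  simp only [hcancel, Matrix.zero_mul, Matrix.mul_zero, zero_add, add_zero] at h3
  convert h3 using 1
  rw [← hcancel (-(1 / 2 : ℝ) • einsteinOp G T₀ (ψ 0) + c • T₀ (ψ 0)
    - (((n : ℝ) - 2) / 2) • hess G v (ψ 0) - (laplacian G v (ψ 0) / 2) • G (ψ 0))]
  congr 2
  simp only [pull, Matrix.mul_add, Matrix.add_mul, Matrix.mul_sub, Matrix.sub_mul,
    Matrix.mul_smul, Matrix.smul_mul]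

end Einstein

end Coord

namespace Coord

variable {n : ℕ}

/-! ### Divergences -/

section

variable {G S : Rn n → Matrix (Fin n) (Fin n) ℝ} {U V : Set (Rn n)} {p y : Rn n}

/-- The 1-form `g^{ki} ∂_k f S_{ij}`. -/
def gradContr (G S : Rn n → Matrix (Fin n) (Fin n) ℝ) (f : Rn n → ℝ) (j : Fin n) (z : Rn n) : ℝ :=
  ∑ k, pd k f z * ((G z)⁻¹ * S z) k j

theorem IsMetricOn.smooth_gradContr (hG : IsMetricOn G V) {f : Rn n → ℝ} (hy : y ∈ V)
    (hS : MSm S y) (hf : ContDiffAt ℝ ∞ f y) (j : Fin n) :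
    ContDiffAt ℝ ∞ (gradContr G S f j) y :=
  ContDiffAt.sum fun k _ => (contDiffAt_pd hf k).mul (((hG.smooth_inv hy).mul hS) k j)

theorem gradContr_pullback {G' S' : Rn n → Matrix (Fin n) (Fin n) ℝ} {ψ : Rn n → Rn n}
    {f f' : Rn n → ℝ} (hψ : IsCoordChange ψ U V) (hP : IsPullback ψ U G' G)
    (hS : IsPullback ψ U S' S) (hfs : ∀ w ∈ V, ContDiffAt ℝ ∞ f w)
    (hf : ∀ z ∈ U, f' z = f (ψ z)) :
    IsFormPullback ψ U (gradContr G' S' f') (gradContr G S f) := by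
  intro z hz j
  have hg : ∀ i, pd i f' z = ∑ a, jac ψ z a i * pd a f (ψ z) := grad_pullback hψ hfs hf z hz
  simp only [gradContr, hg, hP.inv_mul hψ hS hz]
  have h1 : ∀ (v : Fin n → ℝ) (M : Matrix (Fin n) (Fin n) ℝ),
      ∑ k, (∑ a, jac ψ z a k * v a) * ((jac ψ z)⁻¹ * M * jac ψ z) k j =
        ∑ b, jac ψ z b j * ∑ k, v k * M k b := by
    intro v M
    have e1 : ∑ k, (∑ a, jac ψ z a k * v a) * ((jac ψ z)⁻¹ * M * jac ψ z) k j =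
        Matrix.vecMul (Matrix.vecMul v (jac ψ z)) ((jac ψ z)⁻¹ * M * jac ψ z) j := by
      simp only [Matrix.vecMul, dotProduct]
      exact Finset.sum_congr rfl fun k _ => by
        congr 1; exact Finset.sum_congr rfl fun a _ => mul_comm _ _
    rw [e1, Matrix.vecMul_vecMul, ← Matrix.mul_assoc, ← Matrix.mul_assoc, hψ.mul_inv hz,
      Matrix.one_mul, ← Matrix.vecMul_vecMul]
    simp only [Matrix.vecMul, dotProduct]
    exact Finset.sum_congr rfl fun b _ => mul_comm _ _
  exact h1 _ _

/-- The Leibniz rule $\mathrm{div}(S(\nabla f,\cdot))=\langle S,\mathrm{Hess}f\rangle+(\delta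
S)(\nabla f)$, checked in normal coordinates. It serves both for the Einstein tensor and for a
transverse traceless tensor. -/
theorem trace_formDeriv_gradContr {f : Rn n → ℝ} (hV : IsOpen V) (hG : IsMetricOn G V)
    (hS : ∀ w ∈ V, MSm S w) (hdiv : ∀ w ∈ V, ∀ i, divergence G S i w = 0)
    (hf : ∀ w ∈ V, ContDiffAt ℝ ∞ f w) (hy : y ∈ V) :
    trace G (formDeriv G (gradContr G S f)) y = tensorInner G S (hess G f) y := by
  obtain ⟨ψ, U, hψ, rfl, hn⟩ := exists_normal hV hG hy
  have hP := isPullback_pull ψ U G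
  have hPS := isPullback_pull ψ U S
  have h := hn _ hP
  have hθ := gradContr_pullback (f' := fun z => f (ψ z)) hψ hP hPS hf fun _ _ => rfl
  have hH := hess_pullback (u' := fun z => f (ψ z)) hψ hG hP hf fun _ _ => rfl
  rw [← trace_pullback hψ hG hP (formDeriv_pullback hψ hG hP (fun w hw i =>
    hG.smooth_gradContr hw (hS w hw) (hf w hw) i) hθ) h.mem,
    ← tensorInner_pullback hψ hG hP hPS hH h.mem, h.trace_eq, h.tensorInner_eq]
  have hfp : ContDiffAt ℝ ∞ (fun z => f (ψ z)) 0 :=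
    (hf _ (hψ.mapsTo 0 h.mem)).comp 0 (hψ.smooth 0 h.mem)
  have hSp : MSm (pull ψ S) 0 := hPS.smooth hψ hS h.mem
  have hm := h.smooth_inv.mul hSp
  have hd : ∀ k, ∑ i, pd i (fun z => pull ψ S z k i) 0 = 0 := fun k => by
    rw [← h.divergence_eq, divergence_pullback hψ hG hP hS hPS 0 h.mem k]
    exact Finset.sum_eq_zero fun a _ => by rw [hdiv _ (hψ.mapsTo 0 h.mem), mul_zero]
  have h1 : ∀ i, formDeriv (pull ψ G) (gradContr (pull ψ G) (pull ψ S) fun z => f (ψ z)) 0 i i =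
      ∑ k, (pull ψ S 0 k i * hess (pull ψ G) (fun z => f (ψ z)) 0 k i
        + pd k (fun z => f (ψ z)) 0 * pd i (fun z => pull ψ S z k i) 0) := by
    intro i
    have e : gradContr (pull ψ G) (pull ψ S) (fun z => f (ψ z)) i = fun z =>
      ∑ k, pd k (fun z => f (ψ z)) z * ((pull ψ G z)⁻¹ * pull ψ S z) k i := rfl
    rw [h.formDeriv_eq, e, pd_sum fun k _ => (contDiffAt_pd hfp k).mul (hm k i)]
    refine Finset.sum_congr rfl fun k _ => ?_
    rw [pd_mul (contDiffAt_pd hfp k) (hm k i), h.hess_eq, pd_comm hfp i k]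
    have e2 := congrFun (congrFun (mpd_mul h.smooth_inv hSp i) k) i
    beta_reduce at e2
    rw [h.mpd_inv_eq_zero, h.inv_eq_one, Matrix.zero_mul, zero_add, Matrix.one_mul] at e2
    rw [show pd i (fun z => ((pull ψ G z)⁻¹ * pull ψ S z) k i) 0 =
      pd i (fun z => pull ψ S z k i) 0 from e2]
    beta_reduce
    rw [h.inv_eq_one, Matrix.one_mul]
    ring
  simp only [h1, Finset.sum_add_distrib]
  rw [Finset.sum_comm]
  have h2 : ∑ i, ∑ k, pd k (fun z => f (ψ z)) 0 * pd i (fun z => pull ψ S z k i) 0 = 0 := by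
    rw [Finset.sum_comm]
    exact Finset.sum_eq_zero fun k _ => by rw [← Finset.mul_sum, hd, mul_zero]
  rw [h2, add_zero]

/-- The Riemannian density `√det g`. -/
def density (G : Rn n → Matrix (Fin n) (Fin n) ℝ) (z : Rn n) : ℝ := Real.sqrt (G z).det

theorem IsMetricOn.density_pos (hG : IsMetricOn G V) (hy : y ∈ V) : 0 < density G y :=
  Real.sqrt_pos.2 (hG.det_pos hy)

theorem IsMetricOn.smooth_density (hG : IsMetricOn G V) (hy : y ∈ V) :
    ContDiffAt ℝ ∞ (density G) y :=
  (hG.smooth y hy).det.sqrt (hG.det_ne hy)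

theorem adjugate_eq_smul_inv {A : Matrix (Fin n) (Fin n) ℝ} (h : A.det ≠ 0) :
    A.adjugate = A.det • A⁻¹ := by
  rw [Matrix.inv_def, smul_smul, Ring.mul_inverse_cancel _ (isUnit_iff_ne_zero.2 h), one_smul]

/-- Restriction to a coordinate line reduces this to Jacobi's formula in one variable. -/
theorem pd_det (hA : MSm S y) (hd : (S y).det ≠ 0) (a : Fin n) :
    pd a (fun z => (S z).det) y = (S y).det * ((S y)⁻¹ * mpd a S y).trace := by
  have hline : ∀ f : Rn n → ℝ, ContDiffAt ℝ ∞ f y →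
      HasDerivAt (fun t : ℝ => f (y + t • EuclideanSpace.single a (1 : ℝ))) (pd a f y) 0 := by
    intro f hf
    have h1 : HasDerivAt (fun t : ℝ => y + t • EuclideanSpace.single a (1 : ℝ))
        (EuclideanSpace.single a (1 : ℝ)) 0 := by
      simpa using ((hasDerivAt_id (0 : ℝ)).smul_const
        (EuclideanSpace.single a (1 : ℝ) : Rn n)).const_add y
    have h2 : HasFDerivAt f (fderiv ℝ f y) (y + (0 : ℝ) • EuclideanSpace.single a (1 : ℝ)) := by
      simpa using (diff_of_smooth hf).hasFDerivAt
    exact h2.comp_hasDerivAt 0 h1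
  have h1 : HasMDerivAt (fun t : ℝ => S (y + t • EuclideanSpace.single a (1 : ℝ)))
      (mpd a S y) 0 := fun i j => hline _ (hA i j)
  have h2 := h1.det.unique (hline _ hA.det)
  rw [← h2]
  simp [adjugate_eq_smul_inv hd]

/-- Differentiate $\det G=(\sqrt{\det G})^2$ and use metric compatibility: the two connection terms
in $\mathrm{tr}(G^{-1}\partial_aG)$ have equal trace. -/
theorem pd_density (hV : IsOpen V) (hG : IsMetricOn G V) (hy : y ∈ V) (a : Fin n) :
    pd a (density G) y = density G y * (chr G a y).trace := by
  have hs := hG.smooth y hy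
  have h1 : pd a (fun z => (G z).det) y = 2 * density G y * pd a (density G) y := by
    rw [pd_congr (g := fun z => density G z * density G z)
      (Filter.eventuallyEq_of_mem (hV.mem_nhds hy) fun z hz =>
        (Real.mul_self_sqrt (hG.det_pos hz).le).symm),
      pd_mul (hG.smooth_density hy) (hG.smooth_density hy)]
    ring
  have h2 : (G y).det = density G y * density G y := (Real.mul_self_sqrt (hG.det_pos hy).le).symm
  have h3 : ((G y)⁻¹ * mpd a G y).trace = 2 * (chr G a y).trace := by
    rw [mpd_metric hG hV hy, Matrix.mul_add, Matrix.trace_add, ← Matrix.mul_assoc,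
      ← Matrix.mul_assoc, Matrix.nonsing_inv_mul _ (hG.isUnit hy), Matrix.one_mul,
      Matrix.trace_mul_comm, ← Matrix.mul_assoc, Matrix.mul_nonsing_inv _ (hG.isUnit hy),
      Matrix.one_mul, Matrix.trace_transpose]
    ring
  rw [pd_det hs (hG.det_ne hy), h3, h2] at h1
  have h4 := (hG.density_pos hy).ne'
  have h5 : 2 * density G y * (density G y * (chr G a y).trace - pd a (density G) y) = 0 := by
    linarith
  have := (mul_eq_zero.1 h5).resolve_left (by positivity)
  linarith

/-- The contravariant density `√det g g^{ab} θ_b`. -/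
def fluxDensity (G : Rn n → Matrix (Fin n) (Fin n) ℝ) (θ : Fin n → Rn n → ℝ) (a : Fin n)
    (z : Rn n) : ℝ := density G z * ∑ b, (G z)⁻¹ a b * θ b z

theorem IsMetricOn.smooth_fluxDensity (hG : IsMetricOn G V) {θ : Fin n → Rn n → ℝ} (hy : y ∈ V)
    (hθ : ∀ i, ContDiffAt ℝ ∞ (θ i) y) (a : Fin n) : ContDiffAt ℝ ∞ (fluxDensity G θ a) y :=
  (hG.smooth_density hy).mul (ContDiffAt.sum fun b _ => (hG.smooth_inv hy a b).mul (hθ b))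

/-- The Voss–Weyl formula, which makes a covariant divergence a sum of ordinary partial derivatives
that can be integrated. The trace of the connection from the density cancels one of the two
connection terms in the derivative of $G^{-1}$; the other is the correction in $\nabla\theta$. -/
theorem sum_pd_fluxDensity (hV : IsOpen V) (hG : IsMetricOn G V) {θ : Fin n → Rn n → ℝ}
    (hy : y ∈ V) (hθ : ∀ i, ContDiffAt ℝ ∞ (θ i) y) :
    ∑ a, pd a (fluxDensity G θ a) y = density G y * trace G (formDeriv G θ) y := by
  have hi := hG.smooth_inv hy
  have hs : ∀ a, ContDiffAt ℝ ∞ (fun z => ∑ b, (G z)⁻¹ a b * θ b z) y := fun a =>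
    ContDiffAt.sum fun b _ => (hi a b).mul (hθ b)
  have hinv : ∀ a b, pd a (fun z => (G z)⁻¹ a b) y = -((∑ m, (G y)⁻¹ a m * christoffel G b a m y)
      + ∑ m, christoffel G a m a y * (G y)⁻¹ m b) := by
    intro a b
    have := congrFun (congrFun (mpd_inv_metric hV hG hy a) a) b
    rw [mpd_apply] at this
    rw [this, Matrix.neg_apply, Matrix.add_apply, Matrix.mul_apply, Matrix.mul_apply]
    congr 2
    exact Finset.sum_congr rfl fun m _ => by
      rw [chr, Matrix.of_apply, christoffel_symm hG hV hy]
  have h1 : ∀ a, pd a (fluxDensity G θ a) y = density G y *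
      (∑ b, (G y)⁻¹ a b * (pd a (θ b) y) - ∑ b, (∑ m, (G y)⁻¹ a m * christoffel G b a m y) * θ b y
        + (∑ b, (chr G a y).trace * ((G y)⁻¹ a b * θ b y)
          - ∑ b, (∑ m, christoffel G a m a y * (G y)⁻¹ m b) * θ b y)) := by
    intro a
    rw [show fluxDensity G θ a = fun z => density G z * ∑ b, (G z)⁻¹ a b * θ b z from rfl,
      pd_mul (hG.smooth_density hy) (hs a), pd_density hV hG hy,
      pd_sum fun b _ => (hi a b).mul (hθ b)]
    simp only [fun b => pd_mul (hi a b) (hθ b) a, hinv, ← Finset.mul_sum, neg_mul, add_mul,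
      Finset.sum_add_distrib, Finset.sum_neg_distrib]
    ring
  have h2 : ∑ a, ∑ b, (chr G a y).trace * ((G y)⁻¹ a b * θ b y) =
      ∑ a, ∑ b, (∑ m, christoffel G a m a y * (G y)⁻¹ m b) * θ b y := by
    rw [Finset.sum_comm]
    conv_rhs => rw [Finset.sum_comm]
    refine Finset.sum_congr rfl fun b _ => ?_
    simp only [Matrix.trace, Matrix.diag, chr, Matrix.of_apply, Finset.sum_mul]
    rw [Finset.sum_comm]
    exact Finset.sum_congr rfl fun a _ => Finset.sum_congr rfl fun m _ => by ring
  rw [Finset.sum_congr rfl fun a _ => h1 a, ← Finset.mul_sum, Finset.sum_add_distrib,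
    Finset.sum_sub_distrib, Finset.sum_sub_distrib, h2, sub_self, add_zero]
  congr 1
  simp only [trace, formDeriv, Matrix.of_apply, mul_sub, Finset.sum_sub_distrib]
  congr 1
  refine Finset.sum_congr rfl fun a _ => ?_
  simp only [Finset.sum_mul, Finset.mul_sum]
  rw [Finset.sum_comm]
  exact Finset.sum_congr rfl fun m _ => Finset.sum_congr rfl fun b _ => by ring

end

/-! ### Joint smoothness of families -/

section Family

variable {K T : ℝ → Rn n → Matrix (Fin n) (Fin n) ℝ} {q : ℝ × Rn n}

/-- The family `f` of functions is jointly smooth at `q`. -/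
abbrev JointSmooth (f : ℝ → Rn n → ℝ) (q : ℝ × Rn n) : Prop :=
  ContDiffAt ℝ ∞ (fun r : ℝ × Rn n => f r.1 r.2) q

/-- The family `K` of matrix-valued functions is jointly smooth at `q`. -/
abbrev JointMSm (K : ℝ → Rn n → Matrix (Fin n) (Fin n) ℝ) (q : ℝ × Rn n) : Prop :=
  MSm (fun r : ℝ × Rn n => K r.1 r.2) q

/-- The spatial derivative of a jointly smooth family is the derivative of a map depending smoothly
on a parameter; the parameter is the whole pair of time and position. -/
theorem JointSmooth.pd {f : ℝ → Rn n → ℝ} (hf : JointSmooth f q) (i : Fin n) :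
    JointSmooth (fun t => pd i (f t)) q := by
  have h : ContDiffAt ℝ ∞ (fun r : ℝ × Rn n => fderiv ℝ (f r.1) r.2) q := by
    have h1 : ContDiffAt ℝ ∞ (Function.uncurry fun (r : ℝ × Rn n) (z : Rn n) => f r.1 z)
        (q, q.2) := by
      have : (Function.uncurry fun (r : ℝ × Rn n) (z : Rn n) => f r.1 z) =
          (fun r : ℝ × Rn n => f r.1 r.2) ∘ fun s : (ℝ × Rn n) × Rn n => (s.1.1, s.2) := rfl
      rw [this]
      refine ContDiffAt.comp _ (by simpa using hf) ?_
      exact (contDiffAt_fst.comp _ contDiffAt_fst).prodMk contDiffAt_snd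
    exact ContDiffAt.fderiv h1 contDiffAt_snd (by simp)
  exact h.clm_apply contDiffAt_const

theorem jointSmooth_christoffel (hK : JointMSm K q) (hd : (K q.1 q.2).det ≠ 0) (m i j : Fin n) :
    JointSmooth (fun t => christoffel (K t) m i j) q := by
  have hi : JointMSm (fun t z => (K t z)⁻¹) q := hK.inv hd
  refine contDiffAt_const.mul (ContDiffAt.sum fun a _ => (hi m a).mul ?_)
  exact ((JointSmooth.pd (f := fun t z => K t z j a) (hK j a) i).add
    (JointSmooth.pd (f := fun t z => K t z i a) (hK i a) j)).sub
    (JointSmooth.pd (f := fun t z => K t z i j) (hK i j) a)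

theorem jointMSm_ricci (hK : JointMSm K q) (hd : (K q.1 q.2).det ≠ 0) :
    JointMSm (fun t => ricci (K t)) q := by
  have hi : JointMSm (fun t z => (K t z)⁻¹) q := hK.inv hd
  have hc := jointSmooth_christoffel hK hd
  intro j k
  simp only [ricci, Matrix.of_apply, riemann, riemannUp]
  refine ContDiffAt.sum fun i _ => ContDiffAt.sum fun l _ => (hi i l).mul
    (ContDiffAt.sum fun m _ => (hK m l).mul ?_)
  exact (((hc m j k).pd i).sub ((hc m i k).pd j)).add (ContDiffAt.sum fun a _ =>
    ((hc m i a).mul (hc a j k)).sub ((hc m j a).mul (hc a i k)))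

theorem jointSmooth_trace (hK : JointMSm K q) (hd : (K q.1 q.2).det ≠ 0) (hT : JointMSm T q) :
    JointSmooth (fun t => trace (K t) (T t)) q := by
  have hi : JointMSm (fun t z => (K t z)⁻¹) q := hK.inv hd
  exact ContDiffAt.sum fun i _ => ContDiffAt.sum fun j _ => (hi i j).mul (hT i j)

theorem jointSmooth_scalar (hK : JointMSm K q) (hd : (K q.1 q.2).det ≠ 0) :
    JointSmooth (fun t => scalar (K t)) q :=
  jointSmooth_trace hK hd (jointMSm_ricci hK hd)

theorem jointMSm_schouten (hK : JointMSm K q) (hd : (K q.1 q.2).det ≠ 0) :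
    JointMSm (fun t => schouten (K t)) q :=
  (jointMSm_ricci hK hd).sub (MSm.smul ((jointSmooth_scalar hK hd).div_const _) hK)

theorem contDiffAt_elemSymm {E : Type*} [NormedAddCommGroup E] [NormedSpace ℝ E]
    {W : E → Matrix (Fin n) (Fin n) ℝ} {y : E} (hW : MSm W y) (k : ℕ) :
    ContDiffAt ℝ ∞ (fun z => elemSymm k (W z)) y :=
  contDiffAt_const.mul (ContDiffAt.sum fun i _ => ContDiffAt.sum fun j _ =>
    contDiffAt_const.mul (contDiffAt_prod fun a _ => hW (i a) (j a)))

theorem jointSmooth_sigma (hK : JointMSm K q) (hd : (K q.1 q.2).det ≠ 0) (k : ℕ) :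
    JointSmooth (fun t => sigma k (K t)) q := by
  have hi : JointMSm (fun t z => (K t z)⁻¹) q := hK.inv hd
  exact contDiffAt_elemSymm (hi.mul (jointMSm_schouten hK hd)) k

theorem jointMSm_hess {f : Rn n → ℝ} (hK : JointMSm K q) (hd : (K q.1 q.2).det ≠ 0)
    (hf : ContDiffAt ℝ ∞ f q.2) : JointMSm (fun t => hess (K t) f) q := by
  have hc := jointSmooth_christoffel hK hd
  intro a b
  exact ((contDiffAt_pd (contDiffAt_pd hf b) a).comp q contDiffAt_snd).sub
    (ContDiffAt.sum fun m _ => (hc m a b).mul ((contDiffAt_pd hf m).comp q contDiffAt_snd))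

theorem jointSmooth_tensorInner {S : ℝ → Rn n → Matrix (Fin n) (Fin n) ℝ} (hK : JointMSm K q)
    (hd : (K q.1 q.2).det ≠ 0) (hT : JointMSm T q) (hS : JointMSm S q) :
    JointSmooth (fun t => tensorInner (K t) (T t) (S t)) q := by
  have hi : JointMSm (fun t z => (K t z)⁻¹) q := hK.inv hd
  exact ContDiffAt.sum fun i _ => ContDiffAt.sum fun j _ => ContDiffAt.sum fun a _ =>
    ContDiffAt.sum fun b _ => (((hi i a).mul (hi j b)).mul (hT i j)).mul (hS a b)

theorem jointSmooth_density (hK : JointMSm K q) (hd : (K q.1 q.2).det ≠ 0) :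
    JointSmooth (fun t => density (K t)) q :=
  hK.det.sqrt hd

end Family

end Coord

namespace Coord

variable {n : ℕ}

/-! ### Elementary symmetric functions -/

/-- For injective `i` the only nonzero terms are the rearrangements of `i`, and their signed sum is
the Leibniz expansion of a principal minor. -/
theorem elemSymm_eq_sum_det (k : ℕ) (W : Matrix (Fin n) (Fin n) ℝ) :
    elemSymm k W = (1 / (k.factorial : ℝ)) *
      ∑ i : Fin k → Fin n with Function.Injective i, (W.submatrix i i).det := by
  classical
  rw [elemSymm, Finset.sum_filter]
  congr 1
  refine Finset.sum_congr rfl fun i _ => ?_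
  by_cases hi : Function.Injective i
  · simp only [kroneckerDelta, if_pos hi, Finset.sum_mul]
    rw [Finset.sum_comm, ← Matrix.det_transpose, Matrix.det_apply']
    refine Finset.sum_congr rfl fun s _ => ?_
    rw [Finset.sum_eq_single (i ∘ s) (fun j _ hj => by rw [if_neg hj, zero_mul])
      (fun h => absurd (Finset.mem_univ _) h), if_pos rfl]
    rfl
  · simp [kroneckerDelta, hi]

-- The number of orderings of a fixed index set; it cancels the $1/k!$ in the definition of the
-- elementary symmetric function.
open scoped Classical in
theorem card_injective_image (k : ℕ) {s : Finset (Fin n)} (hs : s.card = k) :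
    (Finset.univ.filter fun i : Fin k → Fin n =>
      Function.Injective i ∧ Finset.univ.image i = s).card = k.factorial := by
  have e : {i : Fin k → Fin n // Function.Injective i ∧ Finset.univ.image i = s} ≃
      (Fin k ≃ s) :=
    { toFun := fun i => Equiv.ofBijective
        (fun a => ⟨i.1 a, by
          have := Finset.mem_image_of_mem i.1 (Finset.mem_univ a)
          rwa [i.2.2] at this⟩)
        ⟨fun a b h => i.2.1 (Subtype.ext_iff.1 h), fun b => by
          obtain ⟨a, -, ha⟩ := Finset.mem_image.1 (i.2.2.symm ▸ b.2 : b.1 ∈ Finset.univ.image i.1)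
          exact ⟨a, Subtype.ext ha⟩⟩
      invFun := fun f => ⟨fun a => (f a : Fin n),
        fun a b h => f.injective (Subtype.ext h), by
          ext b
          simp only [Finset.mem_image, Finset.mem_univ, true_and]
          exact ⟨fun ⟨a, ha⟩ => ha ▸ (f a).2, fun hb => ⟨f.symm ⟨b, hb⟩, by simp⟩⟩⟩
      left_inv := fun i => rfl
      right_inv := fun f => by ext a; rfl }
  rw [← Fintype.card_subtype, Fintype.card_congr e,
    Fintype.card_equiv (Fintype.equivOfCardEq (by simp [hs])), Fintype.card_fin]

/-- Grouping the injective maps by their image gives the sum of principal minors. From here on the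
generating polynomial $\det(1+XW)$ replaces the definition by Kronecker deltas. -/
theorem elemSymm_eq_coeff (k : ℕ) (W : Matrix (Fin n) (Fin n) ℝ) :
    elemSymm k W =
      (Matrix.det (1 + (Polynomial.X : Polynomial ℝ) • W.map Polynomial.C)).coeff k := by
  classical
  rw [Matrix.coeff_det_one_add_X_smul_eq_sum_minors, elemSymm_eq_sum_det,
    ← Finset.sum_fiberwise_of_maps_to (t := Finset.univ.powersetCard k)
      (g := fun i : Fin k → Fin n => Finset.univ.image i), Finset.mul_sum]
  · refine Finset.sum_congr rfl fun s hs => ?_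
    have hc := (Finset.mem_powersetCard.1 hs).2
    rw [Finset.sum_congr rfl (g := fun _ => (W.submatrix (Subtype.val : s → Fin n)
      (Subtype.val : s → Fin n)).det), Finset.sum_const, Finset.filter_filter,
      card_injective_image k hc, nsmul_eq_mul, ← mul_assoc, one_div, inv_mul_cancel₀, one_mul]
    · exact_mod_cast k.factorial_ne_zero
    · intro i hi
      simp only [Finset.mem_filter, Finset.mem_univ, true_and] at hi
      let f : Fin k → s := fun a => ⟨i a, hi.2 ▸ Finset.mem_image_of_mem _ (Finset.mem_univ a)⟩
      have hf : Function.Bijective f := ⟨fun a b h => hi.1 (Subtype.ext_iff.1 h), fun b => by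
          obtain ⟨a, -, ha⟩ := Finset.mem_image.1 (hi.2.symm ▸ b.2 : b.1 ∈ Finset.univ.image i)
          exact ⟨a, Subtype.ext ha⟩⟩
      rw [← Matrix.det_submatrix_equiv_self (Equiv.ofBijective f hf), Matrix.submatrix_submatrix]
      rfl
  · intro i hi
    simp only [Finset.mem_filter, Finset.mem_univ, true_and] at hi
    rw [Finset.mem_powersetCard]
    exact ⟨Finset.subset_univ _, by rw [Finset.card_image_of_injective _ hi]; simp⟩

theorem det_one_add_smul (W : Matrix (Fin n) (Fin n) ℝ) (x : ℝ) :
    (1 + x • W).det = ∑ k ∈ Finset.range (n + 1), elemSymm k W * x ^ k := by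
  have h1 : (1 + x • W).det =
      (Matrix.det (1 + (Polynomial.X : Polynomial ℝ) • W.map Polynomial.C)).eval x := by
    rw [← Polynomial.coe_evalRingHom, RingHom.map_det]
    congr 1
    ext i j
    by_cases hij : i = j <;> simp [hij, mul_comm x]
  rw [h1, Polynomial.eval_eq_sum_range' (n := n + 1)]
  · simp only [elemSymm_eq_coeff]
  -- The degree is at most $n$ because there are no larger principal minors.
  · rw [Nat.lt_succ_iff, Polynomial.natDegree_le_iff_coeff_eq_zero]
    intro k hk
    rw [Matrix.coeff_det_one_add_X_smul_eq_sum_minors, Finset.powersetCard_eq_empty.2 (by simpa),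
      Finset.sum_empty]

/-- Conjugation does not change the generating determinant. This makes the $\sigma_k$-curvature
independent of the chart. -/
theorem elemSymm_conj (k : ℕ) (W J : Matrix (Fin n) (Fin n) ℝ) (hJ : IsUnit J.det) :
    elemSymm k (J⁻¹ * W * J) = elemSymm k W := by
  rw [elemSymm_eq_coeff, elemSymm_eq_coeff]
  congr 1
  have h1 : (1 : Matrix (Fin n) (Fin n) (Polynomial ℝ)) + (Polynomial.X : Polynomial ℝ) •
      (J⁻¹ * W * J).map Polynomial.C = (J⁻¹).map Polynomial.C *
        (1 + (Polynomial.X : Polynomial ℝ) • W.map Polynomial.C) * J.map Polynomial.C := by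
    rw [Matrix.mul_add, Matrix.add_mul, Matrix.mul_one, ← Matrix.map_mul,
      Matrix.nonsing_inv_mul _ hJ, Matrix.map_one _ (map_zero _) (map_one _), Matrix.mul_smul,
      Matrix.smul_mul, ← Matrix.map_mul, ← Matrix.map_mul]
  have h2 : ((J⁻¹).map Polynomial.C).det * (J.map Polynomial.C).det = 1 := by
    rw [← Matrix.det_mul, ← Matrix.map_mul, Matrix.nonsing_inv_mul _ hJ,
      Matrix.map_one _ (map_zero _) (map_one _), Matrix.det_one]
  rw [h1, Matrix.det_mul, Matrix.det_mul, mul_right_comm, h2, one_mul]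

theorem sigma_pullback {G G' : Rn n → Matrix (Fin n) (Fin n) ℝ} {U V : Set (Rn n)}
    {ψ : Rn n → Rn n} (hψ : IsCoordChange ψ U V) (hG : IsMetricOn G V)
    (hP : IsPullback ψ U G' G) (k : ℕ) {z : Rn n} (hz : z ∈ U) :
    sigma k G' z = sigma k G (ψ z) := by
  rw [sigma, hP.inv_mul hψ (schouten_pullback hψ hG hP) hz, elemSymm_conj _ _ _ (hψ.isUnit hz),
    sigma]

theorem coeff_one_add_C_mul_X_pow (c : ℝ) (N j : ℕ) :
    ((1 + Polynomial.C c * Polynomial.X : Polynomial ℝ) ^ N).coeff j = N.choose j * c ^ j := by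
  have : (1 + Polynomial.C c * Polynomial.X : Polynomial ℝ) ^ N =
      ((1 + Polynomial.X : Polynomial ℝ) ^ N).comp (Polynomial.C c * Polynomial.X) := by simp
  rw [this, Polynomial.comp_C_mul_X_coeff, Polynomial.coeff_one_add_X_pow]

/-- The coefficient is written as a multiple of the value $\binom nk c^k$ at an umbilic point, so
that later derivatives appear in relative form. -/
theorem coeff_X_mul_pow (c : ℝ) (hc : c ≠ 0) (hn : 1 ≤ n) {k : ℕ} :
    (Polynomial.X * (1 + Polynomial.C c * Polynomial.X : Polynomial ℝ) ^ (n - 1)).coeff k =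
      n.choose k * c ^ k * (k / n / c) := by
  obtain ⟨N, rfl⟩ := Nat.exists_eq_add_of_le' hn
  cases k with
  | zero => simp
  | succ j =>
    rw [Polynomial.coeff_X_mul, coeff_one_add_C_mul_X_pow, Nat.add_sub_cancel]
    have := Nat.add_one_mul_choose_eq N j
    have h2 : ((N : ℝ) + 1) * N.choose j = (N + 1).choose (j + 1) * (j + 1) := by
      exact_mod_cast this
    push_cast
    have : (N : ℝ) + 1 ≠ 0 := by positivity
    field_simp
    linear_combination c ^ (j + 1) * h2

theorem coeff_X_sq_mul_pow (c : ℝ) (hc : c ≠ 0) (hn : 2 ≤ n) {k : ℕ} :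
    (Polynomial.X ^ 2 * (1 + Polynomial.C c * Polynomial.X : Polynomial ℝ) ^ (n - 2)).coeff k =
      n.choose k * c ^ k * (k * (k - 1) / (n * (n - 1)) / c ^ 2) := by
  obtain ⟨N, rfl⟩ := Nat.exists_eq_add_of_le' hn
  rcases k with _ | _ | j
  · simp
  · simp [Polynomial.coeff_X_pow_mul']
  · rw [Polynomial.coeff_X_pow_mul, coeff_one_add_C_mul_X_pow, Nat.add_sub_cancel]
    have h1 := Nat.add_one_mul_choose_eq N j
    have h2 := Nat.add_one_mul_choose_eq (N + 1) (j + 1)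
    have h1' : ((N : ℝ) + 1) * N.choose j = (N + 1).choose (j + 1) * (j + 1) := by
      exact_mod_cast h1
    have h2' : ((N : ℝ) + 1 + 1) * (N + 1).choose (j + 1) =
        (N + 1 + 1).choose (j + 1 + 1) * (j + 1 + 1) := by exact_mod_cast h2
    push_cast
    have e1 : (N : ℝ) + 2 ≠ 0 := by positivity
    have e2 : (N : ℝ) + 2 - 1 ≠ 0 := by
      have : (N : ℝ) + 2 - 1 = N + 1 := by ring
      rw [this]; positivity
    have h3 : ((N : ℝ) + 2) * (N + 1) * N.choose j =
        (N + 2).choose (j + 2) * (j + 2) * (j + 1) := by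
      linear_combination (N + 2 : ℝ) * h1' + (j + 1 : ℝ) * h2'
    field_simp
    simp only [show j + 1 + 1 = j + 2 from rfl]
    linear_combination c ^ (j + 2) * h3

/-- Infinitely many values of $x$ suffice to compare coefficients. This allows the discarding of
those $x$ for which $1+xW$ is singular. -/
theorem sum_coeff_eq {a : ℕ → ℝ} {P : Polynomial ℝ} (S : Set ℝ) (hS : S.Infinite)
    (h : ∀ x ∈ S, ∑ k ∈ Finset.range (n + 1), a k * x ^ k = P.eval x) {k : ℕ} (hk : k ≤ n) :
    a k = P.coeff k := by
  have : P = ∑ k ∈ Finset.range (n + 1), Polynomial.C (a k) * Polynomial.X ^ k := by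
    refine Polynomial.eq_of_infinite_eval_eq _ _ (hS.mono fun x hx => ?_)
    simp [Polynomial.eval_finsetSum, h x hx]
  rw [this, Polynomial.finsetSum_coeff]
  simp only [Polynomial.coeff_C_mul_X_pow]
  simp [Nat.lt_succ_of_le hk]

theorem elemSymm_smul_one {c : ℝ} {k : ℕ} (hk : k ≤ n) :
    elemSymm k (c • (1 : Matrix (Fin n) (Fin n) ℝ)) = n.choose k * c ^ k := by
  rw [← coeff_one_add_C_mul_X_pow]
  refine sum_coeff_eq (a := fun k => elemSymm k (c • (1 : Matrix (Fin n) (Fin n) ℝ))) Set.univ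
    Set.infinite_univ (fun x _ => ?_) hk
  rw [← det_one_add_smul, smul_smul]
  have : (1 : Matrix (Fin n) (Fin n) ℝ) + (x * c) • (1 : Matrix (Fin n) (Fin n) ℝ) =
      (1 + x * c) • (1 : Matrix (Fin n) (Fin n) ℝ) := by rw [add_smul, one_smul]
  rw [this]
  simp [mul_comm x]

theorem contDiffAt_deriv {f : ℝ → ℝ} {t : ℝ} (hf : ContDiffAt ℝ ∞ f t) :
    ContDiffAt ℝ ∞ (deriv f) t :=
  (hf.fderiv_right (m := ∞) (by simp)).clm_apply contDiffAt_const

/-- All $\sigma_k$ are differentiated at once through their generating function and Jacobi's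
formula. -/
theorem HasMDerivAt.elemSymm {W : ℝ → Matrix (Fin n) (Fin n) ℝ} {W' : Matrix (Fin n) (Fin n) ℝ}
    {t : ℝ} (hs : MSm W t) (hW : HasMDerivAt W W' t) (x : ℝ) :
    ∑ k ∈ Finset.range (n + 1), deriv (fun s => elemSymm k (W s)) t * x ^ k =
      ((1 + x • W t).adjugate * (x • W')).trace := by
  have h1 : HasDerivAt (fun s => (1 + x • W s).det)
      (∑ k ∈ Finset.range (n + 1), deriv (fun s => Coord.elemSymm k (W s)) t * x ^ k) t := by
    simp only [det_one_add_smul]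
    exact HasDerivAt.fun_sum fun k _ =>
      ((contDiffAt_elemSymm hs k).differentiableAt (by simp)).hasDerivAt.mul_const _
  have h2 : HasMDerivAt (fun s => 1 + x • W s) (x • W') t := by
    simpa using (HasMDerivAt.const 1 t).add (HasMDerivAt.smul (hasDerivAt_const t x) hW)
  exact h1.unique h2.det

/-- Near $t$ the first derivative is $\det\cdot\mathrm{tr}(M^{-1}M')$ with $M=1+xW$; differentiating
once more gives the square of the trace, minus the trace of the square, plus the second-order term.
-/
theorem deriv_deriv_elemSymm {W W' : ℝ → Matrix (Fin n) (Fin n) ℝ}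
    {W'' : Matrix (Fin n) (Fin n) ℝ} {t : ℝ} (hs : ∀ᶠ s in nhds t, MSm W s)
    (hW : ∀ᶠ s in nhds t, HasMDerivAt W (W' s) s) (hW' : HasMDerivAt W' W'' t) {x : ℝ}
    (hx : (1 + x • W t).det ≠ 0) :
    ∑ k ∈ Finset.range (n + 1), deriv (deriv fun s => elemSymm k (W s)) t * x ^ k =
      (1 + x • W t).det * (((1 + x • W t)⁻¹ * (x • W' t)).trace ^ 2 -
        ((1 + x • W t)⁻¹ * (x • W' t) * ((1 + x • W t)⁻¹ * (x • W' t))).trace +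
        ((1 + x • W t)⁻¹ * (x • W'')).trace) := by
  have hs0 := hs.self_of_nhds
  have hW0 := hW.self_of_nhds
  have h1 : HasDerivAt (fun s => ∑ k ∈ Finset.range (n + 1),
      deriv (fun s => elemSymm k (W s)) s * x ^ k)
      (∑ k ∈ Finset.range (n + 1), deriv (deriv fun s => elemSymm k (W s)) t * x ^ k) t := by
    refine HasDerivAt.fun_sum fun k _ => ?_
    exact ((contDiffAt_deriv (contDiffAt_elemSymm hs0 k)).differentiableAt
      (by simp)).hasDerivAt.mul_const _
  have hm : HasMDerivAt (fun s => 1 + x • W s) (x • W' t) t := by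
    simpa using (HasMDerivAt.const 1 t).add (HasMDerivAt.smul (hasDerivAt_const t x) hW0)
  have hms : MSm (fun s => 1 + x • W s) t :=
    (MSm.const 1 t).add (MSm.smul contDiffAt_const hs0)
  have hx' : HasMDerivAt (fun s => x • W' s) (x • W'') t := by
    simpa using HasMDerivAt.smul (hasDerivAt_const t x) hW'
  have h2 := hm.det.mul ((hm.inv hms hx).mul hx').trace
  refine (h1.unique (h2.congr_of_eventuallyEq ?_)).trans ?_
  · filter_upwards [hs, hW, hms.det.continuousAt.eventually_ne hx] with s h1 h2 h3
    rw [h2.elemSymm h1, adjugate_eq_smul_inv h3]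
    simp only [Pi.mul_apply, Matrix.smul_mul, Matrix.trace_smul, smul_eq_mul]
  · rw [adjugate_eq_smul_inv hx]
    simp only [Matrix.smul_mul, Matrix.trace_smul, Matrix.trace_add, Matrix.neg_mul,
      Matrix.trace_neg, smul_eq_mul, Matrix.mul_assoc]
    ring

/-! ### Expansion at a multiple of the identity -/

section Umbilic

variable {W W' : ℝ → Matrix (Fin n) (Fin n) ℝ} {W'' : Matrix (Fin n) (Fin n) ℝ} {c : ℝ}

theorem one_add_smul_smul_one (x c : ℝ) :
    (1 : Matrix (Fin n) (Fin n) ℝ) + x • c • (1 : Matrix (Fin n) (Fin n) ℝ) =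
      (1 + c * x) • (1 : Matrix (Fin n) (Fin n) ℝ) := by
  rw [add_smul, one_smul, smul_smul, mul_comm]

theorem infinite_one_add_mul_ne (c : ℝ) : {x : ℝ | 1 + c * x ≠ 0}.Infinite := by
  by_cases hc : c = 0
  · simpa [hc] using Set.infinite_univ
  · refine Set.Infinite.mono ?_ (Set.finite_singleton (-c⁻¹)).infinite_compl
    intro x hx h
    refine hx ?_
    rw [Set.mem_singleton_iff]
    field_simp
    linarith

theorem inv_smul_one_matrix {a : ℝ} (ha : a ≠ 0) :
    (a • (1 : Matrix (Fin n) (Fin n) ℝ))⁻¹ = a⁻¹ • (1 : Matrix (Fin n) (Fin n) ℝ) :=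
  Matrix.inv_eq_left_inv (by rw [Matrix.smul_mul, Matrix.one_mul, smul_smul,
    inv_mul_cancel₀ ha, one_smul])

/-- The adjugate of $(1+cx)\cdot1$ is $(1+cx)^{n-1}\cdot1$, so the generating function is
$\mathrm{tr}W'\cdot x(1+cx)^{n-1}$ and its coefficients are binomial. -/
theorem deriv_elemSymm_umbilic (hn : 1 ≤ n) (hc : c ≠ 0) (hs : MSm W 0)
    (hW0 : W 0 = c • (1 : Matrix (Fin n) (Fin n) ℝ)) (hW : HasMDerivAt W (W' 0) 0) {k : ℕ}
    (hk : k ≤ n) :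
    deriv (fun s => elemSymm k (W s)) 0 = n.choose k * c ^ k * (k / n * ((W' 0).trace / c)) := by
  have h := sum_coeff_eq (n := n) (a := fun k => deriv (fun s => elemSymm k (W s)) 0)
    (P := Polynomial.C (W' 0).trace * (Polynomial.X * (1 + Polynomial.C c * Polynomial.X) ^ (n - 1)))
    _ (infinite_one_add_mul_ne c) (fun x (hx : 1 + c * x ≠ 0) => ?_) hk
  · rw [h, Polynomial.coeff_C_mul, coeff_X_mul_pow c hc hn]
    ring
  · have hd : ((1 + c * x) • (1 : Matrix (Fin n) (Fin n) ℝ)).det ≠ 0 := by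
      simpa using pow_ne_zero n hx
    obtain ⟨N, rfl⟩ := Nat.exists_eq_add_of_le' hn
    rw [hW.elemSymm hs, hW0, one_add_smul_smul_one, adjugate_eq_smul_inv hd,
      inv_smul_one_matrix hx]
    simp only [Nat.add_sub_cancel, Matrix.det_smul, Fintype.card_fin, Matrix.det_one, mul_one,
      smul_smul, Matrix.smul_mul, Matrix.one_mul, Matrix.trace_smul, smul_eq_mul, Polynomial.eval_mul,
      Polynomial.eval_C, Polynomial.eval_X, Polynomial.eval_pow, Polynomial.eval_add,
      Polynomial.eval_one, pow_succ, mul_inv_cancel_right₀ hx]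
    ring

/-- Because $W(0)$ is scalar, only $\mathrm{tr}W'$, $\mathrm{tr}W'^2$ and $\mathrm{tr}W''$ survive,
multiplied by $x^2(1+cx)^{n-2}$ and $x(1+cx)^{n-1}$. In particular, $W''$ itself need not be known.
-/
theorem deriv_deriv_elemSymm_umbilic (hn : 2 ≤ n) (hc : c ≠ 0) (hs : ∀ᶠ s in nhds 0, MSm W s)
    (hW0 : W 0 = c • (1 : Matrix (Fin n) (Fin n) ℝ))
    (hW : ∀ᶠ s in nhds 0, HasMDerivAt W (W' s) s) (hW' : HasMDerivAt W' W'' 0) {k : ℕ}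
    (hk : k ≤ n) :
    deriv (deriv fun s => elemSymm k (W s)) 0 = n.choose k * c ^ k *
      (k * (k - 1) / (n * (n - 1)) * (((W' 0).trace / c) ^ 2 - (W' 0 * W' 0).trace / c ^ 2) +
        k / n * (W''.trace / c)) := by
  have h := sum_coeff_eq (n := n) (a := fun k => deriv (deriv fun s => elemSymm k (W s)) 0)
    (P := Polynomial.C ((W' 0).trace ^ 2 - (W' 0 * W' 0).trace) *
      (Polynomial.X ^ 2 * (1 + Polynomial.C c * Polynomial.X) ^ (n - 2)) +
      Polynomial.C W''.trace * (Polynomial.X * (1 + Polynomial.C c * Polynomial.X) ^ (n - 1)))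
    _ (infinite_one_add_mul_ne c) (fun x (hx : 1 + c * x ≠ 0) => ?_) hk
  · rw [h, Polynomial.coeff_add, Polynomial.coeff_C_mul, Polynomial.coeff_C_mul,
      coeff_X_sq_mul_pow c hc hn, coeff_X_mul_pow c hc (by omega)]
    ring
  · have hx' : 1 + c * x ≠ 0 := hx
    have hd : (1 + x • W 0).det ≠ 0 := by
      rw [hW0, one_add_smul_smul_one]
      simpa using pow_ne_zero n hx
    obtain ⟨N, rfl⟩ := Nat.exists_eq_add_of_le' hn
    rw [deriv_deriv_elemSymm hs hW hW' hd, hW0, one_add_smul_smul_one, inv_smul_one_matrix hx]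
    simp
    field_simp
    ring

end Umbilic

end Coord

open Coord

/-! ### Changes of charts -/

section Charts

variable {n : ℕ}

/-- The differential of the inverse of the chart at `c`, i.e. the coordinate frame. -/
def frame (M : Type*) [TopologicalSpace M] [ChartedSpace (Rn n) M] (c : M) (y : Rn n) :
    Rn n →L[ℝ] Rn n :=
  mfderiv (𝓡 n) (𝓡 n) (chartAt (Rn n) c).symm y

/-- The coordinate change from the chart at `d` to the chart at `c`. -/
def transition (M : Type*) [TopologicalSpace M] [ChartedSpace (Rn n) M] (c d : M) (y : Rn n) :
    Rn n :=
  chartAt (Rn n) c ((chartAt (Rn n) d).symm y)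

/-- The domain of the coordinate change from the chart at `d` to the chart at `c`. -/
def overlap (M : Type*) [TopologicalSpace M] [ChartedSpace (Rn n) M] (c d : M) : Set (Rn n) :=
  ((chartAt (Rn n) d).symm.trans (chartAt (Rn n) c)).source

variable {M : Type*} [TopologicalSpace M] [ChartedSpace (Rn n) M]

/-- A tensor field as a function with values in a fixed space. -/
def form (T : TensorField n M) (x : M) : Rn n →L[ℝ] Rn n →L[ℝ] ℝ := T x

theorem comp_apply (T : TensorField n M) (c : M) (y : Rn n) (i j : Fin n) :
    comp T c y i j = form T ((chartAt (Rn n) c).symm y)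
      (frame M c y (EuclideanSpace.single i 1)) (frame M c y (EuclideanSpace.single j 1)) := rfl

theorem comp_line (g h : TensorField n M) (t : ℝ) (c : M) (y : Rn n) :
    comp (g + t • h) c y = comp g c y + t • comp h c y := rfl

theorem isOpen_overlap (c d : M) : IsOpen (overlap M c d : Set (Rn n)) :=
  ((chartAt (Rn n) d).symm.trans (chartAt (Rn n) c)).open_source

theorem mem_overlap {c d : M} {y : Rn n} : y ∈ overlap M c d ↔
    y ∈ (chartAt (Rn n) d).target ∧ (chartAt (Rn n) d).symm y ∈ (chartAt (Rn n) c).source := by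
  simp [overlap]

theorem symm_transition {c d : M} {y : Rn n} (hy : y ∈ overlap M c d) :
    (chartAt (Rn n) c).symm (transition M c d y) = (chartAt (Rn n) d).symm y :=
  (chartAt (Rn n) c).left_inv (mem_overlap.1 hy).2

theorem transition_mem_target {c d : M} {y : Rn n} (hy : y ∈ overlap M c d) :
    transition M c d y ∈ (chartAt (Rn n) c).target :=
  (chartAt (Rn n) c).map_source (mem_overlap.1 hy).2

theorem transition_mem_overlap {c d : M} {y : Rn n} (hy : y ∈ overlap M c d) :
    transition M c d y ∈ overlap M d c := by
  refine mem_overlap.2 ⟨transition_mem_target hy, ?_⟩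
  rw [symm_transition hy]
  exact (chartAt (Rn n) d).map_target (mem_overlap.1 hy).1

theorem transition_transition {c d : M} {y : Rn n} (hy : y ∈ overlap M c d) :
    transition M d c (transition M c d y) = y := by
  rw [transition, symm_transition hy, (chartAt (Rn n) d).right_inv (mem_overlap.1 hy).1]

theorem form_sum (T : TensorField n M) (c : M) (y : Rn n) (v : Fin n → ℝ) :
    form T ((chartAt (Rn n) c).symm y)
      (frame M c y (∑ i, v i • EuclideanSpace.single i 1))
      (frame M c y (∑ i, v i • EuclideanSpace.single i 1)) = v ⬝ᵥ (comp T c y).mulVec v := by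
  simp only [map_sum, map_smul, sum_apply, smul_apply,
    smul_eq_mul, dotProduct, Matrix.mulVec, comp_apply, Finset.mul_sum]
  rw [Finset.sum_comm]
  exact Finset.sum_congr rfl fun a _ => Finset.sum_congr rfl fun b _ => by ring

variable [IsManifold (𝓡 n) ∞ M]

theorem contDiffAt_transition {c d : M} {y : Rn n} (hy : y ∈ overlap M c d) :
    ContDiffAt ℝ ∞ (transition M c d) y := by
  rw [← contMDiffAt_iff_contDiffAt]
  exact ((contMDiffOn_chart (I := 𝓡 n) (n := ∞) (x := c)).comp'
    (contMDiffOn_chart_symm (I := 𝓡 n) (n := ∞) (x := d))).contMDiffAt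
      ((isOpen_overlap c d).mem_nhds hy)

theorem hasMFDerivAt_frame (c : M) {y : Rn n} (hy : y ∈ (chartAt (Rn n) c).target) :
    HasMFDerivAt (𝓡 n) (𝓡 n) (chartAt (Rn n) c).symm y (frame M c y) :=
  (mdifferentiableAt_atlas_symm (chart_mem_atlas _ c) hy).hasMFDerivAt

/-- The chain rule for the inverse chart at `d` written as the inverse chart at `c` after the
transition map. -/
theorem frame_eq_comp {c d : M} {y : Rn n} (hy : y ∈ overlap M c d) :
    frame M d y = (frame M c (transition M c d y)).comp (fderiv ℝ (transition M c d) y) := by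
  have h1 : HasMFDerivAt (𝓡 n) (𝓡 n) (transition M c d) y (fderiv ℝ (transition M c d) y) :=
    ((contDiffAt_transition hy).differentiableAt (by simp)).hasFDerivAt.hasMFDerivAt
  have h2 := (hasMFDerivAt_frame c (transition_mem_target hy)).comp y h1
  have h3 := h2.congr_of_eventuallyEq (f₁ := (chartAt (Rn n) d).symm)
    (Filter.eventuallyEq_of_mem ((isOpen_overlap c d).mem_nhds hy) fun z hz =>
      (symm_transition hz).symm)
  exact hasMFDerivAt_unique (hasMFDerivAt_frame d (mem_overlap.1 hy).1) h3

theorem frame_injective {c : M} {y : Rn n} (hy : y ∈ (chartAt (Rn n) c).target) :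
    Function.Injective (frame M c y) :=
  (mdifferentiable_of_mem_atlas (I := 𝓡 n) (chart_mem_atlas (Rn n) c)).symm.mfderiv_injective hy

theorem isPullback_comp (T : TensorField n M) (c d : M) :
    IsPullback (transition M c d) (overlap M c d) (comp T d) (comp T c) := by
  intro y hy
  ext i j
  rw [comp_apply, frame_eq_comp hy, ContinuousLinearMap.comp_apply, ContinuousLinearMap.comp_apply,
    fderiv_single (contDiffAt_transition hy), fderiv_single (contDiffAt_transition hy)]
  simp only [map_sum, map_smul, sum_apply, smul_apply,
    smul_eq_mul, Matrix.mul_apply, Matrix.transpose_apply, comp_apply, symm_transition hy,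
    Finset.sum_mul, Finset.mul_sum]
  refine Finset.sum_congr rfl fun a _ => Finset.sum_congr rfl fun b _ => ?_
  ring

theorem isCoordChange_transition (c d : M) :
    IsCoordChange (transition M c d) (overlap M c d) (chartAt (Rn n) c).target where
  isOpen_source := isOpen_overlap c d
  isOpen_target := (chartAt (Rn n) c).open_target
  mapsTo _ hz := transition_mem_target hz
  smooth _ hz := contDiffAt_transition hz
  det_ne y hy := by
    -- The reverse transition map provides a left inverse of the Jacobian matrix.
    have h : jac (transition M d c) (transition M c d y) * jac (transition M c d) y = 1 := by
      ext i j
      have h1 : pd j (fun z => transition M d c (transition M c d z) i) y =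
          if i = j then 1 else 0 := by
        rw [pd_congr (g := fun z => z i) (Filter.eventuallyEq_of_mem
          ((isOpen_overlap c d).mem_nhds hy) fun z hz => by
            beta_reduce; rw [transition_transition hz]), pd_coordinate]
        exact if_congr eq_comm rfl rfl
      rw [pd_comp (f := fun w => transition M d c w i)
        (contDiffAt_coord (contDiffAt_transition (transition_mem_overlap hy)) i)
        (contDiffAt_transition hy)] at h1
      rw [Matrix.mul_apply, Matrix.one_apply, ← h1]
      exact Finset.sum_congr rfl fun a _ => mul_comm _ _
    have h2 := congrArg Matrix.det h
    rw [Matrix.det_mul, Matrix.det_one] at h2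
    exact right_ne_zero_of_mul_eq_one h2

/-- The coordinate vector fields are smooth sections, being images of constant fields under the
tangent map of the inverse chart. A component is the smooth bundle map `T` evaluated on two of them.
-/
theorem smooth_comp {T : TensorField n M} (hT : IsSmoothSymm T) (c : M) {y : Rn n}
    (hy : y ∈ (chartAt (Rn n) c).target) : MSm (comp T c) y := by
  have hO := (chartAt (Rn n) c).open_target
  have hs := contMDiffOn_chart_symm (I := 𝓡 n) (n := ∞) (x := c)
  have hv : ∀ v : Rn n, ContMDiffAt (𝓡 n) (𝓡 n).tangent ∞
      (fun z => (⟨(chartAt (Rn n) c).symm z, frame M c z v⟩ : TangentBundle (𝓡 n) M)) y := by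
    intro v
    have h1 := hs.contMDiffOn_tangentMapWithin (m := ∞) (by simp) hO.uniqueMDiffOn
    have h2 : ContMDiffAt (𝓡 n) (𝓡 n).tangent ∞
        (fun z : Rn n => (⟨z, v⟩ : TangentBundle (𝓡 n) (Rn n))) y :=
      contMDiffAt_vectorSpace_iff_contDiffAt.2 contDiffAt_const
    have h3 := ContMDiffWithinAt.comp y (h1 ⟨y, v⟩ hy)
      (h2.contMDiffWithinAt (s := (chartAt (Rn n) c).target)) (fun z hz => hz)
    refine (h3.contMDiffAt (hO.mem_nhds hy)).congr_of_eventuallyEq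
      (Filter.eventuallyEq_of_mem (hO.mem_nhds hy) fun z hz => ?_)
    simp only [Function.comp_apply, tangentMapWithin, mfderivWithin_of_isOpen hO hz]
    rfl
  intro i j
  have h1 := (hT.smooth ((chartAt (Rn n) c).symm y)).comp y (hs.contMDiffAt (hO.mem_nhds hy))
  have h2 := ContMDiffAt.clm_bundle_apply₂ (F₁ := Rn n) (F₂ := Rn n) (F₃ := ℝ)
    (E₃ := Bundle.Trivial M ℝ) h1 (hv (EuclideanSpace.single i 1)) (hv (EuclideanSpace.single j 1))
  rw [Bundle.contMDiffAt_totalSpace] at h2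
  exact contMDiffAt_iff_contDiffAt.1 h2.2

theorem comp_transpose {T : TensorField n M} (hT : IsSmoothSymm T) (c : M) (y : Rn n) :
    (comp T c y).transpose = comp T c y := by
  ext i j
  exact hT.symm _ _ _

/-- `g` is a smooth Riemannian metric: its component matrices are so in each chart. -/
def IsMetric (g : TensorField n M) : Prop :=
  ∀ c : M, IsMetricOn (comp g c) (chartAt (Rn n) c).target

theorem isSmoothSymm_inner (gbar : Bundle.ContMDiffRiemannianMetric (𝓡 n) ∞ (Rn n)
    (fun x : M ↦ TangentSpace (𝓡 n) x)) : IsSmoothSymm gbar.inner :=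
  ⟨gbar.symm, gbar.contMDiff⟩

theorem isMetric_inner (gbar : Bundle.ContMDiffRiemannianMetric (𝓡 n) ∞ (Rn n)
    (fun x : M ↦ TangentSpace (𝓡 n) x)) : IsMetric gbar.inner := fun c =>
  ⟨fun _ hz => smooth_comp (isSmoothSymm_inner gbar) c hz, fun z hz => by
    refine Matrix.PosDef.of_dotProduct_mulVec_pos ?_ fun v hv => ?_
    · exact comp_transpose (isSmoothSymm_inner gbar) c z
    · rw [star_trivial, ← form_sum]
      -- A nonzero coordinate vector gives a nonzero tangent vector because the coordinate frame is
      -- injective.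
      refine gbar.pos _ _ fun h0 => hv ?_
      have h1 := frame_injective hz (h0.trans (map_zero (frame M c z)).symm)
      ext i
      have := congrArg (fun w : Rn n => w i) h1
      simpa [Pi.single_apply] using this⟩

end Charts

open Coord

/-! ### Scalars and smooth functions on a manifold -/

section Scalars

variable {n : ℕ} {M : Type*} [TopologicalSpace M] [ChartedSpace (Rn n) M]

/-- The coordinate expressions `F c` of a function agree. -/
def IsScalar (F : M → Rn n → ℝ) : Prop :=
  ∀ c d, ∀ y ∈ overlap M c d, F d y = F c (transition M c d y)

/-- The function with the coordinate expressions `F`, evaluated at `x` in the chart at `x`. -/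
def atCenter (F : M → Rn n → ℝ) (x : M) : ℝ := F x (chartAt (Rn n) x x)

/-- Evaluating each point in its own chart is harmless for invariant scalars. This bridges the
pointwise definitions and calculations made throughout one fixed chart. -/
theorem IsScalar.atCenter_symm {F : M → Rn n → ℝ} (hF : IsScalar F) {c : M} {y : Rn n}
    (hy : y ∈ (chartAt (Rn n) c).target) : atCenter F ((chartAt (Rn n) c).symm y) = F c y :=
  (hF _ _ y (mem_overlap.2 ⟨hy, mem_chart_source (Rn n) _⟩)).symm

theorem read_apply (u : M → ℝ) {c x : M} (hx : x ∈ (chartAt (Rn n) c).source) :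
    read u c (chartAt (Rn n) c x) = u x := by
  rw [read, (chartAt (Rn n) c).left_inv hx]

theorem isScalar_read (u : M → ℝ) : IsScalar (read (n := n) u) := fun c d y hy => by
  rw [read, read, symm_transition hy]

/-- `u` is smooth in every chart of the atlas. -/
def IsSmoothFun (u : M → ℝ) : Prop :=
  ∀ c : M, ∀ y ∈ (chartAt (Rn n) c).target, ContDiffAt ℝ ∞ (read u c) y

theorem IsScalar.isSmoothFun {F : M → Rn n → ℝ} (hF : IsScalar F)
    (hs : ∀ c, ∀ y ∈ (chartAt (Rn n) c).target, ContDiffAt ℝ ∞ (F c) y) :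
    IsSmoothFun (n := n) (atCenter F) := fun c y hy =>
  (hs c y hy).congr_of_eventuallyEq (Filter.eventuallyEq_of_mem
    ((chartAt (Rn n) c).open_target.mem_nhds hy) fun _ hz => hF.atCenter_symm hz)

theorem IsSmoothFun.continuous {u : M → ℝ} (hu : IsSmoothFun (n := n) u) : Continuous u := by
  rw [continuous_iff_continuousAt]
  intro x
  have hx := mem_chart_source (Rn n) x
  have h1 : ContinuousAt (fun z => read u x (chartAt (Rn n) x z)) x :=
    ContinuousAt.comp (f := chartAt (Rn n) x)
      (hu x _ (mem_chart_target (Rn n) x)).continuousAt ((chartAt (Rn n) x).continuousAt hx)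
  exact h1.congr (Filter.eventuallyEq_of_mem ((chartAt (Rn n) x).open_source.mem_nhds hx)
    fun z hz => read_apply u hz)

variable [IsManifold (𝓡 n) ∞ M]

theorem isSmoothFun_of_contMDiff {u : M → ℝ} (hu : ContMDiff (𝓡 n) 𝓘(ℝ, ℝ) ∞ u) :
    IsSmoothFun (n := n) u := fun c _ hy =>
  contMDiffAt_iff_contDiffAt.1 ((hu _).comp _ ((contMDiffOn_chart_symm (I := 𝓡 n) (n := ∞)
    (x := c)).contMDiffAt ((chartAt (Rn n) c).open_target.mem_nhds hy)))

end Scalars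

/-! ### The Riemannian measure -/

section Measure

variable {n : ℕ}

/-- Continuity on the open set alone does not control the behaviour at its boundary; vanishing off a
compact subset does. -/
theorem integrableOn_of_eq_zero_off_compact {K O : Set (Rn n)} (hK : IsCompact K) (hKO : K ⊆ O)
    (hO : MeasurableSet O) {f : Rn n → ℝ} (hf : ContinuousOn f O) (h0 : ∀ y ∈ O \ K, f y = 0) :
    IntegrableOn f O := by
  rw [← Set.union_sdiff_cancel hKO]
  refine ((hf.mono hKO).integrableOn_compact hK).union ?_
  exact integrableOn_zero.congr_fun (fun y hy => (h0 y hy).symm) (hO.diff hK.measurableSet)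

theorem det_fderiv_eq_det_jac {ψ : Rn n → Rn n} {z : Rn n} (hψ : ContDiffAt ℝ ∞ ψ z) :
    (fderiv ℝ ψ z).det = (jac ψ z).det := by
  rw [ContinuousLinearMap.det,
    ← LinearMap.det_toMatrix (EuclideanSpace.basisFun (Fin n) ℝ).toBasis]
  congr 1
  ext i j
  rw [LinearMap.toMatrix_apply]
  simp [fderiv_single hψ]

variable {M : Type*} [TopologicalSpace M] [ChartedSpace (Rn n) M]

theorem IsSmoothFun.continuousOn {u : M → ℝ} (hu : IsSmoothFun (n := n) u) (c : M) :
    ContinuousOn (read u c) (chartAt (Rn n) c).target := fun y hy =>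
  (hu c y hy).continuousAt.continuousWithinAt

theorem continuousOn_read {u : M → ℝ} (hu : Continuous u) (c : M) :
    ContinuousOn (read u c) (chartAt (Rn n) c).target :=
  hu.comp_continuousOn (chartAt (Rn n) c).continuousOn_symm

theorem IsMetric.continuousOn_density {g : TensorField n M} (hg : IsMetric g) (c : M) :
    ContinuousOn (density (comp g c)) (chartAt (Rn n) c).target := fun _ hy =>
  ((hg c).smooth_density hy).continuousAt.continuousWithinAt

theorem aemeasurable_symm [MeasurableSpace M] [BorelSpace M] (g : TensorField n M) (c : M) :
    AEMeasurable (chartAt (Rn n) c).symm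
      (((volume : Measure (Rn n)).restrict (chartAt (Rn n) c).target).withDensity
        fun y => ENNReal.ofReal (density (comp g c) y)) :=
  ((chartAt (Rn n) c).continuousOn_symm.aemeasurable
    (chartAt (Rn n) c).open_target.measurableSet).mono_ac (withDensity_absolutelyContinuous _ _)

theorem aemeasurable_density {g : TensorField n M} (hg : IsMetric g) (c : M) :
    AEMeasurable (fun y => ENNReal.ofReal (density (comp g c) y))
      ((volume : Measure (Rn n)).restrict (chartAt (Rn n) c).target) :=
  ((hg.continuousOn_density c).aemeasurable
    (chartAt (Rn n) c).open_target.measurableSet).ennreal_ofReal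

variable [IsManifold (𝓡 n) ∞ M]

theorem density_transition (g : TensorField n M) {c d : M} {y : Rn n} (hy : y ∈ overlap M c d) :
    density (comp g d) y =
      |(jac (transition M c d) y).det| * density (comp g c) (transition M c d y) := by
  rw [density, isPullback_comp g c d y hy, Matrix.det_mul, Matrix.det_mul, Matrix.det_transpose,
    mul_right_comm, Real.sqrt_mul (mul_self_nonneg _), Real.sqrt_mul_self_eq_abs, density]

/-- Change of variables under the transition map: the density transforms with exactly the absolute
value of the Jacobian determinant. -/
theorem setIntegral_overlap (g : TensorField n M) (f : M → ℝ) (c d : M) :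
    ∫ y in overlap M d c, read f c y * density (comp g c) y =
      ∫ y in overlap M c d, read f d y * density (comp g d) y := by
  have himg : (overlap M d c : Set (Rn n)) = transition M c d '' overlap M c d := by
    ext y
    refine ⟨fun hy => ⟨_, transition_mem_overlap hy, transition_transition hy⟩, ?_⟩
    rintro ⟨z, hz, rfl⟩
    exact transition_mem_overlap hz
  rw [himg, integral_image_eq_integral_abs_det_fderiv_smul volume
    (isOpen_overlap c d).measurableSet (fun z hz =>
      ((contDiffAt_transition hz).differentiableAt (by simp)).hasFDerivAt.hasFDerivWithinAt)
    (fun z hz w hw h => by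
      rw [← transition_transition hz, ← transition_transition hw]; exact congrArg _ h)]
  refine setIntegral_congr_fun (isOpen_overlap c d).measurableSet fun y hy => ?_
  simp only [smul_eq_mul]
  rw [density_transition g hy, det_fderiv_eq_det_jac (contDiffAt_transition hy), read, read,
    symm_transition hy]
  ring

/-- Both integrals only see the overlap of the two charts, where they agree by change of variables.
-/
theorem setIntegral_chart_eq (g : TensorField n M) {f : M → ℝ} {c d : M}
    (hc : ∀ x, x ∉ (chartAt (Rn n) c).source → f x = 0)
    (hd : ∀ x, x ∉ (chartAt (Rn n) d).source → f x = 0) :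
    ∫ y in (chartAt (Rn n) c).target, read f c y * density (comp g c) y =
      ∫ y in (chartAt (Rn n) d).target, read f d y * density (comp g d) y := by
  have h : ∀ c d : M, (∀ x, x ∉ (chartAt (Rn n) d).source → f x = 0) →
      ∫ y in (chartAt (Rn n) c).target, read f c y * density (comp g c) y =
        ∫ y in overlap M d c, read f c y * density (comp g c) y := by
    intro c d hd
    refine setIntegral_eq_of_subset_of_forall_sdiff_eq_zero
      (chartAt (Rn n) c).open_target.measurableSet (fun y hy => (mem_overlap.1 hy).1)
      fun y hy => ?_
    rw [read, hd _ fun h => hy.2 (mem_overlap.2 ⟨hy.1, h⟩), zero_mul]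
  rw [h c d hd, h d c hc, setIntegral_overlap]

variable [CompactSpace M] [T2Space M]

variable (n M) in
theorem finite_chartPartition : {c | (Function.support (chartPartition n M c)).Nonempty}.Finite :=
  (chartPartition n M).locallyFinite.finite_nonempty_of_compact

variable (n M) in
/-- The finitely many charts that carry the partition of unity. -/
def chartFinset : Finset M := (finite_chartPartition n M).toFinset

theorem chartPartition_eq_zero {c : M} (hc : c ∉ chartFinset n M) (x : M) :
    chartPartition n M c x = 0 := by
  by_contra h
  exact hc ((finite_chartPartition n M).mem_toFinset.2 ⟨x, h⟩)

theorem sum_chartPartition (x : M) : ∑ c ∈ chartFinset n M, chartPartition n M c x = 1 := by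
  rw [← (chartPartition n M).sum_eq_one (Set.mem_univ x)]
  refine (finsum_eq_sum_of_support_subset _ fun c hc => ?_).symm
  by_contra h
  exact hc (chartPartition_eq_zero h x)

theorem tsupport_chartPartition (c : M) :
    tsupport (chartPartition n M c) ⊆ (chartAt (Rn n) c).source :=
  (SmoothPartitionOfUnity.exists_isSubordinate_chartAt_source (𝓡 n) M).choose_spec c

theorem isSmoothFun_chartPartition (c : M) : IsSmoothFun (n := n) (chartPartition n M c) :=
  isSmoothFun_of_contMDiff ((chartPartition n M).toFun c).contMDiff

/-- The image of the support of the cutoff function in the chart at `c`. -/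
def cutSupport (c : M) : Set (Rn n) := chartAt (Rn n) c '' tsupport (chartPartition n M c)

theorem isCompact_cutSupport (c : M) : IsCompact (cutSupport c : Set (Rn n)) :=
  (isClosed_tsupport _).isCompact.image_of_continuousOn
    ((chartAt (Rn n) c).continuousOn.mono (tsupport_chartPartition c))

theorem cutSupport_subset (c : M) : (cutSupport c : Set (Rn n)) ⊆ (chartAt (Rn n) c).target := by
  rintro _ ⟨x, hx, rfl⟩
  exact (chartAt (Rn n) c).map_source (tsupport_chartPartition c hx)

theorem symm_notMem_tsupport {c : M} {y : Rn n}
    (hy : y ∈ (chartAt (Rn n) c).target \ cutSupport c) :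
    (chartAt (Rn n) c).symm y ∉ tsupport (chartPartition n M c) := fun h =>
  hy.2 ⟨_, h, (chartAt (Rn n) c).right_inv hy.1⟩

theorem read_chartPartition_eq_zero {c : M} {y : Rn n}
    (hy : y ∈ (chartAt (Rn n) c).target \ cutSupport c) :
    read (chartPartition n M c) c y = 0 :=
  image_eq_zero_of_notMem_tsupport (f := chartPartition n M c) (symm_notMem_tsupport hy)

theorem integrableOn_cut (c : M) {f : Rn n → ℝ} (hf : ContinuousOn f (chartAt (Rn n) c).target) :
    IntegrableOn (fun y => read (chartPartition n M c) c y * f y) (chartAt (Rn n) c).target :=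
  integrableOn_of_eq_zero_off_compact (isCompact_cutSupport c) (cutSupport_subset c)
    (chartAt (Rn n) c).open_target.measurableSet
    (((isSmoothFun_chartPartition c).continuousOn c).mul hf)
    fun y hy => by rw [read_chartPartition_eq_zero hy, zero_mul]

variable [MeasurableSpace M] {g : TensorField n M}

/-- The measure `√(det g_{ij}) dy` of the chart at `c`. -/
def chartMeasure (g : TensorField n M) (c : M) : Measure M :=
  (((volume : Measure (Rn n)).restrict (chartAt (Rn n) c).target).withDensity
    fun y => ENNReal.ofReal (density (comp g c) y)).map (chartAt (Rn n) c).symm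

/-- The part of the Riemannian measure that the chart at `c` contributes. -/
def cutMeasure (g : TensorField n M) (c : M) : Measure M :=
  (chartMeasure g c).withDensity fun x => ENNReal.ofReal (chartPartition n M c x)

/-- By compactness and local finiteness only finitely many cutoff functions are not identically
zero. -/
theorem volumeMeasure_eq_sum (g : TensorField n M) :
    volumeMeasure g = ∑ c ∈ chartFinset n M, cutMeasure g c := by
  ext s hs
  rw [volumeMeasure, Measure.sum_apply _ hs, Measure.finsetSum_apply]
  refine tsum_eq_sum fun c hc => ?_
  simp [chartPartition_eq_zero hc]

variable [BorelSpace M]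

theorem integral_cutMeasure (hg : IsMetric g) {f : M → ℝ} (hf : Continuous f) (c : M) :
    ∫ x, f x ∂(cutMeasure g c) = ∫ y in (chartAt (Rn n) c).target,
      read (chartPartition n M c) c y * (read f c y * density (comp g c) y) := by
  have hρ := (isSmoothFun_chartPartition (n := n) c).continuous
  rw [cutMeasure, integral_withDensity_eq_integral_toReal_smul₀
    (hρ.measurable.ennreal_ofReal.aemeasurable) (by simp), chartMeasure,
    integral_map (f := fun x => (ENNReal.ofReal (chartPartition n M c x)).toReal • f x)
      (aemeasurable_symm g c)
      ((hρ.measurable.ennreal_ofReal.ennreal_toReal.smul hf.measurable).aestronglyMeasurable),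
    integral_withDensity_eq_integral_toReal_smul₀ (aemeasurable_density hg c) (by simp)]
  refine integral_congr_ae (ae_of_all _ fun y => ?_)
  simp only [smul_eq_mul]
  rw [ENNReal.toReal_ofReal (show 0 ≤ density (comp g c) y from Real.sqrt_nonneg _),
    ENNReal.toReal_ofReal ((chartPartition n M).nonneg c _), read, read]
  ring

theorem cutMeasure_univ_lt_top (hg : IsMetric g) (c : M) : cutMeasure g c Set.univ < ⊤ := by
  have hρ := (isSmoothFun_chartPartition (n := n) c).continuous
  rw [cutMeasure, withDensity_apply _ MeasurableSet.univ, Measure.restrict_univ, chartMeasure,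
    lintegral_map' hρ.measurable.ennreal_ofReal.aemeasurable (aemeasurable_symm g c),
    lintegral_withDensity_eq_lintegral_mul₀' (aemeasurable_density hg c)]
  · refine lt_of_eq_of_lt (lintegral_congr fun y => ?_)
      (integrableOn_cut c (hg.continuousOn_density c)).lintegral_lt_top
    rw [Pi.mul_apply, mul_comm, read, ENNReal.ofReal_mul ((chartPartition n M).nonneg c _)]
  · exact hρ.measurable.ennreal_ofReal.comp_aemeasurable (aemeasurable_symm g c)

theorem isFiniteMeasure_volumeMeasure (hg : IsMetric g) : IsFiniteMeasure (volumeMeasure g) := by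
  rw [volumeMeasure_eq_sum]
  refine ⟨?_⟩
  rw [Measure.finsetSum_apply]
  exact ENNReal.sum_lt_top.2 fun c _ => cutMeasure_univ_lt_top hg c

theorem integrable_volumeMeasure (hg : IsMetric g) {f : M → ℝ} (hf : Continuous f) :
    Integrable f (volumeMeasure g) :=
  have := isFiniteMeasure_volumeMeasure hg
  hf.integrable_of_hasCompactSupport (HasCompactSupport.of_compactSpace f)

theorem integral_volumeMeasure (hg : IsMetric g) {f : M → ℝ} (hf : Continuous f) :
    ∫ x, f x ∂(volumeMeasure g) = ∑ c ∈ chartFinset n M, ∫ y in (chartAt (Rn n) c).target,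
      read (chartPartition n M c) c y * (read f c y * density (comp g c) y) := by
  rw [volumeMeasure_eq_sum, integral_finsetSum_measure fun c _ => ?_]
  · exact Finset.sum_congr rfl fun c _ => integral_cutMeasure hg hf c
  · have : IsFiniteMeasure (cutMeasure g c) := ⟨cutMeasure_univ_lt_top hg c⟩
    exact hf.integrable_of_hasCompactSupport (HasCompactSupport.of_compactSpace f)

/-- Each cut-off piece is moved into the single chart containing the support, where the cutoffs add
up to $1$. Hence the glued measure does not depend on the partition of unity. -/
theorem integral_eq_setIntegral_chart (hg : IsMetric g) {f : M → ℝ} (hf : Continuous f) {c : M}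
    (hc : tsupport f ⊆ (chartAt (Rn n) c).source) :
    ∫ x, f x ∂(volumeMeasure g) =
      ∫ y in (chartAt (Rn n) c).target, read f c y * density (comp g c) y := by
  have h0 : ∀ x, x ∉ (chartAt (Rn n) c).source → f x = 0 := fun x hx =>
    image_eq_zero_of_notMem_tsupport fun h => hx (hc h)
  rw [integral_volumeMeasure hg hf]
  have h1 : ∀ d : M, ∫ y in (chartAt (Rn n) d).target,
      read (chartPartition n M d) d y * (read f d y * density (comp g d) y) =
      ∫ y in (chartAt (Rn n) c).target,
        read (chartPartition n M d) c y * (read f c y * density (comp g c) y) := by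
    intro d
    have := setIntegral_chart_eq g (f := fun x => chartPartition n M d x * f x) (c := d) (d := c)
      (fun x hx => by
        rw [image_eq_zero_of_notMem_tsupport fun h => hx (tsupport_chartPartition d h), zero_mul])
      (fun x hx => by rw [h0 x hx, mul_zero])
    simpa only [read, mul_assoc] using this
  have hK : IsCompact (chartAt (Rn n) c '' tsupport f) :=
    (isClosed_tsupport _).isCompact.image_of_continuousOn
      ((chartAt (Rn n) c).continuousOn.mono hc)
  rw [Finset.sum_congr rfl fun d _ => h1 d, ← integral_finsetSum]
  · refine integral_congr_ae (ae_of_all _ fun y => ?_)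
    simp only [← Finset.sum_mul, read, sum_chartPartition, one_mul]
  · intro d _
    refine integrableOn_of_eq_zero_off_compact hK ?_ (chartAt (Rn n) c).open_target.measurableSet
      (((isSmoothFun_chartPartition d).continuousOn c).mul ((continuousOn_read hf c).mul
        (hg.continuousOn_density c))) fun y hy => ?_
    · rintro _ ⟨x, hx, rfl⟩
      exact (chartAt (Rn n) c).map_source (hc hx)
    · have : read f c y = 0 := image_eq_zero_of_notMem_tsupport (f := f) fun h =>
        hy.2 ⟨_, h, (chartAt (Rn n) c).right_inv hy.1⟩
      rw [this, zero_mul, mul_zero]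

end Measure

open Coord

/-! ### The divergence theorem -/

section Divergence

variable {n : ℕ}

/-- Integration by parts against the constant function $1$. -/
theorem integral_pd_eq_zero {w : Rn n → ℝ} (hw : ∀ y, ContDiffAt ℝ ∞ w y)
    (hc : HasCompactSupport w) (a : Fin n) : ∫ y, pd a w y = 0 := by
  have hd : Continuous (pd a w) :=
    continuous_iff_continuousAt.2 fun y => (contDiffAt_pd (hw y) a).continuousAt
  have hcd : HasCompactSupport (pd a w) := by
    refine (hc.fderiv ℝ).mono fun y hy h => hy ?_
    rw [pd, h, zero_apply]
  have hwc : Continuous w := continuous_iff_continuousAt.2 fun y => (hw y).continuousAt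
  have h := integral_mul_fderiv_eq_neg_fderiv_mul_of_integrable (μ := (volume : Measure (Rn n)))
    (f := fun _ => (1 : ℝ)) (g := w) (v := EuclideanSpace.single a 1) (by simp)
    (by simp only [one_mul]; exact hd.integrable_of_hasCompactSupport hcd)
    (by simp only [one_mul]; exact hwc.integrable_of_hasCompactSupport hc) (by simp)
    (fun y _ => (hw y).differentiableAt (by simp))
  simpa [pd] using h

variable {M : Type*} [TopologicalSpace M] [ChartedSpace (Rn n) M]
  [IsManifold (𝓡 n) ∞ M] [CompactSpace M] [T2Space M]

/-- After multiplication by the cutoff, the function extends by zero to a smooth compactly supported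
function on all of $\mathbb R^n$. -/
theorem setIntegral_pd_cut (c : M) {F : Rn n → ℝ}
    (hF : ∀ y ∈ (chartAt (Rn n) c).target, ContDiffAt ℝ ∞ F y) (a : Fin n) :
    ∫ y in (chartAt (Rn n) c).target,
      pd a (fun z => read (chartPartition n M c) c z * F z) y = 0 := by
  have hO := (chartAt (Rn n) c).open_target
  set w := (chartAt (Rn n) c).target.indicator
    (fun z => read (chartPartition n M c) c z * F z) with hw
  have hw0 : ∀ y, y ∉ cutSupport c → w y = 0 := by
    intro y hy
    by_cases hm : y ∈ (chartAt (Rn n) c).target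
    · rw [hw, Set.indicator_of_mem hm, read_chartPartition_eq_zero ⟨hm, hy⟩, zero_mul]
    · rw [hw, Set.indicator_of_notMem hm]
  have hws : ∀ y, ContDiffAt ℝ ∞ w y := by
    intro y
    by_cases hm : y ∈ (chartAt (Rn n) c).target
    · exact ((isSmoothFun_chartPartition c c y hm).mul (hF y hm)).congr_of_eventuallyEq
        (Filter.eventuallyEq_of_mem (hO.mem_nhds hm) fun z hz => Set.indicator_of_mem hz _)
    · exact (contDiffAt_const (c := (0 : ℝ))).congr_of_eventuallyEq (Filter.eventuallyEq_of_mem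
        ((isCompact_cutSupport c).isClosed.isOpen_compl.mem_nhds
          fun h => hm (cutSupport_subset c h)) fun z hz => hw0 z hz)
  have hwc : HasCompactSupport w :=
    HasCompactSupport.intro (isCompact_cutSupport c) fun y hy => hw0 y hy
  rw [← integral_pd_eq_zero hws hwc a, ← setIntegral_eq_integral_of_forall_compl_eq_zero
    (f := pd a w) (s := (chartAt (Rn n) c).target)]
  · exact setIntegral_congr_fun hO.measurableSet fun y hy => pd_congr (Filter.eventuallyEq_of_mem
      (hO.mem_nhds hy) fun z hz => (Set.indicator_of_mem hz fun z =>
        read (chartPartition n M c) c z * F z).symm) a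
  · intro y hy
    rw [pd_congr (g := fun _ => (0 : ℝ)) (Filter.eventuallyEq_of_mem
      ((isCompact_cutSupport c).isClosed.isOpen_compl.mem_nhds
        fun h => hy (cutSupport_subset c h)) fun z hz => hw0 z hz), pd_const]

variable {g : TensorField n M} {θ : M → Fin n → Rn n → ℝ}

/-- The coordinate expressions `θ c` are those of a smooth 1-form. -/
structure IsOneForm (θ : M → Fin n → Rn n → ℝ) : Prop where
  smooth : ∀ c, ∀ y ∈ (chartAt (Rn n) c).target, ∀ i, ContDiffAt ℝ ∞ (θ c i) y
  pullback : ∀ c d, IsFormPullback (transition M c d) (overlap M c d) (θ d) (θ c)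

/-- The coordinate expressions `T c` are those of a smooth 2-tensor. -/
structure IsTensor (T : M → Rn n → Matrix (Fin n) (Fin n) ℝ) : Prop where
  smooth : ∀ c, ∀ y ∈ (chartAt (Rn n) c).target, MSm (T c) y
  pullback : ∀ c d, IsPullback (transition M c d) (overlap M c d) (T d) (T c)

omit [CompactSpace M] [T2Space M] in
theorem IsTensor.isScalar_trace {T : M → Rn n → Matrix (Fin n) (Fin n) ℝ} (hg : IsMetric g)
    (hT : IsTensor T) : IsScalar fun c => trace (comp g c) (T c) := fun c d _ hy =>
  trace_pullback (isCoordChange_transition c d) (hg c) (isPullback_comp g c d) (hT.pullback c d) hy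

omit [CompactSpace M] [T2Space M] in
theorem IsTensor.isSmoothFun_trace {T : M → Rn n → Matrix (Fin n) (Fin n) ℝ} (hg : IsMetric g)
    (hT : IsTensor T) : IsSmoothFun (n := n) (atCenter fun c => trace (comp g c) (T c)) :=
  (hT.isScalar_trace hg).isSmoothFun fun c y hy => (hg c).smooth_trace hy (hT.smooth c y hy)

omit [CompactSpace M] [T2Space M] in
theorem IsOneForm.isTensor_formDeriv (hg : IsMetric g) (hθ : IsOneForm θ) :
    IsTensor fun c => formDeriv (comp g c) (θ c) where
  smooth c y hy := (hg c).smooth_formDeriv hy (hθ.smooth c y hy)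
  pullback c d := formDeriv_pullback (isCoordChange_transition c d) (hg c) (isPullback_comp g c d)
    (hθ.smooth c) (hθ.pullback c d)

omit [CompactSpace M] [T2Space M] in
-- The tensor $du\otimes\theta$, whose trace is the pairing of $du$ with $\theta$; this is the error
-- term created by a cutoff in the divergence theorem.
theorem IsOneForm.isTensor_pd_mul {u : M → ℝ} (hu : IsSmoothFun (n := n) u) (hθ : IsOneForm θ) :
    IsTensor fun c y => Matrix.of fun a b => pd a (read u c) y * θ c b y where
  smooth c y hy a b := (contDiffAt_pd (hu c y hy) a).mul (hθ.smooth c y hy b)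
  pullback c d y hy := by
    ext i j
    have hg := grad_pullback (isCoordChange_transition c d) (hu c) (u' := read u d)
      (fun z hz => isScalar_read u c d z hz) y hy i
    beta_reduce at hg ⊢
    rw [Matrix.of_apply, hθ.pullback c d y hy j]
    simp only [Matrix.mul_apply, Matrix.transpose_apply, Matrix.of_apply, Finset.sum_mul, hg,
      Finset.mul_sum]
    exact Finset.sum_congr rfl fun a _ => Finset.sum_congr rfl fun b _ => by ring

variable [MeasurableSpace M] [BorelSpace M]

/-- The divergence theorem. For each cutoff,
$\rho_c\,\mathrm{div}\,\theta=\mathrm{div}(\rho_c\theta)-\langle d\rho_c,\theta\rangle$, and the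
first term integrates to zero in its chart. Summing over $c$ removes the second, since $\sum_c
d\rho_c=d1=0$. -/
theorem integral_trace_formDeriv (hg : IsMetric g) (hθ : IsOneForm θ) :
    ∫ x, atCenter (fun c => trace (comp g c) (formDeriv (comp g c) (θ c))) x ∂(volumeMeasure g)
      = 0 := by
  have hD := hθ.isTensor_formDeriv hg
  have hQ : ∀ c : M, IsTensor fun d y =>
      Matrix.of fun a b => pd a (read (chartPartition n M c) d) y * θ d b y := fun c =>
    hθ.isTensor_pd_mul (isSmoothFun_chartPartition c)
  set Q : M → M → ℝ := fun c => atCenter fun d => trace (comp g d) fun y =>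
      Matrix.of fun a b => pd a (read (chartPartition n M c) d) y * θ d b y with hQd
  have hQc : ∀ c, Continuous (Q c) := fun c => ((hQ c).isSmoothFun_trace hg).continuous
  have hflux : ∀ (c : M) (a : Fin n), ∀ y ∈ (chartAt (Rn n) c).target,
      ContDiffAt ℝ ∞ (fluxDensity (comp g c) (θ c) a) y := fun c a y hy =>
    (hg c).smooth_fluxDensity hy (hθ.smooth c y hy) a
  have h1 : ∀ c : M, ∫ y in (chartAt (Rn n) c).target, read (chartPartition n M c) c y *
      (read (atCenter fun c => trace (comp g c) (formDeriv (comp g c) (θ c))) c y *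
        density (comp g c) y) = -∫ x, Q c x ∂(volumeMeasure g) := by
    intro c
    have hO := (chartAt (Rn n) c).open_target
    -- The error term is supported where the cutoff is, so its global integral may be computed in
    -- the same chart.
    have hQs : tsupport (Q c) ⊆ tsupport (chartPartition n M c) := by
      refine closure_minimal (fun x hx => ?_) (isClosed_tsupport _)
      by_contra h
      refine hx ?_
      have h0 : read (chartPartition n M c) x =ᶠ[nhds (chartAt (Rn n) x x)] fun _ => 0 := by
        have hev : ∀ᶠ z in nhds x, z ∉ tsupport (chartPartition n M c) :=
          (isClosed_tsupport _).isOpen_compl.mem_nhds h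
        have hcont := (chartAt (Rn n) x).continuousAt_symm (mem_chart_target (Rn n) x)
        rw [ContinuousAt, (chartAt (Rn n) x).left_inv (mem_chart_source (Rn n) x)] at hcont
        exact (hcont.eventually hev).mono fun z hz =>
          image_eq_zero_of_notMem_tsupport (f := chartPartition n M c) hz
      simp only [hQd, atCenter, trace, Matrix.of_apply, pd_congr h0, pd_const, zero_mul, mul_zero,
        Finset.sum_const_zero]
    rw [integral_eq_setIntegral_chart hg (hQc c) (hQs.trans (tsupport_chartPartition c)),
      eq_neg_iff_add_eq_zero, ← integral_add]
    · have h2 : ∑ a, ∫ y in (chartAt (Rn n) c).target, pd a (fun z =>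
          read (chartPartition n M c) c z * fluxDensity (comp g c) (θ c) a z) y = 0 :=
        Finset.sum_eq_zero fun a _ => setIntegral_pd_cut c (hflux c a) a
      rw [← integral_finsetSum] at h2
      · rw [← h2]
        refine setIntegral_congr_fun hO.measurableSet fun y hy => ?_
        have e1 : ∀ a, pd a (fun z => read (chartPartition n M c) c z *
            fluxDensity (comp g c) (θ c) a z) y =
            read (chartPartition n M c) c y * pd a (fluxDensity (comp g c) (θ c) a) y +
              pd a (read (chartPartition n M c) c) y * fluxDensity (comp g c) (θ c) a y := by
          intro a
          rw [pd_mul (isSmoothFun_chartPartition c c y hy) (hflux c a y hy)]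
          ring
        rw [Finset.sum_congr rfl fun a _ => e1 a, Finset.sum_add_distrib, ← Finset.mul_sum,
          sum_pd_fluxDensity hO (hg c) hy (hθ.smooth c y hy), read, read,
          (hD.isScalar_trace hg).atCenter_symm hy, show read (Q c) c y = _ from
            ((hQ c).isScalar_trace hg).atCenter_symm hy]
        congr 1
        · ring
        · simp only [trace, Matrix.of_apply, fluxDensity, Finset.sum_mul, Finset.mul_sum]
          exact Finset.sum_congr rfl fun a _ => Finset.sum_congr rfl fun b _ => by ring
      · intro a _
        refine integrableOn_of_eq_zero_off_compact (isCompact_cutSupport c) (cutSupport_subset c)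
          hO.measurableSet (fun y hy => ((contDiffAt_pd ((isSmoothFun_chartPartition c c y hy).mul
            (hflux c a y hy)) a).continuousAt).continuousWithinAt) fun y hy => ?_
        rw [pd_congr (g := fun _ => (0 : ℝ)) ?_, pd_const]
        refine Filter.eventuallyEq_of_mem ((hO.sdiff (isCompact_cutSupport c).isClosed).mem_nhds hy)
          fun z hz => ?_
        rw [read_chartPartition_eq_zero hz, zero_mul]
    · exact integrableOn_cut c ((continuousOn_read (hD.isSmoothFun_trace hg).continuous c).mul
        (hg.continuousOn_density c))
    · refine integrableOn_of_eq_zero_off_compact (isCompact_cutSupport c) (cutSupport_subset c)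
        hO.measurableSet ((continuousOn_read (hQc c) c).mul (hg.continuousOn_density c))
        fun y hy => ?_
      have : read (Q c) c y = 0 := image_eq_zero_of_notMem_tsupport (f := Q c) fun h =>
        symm_notMem_tsupport hy (hQs h)
      rw [this, zero_mul]
  rw [integral_volumeMeasure hg (hD.isSmoothFun_trace hg).continuous,
    Finset.sum_congr rfl fun c _ => h1 c, Finset.sum_neg_distrib,
    ← integral_finsetSum _ fun c _ => integrable_volumeMeasure hg (hQc c), neg_eq_zero]
  refine integral_eq_zero_of_ae (ae_of_all _ fun x => ?_)
  have hx := mem_chart_target (Rn n) x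
  have h3 : ∀ a, ∑ c ∈ chartFinset n M, pd a (read (chartPartition n M c) x) (chartAt (Rn n) x x)
      = 0 := by
    intro a
    rw [← pd_sum fun c _ => isSmoothFun_chartPartition c x _ hx]
    simp only [read, sum_chartPartition, pd_const]
  simp only [hQd, atCenter, trace, Matrix.of_apply, Pi.zero_apply]
  rw [Finset.sum_comm]
  refine Finset.sum_eq_zero fun a _ => ?_
  rw [Finset.sum_comm]
  refine Finset.sum_eq_zero fun b _ => ?_
  rw [← Finset.mul_sum, ← Finset.sum_mul, h3, zero_mul, mul_zero]

end Divergence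

open Coord

/-! ### Smooth families of functions and their integrals -/

section Families

variable {n : ℕ}

/-- Positivity on the compact unit sphere is an open condition uniformly in the parameter, and it
scales to all nonzero vectors. -/
theorem eventually_posDef {X : Type*} [TopologicalSpace X] {A : X → Matrix (Fin n) (Fin n) ℝ}
    {x₀ : X} (hA : ∀ i j, ContinuousAt (fun x => A x i j) x₀)
    (hs : ∀ x, (A x).transpose = A x) (h : (A x₀).PosDef) : ∀ᶠ x in nhds x₀, (A x).PosDef := by
  have hK : ∀ᶠ x in nhds x₀, ∀ v ∈ Metric.sphere (0 : Fin n → ℝ) 1, 0 < v ⬝ᵥ (A x).mulVec v := by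
    refine (isCompact_sphere (0 : Fin n → ℝ) 1).eventually_forall_of_forall_eventually
      fun v hv => ?_
    have hc : ContinuousAt (fun z : X × (Fin n → ℝ) => z.2 ⬝ᵥ (A z.1).mulVec z.2) (x₀, v) := by
      simp only [dotProduct, Matrix.mulVec]
      refine tendsto_finsetSum _ fun i _ => Filter.Tendsto.mul ?_ (tendsto_finsetSum _ fun j _ =>
        Filter.Tendsto.mul ?_ ?_)
      · exact ((continuous_apply i).comp continuous_snd).continuousAt
      · exact ContinuousAt.comp (f := Prod.fst) (x := ((x₀, v) : X × (Fin n → ℝ))) (hA i j)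
          continuousAt_fst
      · exact ((continuous_apply j).comp continuous_snd).continuousAt
    refine hc.eventually (lt_mem_nhds ?_)
    have hv0 : v ≠ 0 := by
      rintro rfl
      simp at hv
    simpa using h.dotProduct_mulVec_pos hv0
  filter_upwards [hK] with x hx
  refine Matrix.PosDef.of_dotProduct_mulVec_pos (hs x) fun v hv => ?_
  have hn : 0 < ‖v‖ := norm_pos_iff.2 hv
  have h1 := hx (‖v‖⁻¹ • v) (by simp [norm_smul, hn.ne'])
  rw [Matrix.mulVec_smul, dotProduct_smul, smul_dotProduct, smul_eq_mul, smul_eq_mul] at h1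
  rw [star_trivial]
  have h2 := (pos_iff_pos_of_mul_pos h1).1 (inv_pos.2 hn)
  exact (pos_iff_pos_of_mul_pos h2).1 (inv_pos.2 hn)

variable {M : Type*} [TopologicalSpace M] [ChartedSpace (Rn n) M]

/-- The family `f` of functions is smooth in time and space at time `0`. -/
def IsSmoothFamily (n : ℕ) {M : Type*} [TopologicalSpace M] [ChartedSpace (Rn n) M]
    (f : ℝ → M → ℝ) : Prop :=
  ∀ x, ContDiffAt ℝ ∞ (fun r : ℝ × Rn n => f r.1 ((chartAt (Rn n) x).symm r.2))
    (0, chartAt (Rn n) x x)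

theorem tendsto_chart (t : ℝ) (x : M) : Filter.Tendsto
    (fun q : ℝ × M => (q.1, chartAt (Rn n) x q.2)) (nhds (t, x))
    (nhds (t, chartAt (Rn n) x x)) := by
  have h := ((chartAt (Rn n) x).continuousAt (mem_chart_source (Rn n) x))
  exact (continuousAt_fst.prodMk (ContinuousAt.comp (f := Prod.snd) (x := ((t, x) : ℝ × M)) h
    continuousAt_snd))

theorem eventually_mem_source (t : ℝ) (x : M) :
    ∀ᶠ q : ℝ × M in nhds (t, x), q.2 ∈ (chartAt (Rn n) x).source :=
  continuousAt_snd.eventually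
    ((chartAt (Rn n) x).open_source.mem_nhds (mem_chart_source (Rn n) x))

theorem isSmoothFamily_atCenter {F : ℝ → M → Rn n → ℝ} (hF : ∀ᶠ t in nhds 0, IsScalar (F t))
    (hs : ∀ c, ∀ y ∈ (chartAt (Rn n) c).target, JointSmooth (fun t => F t c) (0, y)) :
    IsSmoothFamily n fun t => atCenter (F t) := by
  intro x
  refine (hs x _ (mem_chart_target (Rn n) x)).congr_of_eventuallyEq ?_
  have h1 : ∀ᶠ r : ℝ × Rn n in nhds (0, chartAt (Rn n) x x), IsScalar (F r.1) :=
    (continuousAt_fst (p := ((0 : ℝ), chartAt (Rn n) x x))).eventually hF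
  have h2 : ∀ᶠ r : ℝ × Rn n in nhds (0, chartAt (Rn n) x x), r.2 ∈ (chartAt (Rn n) x).target :=
    continuousAt_snd.eventually
      ((chartAt (Rn n) x).open_target.mem_nhds (mem_chart_target (Rn n) x))
  filter_upwards [h1, h2] with r hr1 hr2
  exact hr1.atCenter_symm hr2

variable {f f₁ f₂ : ℝ → M → ℝ}

theorem IsSmoothFamily.add (h₁ : IsSmoothFamily n f₁) (h₂ : IsSmoothFamily n f₂) :
    IsSmoothFamily n fun t x => f₁ t x + f₂ t x := fun x => (h₁ x).add (h₂ x)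

theorem IsSmoothFamily.mul (h₁ : IsSmoothFamily n f₁) (h₂ : IsSmoothFamily n f₂) :
    IsSmoothFamily n fun t x => f₁ t x * f₂ t x := fun x => (h₁ x).mul (h₂ x)

theorem IsSmoothFamily.div (h₁ : IsSmoothFamily n f₁) (h₂ : IsSmoothFamily n f₂)
    (h0 : ∀ x, f₂ 0 x ≠ 0) : IsSmoothFamily n fun t x => f₁ t x / f₂ t x := fun x =>
  (h₁ x).div (h₂ x) (h0 _)

/-- The time derivative of a family. -/
def timeDeriv (f : ℝ → M → ℝ) (t : ℝ) (x : M) : ℝ := deriv (fun s => f s x) t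

theorem hasDerivAt_slice {F : ℝ × Rn n → ℝ} {r : ℝ × Rn n} (hF : DifferentiableAt ℝ F r) :
    HasDerivAt (fun s => F (s, r.2)) (fderiv ℝ F r (1, 0)) r.1 := by
  have h1 : HasDerivAt (fun s : ℝ => (s, r.2)) ((1 : ℝ), (0 : Rn n)) r.1 :=
    (hasDerivAt_id r.1).prodMk (hasDerivAt_const _ _)
  exact HasFDerivAt.comp_hasDerivAt (f := fun s : ℝ => (s, r.2)) r.1 hF.hasFDerivAt h1

theorem IsSmoothFamily.eventually_differentiableAt (hf : IsSmoothFamily n f) (x : M) :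
    ∀ᶠ r in nhds ((0 : ℝ), chartAt (Rn n) x x), DifferentiableAt ℝ
      (fun r : ℝ × Rn n => f r.1 ((chartAt (Rn n) x).symm r.2)) r := by
  have h1 : ContDiffAt ℝ 1 (fun r : ℝ × Rn n => f r.1 ((chartAt (Rn n) x).symm r.2))
      (0, chartAt (Rn n) x x) := (hf x).of_le (by exact_mod_cast le_top)
  exact (h1.eventually (by simp)).mono fun r hr => hr.differentiableAt (by simp)

/-- Closure under the time derivative is what makes the later inductions on the order of
differentiability possible: in a chart it is a directional derivative of a jointly smooth function.
-/
theorem IsSmoothFamily.timeDeriv (hf : IsSmoothFamily n f) :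
    IsSmoothFamily n (timeDeriv f) := by
  intro x
  have h1 : ContDiffAt ℝ ∞ (fun r => fderiv ℝ
      (fun r : ℝ × Rn n => f r.1 ((chartAt (Rn n) x).symm r.2)) r ((1 : ℝ), (0 : Rn n)))
      (0, chartAt (Rn n) x x) := ((hf x).fderiv_right (m := ∞) (by simp)).clm_apply contDiffAt_const
  refine h1.congr_of_eventuallyEq ((hf.eventually_differentiableAt x).mono fun r hr => ?_)
  exact (hasDerivAt_slice hr).deriv

variable [CompactSpace M]

/-- The tube lemma over the compact manifold: local statements near $(0,x)$ give one time interval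
valid for all points. -/
theorem eventually_forall_of_chart {P : ℝ → M → Prop}
    (h : ∀ x : M, ∀ᶠ q : ℝ × M in nhds (0, x), P q.1 q.2) : ∀ᶠ t in nhds 0, ∀ x, P t x := by
  have := isCompact_univ.eventually_forall_of_forall_eventually (x₀ := (0 : ℝ))
    (K := (Set.univ : Set M)) (P := P) fun x _ => h x
  exact this.mono fun t ht x => ht x (Set.mem_univ x)

theorem IsSmoothFamily.eventually_hasDerivAt (hf : IsSmoothFamily n f) :
    ∀ᶠ t in nhds 0, ∀ x, HasDerivAt (fun s => f s x) (QuotientCurvature.timeDeriv f t x) t := by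
  refine eventually_forall_of_chart fun x => ?_
  filter_upwards [(tendsto_chart 0 x).eventually (hf.eventually_differentiableAt x),
    eventually_mem_source (n := n) 0 x] with q hq hx
  have h := hasDerivAt_slice hq
  simp only [(chartAt (Rn n) x).left_inv hx] at h
  exact h.differentiableAt.hasDerivAt

theorem IsSmoothFamily.eventually_continuous (hf : IsSmoothFamily n f) :
    ∀ᶠ t in nhds 0, Continuous (f t) := by
  have h : ∀ᶠ t in nhds 0, ∀ x, ContinuousAt (f t) x := by
    refine eventually_forall_of_chart fun x => ?_
    filter_upwards [(tendsto_chart 0 x).eventually (hf.eventually_differentiableAt x),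
      eventually_mem_source (n := n) 0 x] with q hq hx
    have h2 : ContinuousAt (fun z : M => (q.1, chartAt (Rn n) x z)) q.2 :=
      continuousAt_const.prodMk ((chartAt (Rn n) x).continuousAt hx)
    refine (ContinuousAt.comp (f := fun z : M => (q.1, chartAt (Rn n) x z)) hq.continuousAt
      h2).congr ?_
    filter_upwards [(chartAt (Rn n) x).open_source.mem_nhds hx] with z hz
    simp [(chartAt (Rn n) x).left_inv hz]
  exact h.mono fun t ht => continuous_iff_continuousAt.2 ht

/-- Supplies the constant dominating function when the time derivative is taken under the integral.
-/
theorem IsSmoothFamily.eventually_bounded (hf : IsSmoothFamily n f) :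
    ∃ C, ∀ᶠ t in nhds 0, ∀ x, ‖f t x‖ ≤ C := by
  have hc : Continuous (f 0) := hf.eventually_continuous.self_of_nhds
  obtain ⟨C, hC⟩ := isCompact_univ.exists_bound_of_continuousOn hc.continuousOn
  refine ⟨C + 1, eventually_forall_of_chart fun x => ?_⟩
  have h0 : ‖f 0 ((chartAt (Rn n) x).symm (chartAt (Rn n) x x))‖ < C + 1 :=
    (hC _ (Set.mem_univ _)).trans_lt (lt_add_one C)
  have h1 := (hf x).continuousAt.norm.eventually (gt_mem_nhds h0)
  filter_upwards [(tendsto_chart 0 x).eventually h1, eventually_mem_source (n := n) 0 x]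
    with q hq hx
  rw [(chartAt (Rn n) x).left_inv hx] at hq
  exact hq.le

variable [MeasurableSpace M] [BorelSpace M] {μ : Measure M} [IsFiniteMeasure μ]

theorem IsSmoothFamily.hasDerivAt_integral (hf : IsSmoothFamily n f) (μ : Measure M)
    [IsFiniteMeasure μ] : ∀ᶠ t in nhds 0, HasDerivAt (fun s => ∫ x, f s x ∂μ)
      (∫ x, QuotientCurvature.timeDeriv f t x ∂μ) t := by
  obtain ⟨C, hC⟩ := hf.timeDeriv.eventually_bounded
  -- The conclusion is wanted for all $t$ near $0$, and at each of them the dominated-convergence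
  -- hypotheses must hold on a neighbourhood of that $t$.
  have h := (hf.eventually_hasDerivAt.and (hf.eventually_continuous.and
    (hf.timeDeriv.eventually_continuous.and hC))).eventually_nhds
  filter_upwards [h] with t ht
  have h0 := ht.self_of_nhds
  refine (hasDerivAt_integral_of_dominated_loc_of_deriv_le (bound := fun _ => C) ht
    (ht.mono fun s hs => hs.2.1.aestronglyMeasurable)
    (h0.2.1.integrable_of_hasCompactSupport (HasCompactSupport.of_compactSpace _))
    h0.2.2.1.aestronglyMeasurable (ae_of_all _ fun x s hs => hs.2.2.2 x)
    (integrable_const C) (ae_of_all _ fun x s hs => hs.1 x)).2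

/-- Induction on the order: the derivative of the integral is the integral of another smooth family.
-/
theorem IsSmoothFamily.contDiffAt_integral (μ : Measure M) [IsFiniteMeasure μ] (m : ℕ) :
    ∀ {f : ℝ → M → ℝ}, IsSmoothFamily n f → ContDiffAt ℝ m (fun t => ∫ x, f t x ∂μ) 0 := by
  induction m with
  | zero =>
    intro f hf
    refine contDiffAt_zero.2 ?_
    have h := (hf.hasDerivAt_integral μ)
    exact ⟨_, h, fun t ht => ht.continuousAt.continuousWithinAt⟩
  | succ m ih =>
    intro f hf
    refine (contDiffAt_succ_iff_hasFDerivAt (n := m)).2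
      ⟨fun t => ContinuousLinearMap.toSpanSingleton ℝ (∫ x, QuotientCurvature.timeDeriv f t x ∂μ),
        ⟨_, hf.hasDerivAt_integral μ, fun t ht => ht.hasFDerivAt⟩, ?_⟩
    exact (ContinuousLinearMap.toSpanSingletonCLE (𝕜 := ℝ) (E := ℝ)).contDiff.contDiffAt.comp
      (0 : ℝ) (ih hf.timeDeriv)

theorem IsSmoothFamily.deriv_integral (hf : IsSmoothFamily n f) (μ : Measure M)
    [IsFiniteMeasure μ] : deriv (fun t => ∫ x, f t x ∂μ) 0 =
      ∫ x, QuotientCurvature.timeDeriv f 0 x ∂μ :=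
  (hf.hasDerivAt_integral μ).self_of_nhds.deriv

theorem IsSmoothFamily.deriv_deriv_integral (hf : IsSmoothFamily n f) (μ : Measure M)
    [IsFiniteMeasure μ] : deriv (deriv fun t => ∫ x, f t x ∂μ) 0 =
      ∫ x, QuotientCurvature.timeDeriv (QuotientCurvature.timeDeriv f) 0 x ∂μ := by
  rw [← hf.timeDeriv.deriv_integral μ]
  exact Filter.EventuallyEq.deriv_eq ((hf.hasDerivAt_integral μ).mono fun t ht => ht.deriv)

end Families

/-! ### Lines of metrics -/

section Lines

variable {n : ℕ} {M : Type*} [TopologicalSpace M] [ChartedSpace (Rn n) M]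
  [IsManifold (𝓡 n) ∞ M] {g h : TensorField n M}

theorem IsSmoothSymm.isTensor {T : TensorField n M} (hT : IsSmoothSymm T) : IsTensor (comp T) :=
  ⟨fun c _ hy => smooth_comp hT c hy, fun c d => isPullback_comp T c d⟩

theorem jointMSm_line (hg : IsSmoothSymm g) (hh : IsSmoothSymm h) (c : M) (t : ℝ) {y : Rn n}
    (hy : y ∈ (chartAt (Rn n) c).target) : JointMSm (fun t => comp (g + t • h) c) (t, y) :=
  fun i j => (((smooth_comp hg c hy i j).comp (t, y) contDiffAt_snd)).add
    (contDiffAt_fst.mul ((smooth_comp hh c hy i j).comp (t, y) contDiffAt_snd))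

/-- Chart domains are not compact, so positivity cannot be tested uniformly in a given chart. It is
obtained near each point in the chart centred there, made uniform by compactness, and then carried
to every chart by congruence with the Jacobian. -/
theorem eventually_isMetric [CompactSpace M] (hg : IsSmoothSymm g) (hm : IsMetric g)
    (hh : IsSmoothSymm h) : ∀ᶠ t in nhds (0 : ℝ), IsMetric (g + t • h) := by
  have h1 : ∀ᶠ t in nhds (0 : ℝ), ∀ x : M, ∃ c : M, x ∈ (chartAt (Rn n) c).source ∧
      (comp (g + t • h) c (chartAt (Rn n) c x)).PosDef := by
    refine eventually_forall_of_chart fun x => ?_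
    have hx := mem_chart_target (Rn n) x
    have h2 : ∀ᶠ r in nhds ((0 : ℝ), chartAt (Rn n) x x),
        (comp (g + r.1 • h) x r.2).PosDef := by
      refine eventually_posDef (A := fun r : ℝ × Rn n => comp (g + r.1 • h) x r.2)
        (fun i j => (jointMSm_line hg hh x 0 hx i j).continuousAt) (fun r => ?_) ?_
      · rw [comp_line, Matrix.transpose_add, Matrix.transpose_smul, comp_transpose hg,
          comp_transpose hh]
      · have h0 : comp (g + (0 : ℝ) • h) x (chartAt (Rn n) x x) =
            comp g x (chartAt (Rn n) x x) := by rw [comp_line, zero_smul, add_zero]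
        exact h0.symm ▸ (hm x).posDef _ hx
    filter_upwards [(tendsto_chart 0 x).eventually h2, eventually_mem_source (n := n) 0 x]
      with q hq hqx
    exact ⟨x, hqx, hq⟩
  filter_upwards [h1] with t ht d
  refine ⟨fun z hz => (smooth_comp hg d hz).add (MSm.smul contDiffAt_const (smooth_comp hh d hz)),
    fun z hz => ?_⟩
  obtain ⟨c, hc, hp⟩ := ht ((chartAt (Rn n) d).symm z)
  have hzo : z ∈ overlap M c d := mem_overlap.2 ⟨hz, hc⟩
  rw [isPullback_comp (g + t • h) c d z hzo]
  have := hp.conjTranspose_mul_mul_same (B := jac (transition M c d) z)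
    (Matrix.mulVec_injective_of_isUnit ((Matrix.isUnit_iff_isUnit_det _).2
      ((isCoordChange_transition c d).isUnit hzo)))
  rwa [Matrix.conjTranspose_eq_transpose_of_trivial] at this

/-- The density of the measure of `g'` with respect to that of `g`. -/
def densityRatio (g g' : TensorField n M) (c : M) (y : Rn n) : ℝ :=
  density (comp g' c) y / density (comp g c) y

/-- Both densities acquire the same Jacobian factor, so their quotient is a genuine function on the
manifold. -/
theorem isScalar_densityRatio (g g' : TensorField n M) : IsScalar (densityRatio g g') := by
  intro c d y hy
  have hJ := abs_ne_zero.2 ((isCoordChange_transition c d).det_ne y hy)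
  rw [densityRatio, densityRatio, density_transition g hy, density_transition g' hy,
    mul_div_mul_left _ _ hJ]

theorem isSmoothFun_densityRatio {g' : TensorField n M} (hg : IsMetric g) (hg' : IsMetric g') :
    IsSmoothFun (n := n) (atCenter (densityRatio g g')) :=
  (isScalar_densityRatio g g').isSmoothFun fun c _ hy =>
    ((hg' c).smooth_density hy).div ((hg c).smooth_density hy) ((hg c).density_pos hy).ne'

variable [CompactSpace M] [T2Space M] [MeasurableSpace M] [BorelSpace M]

/-- Moves the time-dependent volume to a fixed measure, so that differentiation under the integral
sign applies. -/
theorem integral_volumeMeasure_eq {g' : TensorField n M} (hg : IsMetric g) (hg' : IsMetric g')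
    {f : M → ℝ} (hf : Continuous f) : ∫ x, f x ∂(volumeMeasure g') =
      ∫ x, f x * atCenter (densityRatio g g') x ∂(volumeMeasure g) := by
  rw [integral_volumeMeasure hg' hf,
    integral_volumeMeasure hg (f := fun x => f x * atCenter (densityRatio g g') x)
      (hf.mul (isSmoothFun_densityRatio hg hg').continuous)]
  refine Finset.sum_congr rfl fun c _ =>
    setIntegral_congr_fun (chartAt (Rn n) c).open_target.measurableSet fun y hy => ?_
  have h1 : read (fun x => f x * atCenter (densityRatio g g') x) c y =
      read f c y * densityRatio g g' c y := by
    rw [← (isScalar_densityRatio g g').atCenter_symm hy]; rfl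
  rw [h1, densityRatio, mul_assoc (read f c y), div_mul_cancel₀ _ ((hg c).density_pos hy).ne']

end Lines

namespace Coord

variable {n : ℕ}

/-! ### Symmetry of the Ricci tensor -/

section Symmetry

variable {G T : Rn n → Matrix (Fin n) (Fin n) ℝ} {V : Set (Rn n)} {y : Rn n}

theorem pd_log_density (hV : IsOpen V) (hG : IsMetricOn G V) (hy : y ∈ V) (k : Fin n) :
    pd k (fun z => Real.log (density G z)) y = ∑ i, christoffel G i k i y := by
  have hd := diff_of_smooth (hG.smooth_density hy)
  have h0 := (hG.density_pos hy).ne'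
  have h1 := pd_density hV hG hy k
  rw [pd] at h1
  rw [pd, (hd.hasFDerivAt.log h0).fderiv, smul_apply, h1, smul_eq_mul, inv_mul_cancel_left₀ h0]
  rfl

/-- The only term of the Ricci tensor that is not visibly symmetric is $\partial_j\Gamma^i_{ik}$,
and it equals $\partial_j\partial_k\log\sqrt{\det G}$. -/
theorem ricci_transpose (hV : IsOpen V) (hG : IsMetricOn G V) (hy : y ∈ V) :
    (ricci G y).transpose = ricci G y := by
  have hL : ContDiffAt ℝ ∞ (fun z => Real.log (density G z)) y :=
    (hG.smooth_density hy).log (hG.density_pos hy).ne'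
  have hc : ∀ m i j, ContDiffAt ℝ ∞ (christoffel G m i j) y :=
    contDiffAt_christoffel (hG.smooth y hy) (hG.det_ne hy)
  have hs : ∀ m i j, christoffel G m i j =ᶠ[nhds y] christoffel G m j i := fun m i j =>
    Filter.eventuallyEq_of_mem (hV.mem_nhds hy) fun z hz => christoffel_symm hG hV hz m i j
  have h2 : ∀ j k, ∑ i, pd j (christoffel G i i k) y =
      pd j (pd k fun z => Real.log (density G z)) y := by
    intro j k
    rw [← pd_sum fun i _ => hc i i k]
    refine pd_congr (Filter.eventuallyEq_of_mem (hV.mem_nhds hy) fun z hz => ?_) j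
    rw [pd_log_density hV hG hz]
    exact Finset.sum_congr rfl fun i _ => christoffel_symm hG hV hz i i k
  have h1 : ∀ j k, ricci G y j k = ∑ i, pd i (christoffel G i j k) y
      - pd j (pd k fun z => Real.log (density G z)) y
      + (∑ i, ∑ a, christoffel G i i a y * christoffel G a j k y
        - ∑ i, ∑ a, christoffel G i j a y * christoffel G a i k y) := by
    intro j k
    rw [ricci_eq hG hy, ← h2, ← Finset.sum_sub_distrib, ← Finset.sum_sub_distrib,
      ← Finset.sum_add_distrib]
    refine Finset.sum_congr rfl fun i _ => ?_
    simp only [curvF, Matrix.add_apply, Matrix.sub_apply, mpd_apply, chr, Matrix.of_apply,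
      Matrix.mul_apply]
  ext j k
  rw [Matrix.transpose_apply, h1, h1, pd_comm hL k j]
  congr 1
  · congr 1
    exact Finset.sum_congr rfl fun i _ => pd_congr (hs i k j) i
  · congr 1
    · exact Finset.sum_congr rfl fun i _ => Finset.sum_congr rfl fun a _ => by
        rw [(hs a k j).eq_of_nhds]
    · rw [Finset.sum_comm]
      exact Finset.sum_congr rfl fun i _ => Finset.sum_congr rfl fun a _ => by
        rw [(hs a k i).eq_of_nhds, (hs i a j).eq_of_nhds, mul_comm]

theorem hess_transpose (hV : IsOpen V) (hG : IsMetricOn G V) {u : Rn n → ℝ}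
    (hu : ContDiffAt ℝ ∞ u y) (hy : y ∈ V) : (hess G u y).transpose = hess G u y := by
  ext a b
  simp only [hess, formDeriv, Matrix.transpose_apply, Matrix.of_apply]
  rw [pd_comm hu b a, Finset.sum_congr rfl fun m _ => by rw [christoffel_symm hG hV hy m b a]]

theorem IsMetricOn.smooth_einsteinOp (hG : IsMetricOn G V) (hV : IsOpen V)
    (hT : ∀ w ∈ V, MSm T w) (hy : y ∈ V) : MSm (einsteinOp G T) y := by
  have hC : ∀ b a, MSm (covD2 G T b a) y := fun b a =>
    (hG.smooth_covD (fun w hw => hG.smooth_covD hT hw a) hy b).sub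
      (MSm.sum fun m _ => MSm.smul (contDiffAt_christoffel (hG.smooth y hy) (hG.det_ne hy) m b a)
        (hG.smooth_covD hT hy m))
  have hR : MSm (fun z => (2 : ℝ) • Matrix.of fun j k =>
      ∑ i, ((G z)⁻¹ * T z * curvF G i j z) i k) y :=
    MSm.smul contDiffAt_const fun j k => by
      simp only [Matrix.of_apply]
      exact ContDiffAt.sum fun i _ =>
        (((hG.smooth_inv hy).mul (hT y hy)).mul ((hG.smooth y hy).curvF (hG.det_ne hy) i j)) i k
  refine ((MSm.sum (s := Finset.univ) fun b _ => MSm.sum (s := Finset.univ) fun a _ =>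
    MSm.smul (hG.smooth_inv hy b a) (hC b a)).add
    hR).congr (Filter.eventuallyEq_of_mem (hV.mem_nhds hy) fun z hz => ?_)
  exact einsteinOp_eq hG hz T

theorem IsMetricOn.smooth_tensorInner {S : Rn n → Matrix (Fin n) (Fin n) ℝ}
    (hG : IsMetricOn G V) (hT : MSm T y) (hS : MSm S y) (hy : y ∈ V) :
    ContDiffAt ℝ ∞ (tensorInner G T S) y := by
  have hi := hG.smooth_inv hy
  exact ContDiffAt.sum fun i _ => ContDiffAt.sum fun j _ => ContDiffAt.sum fun a _ =>
    ContDiffAt.sum fun b _ => (((hi i a).mul (hi j b)).mul (hT i j)).mul (hS a b)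

end Symmetry

/-! ### Variations along a line of metrics -/

section Line

/-- The line of matrix-valued functions `G + t T`. -/
abbrev line (G T : Rn n → Matrix (Fin n) (Fin n) ℝ) (t : ℝ) (z : Rn n) :
    Matrix (Fin n) (Fin n) ℝ := G z + t • T z

/-- The Ricci endomorphism. -/
def ricciEnd (G : Rn n → Matrix (Fin n) (Fin n) ℝ) (y : Rn n) : Matrix (Fin n) (Fin n) ℝ :=
  (G y)⁻¹ * ricci G y

variable {G T T₀ : Rn n → Matrix (Fin n) (Fin n) ℝ} {v : Rn n → ℝ} {c : ℝ} {V : Set (Rn n)}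
  {y : Rn n}

theorem line_zero : line G T 0 = G := by
  funext z
  rw [line, zero_smul, add_zero]

theorem line_add (s t : ℝ) : line (line G T t) T s = line G T (t + s) := by
  funext z
  simp only [line, add_smul, add_assoc]

theorem scalar_eq_trace_ricciEnd (hG : IsMetricOn G V) (hy : y ∈ V) :
    scalar G y = (ricciEnd G y).trace := trace_eq hG hy _

theorem hasMDerivAt_line (t : ℝ) : HasMDerivAt (fun s => line G T s y) (T y) t :=
  HasMDerivAt.line (G y) (T y) t

theorem hasDerivAt_density_line {t : ℝ} (h : IsMetricOn (line G T t) V) (hy : y ∈ V) :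
    HasDerivAt (fun s => density (line G T s) y)
      (density (line G T t) y * (((line G T t y)⁻¹ * T y).trace / 2)) t := by
  have h1 := (hasMDerivAt_line (G := G) (T := T) (y := y) t).det.sqrt (h.det_ne hy)
  refine h1.congr_deriv ?_
  rw [adjugate_eq_smul_inv (h.det_ne hy), Matrix.smul_mul, Matrix.trace_smul, smul_eq_mul]
  have h2 := (h.density_pos hy).ne'
  have h3 : (line G T t y).det = density (line G T t) y * density (line G T t) y :=
    (Real.mul_self_sqrt (h.det_pos hy).le).symm
  rw [show √(line G T t y).det = density (line G T t) y from rfl, h3]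
  field_simp

theorem hasDerivAt_trace_inv_line {t : ℝ} (h : IsMetricOn (line G T t) V) (hy : y ∈ V) :
    HasDerivAt (fun s => ((line G T s y)⁻¹ * T y).trace)
      (-((line G T t y)⁻¹ * T y * ((line G T t y)⁻¹ * T y)).trace) t := by
  have h1 := ((HasMDerivAt.inv (MSm.line (G y) (T y) t) (h.det_ne hy)
    (hasMDerivAt_line (G := G) (T := T) (y := y) t)).mul (HasMDerivAt.const (T y) t)).trace
  refine h1.congr_deriv ?_
  rw [Matrix.mul_zero, add_zero, Matrix.neg_mul, Matrix.trace_neg]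
  simp only [Matrix.mul_assoc]

/-- The variation formula holds at any metric, so the line is restarted at time $t$. Having it for
all small $t$, and not only at the Einstein metric, is what permits a second differentiation. -/
theorem hasDerivAt_scalar_line (hV : IsOpen V) {t : ℝ}
    (hpos : ∀ᶠ s in nhds t, IsMetricOn (line G T s) V) (hT : ∀ w ∈ V, MSm T w)
    (hTs : ∀ w ∈ V, (T w).transpose = T w) (hy : y ∈ V) :
    HasDerivAt (fun s => scalar (line G T s) y)
      (trace (line G T t) (formDeriv (line G T t) fun i z =>
        divergence (line G T t) T i z - pd i (trace (line G T t) T) z) y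
        - tensorInner (line G T t) (ricci (line G T t)) T y) t := by
  have hc : Filter.Tendsto (fun s : ℝ => t + s) (nhds 0) (nhds t) := by
    have : ContinuousAt (fun s : ℝ => t + s) 0 := by fun_prop
    simpa [ContinuousAt] using this
  have h1 := hasDerivAt_scalar (G := line G T t) hV hpos.self_of_nhds hT hTs
    ((hc.eventually hpos).mono fun s hs => by
      rw [← line_add] at hs
      exact hs) hy
  have h2 : HasDerivAt (fun s => scalar (line G T (t + s)) y) _ 0 :=
    h1.congr_of_eventuallyEq (Filter.Eventually.of_forall fun s => by
      beta_reduce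
      rw [← line_add])
  have h3 := HasDerivAt.comp_sub_const (x := t) (a := t) (by rwa [sub_self])
    (f := fun s => scalar (line G T (t + s)) y)
  simpa using h3

/-- The infinitesimal data of a line of metrics through an Einstein metric `G`, in the direction
`T₀ + v G` with `T₀` transverse and traceless. -/
structure IsEinsteinLine (G T T₀ : Rn n → Matrix (Fin n) (Fin n) ℝ) (v : Rn n → ℝ) (c : ℝ)
    (V : Set (Rn n)) : Prop where
  isOpen : IsOpen V
  metric : IsMetricOn G V
  ricci_eq : ∀ w ∈ V, ricci G w = c • G w
  smooth₀ : ∀ w ∈ V, MSm T₀ w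
  symm₀ : ∀ w ∈ V, (T₀ w).transpose = T₀ w
  trace₀ : ∀ w ∈ V, trace G T₀ w = 0
  div₀ : ∀ w ∈ V, ∀ i, divergence G T₀ i w = 0
  smooth_v : ∀ w ∈ V, ContDiffAt ℝ ∞ v w
  eq : ∀ w ∈ V, T w = T₀ w + v w • G w
  pos₀ : ∀ᶠ t in nhds 0, IsMetricOn (line G T₀ t) V
  pos : ∀ᶠ t in nhds 0, IsMetricOn (line G T t) V

/-- Dropping the conformal part isolates the contribution of the transverse traceless tensor in
later comparisons. -/
theorem IsEinsteinLine.traceless (h : IsEinsteinLine G T T₀ v c V) :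
    IsEinsteinLine G T₀ T₀ (fun _ => 0) c V :=
  { h with
    smooth_v := fun _ _ => contDiffAt_const
    eq := fun _ _ => by rw [zero_smul, add_zero]
    pos := h.pos₀ }

/-- The derivative of the Ricci endomorphism. -/
def ricciEndDeriv (G T₀ : Rn n → Matrix (Fin n) (Fin n) ℝ) (v : Rn n → ℝ) (c : ℝ) (y : Rn n) :
    Matrix (Fin n) (Fin n) ℝ :=
  -(1 / 2 : ℝ) • ((G y)⁻¹ * einsteinOp G T₀ y) - (((n : ℝ) - 2) / 2) • ((G y)⁻¹ * hess G v y)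
    - (laplacian G v y / 2 + c * v y) • (1 : Matrix (Fin n) (Fin n) ℝ)

theorem IsEinsteinLine.ricciEnd_eq (h : IsEinsteinLine G T T₀ v c V) (hy : y ∈ V) :
    ricciEnd G y = c • (1 : Matrix (Fin n) (Fin n) ℝ) := by
  rw [ricciEnd, h.ricci_eq y hy, Matrix.mul_smul, Matrix.nonsing_inv_mul _ (h.metric.isUnit hy)]

/-- The term $c\,T_0$ in the variation of the Ricci tensor is cancelled by the variation of the
inverse metric acting on $c\,G$. -/
theorem IsEinsteinLine.hasMDerivAt_ricciEnd (h : IsEinsteinLine G T T₀ v c V) (hy : y ∈ V) :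
    HasMDerivAt (fun t => ricciEnd (line G T t) y) (ricciEndDeriv G T₀ v c y) 0 := by
  have hu := h.metric.isUnit hy
  have hl : line G T 0 y = G y := by rw [line_zero]
  have h1 := hasMDerivAt_ricci h.isOpen h.metric h.ricci_eq h.smooth₀ h.symm₀ h.trace₀ h.div₀
    h.smooth_v h.eq h.pos hy
  have h0 : (G y + (0 : ℝ) • T y).det ≠ 0 := by
    rw [zero_smul, add_zero]
    exact h.metric.det_ne hy
  have h2 := HasMDerivAt.inv (MSm.line (G y) (T y) 0) h0
    (hasMDerivAt_line (G := G) (T := T) (y := y) 0)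
  have h3 := h2.mul h1
  have h4 : ricci (fun z => G z + (0 : ℝ) • T z) y = c • G y := by
    rw [show (fun z => G z + (0 : ℝ) • T z) = G from line_zero, h.ricci_eq y hy]
  rw [h4, zero_smul, add_zero] at h3
  have h5 : (-((G y)⁻¹ * T y * (G y)⁻¹)) * (c • G y) + (G y)⁻¹ *
      (-(1 / 2 : ℝ) • einsteinOp G T₀ y + c • T₀ y - (((n : ℝ) - 2) / 2) • hess G v y
        - (laplacian G v y / 2) • G y) = ricciEndDeriv G T₀ v c y := by
    rw [Matrix.neg_mul, Matrix.mul_smul, Matrix.mul_assoc, Matrix.nonsing_inv_mul _ hu,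
      Matrix.mul_one, h.eq y hy, ricciEndDeriv]
    simp only [Matrix.mul_add, Matrix.mul_sub, Matrix.mul_smul, Matrix.nonsing_inv_mul _ hu]
    module
  rw [h5] at h3
  exact h3

theorem IsEinsteinLine.hasDerivAt_scalar_trace (h : IsEinsteinLine G T T₀ v c V) (hy : y ∈ V) :
    HasDerivAt (fun t => scalar (line G T t) y) (ricciEndDeriv G T₀ v c y).trace 0 :=
  (h.hasMDerivAt_ricciEnd hy).trace.congr_of_eventuallyEq
    (h.pos.mono fun _ ht => scalar_eq_trace_ricciEnd ht hy)

/-- Two expressions for the derivative of the scalar curvature in the direction $T_0$ are compared.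
The divergence formula gives zero; the trace of the Ricci endomorphism gives
$-\frac12\mathrm{tr}\,\Delta_ET_0$. -/
theorem IsEinsteinLine.trace_einsteinOp (h : IsEinsteinLine G T T₀ v c V) (hy : y ∈ V) :
    ((G y)⁻¹ * einsteinOp G T₀ y).trace = 0 := by
  have h0 := h.traceless
  have hpd : ∀ (θ : Rn n → ℝ), (∀ w ∈ V, θ w = 0) → ∀ i, ∀ w ∈ V, pd i θ w = 0 := by
    intro θ hθ i w hw
    rw [pd_congr (g := fun _ => (0 : ℝ)) (Filter.eventuallyEq_of_mem (h.isOpen.mem_nhds hw) hθ),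
      pd_const]
  have hlap : laplacian G (fun _ => (0 : ℝ)) y = 0 := by
    simp only [laplacian, hpd _ (fun _ _ => rfl) _ y hy, mul_zero, Finset.sum_const_zero, sub_zero]
    refine Finset.sum_eq_zero fun i _ => Finset.sum_eq_zero fun j _ => ?_
    rw [hpd _ (fun w hw => hpd _ (fun _ _ => rfl) _ w hw) _ y hy, mul_zero]
  have hhess : hess G (fun _ => (0 : ℝ)) y = 0 := by
    ext i j
    simp only [hess, formDeriv, Matrix.of_apply, hpd _ (fun _ _ => rfl) _ y hy, mul_zero,
      Finset.sum_const_zero, sub_zero, Matrix.zero_apply]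
    exact hpd _ (fun w hw => hpd _ (fun _ _ => rfl) _ w hw) _ y hy
  have h1 := h0.hasDerivAt_scalar_trace hy
  have h2 := hasDerivAt_scalar h.isOpen h.metric h.smooth₀ h.symm₀ h.pos₀ hy
  have h3 := h1.unique h2
  have hz : ∀ i, ∀ w ∈ V, divergence G T₀ i w - pd i (trace G T₀) w = 0 := fun i w hw => by
    rw [h.div₀ w hw, hpd _ h.trace₀ i w hw, sub_zero]
  have hf : formDeriv G (fun i z => divergence G T₀ i z - pd i (trace G T₀) z) y = 0 := by
    ext i j
    simp only [formDeriv, Matrix.of_apply, hz _ y hy, mul_zero, Finset.sum_const_zero, sub_zero,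
      Matrix.zero_apply]
    exact hpd _ (hz j) i y hy
  have hr : tensorInner G (ricci G) T₀ y = 0 := by
    rw [tensorInner_eq h.metric hy, h.ricci_eq y hy, Matrix.transpose_smul, h.metric.transpose hy,
      Matrix.mul_smul, Matrix.nonsing_inv_mul _ (h.metric.isUnit hy), Matrix.smul_mul,
      Matrix.one_mul, Matrix.smul_mul, Matrix.trace_smul, ← trace_eq h.metric hy, h.trace₀ y hy,
      smul_zero]
  rw [trace_eq h.metric hy, hf, hr, Matrix.mul_zero, Matrix.trace_zero, sub_zero, ricciEndDeriv,
    hlap, hhess] at h3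
  simpa using h3

theorem IsEinsteinLine.trace_ricciEndDeriv (h : IsEinsteinLine G T T₀ v c V) (hy : y ∈ V) :
    (ricciEndDeriv G T₀ v c y).trace = -(((n : ℝ) - 1) * laplacian G v y) - n * c * v y := by
  rw [ricciEndDeriv, Matrix.trace_sub, Matrix.trace_sub, Matrix.trace_smul, Matrix.trace_smul,
    Matrix.trace_smul, h.trace_einsteinOp hy, ← trace_eq h.metric hy, ← laplacian_eq]
  simp
  ring

/-- The Ricci tensors along the line are symmetric, hence so is their derivative, and all its terms
other than $\Delta_ET_0$ are symmetric. -/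
theorem IsEinsteinLine.einsteinOp_transpose (h : IsEinsteinLine G T T₀ v c V) (hy : y ∈ V) :
    (einsteinOp G T₀ y).transpose = einsteinOp G T₀ y := by
  have h1 := hasMDerivAt_ricci h.isOpen h.metric h.ricci_eq h.smooth₀ h.symm₀ h.trace₀ h.div₀
    h.smooth_v h.eq h.pos hy
  have h2 : HasMDerivAt (fun t : ℝ => ricci (fun z => G z + t • T z) y)
      (-(1 / 2 : ℝ) • einsteinOp G T₀ y + c • T₀ y - (((n : ℝ) - 2) / 2) • hess G v y
        - (laplacian G v y / 2) • G y).transpose 0 :=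
    HasMDerivAt.congr (A := fun t : ℝ => (ricci (fun z => G z + t • T z) y).transpose)
      (fun i j => h1 j i) (h.pos.mono fun t ht => (ricci_transpose h.isOpen ht hy).symm)
  have h3 := HasMDerivAt.unique h2 h1
  rw [Matrix.transpose_sub, Matrix.transpose_sub, Matrix.transpose_add, Matrix.transpose_smul,
    Matrix.transpose_smul, Matrix.transpose_smul, Matrix.transpose_smul, h.symm₀ y hy,
    h.metric.transpose hy, hess_transpose h.isOpen h.metric (h.smooth_v y hy) hy] at h3
  have h4 := add_right_cancel (sub_left_inj.1 (sub_left_inj.1 h3))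
  exact smul_right_injective _ (by norm_num : (-(1 / 2) : ℝ) ≠ 0) h4

end Line

end Coord

/-! ### Second order expansions -/

/-- `f` is `C²` at `0`, with value `a ≠ 0` and derivatives `a b` and `a d`. -/
structure HasRelJet (f : ℝ → ℝ) (a b d : ℝ) : Prop where
  ne : a ≠ 0
  contDiff : ContDiffAt ℝ 2 f 0
  eq : f 0 = a
  deriv_eq : deriv f 0 = a * b
  deriv_deriv_eq : deriv (deriv f) 0 = a * d

section Jets

variable {f g f' g' : ℝ → ℝ} {a b d a' b' d' : ℝ}

theorem eventually_differentiableAt_of_contDiffAt_two (hf : ContDiffAt ℝ 2 f 0) :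
    ∀ᶠ t in nhds 0, DifferentiableAt ℝ f t :=
  (hf.eventually (by simp)).mono fun _ ht => ht.differentiableAt (by simp)

theorem hasDerivAt_deriv_of_contDiffAt_two (hf : ContDiffAt ℝ 2 f 0) :
    HasDerivAt (deriv f) (deriv (deriv f) 0) 0 := by
  have h : ContDiffAt ℝ 1 (fun t => fderiv ℝ f t 1) 0 :=
    (hf.fderiv_right (m := 1) (by norm_num)).clm_apply contDiffAt_const
  exact (h.differentiableAt (by simp)).hasDerivAt

theorem HasRelJet.of_hasDerivAt (ha : a ≠ 0) (hc : ContDiffAt ℝ 2 f 0) (h0 : f 0 = a)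
    (h1 : ∀ᶠ t in nhds 0, HasDerivAt f (f' t) t) (hb : f' 0 = a * b)
    (h2 : HasDerivAt f' (a * d) 0) : HasRelJet f a b d where
  ne := ha
  contDiff := hc
  eq := h0
  deriv_eq := by rw [h1.self_of_nhds.deriv, hb]
  deriv_deriv_eq := by
    rw [Filter.EventuallyEq.deriv_eq (h1.mono fun t ht => ht.deriv), h2.deriv]

theorem HasRelJet.hasDerivAt (h : HasRelJet f a b d) : HasDerivAt f (a * b) 0 := by
  rw [← h.deriv_eq]
  exact (eventually_differentiableAt_of_contDiffAt_two h.contDiff).self_of_nhds.hasDerivAt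

theorem HasRelJet.hasDerivAt_deriv (h : HasRelJet f a b d) : HasDerivAt (deriv f) (a * d) 0 := by
  rw [← h.deriv_deriv_eq]
  exact hasDerivAt_deriv_of_contDiffAt_two h.contDiff

theorem HasRelJet.eventually_hasDerivAt (h : HasRelJet f a b d) :
    ∀ᶠ t in nhds 0, HasDerivAt f (deriv f t) t :=
  (eventually_differentiableAt_of_contDiffAt_two h.contDiff).mono fun _ ht => ht.hasDerivAt

/-- Leibniz' rule; the values factor out of the relative coefficients. -/
theorem HasRelJet.mul (hf : HasRelJet f a b d) (hg : HasRelJet g a' b' d') :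
    HasRelJet (fun t => f t * g t) (a * a') (b + b') (d + 2 * b * b' + d') := by
  refine HasRelJet.of_hasDerivAt (f' := fun t => deriv f t * g t + f t * deriv g t)
    (mul_ne_zero hf.ne hg.ne) (hf.contDiff.mul hg.contDiff) (by rw [hf.eq, hg.eq]) ?_ ?_ ?_
  · filter_upwards [hf.eventually_hasDerivAt, hg.eventually_hasDerivAt] with t h1 h2
    exact h1.mul h2
  · rw [hf.eq, hg.eq, hf.deriv_eq, hg.deriv_eq]
    ring
  · refine ((hf.hasDerivAt_deriv.mul hg.hasDerivAt).add
      (hf.hasDerivAt.mul hg.hasDerivAt_deriv)).congr_deriv ?_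
    rw [hf.eq, hg.eq, hf.deriv_eq, hg.deriv_eq]
    ring

theorem HasRelJet.zpow (hf : HasRelJet f a b d) (m : ℤ) :
    HasRelJet (fun t => f t ^ m) (a ^ m) (m * b) (m * (m - 1) * b ^ 2 + m * d) := by
  have h0 : ∀ᶠ t in nhds 0, f t ≠ 0 :=
    hf.contDiff.continuousAt.eventually_ne (by rw [hf.eq]; exact hf.ne)
  have hd : ∀ (t : ℝ) (j : ℤ) (D : ℝ), f t ≠ 0 → HasDerivAt f D t →
      HasDerivAt (fun t => f t ^ j) (j * f t ^ (j - 1) * D) t := fun t j D hne h =>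
    (hasDerivAt_zpow j (f t) (Or.inl hne)).comp t h
  have hne := hf.ne
  refine HasRelJet.of_hasDerivAt (f' := fun t => m * f t ^ (m - 1) * deriv f t)
    (zpow_ne_zero m hne) ?_ (by rw [hf.eq]) ?_ ?_ ?_
  · have h1 : ContDiffAt ℝ 2 (fun x : ℝ => x ^ m) (f 0) := by
      rw [hf.eq]
      -- Both signs of the exponent occur; smoothness of a negative power uses that the value is
      -- nonzero, not that it is positive.
      rcases m with j | j
      · simpa using contDiffAt_id.pow j
      · simp only [zpow_negSucc]
        exact ContDiffAt.inv (contDiffAt_id.pow (j + 1)) (pow_ne_zero _ hne)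
    exact h1.comp 0 hf.contDiff
  · filter_upwards [h0, hf.eventually_hasDerivAt] with t h1 h2
    exact hd t m _ h1 h2
  · rw [hf.eq, hf.deriv_eq, zpow_sub_one₀ hne]
    field_simp
  · refine ((((hd 0 (m - 1) _ h0.self_of_nhds hf.hasDerivAt).const_mul (m : ℝ)).mul
      hf.hasDerivAt_deriv)).congr_deriv ?_
    rw [hf.eq, hf.deriv_eq, zpow_sub_one₀ hne, zpow_sub_one₀ hne]
    push_cast
    field_simp

theorem HasRelJet.inv (hf : HasRelJet f a b d) :
    HasRelJet (fun t => (f t)⁻¹) a⁻¹ (-b) (2 * b ^ 2 - d) := by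
  have h := hf.zpow (-1)
  simp only [zpow_neg, zpow_one] at h
  have h1 : ((-1 : ℤ) : ℝ) * b = -b := by push_cast; ring
  have h2 : ((-1 : ℤ) : ℝ) * (((-1 : ℤ) : ℝ) - 1) * b ^ 2 + ((-1 : ℤ) : ℝ) * d =
      2 * b ^ 2 - d := by push_cast; ring
  rwa [h1, h2] at h

theorem HasRelJet.div (hf : HasRelJet f a b d) (hg : HasRelJet g a' b' d') :
    HasRelJet (fun t => f t / g t) (a / a') (b - b') (d - d' - 2 * b * b' + 2 * b' ^ 2) := by
  have h := hf.mul hg.inv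
  have h2 : d + 2 * b * -b' + (2 * b' ^ 2 - d') = d - d' - 2 * b * b' + 2 * b' ^ 2 := by ring
  simp only [← div_eq_mul_inv, ← sub_eq_add_neg] at h
  rwa [h2] at h

end Jets

/-! ### Pointwise expansions along a line through an Einstein metric -/

namespace Coord

variable {n : ℕ} {G T T₀ : Rn n → Matrix (Fin n) (Fin n) ℝ} {v f : Rn n → ℝ} {c : ℝ}
  {V : Set (Rn n)} {y : Rn n}

section Pointwise

theorem IsEinsteinLine.smooth_T (h : IsEinsteinLine G T T₀ v c V) (hy : y ∈ V) : MSm T y :=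
  ((h.smooth₀ y hy).add (MSm.smul (h.smooth_v y hy) (h.metric.smooth y hy))).congr
    (Filter.eventuallyEq_of_mem (h.isOpen.mem_nhds hy) h.eq)

theorem IsEinsteinLine.inv_mul_T (h : IsEinsteinLine G T T₀ v c V) (hy : y ∈ V) :
    (G y)⁻¹ * T y = (G y)⁻¹ * T₀ y + v y • (1 : Matrix (Fin n) (Fin n) ℝ) := by
  rw [h.eq y hy, Matrix.mul_add, Matrix.mul_smul, Matrix.nonsing_inv_mul _ (h.metric.isUnit hy)]

theorem IsEinsteinLine.trace_inv_mul_T₀ (h : IsEinsteinLine G T T₀ v c V) (hy : y ∈ V) :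
    ((G y)⁻¹ * T₀ y).trace = 0 := by
  rw [← trace_eq h.metric hy, h.trace₀ y hy]

theorem tensorInner_eq_trace_mul (hG : IsMetricOn G V) (hy : y ∈ V)
    {A B : Rn n → Matrix (Fin n) (Fin n) ℝ} (hA : (A y).transpose = A y) :
    tensorInner G A B y = (((G y)⁻¹ * A y) * ((G y)⁻¹ * B y)).trace := by
  rw [tensorInner_eq hG hy, hA, Matrix.mul_assoc ((G y)⁻¹ * A y)]

/-- `|T|²` in terms of the trace-free part. -/
theorem IsEinsteinLine.trace_T_mul_T (h : IsEinsteinLine G T T₀ v c V) (hy : y ∈ V) :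
    (((G y)⁻¹ * T y) * ((G y)⁻¹ * T y)).trace = tensorInner G T₀ T₀ y + n * v y ^ 2 := by
  rw [h.inv_mul_T hy, tensorInner_eq_trace_mul h.metric hy (h.symm₀ y hy)]
  simp only [Matrix.mul_add, Matrix.add_mul, Matrix.mul_smul, Matrix.smul_mul, Matrix.mul_one,
    Matrix.one_mul, Matrix.trace_add, Matrix.trace_smul, Matrix.trace_one, Fintype.card_fin,
    smul_eq_mul, h.trace_inv_mul_T₀ hy]
  ring

theorem IsEinsteinLine.trace_T (h : IsEinsteinLine G T T₀ v c V) (hy : y ∈ V) :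
    ((G y)⁻¹ * T y).trace = n * v y := by
  rw [h.inv_mul_T hy, Matrix.trace_add, h.trace_inv_mul_T₀ hy, Matrix.trace_smul,
    Matrix.trace_one, Fintype.card_fin, smul_eq_mul]
  ring

theorem IsEinsteinLine.trace_ricciEndDeriv_mul_T (h : IsEinsteinLine G T T₀ v c V) (hy : y ∈ V) :
    (ricciEndDeriv G T₀ v c y * ((G y)⁻¹ * T y)).trace =
      -(1 / 2) * tensorInner G T₀ (einsteinOp G T₀) y
        - ((n : ℝ) - 2) / 2 * tensorInner G T₀ (hess G v) y
        + v y * (-(((n : ℝ) - 1) * laplacian G v y) - n * c * v y) := by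
  rw [h.inv_mul_T hy, Matrix.mul_add, Matrix.trace_add, Matrix.mul_smul, Matrix.mul_one,
    Matrix.trace_smul, h.trace_ricciEndDeriv hy,
    tensorInner_eq_trace_mul h.metric hy (h.symm₀ y hy),
    tensorInner_eq_trace_mul h.metric hy (h.symm₀ y hy), ricciEndDeriv,
    Matrix.trace_mul_comm ((G y)⁻¹ * T₀ y), Matrix.trace_mul_comm ((G y)⁻¹ * T₀ y)]
  simp only [Matrix.sub_mul, Matrix.smul_mul, Matrix.one_mul, Matrix.trace_sub, Matrix.trace_smul,
    smul_eq_mul, h.trace_inv_mul_T₀ hy]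
  ring

/-- The pairing of the linearized Einstein endomorphism with a Hessian. It becomes an integral
identity once the divergence-free property is linearized. -/
theorem IsEinsteinLine.trace_ricciEndDeriv_mul_hess (h : IsEinsteinLine G T T₀ v c V)
    (hy : y ∈ V) (f : Rn n → ℝ) : (ricciEndDeriv G T₀ v c y * ((G y)⁻¹ * hess G f y)).trace
        - (ricciEndDeriv G T₀ v c y).trace / 2 * laplacian G f y =
      -(1 / 2) * tensorInner G (einsteinOp G T₀) (hess G f) y
        + ((n : ℝ) - 2) / 2 * (laplacian G v y * laplacian G f y + c * (v y * laplacian G f y)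
          - tensorInner G (hess G v) (hess G f) y) := by
  rw [h.trace_ricciEndDeriv hy, tensorInner_eq_trace_mul h.metric hy (h.einsteinOp_transpose hy),
    tensorInner_eq_trace_mul h.metric hy (hess_transpose h.isOpen h.metric (h.smooth_v y hy) hy),
    ricciEndDeriv]
  simp only [Matrix.sub_mul, Matrix.smul_mul, Matrix.one_mul, Matrix.trace_sub, Matrix.trace_smul,
    smul_eq_mul]
  rw [← trace_eq h.metric hy, ← laplacian_eq]
  ring

/-- Orthogonal splitting into the trace and the trace-free part, the latter being
$-\frac12\Delta_ET_0-\frac{n-2}2(\mathrm{Hess}\,v-\frac{\Delta v}nG)$ with an index raised. -/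
theorem IsEinsteinLine.trace_ricciEndDeriv_sq (h : IsEinsteinLine G T T₀ v c V) (hn : n ≠ 0)
    (hy : y ∈ V) : (ricciEndDeriv G T₀ v c y * ricciEndDeriv G T₀ v c y).trace =
      (ricciEndDeriv G T₀ v c y).trace ^ 2 / n +
      (1 / 4 * tensorInner G (einsteinOp G T₀) (einsteinOp G T₀) y
        + ((n : ℝ) - 2) / 2 * tensorInner G (einsteinOp G T₀) (hess G v) y
        + ((n : ℝ) - 2) ^ 2 / 4 * (tensorInner G (hess G v) (hess G v) y
          - laplacian G v y ^ 2 / n)) := by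
  have hL : ((G y)⁻¹ * hess G v y).trace = laplacian G v y := by
    rw [← trace_eq h.metric hy, ← laplacian_eq]
  have hE := h.trace_einsteinOp hy
  have hn' : (n : ℝ) ≠ 0 := by exact_mod_cast hn
  rw [h.trace_ricciEndDeriv hy, tensorInner_eq_trace_mul h.metric hy (h.einsteinOp_transpose hy),
    tensorInner_eq_trace_mul h.metric hy (h.einsteinOp_transpose hy),
    tensorInner_eq_trace_mul h.metric hy (hess_transpose h.isOpen h.metric (h.smooth_v y hy) hy),
    ricciEndDeriv]
  simp only [Matrix.sub_mul, Matrix.mul_sub, Matrix.smul_mul, Matrix.mul_smul, Matrix.one_mul,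
    Matrix.mul_one, Matrix.trace_sub, Matrix.trace_smul, smul_eq_mul, hL, hE, Matrix.trace_one,
    Fintype.card_fin, Matrix.trace_mul_comm ((G y)⁻¹ * hess G v y) ((G y)⁻¹ * einsteinOp G T₀ y)]
  field_simp
  ring

theorem IsEinsteinLine.hasMDerivAt_inv_mul (h : IsEinsteinLine G T T₀ v c V) (hy : y ∈ V) :
    HasMDerivAt (fun t => (line G T t y)⁻¹ * T y) (-((G y)⁻¹ * T y * ((G y)⁻¹ * T y))) 0 := by
  have h0 : line G T 0 y = G y := by rw [line_zero]
  have hd : (line G T 0 y).det ≠ 0 := by rw [h0]; exact h.metric.det_ne hy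
  have h1 := (HasMDerivAt.inv (MSm.line (G y) (T y) 0) hd
    (hasMDerivAt_line (G := G) (T := T) (y := y) 0)).mul (HasMDerivAt.const (T y) 0)
  have h2 : -((G y + (0 : ℝ) • T y)⁻¹ * T y * (G y + (0 : ℝ) • T y)⁻¹) * T y
      + (line G T 0 y)⁻¹ * 0 = -((G y)⁻¹ * T y * ((G y)⁻¹ * T y)) := by
    rw [zero_smul, add_zero, Matrix.mul_zero, add_zero, Matrix.neg_mul]
    simp only [Matrix.mul_assoc]
  rw [← h2]
  exact h1

/-- The pairing is the trace of the Ricci endomorphism times $G_t^{-1}T$, and the former is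
$c\cdot1$ at $t=0$, so only $|T|^2$ is needed from the latter. -/
theorem IsEinsteinLine.hasDerivAt_tensorInner_ricci (h : IsEinsteinLine G T T₀ v c V)
    (hy : y ∈ V) : HasDerivAt (fun t => tensorInner (line G T t) (ricci (line G T t)) T y)
      (-(1 / 2) * tensorInner G T₀ (einsteinOp G T₀) y
        - ((n : ℝ) - 2) / 2 * tensorInner G T₀ (hess G v) y
        + v y * (-(((n : ℝ) - 1) * laplacian G v y) - n * c * v y)
        - c * (tensorInner G T₀ T₀ y + n * v y ^ 2)) 0 := by
  have h1 := ((h.hasMDerivAt_ricciEnd hy).mul (h.hasMDerivAt_inv_mul hy)).trace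
  refine (h1.congr_of_eventuallyEq (h.pos.mono fun t ht => ?_)).congr_deriv ?_
  · exact tensorInner_eq_trace_mul ht hy (ricci_transpose h.isOpen ht hy)
  · rw [line_zero, h.ricciEnd_eq hy, Matrix.trace_add, h.trace_ricciEndDeriv_mul_T hy,
      Matrix.smul_mul, Matrix.one_mul, Matrix.trace_smul, Matrix.trace_neg, h.trace_T_mul_T hy,
      smul_eq_mul]
    ring

theorem IsEinsteinLine.tensorInner_ricci (h : IsEinsteinLine G T T₀ v c V) (hy : y ∈ V) :
    tensorInner G (ricci G) T y = n * c * v y := by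
  rw [tensorInner_eq_trace_mul h.metric hy (ricci_transpose h.isOpen h.metric hy),
    ← ricciEnd, h.ricciEnd_eq hy, Matrix.smul_mul, Matrix.one_mul, Matrix.trace_smul,
    h.trace_T hy, smul_eq_mul]
  ring

theorem IsEinsteinLine.jointMSm_line (h : IsEinsteinLine G T T₀ v c V) (hy : y ∈ V) (t : ℝ) :
    JointMSm (line G T) (t, y) := fun i j =>
  ((h.metric.smooth y hy i j).comp (t, y) contDiffAt_snd).add
    (contDiffAt_fst.mul ((h.smooth_T hy i j).comp (t, y) contDiffAt_snd))

/-- Slicing a jointly smooth family. -/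
theorem JointMSm.slice {K : ℝ → Rn n → Matrix (Fin n) (Fin n) ℝ} {t : ℝ}
    (h : JointMSm K (t, y)) : MSm (fun s => K s y) t :=
  MSm.comp (f := fun s : ℝ => (s, y)) h (contDiffAt_id.prodMk contDiffAt_const)

theorem JointSmooth.slice {K : ℝ → Rn n → ℝ} {t : ℝ}
    (h : JointSmooth K (t, y)) : ContDiffAt ℝ ∞ (fun s => K s y) t :=
  ContDiffAt.comp (f := fun s : ℝ => (s, y)) t h (contDiffAt_id.prodMk contDiffAt_const)

/-- The constant $c-nc/2$ makes the endomorphism paired with the Hessian vanish at $t=0$. The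
variation of the Hessian, and of its trace, therefore contributes nothing; only its existence is
used. -/
theorem IsEinsteinLine.hasDerivAt_hess_pairing (h : IsEinsteinLine G T T₀ v c V) (hy : y ∈ V)
    (hf : ContDiffAt ℝ ∞ f y) :
    HasDerivAt (fun t => tensorInner (line G T t) (ricci (line G T t)) (hess (line G T t) f) y
        - (scalar (line G T t) y / 2 + (c - n * c / 2)) * laplacian (line G T t) f y)
      (-(1 / 2) * tensorInner G (einsteinOp G T₀) (hess G f) y
        + ((n : ℝ) - 2) / 2 * (laplacian G v y * laplacian G f y + c * (v y * laplacian G f y)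
          - tensorInner G (hess G v) (hess G f) y)) 0 := by
  have hd : (line G T 0 y).det ≠ 0 := by rw [line_zero]; exact h.metric.det_ne hy
  have hJ := h.jointMSm_line hy 0
  have hi : JointMSm (fun t z => (line G T t z)⁻¹) (0, y) := hJ.inv hd
  have hH : JointMSm (fun t z => (line G T t z)⁻¹ * hess (line G T t) f z) (0, y) :=
    hi.mul (jointMSm_hess hJ hd hf)
  have hb := (JointMSm.slice hH).hasMDerivAt
  have hs := ((h.hasDerivAt_scalar_trace hy).div_const 2).add_const (c - n * c / 2)
  have h1 := ((h.hasMDerivAt_ricciEnd hy).mul hb).trace.sub (hs.mul hb.trace)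
  refine (h1.congr_of_eventuallyEq (h.pos.mono fun t ht => ?_)).congr_deriv ?_
  · rw [tensorInner_eq_trace_mul ht hy (ricci_transpose h.isOpen ht hy), laplacian_eq,
      trace_eq ht hy]
    rfl
  · have hsc : scalar G y = n * c := by
      rw [scalar_eq_trace_ricciEnd h.metric hy, h.ricciEnd_eq hy, Matrix.trace_smul,
        Matrix.trace_one, Fintype.card_fin, smul_eq_mul, mul_comm]
    rw [← h.trace_ricciEndDeriv_mul_hess hy, line_zero, h.ricciEnd_eq hy, hsc, Matrix.trace_add,
      Matrix.smul_mul, Matrix.one_mul, Matrix.trace_smul, laplacian_eq, trace_eq h.metric hy,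
      smul_eq_mul]
    ring

/-- The Schouten endomorphism is the Ricci endomorphism minus a multiple of the identity, so both
have the same trace-free part, and its trace is proportional to the scalar curvature near $t=0$. The
umbilic expansion requires nothing else. -/
theorem IsEinsteinLine.hasRelJet_sigma (h : IsEinsteinLine G T T₀ v c V) (hn : 3 ≤ n) (hc : c ≠ 0)
    (hy : y ∈ V) {k : ℕ} (hk : k ≤ n) {c₀ R₁ R₂ tf : ℝ}
    (hc₀ : c₀ = ((n : ℝ) - 2) / (2 * (n - 1)) * c)
    (hR₁ : deriv (fun t => scalar (line G T t) y) 0 = R₁)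
    (hR₂ : deriv (deriv fun t => scalar (line G T t) y) 0 = R₂)
    (htf : (ricciEndDeriv G T₀ v c y * ricciEndDeriv G T₀ v c y).trace = R₁ ^ 2 / n + tf) :
    HasRelJet (fun t => sigma k (line G T t) y) (n.choose k * c₀ ^ k) (k / n * (R₁ / c))
      (k * (k - 1) / n ^ 2 * (R₁ / c) ^ 2 - k * (k - 1) / (n * (n - 1)) * (tf / c₀ ^ 2)
        + k / n * (R₂ / c)) := by
  have hn1 : (n : ℝ) - 1 ≠ 0 := by
    have : (3 : ℝ) ≤ n := by exact_mod_cast hn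
    linarith
  have hn2 : (n : ℝ) - 2 ≠ 0 := by
    have : (3 : ℝ) ≤ n := by exact_mod_cast hn
    linarith
  have hn0 : (n : ℝ) ≠ 0 := by
    have : (3 : ℝ) ≤ n := by exact_mod_cast hn
    linarith
  have hc0 : c₀ ≠ 0 := by rw [hc₀]; positivity
  have hd : ∀ᶠ t in nhds 0, (line G T t y).det ≠ 0 := h.pos.mono fun t ht => ht.det_ne hy
  set W : ℝ → Matrix (Fin n) (Fin n) ℝ := fun t => (line G T t y)⁻¹ * schouten (line G T t) y
    with hW
  have hs : ∀ᶠ t in nhds 0, MSm W t := hd.mono fun t ht =>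
    JointMSm.slice (K := fun t z => (line G T t z)⁻¹ * schouten (line G T t) z)
      (MSm.mul (MSm.inv (h.jointMSm_line hy t) ht) (jointMSm_schouten (h.jointMSm_line hy t) ht))
  have hWe : ∀ᶠ t in nhds 0, W t = ricciEnd (line G T t) y
      - (scalar (line G T t) y / (2 * ((n : ℝ) - 1))) • (1 : Matrix (Fin n) (Fin n) ℝ) :=
    h.pos.mono fun t ht => by
      rw [hW]
      beta_reduce
      rw [schouten, Matrix.mul_sub, Matrix.mul_smul, Matrix.nonsing_inv_mul _ (ht.isUnit hy)]
      rfl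
  set R : ℝ → ℝ := fun t => scalar (line G T t) y with hR
  have hRs : ∀ᶠ t in nhds 0, ContDiffAt ℝ ∞ R t := hd.mono fun t ht =>
    JointSmooth.slice (jointSmooth_scalar (h.jointMSm_line hy t) ht)
  -- The derivatives are introduced only as existing; $W'$ is identified at $t=0$, and of $W''$ only
  -- the trace is ever computed.
  set W' : ℝ → Matrix (Fin n) (Fin n) ℝ := fun t => Matrix.of fun i j =>
    deriv (fun s => W s i j) t with hW'
  have hWd : ∀ᶠ t in nhds 0, HasMDerivAt W (W' t) t := hs.mono fun t ht => ht.hasMDerivAt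
  have hW's : MSm W' 0 := fun i j => contDiffAt_deriv (hs.self_of_nhds i j)
  have hW'd := hW's.hasMDerivAt
  set W'' : Matrix (Fin n) (Fin n) ℝ := Matrix.of fun i j => deriv (fun s => W' s i j) 0
  have htr : ∀ᶠ t in nhds 0, (W t).trace = ((n : ℝ) - 2) / (2 * (n - 1)) * R t := by
    filter_upwards [hWe, h.pos] with t ht hpos
    rw [ht, Matrix.trace_sub, ← scalar_eq_trace_ricciEnd hpos hy, Matrix.trace_smul,
      Matrix.trace_one, Fintype.card_fin, smul_eq_mul, hR]
    field_simp
    ring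
  have htr' : ∀ᶠ t in nhds 0, (W' t).trace = ((n : ℝ) - 2) / (2 * (n - 1)) * deriv R t := by
    filter_upwards [htr.eventually_nhds, hWd, hRs] with t ht hw hr
    exact (hw.trace.congr_of_eventuallyEq (ht.mono fun s hs => hs.symm)).unique
      ((hr.differentiableAt (by simp)).hasDerivAt.const_mul _)
  have htr'' : W''.trace = ((n : ℝ) - 2) / (2 * (n - 1)) * R₂ := by
    rw [← hR₂]
    exact (hW'd.trace.congr_of_eventuallyEq (htr'.mono fun s hs => hs.symm)).unique
      (((contDiffAt_deriv hRs.self_of_nhds).differentiableAt (by simp)).hasDerivAt.const_mul _)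
  have hW0 : W 0 = c₀ • (1 : Matrix (Fin n) (Fin n) ℝ) := by
    rw [hWe.self_of_nhds, line_zero, scalar_eq_trace_ricciEnd h.metric hy, h.ricciEnd_eq hy,
      Matrix.trace_smul, Matrix.trace_one, Fintype.card_fin, smul_eq_mul, ← sub_smul, hc₀]
    congr 1
    field_simp
    ring
  have hP : R₁ = (ricciEndDeriv G T₀ v c y).trace := by
    rw [← hR₁, (h.hasDerivAt_scalar_trace hy).deriv]
  have hW'0 : W' 0 = ricciEndDeriv G T₀ v c y
      - (R₁ / (2 * ((n : ℝ) - 1))) • (1 : Matrix (Fin n) (Fin n) ℝ) := by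
    refine hWd.self_of_nhds.unique (HasMDerivAt.congr ?_ hWe)
    have h1 := (h.hasDerivAt_scalar_trace hy).div_const (2 * ((n : ℝ) - 1))
    have h2 := (h.hasMDerivAt_ricciEnd hy).sub (HasMDerivAt.smul h1 (HasMDerivAt.const 1 0))
    rw [smul_zero, add_zero, ← hP] at h2
    exact h2
  -- The trace parts of the two endomorphisms differ by the factor $(n-2)/(2(n-1))=c_0/c$, which is
  -- why division by $c_0^2$ leaves $(R_1/c)^2/n$.
  have hsq : (W' 0 * W' 0).trace / c₀ ^ 2 = (R₁ / c) ^ 2 / n + tf / c₀ ^ 2 := by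
    rw [hW'0]
    simp only [Matrix.sub_mul, Matrix.mul_sub, Matrix.smul_mul, Matrix.mul_smul, Matrix.one_mul,
      Matrix.mul_one, Matrix.trace_sub, Matrix.trace_smul, smul_eq_mul, htf, ← hP,
      Matrix.trace_one, Fintype.card_fin]
    rw [hc₀]
    field_simp
    ring
  have ht1 : (W' 0).trace / c₀ = R₁ / c := by
    rw [htr'.self_of_nhds, hR₁, hc₀]
    field_simp
  have ht2 : W''.trace / c₀ = R₂ / c := by
    rw [htr'', hc₀]
    field_simp
  refine ⟨mul_ne_zero (by exact_mod_cast (Nat.choose_pos hk).ne') (pow_ne_zero _ hc0), ?_, ?_, ?_, ?_⟩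
  · exact contDiffAt_infty.1 (contDiffAt_elemSymm hs.self_of_nhds k) 2
  · rw [← elemSymm_smul_one hk, ← hW0]
    rfl
  · rw [← ht1]
    exact deriv_elemSymm_umbilic (by omega) hc0 hs.self_of_nhds hW0 hWd.self_of_nhds hk
  · have h2 := deriv_deriv_elemSymm_umbilic (by omega) hc0 hs hW0 hWd hW'd hk
    rw [ht1, ht2, hsq] at h2
    refine h2.trans ?_
    field_simp
    ring

theorem IsEinsteinLine.hasRelJet_density (h : IsEinsteinLine G T T₀ v c V) (hy : y ∈ V) :
    HasRelJet (fun t => density (line G T t) y / density G y) 1 (n * v y / 2)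
      ((n * v y / 2) ^ 2 - (tensorInner G T₀ T₀ y + n * v y ^ 2) / 2) := by
  have h0 := (h.metric.density_pos hy).ne'
  have hd : (line G T 0 y).det ≠ 0 := by rw [line_zero]; exact h.metric.det_ne hy
  have h1 : HasDerivAt (fun t => density (line G T t) y) (density G y * (n * v y / 2)) 0 := by
    have := hasDerivAt_density_line (G := G) (T := T) h.pos.self_of_nhds hy
    rwa [line_zero, h.trace_T hy] at this
  have h2 := hasDerivAt_trace_inv_line (G := G) (T := T) h.pos.self_of_nhds hy
  rw [line_zero, h.trace_T_mul_T hy] at h2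
  refine HasRelJet.of_hasDerivAt (f' := fun t => density (line G T t) y *
    (((line G T t y)⁻¹ * T y).trace / 2) / density G y) one_ne_zero ?_ ?_ ?_ ?_ ?_
  · exact contDiffAt_infty.1
      ((JointSmooth.slice (jointSmooth_density (h.jointMSm_line hy 0) hd)).div_const _) 2
  · rw [line_zero, div_self h0]
  · filter_upwards [h.pos] with t ht
    exact (hasDerivAt_density_line ht hy).div_const _
  · rw [line_zero, h.trace_T hy]
    field_simp
  · refine ((h1.mul (h2.div_const 2)).div_const _).congr_deriv ?_
    rw [line_zero, h.trace_T hy]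
    field_simp
    ring

end Pointwise

end Coord

open Coord

/-! ### Tensors built from a metric -/

section Tensors

variable {n : ℕ} {M : Type*} [TopologicalSpace M] [ChartedSpace (Rn n) M] [IsManifold (𝓡 n) ∞ M]
  {g : TensorField n M} {A B : M → Rn n → Matrix (Fin n) (Fin n) ℝ} {f : M → ℝ}
  {θ : M → Fin n → Rn n → ℝ}

theorem isTensor_ricci (hg : IsMetric g) : IsTensor fun c => ricci (comp g c) :=
  ⟨fun c _ hy => (hg c).smooth_ricci (chartAt (Rn n) c).open_target hy, fun c d =>
    ricci_pullback (isCoordChange_transition c d) (hg c) (isPullback_comp g c d)⟩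

theorem isOneForm_grad (hf : IsSmoothFun (n := n) f) :
    IsOneForm fun (c : M) i => pd i (read (n := n) f c) :=
  ⟨fun c y hy i => contDiffAt_pd (hf c y hy) i, fun c d =>
    grad_pullback (isCoordChange_transition c d) (hf c) fun z hz => isScalar_read f c d z hz⟩

theorem isTensor_hess (hg : IsMetric g) (hf : IsSmoothFun (n := n) f) :
    IsTensor fun c => hess (comp g c) (read f c) :=
  (isOneForm_grad hf).isTensor_formDeriv hg

theorem IsTensor.isTensor_einsteinOp (hA : IsTensor A) (hg : IsMetric g) :
    IsTensor fun c => einsteinOp (comp g c) (A c) :=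
  ⟨fun c _ hy => (hg c).smooth_einsteinOp (chartAt (Rn n) c).open_target (hA.smooth c) hy,
    fun c d => einsteinOp_pullback (isCoordChange_transition c d) (hg c) (isPullback_comp g c d)
      (hA.smooth c) (hA.pullback c d)⟩

theorem isScalar_scalar (hg : IsMetric g) : IsScalar fun c => scalar (comp g c) :=
  (isTensor_ricci hg).isScalar_trace hg

theorem isTensor_einsteinTensor (hg : IsMetric g) :
    IsTensor fun c y => ricci (comp g c) y - (scalar (comp g c) y / 2) • comp g c y where
  smooth c y hy := ((hg c).smooth_ricci (chartAt (Rn n) c).open_target hy).sub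
    (MSm.smul (((hg c).smooth_scalar (chartAt (Rn n) c).open_target hy).div_const 2) ((hg c).smooth y hy))
  pullback c d y hy := by
    have h1 := (isTensor_ricci hg).pullback c d y hy
    have h2 := isScalar_scalar hg c d y hy
    beta_reduce at h1 h2 ⊢
    rw [h1, h2,
      isPullback_comp g c d y hy]
    simp only [Matrix.mul_sub, Matrix.sub_mul, Matrix.mul_smul, Matrix.smul_mul]

theorem IsTensor.isScalar_tensorInner (hA : IsTensor A) (hB : IsTensor B) (hg : IsMetric g) :
    IsScalar fun c => tensorInner (comp g c) (A c) (B c) := fun c d _ hy =>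
  tensorInner_pullback (isCoordChange_transition c d) (hg c) (isPullback_comp g c d)
    (hA.pullback c d) (hB.pullback c d) hy

theorem IsTensor.isSmoothFun_tensorInner (hA : IsTensor A) (hB : IsTensor B) (hg : IsMetric g) :
    IsSmoothFun (n := n) (atCenter fun c => tensorInner (comp g c) (A c) (B c)) :=
  (hA.isScalar_tensorInner hB hg).isSmoothFun fun c y hy =>
    (hg c).smooth_tensorInner (hA.smooth c y hy) (hB.smooth c y hy) hy

theorem isSmoothFun_laplacian (hg : IsMetric g) (hf : IsSmoothFun (n := n) f) :
    IsSmoothFun (n := n) (laplacian g f) :=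
  (isTensor_hess hg hf).isSmoothFun_trace hg

theorem isSmoothFun_gradSq (hg : IsMetric g) (hf : IsSmoothFun (n := n) f) :
    IsSmoothFun (n := n) (gradSq g f) := by
  have h : IsScalar fun c => Coord.gradSq (comp g c) (read f c) := fun c d _ hy =>
    gradSq_pullback (isCoordChange_transition c d) (isPullback_comp g c d) (hf c)
      (fun z hz => isScalar_read f c d z hz) hy
  refine h.isSmoothFun fun c y hy => ContDiffAt.sum fun i _ => ContDiffAt.sum fun j _ => ?_
  exact ((hg c).smooth_inv hy i j).mul
    ((contDiffAt_pd (hf c y hy) i).mul (contDiffAt_pd (hf c y hy) j))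

theorem isOneForm_gradContr (hg : IsMetric g) (hA : IsTensor A) (hf : IsSmoothFun (n := n) f) :
    IsOneForm fun c => gradContr (comp g c) (A c) (read f c) :=
  ⟨fun c y hy i => (hg c).smooth_gradContr hy (hA.smooth c y hy) (hf c y hy) i, fun c d =>
    gradContr_pullback (isCoordChange_transition c d) (isPullback_comp g c d) (hA.pullback c d)
      (hf c) fun z hz => isScalar_read f c d z hz⟩

omit [IsManifold (𝓡 n) ∞ M] in
theorem IsOneForm.mul_fun (hθ : IsOneForm θ) (hf : IsSmoothFun (n := n) f) :
    IsOneForm fun c i y => read f c y * θ c i y where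
  smooth c y hy i := (hf c y hy).mul (hθ.smooth c y hy i)
  pullback c d y hy i := by
    beta_reduce
    rw [hθ.pullback c d y hy i, isScalar_read f c d y hy, Finset.mul_sum]
    exact Finset.sum_congr rfl fun a _ => by ring

theorem IsTensor.isOneForm_divergence_sub (hA : IsTensor A) (hg : IsMetric g) :
    IsOneForm fun c i y => divergence (comp g c) (A c) i y - pd i (trace (comp g c) (A c)) y where
  smooth c y hy i := ((hg c).smooth_divergence (hA.smooth c) hy i).sub
    (contDiffAt_pd ((hg c).smooth_trace hy (hA.smooth c y hy)) i)
  pullback c d y hy i := by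
    have h1 := divergence_pullback (isCoordChange_transition c d) (hg c) (isPullback_comp g c d)
      (hA.smooth c) (hA.pullback c d) y hy i
    have h2 := grad_pullback (isCoordChange_transition c d)
      (fun w hw => (hg c).smooth_trace hw (hA.smooth c w hw))
      (fun z hz => hA.isScalar_trace hg c d z hz) y hy i
    beta_reduce at h1 h2 ⊢
    rw [h1, h2, ← Finset.sum_sub_distrib]
    exact Finset.sum_congr rfl fun a _ => by ring

variable [CompactSpace M] [T2Space M] [MeasurableSpace M] [BorelSpace M]

theorem integral_laplacian (hg : IsMetric g) (hf : IsSmoothFun (n := n) f) :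
    ∫ x, laplacian g f x ∂(volumeMeasure g) = 0 :=
  integral_trace_formDeriv hg (isOneForm_grad hf)

/-- The divergence theorem for the 1-form $f\,df$. -/
theorem integral_mul_laplacian (hg : IsMetric g) (hf : IsSmoothFun (n := n) f) :
    ∫ x, (f x * laplacian g f x + gradSq g f x) ∂(volumeMeasure g) = 0 := by
  rw [← integral_trace_formDeriv hg ((isOneForm_grad hf).mul_fun hf)]
  refine integral_congr_ae (ae_of_all _ fun x => ?_)
  have hy := mem_chart_target (Rn n) x
  have hs := hf x _ hy
  beta_reduce
  rw [QuotientCurvature.laplacian, QuotientCurvature.gradSq, atCenter, ← read_apply f (mem_chart_source (Rn n) x), Coord.laplacian,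
    Coord.gradSq, Coord.trace, Finset.mul_sum, ← Finset.sum_add_distrib]
  refine Finset.sum_congr rfl fun i _ => ?_
  rw [Finset.mul_sum, ← Finset.sum_add_distrib]
  refine Finset.sum_congr rfl fun j _ => ?_
  rw [formDeriv, Matrix.of_apply, pd_mul hs (contDiffAt_pd hs j)]
  have : ∀ m, christoffel (comp g x) m i j (chartAt (Rn n) x x) *
      (read f x (chartAt (Rn n) x x) * pd m (read f x) (chartAt (Rn n) x x)) =
      read f x (chartAt (Rn n) x x) * (christoffel (comp g x) m i j (chartAt (Rn n) x x) *
        pd m (read f x) (chartAt (Rn n) x x)) := fun m => by ring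
  simp only [this, ← Finset.mul_sum]
  ring

/-- For divergence-free $A$ the integrand is the divergence of $A(\nabla f,\cdot)$. -/
theorem integral_tensorInner_hess (hg : IsMetric g) (hA : IsTensor A)
    (hdiv : ∀ c, ∀ y ∈ (chartAt (Rn n) c).target, ∀ i, divergence (comp g c) (A c) i y = 0)
    (hf : IsSmoothFun (n := n) f) :
    ∫ x, atCenter (fun c => tensorInner (comp g c) (A c) (hess (comp g c) (read f c))) x
      ∂(volumeMeasure g) = 0 := by
  rw [← integral_trace_formDeriv hg (isOneForm_gradContr hg hA hf)]
  refine integral_congr_ae (ae_of_all _ fun x => ?_)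
  exact (trace_formDeriv_gradContr (chartAt (Rn n) x).open_target (hg x) (hA.smooth x) (hdiv x)
    (hf x) (mem_chart_target (Rn n) x)).symm

theorem integral_linearCombination {m : ℕ} (hg : IsMetric g) (a : Fin m → ℝ) (F : Fin m → M → ℝ)
    (hF : ∀ i, Continuous (F i)) : ∫ x, ∑ i, a i * F i x ∂(volumeMeasure g) =
      ∑ i, a i * ∫ x, F i x ∂(volumeMeasure g) := by
  rw [integral_finsetSum _ fun i _ => (integrable_volumeMeasure hg (hF i)).const_mul (a i)]
  exact Finset.sum_congr rfl fun i _ => integral_const_mul _ _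

end Tensors

/-! ### Variations of an Einstein metric -/

section Variations

variable {n : ℕ} {M : Type*} [TopologicalSpace M] [ChartedSpace (Rn n) M] [IsManifold (𝓡 n) ∞ M]
  {g h h₀ : TensorField n M} {v f : M → ℝ} {c : ℝ}

/-- `g` is an Einstein metric and `h = h₀ + v g` with `h₀` transverse and traceless. -/
structure IsEinsteinVariation (g h h₀ : TensorField n M) (v : M → ℝ) (c : ℝ) : Prop where
  smooth_g : IsSmoothSymm g
  metric : IsMetric g
  ricci_eq : ∀ d, ∀ y ∈ (chartAt (Rn n) d).target, ricci (comp g d) y = c • comp g d y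
  smooth₀ : IsSmoothSymm h₀
  smooth_h : IsSmoothSymm h
  trace₀ : ∀ d, ∀ y ∈ (chartAt (Rn n) d).target, trace (comp g d) (comp h₀ d) y = 0
  div₀ : ∀ d, ∀ y ∈ (chartAt (Rn n) d).target, ∀ i, divergence (comp g d) (comp h₀ d) i y = 0
  smooth_v : IsSmoothFun (n := n) v
  eq : ∀ x a b, form h x a b = form h₀ x a b + v x * form g x a b

theorem IsEinsteinVariation.traceless (H : IsEinsteinVariation g h h₀ v c) :
    IsEinsteinVariation g h₀ h₀ (fun _ => 0) c :=
  { H with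
    smooth_h := H.smooth₀
    smooth_v := fun _ _ _ => contDiffAt_const
    eq := fun _ _ _ => by rw [zero_mul, add_zero] }

variable [CompactSpace M]

theorem IsEinsteinVariation.chart (H : IsEinsteinVariation g h h₀ v c) (d : M) :
    IsEinsteinLine (comp g d) (comp h d) (comp h₀ d) (read v d) c (chartAt (Rn n) d).target where
  isOpen := (chartAt (Rn n) d).open_target
  metric := H.metric d
  ricci_eq := H.ricci_eq d
  smooth₀ w hw := smooth_comp H.smooth₀ d hw
  symm₀ w _ := comp_transpose H.smooth₀ d w
  trace₀ := H.trace₀ d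
  div₀ := H.div₀ d
  smooth_v := H.smooth_v d
  eq w _ := by
    ext i j
    rw [comp_apply, H.eq]
    rfl
  pos₀ := (eventually_isMetric H.smooth_g H.metric H.smooth₀).mono fun t ht => ht d
  pos := (eventually_isMetric H.smooth_g H.metric H.smooth_h).mono fun t ht => ht d

theorem IsEinsteinVariation.eventually_isMetric (H : IsEinsteinVariation g h h₀ v c) :
    ∀ᶠ t in nhds (0 : ℝ), IsMetric (g + t • h) :=
  QuotientCurvature.eventually_isMetric H.smooth_g H.metric H.smooth_h

theorem IsEinsteinVariation.isSmoothFamily (H : IsEinsteinVariation g h h₀ v c)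
    {F : ℝ → M → Rn n → ℝ} (hF : ∀ t, IsMetric (g + t • h) → IsScalar (F t))
    (hs : ∀ d, ∀ y ∈ (chartAt (Rn n) d).target,
      JointMSm (fun t => comp (g + t • h) d) (0, y) → (comp (g + (0 : ℝ) • h) d y).det ≠ 0 →
      JointSmooth (fun t => F t d) (0, y)) : IsSmoothFamily n fun t => atCenter (F t) :=
  isSmoothFamily_atCenter (H.eventually_isMetric.mono hF) fun d y hy =>
    hs d y hy (jointMSm_line H.smooth_g H.smooth_h d 0 hy)
      ((H.eventually_isMetric.self_of_nhds d).det_ne hy)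

theorem jointMSm_const {A : Rn n → Matrix (Fin n) (Fin n) ℝ} {t : ℝ} {y : Rn n} (hA : MSm A y) :
    JointMSm (fun _ => A) (t, y) := fun i j => (hA i j).comp (t, y) contDiffAt_snd

theorem IsEinsteinVariation.isSmoothFamily_scalar (H : IsEinsteinVariation g h h₀ v c) :
    IsSmoothFamily n fun t => atCenter fun d : M => scalar (comp (g + t • h) d) :=
  H.isSmoothFamily (fun _ ht => isScalar_scalar ht) fun _ _ _ h1 h2 => jointSmooth_scalar h1 h2

theorem IsEinsteinVariation.isSmoothFamily_sigma (H : IsEinsteinVariation g h h₀ v c) (k : ℕ) :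
    IsSmoothFamily n fun t => sigma (M := M) k (g + t • h) :=
  H.isSmoothFamily (F := fun t d => Coord.sigma k (comp (g + t • h) d))
    (fun t ht c d y hy => sigma_pullback (isCoordChange_transition c d) (ht c)
      (isPullback_comp (g + t • h) c d) k hy) fun _ _ _ h1 h2 => jointSmooth_sigma h1 h2 k

theorem IsEinsteinVariation.isSmoothFamily_densityRatio (H : IsEinsteinVariation g h h₀ v c) :
    IsSmoothFamily n fun t => atCenter (densityRatio g (g + t • h)) :=
  H.isSmoothFamily (fun _ _ => isScalar_densityRatio _ _) fun d _ hy h1 h2 =>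
    (jointSmooth_density h1 h2).div (ContDiffAt.comp (f := Prod.snd) (x := ((0 : ℝ), _)) ((H.metric d).smooth_density hy)
      contDiffAt_snd)
      ((H.metric d).density_pos hy).ne'

theorem IsEinsteinVariation.isSmoothFamily_ricci (H : IsEinsteinVariation g h h₀ v c) :
    IsSmoothFamily n fun t => atCenter fun d : M =>
      tensorInner (comp (g + t • h) d) (ricci (comp (g + t • h) d)) (comp h d) :=
  H.isSmoothFamily (fun _ ht => (isTensor_ricci ht).isScalar_tensorInner H.smooth_h.isTensor ht)
    fun _ _ hy h1 h2 => jointSmooth_tensorInner h1 h2 (jointMSm_ricci h1 h2)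
      (jointMSm_const (smooth_comp H.smooth_h _ hy))

variable [T2Space M] [MeasurableSpace M] [BorelSpace M]

/-- The mechanism behind both integral identities below: a relation valid for every metric on the
line is written against the fixed measure of `g` and differentiated there. -/
theorem IsEinsteinVariation.integral_timeDeriv_eq_zero (H : IsEinsteinVariation g h h₀ v c)
    {F : ℝ → M → ℝ} (hF : IsSmoothFamily n F)
    (h0 : ∀ᶠ t in nhds 0, Continuous (F t) → ∫ x, F t x ∂(volumeMeasure (g + t • h)) = 0) :
    ∫ x, timeDeriv (fun t x => F t x * atCenter (densityRatio g (g + t • h)) x) 0 x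
      ∂(volumeMeasure g) = 0 := by
  have := isFiniteMeasure_volumeMeasure H.metric
  rw [← (hF.mul H.isSmoothFamily_densityRatio).deriv_integral (volumeMeasure g)]
  have h1 : (fun t => ∫ x, F t x * atCenter (densityRatio g (g + t • h)) x ∂(volumeMeasure g))
      =ᶠ[nhds 0] fun _ => 0 := by
    filter_upwards [H.eventually_isMetric, h0, hF.eventually_continuous] with t ht h0t hc
    rw [← integral_volumeMeasure_eq H.metric ht hc, h0t hc]
  rw [h1.deriv_eq, deriv_const]

omit [T2Space M] [MeasurableSpace M] [BorelSpace M] in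
theorem IsEinsteinVariation.hasRelJet_densityRatio (H : IsEinsteinVariation g h h₀ v c) (x : M) :
    HasRelJet (fun t => atCenter (densityRatio g (g + t • h)) x) 1 (n * v x / 2)
      ((n * v x / 2) ^ 2 - (atCenter (fun d => tensorInner (comp g d) (comp h₀ d) (comp h₀ d)) x
        + n * v x ^ 2) / 2) := by
  have h1 := (H.chart x).hasRelJet_density (mem_chart_target (Rn n) x)
  rwa [read_apply v (mem_chart_source (Rn n) x)] at h1

/-- The second derivative of the scalar curvature at `t = 0`. -/
def scalarSecondDeriv (g h : TensorField n M) (x : M) : ℝ :=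
  timeDeriv (timeDeriv fun t => atCenter fun d : M => scalar (comp (g + t • h) d)) 0 x

/-- Along the line $R'+\langle\mathrm{Ric},h\rangle$ is a divergence, so its integral vanishes
identically in $t$. The derivative at $0$ contains $R''$ together with first variations already
known and the variation $nv/2$ of the volume. -/
theorem IsEinsteinVariation.integral_scalarSecondDeriv (H : IsEinsteinVariation g h h₀ v c) :
    ∫ x, (scalarSecondDeriv g h x + (-(1 / 2) * innerEinsteinOp g h₀ x
        - ((n : ℝ) - 2) / 2 *
          atCenter (fun d => tensorInner (comp g d) (comp h₀ d) (hess (comp g d) (read v d))) x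
        + v x * (-(((n : ℝ) - 1) * laplacian g v x) - n * c * v x)
        - c * (atCenter (fun d => tensorInner (comp g d) (comp h₀ d) (comp h₀ d)) x
          + n * v x ^ 2))
        + -(((n : ℝ) - 1) * laplacian g v x) * (n * v x / 2)) ∂(volumeMeasure g) = 0 := by
  have hR := H.isSmoothFamily_scalar
  have hI := H.isSmoothFamily_ricci
  rw [← H.integral_timeDeriv_eq_zero (hR.timeDeriv.add hI) ?_]
  · refine integral_congr_ae (ae_of_all _ fun x => ?_)
    have hy := mem_chart_target (Rn n) x
    have hx := read_apply v (mem_chart_source (Rn n) x)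
    have hL := H.chart x
    have h1 := hR.timeDeriv.eventually_hasDerivAt.self_of_nhds x
    have h2 := hL.hasDerivAt_tensorInner_ricci hy
    have h3 := (H.hasRelJet_densityRatio x).hasDerivAt
    have h4 := ((h1.add h2).mul h3).deriv
    have h5 : timeDeriv (fun t => atCenter fun d : M => scalar (comp (g + t • h) d)) 0 x =
        -(((n : ℝ) - 1) * laplacian g v x) - n * c * v x := by
      rw [← hx]
      exact (hL.hasDerivAt_scalar_trace hy).deriv.trans (hL.trace_ricciEndDeriv hy)
    have h6 : tensorInner (line (comp g x) (comp h x) 0) (ricci (line (comp g x) (comp h x) 0))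
        (comp h x) (chartAt (Rn n) x x) = n * c * v x := by
      rw [line_zero, hL.tensorInner_ricci hy, hx]
    refine Eq.trans ?_ h4.symm
    rw [(H.hasRelJet_densityRatio x).eq, hx]
    simp only [Pi.add_apply]
    rw [h5, h6]
    simp only [scalarSecondDeriv, innerEinsteinOp, laplacian, atCenter]
    ring
  -- At each small $t$ the sum is the divergence of $\delta h-d\,\mathrm{tr}\,h$ for the metric
  -- $g+th$.
  · filter_upwards [H.eventually_isMetric.eventually_nhds] with t ht _
    rw [← integral_trace_formDeriv ht.self_of_nhds
      (H.smooth_h.isTensor.isOneForm_divergence_sub ht.self_of_nhds)]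
    refine integral_congr_ae (ae_of_all _ fun x => ?_)
    have h1 := (hasDerivAt_scalar_line (chartAt (Rn n) x).open_target (G := comp g x)
      (T := comp h x) (t := t) (ht.mono fun s hs => hs x) (fun w hw => smooth_comp H.smooth_h x hw)
      (fun w _ => comp_transpose H.smooth_h x w) (mem_chart_target (Rn n) x)).deriv
    exact eq_sub_iff_add_eq.1 h1

theorem Coord.tensorInner_sub_smul {G A B : Rn n → Matrix (Fin n) (Fin n) ℝ} {s : Rn n → ℝ}
    {V : Set (Rn n)} {y : Rn n} (hG : IsMetricOn G V) (hy : y ∈ V) :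
    tensorInner G (fun z => A z - s z • G z) B y = tensorInner G A B y - s y * trace G B y := by
  rw [tensorInner_eq hG hy, tensorInner_eq hG hy, trace_eq hG hy, Matrix.transpose_sub,
    Matrix.transpose_smul, hG.transpose hy]
  simp only [Matrix.mul_sub, Matrix.sub_mul, Matrix.mul_smul, Matrix.smul_mul, Matrix.trace_sub,
    Matrix.trace_smul, smul_eq_mul, Matrix.nonsing_inv_mul _ (hG.isUnit hy), Matrix.one_mul]

/-- For every metric, $\int\langle\mathrm{Ric}-\frac R2g,\mathrm{Hess}f\rangle$ and $\int\Delta f$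
vanish. The combination differentiated here vanishes pointwise at $t=0$, so the change of the volume
plays no role. -/
theorem IsEinsteinVariation.integral_hess_pairing (H : IsEinsteinVariation g h h₀ v c)
    (hf : IsSmoothFun (n := n) f) :
    ∫ x, (-(1 / 2) * atCenter (fun d => tensorInner (comp g d) (einsteinOp (comp g d) (comp h₀ d))
          (hess (comp g d) (read f d))) x
        + ((n : ℝ) - 2) / 2 * (laplacian g v x * laplacian g f x + c * (v x * laplacian g f x)
          - atCenter (fun d => tensorInner (comp g d) (hess (comp g d) (read v d))
            (hess (comp g d) (read f d))) x)) ∂(volumeMeasure g) = 0 := by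
  set F : ℝ → M → Rn n → ℝ := fun t d y => tensorInner (comp (g + t • h) d)
      (ricci (comp (g + t • h) d)) (hess (comp (g + t • h) d) (read f d)) y
      - (scalar (comp (g + t • h) d) y / 2 + (c - n * c / 2)) *
        Coord.laplacian (comp (g + t • h) d) (read f d) y with hFd
  have hF : IsSmoothFamily n fun t => atCenter (F t) := by
    refine H.isSmoothFamily (fun t ht d d' y hy => ?_) fun d _ hy h1 h2 => ?_
    · have e1 := (isTensor_ricci ht).isScalar_tensorInner (isTensor_hess ht hf) ht d d' y hy
      have e2 := isScalar_scalar ht d d' y hy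
      have e3 := (isTensor_hess ht hf).isScalar_trace ht d d' y hy
      beta_reduce at e1 e2 e3
      simp only [hFd, Coord.laplacian_eq]
      rw [e1, e2, e3]
    · have hh := jointMSm_hess h1 h2 (hf d _ hy)
      have j1 := jointSmooth_tensorInner h1 h2 (jointMSm_ricci h1 h2) hh
      have j2 : JointSmooth (fun t => Coord.laplacian (comp (g + t • h) d) (read f d)) (0, _) :=
        jointSmooth_trace h1 h2 hh
      have j3 := ((jointSmooth_scalar h1 h2).div_const 2).add
        (contDiffAt_const (c := c - n * c / 2))
      exact j1.sub (j3.mul j2)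
  rw [← H.integral_timeDeriv_eq_zero hF ?_]
  · refine integral_congr_ae (ae_of_all _ fun x => ?_)
    have hy := mem_chart_target (Rn n) x
    have hL := H.chart x
    have h2 := hL.hasDerivAt_hess_pairing hy (hf x _ hy)
    have h3 := (H.hasRelJet_densityRatio x).hasDerivAt
    have h4 := (h2.mul h3).deriv
    have h6 : tensorInner (comp g x) (ricci (comp g x)) (hess (comp g x) (read f x))
          (chartAt (Rn n) x x)
        - (scalar (comp g x) (chartAt (Rn n) x x) / 2 + (c - n * c / 2)) *
          Coord.laplacian (comp g x) (read f x) (chartAt (Rn n) x x) = 0 := by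
      rw [scalar_eq_trace_ricciEnd hL.metric hy, hL.ricciEnd_eq hy, Matrix.trace_smul,
        Matrix.trace_one, Fintype.card_fin, smul_eq_mul, tensorInner_eq_trace_mul hL.metric hy
          (ricci_transpose hL.isOpen hL.metric hy), ← ricciEnd, hL.ricciEnd_eq hy,
        Matrix.smul_mul, Matrix.one_mul, Matrix.trace_smul, smul_eq_mul, ← trace_eq hL.metric hy,
        ← Coord.laplacian_eq]
      ring
    refine Eq.trans ?_ h4.symm
    rw [(H.hasRelJet_densityRatio x).eq, line_zero, h6,
      read_apply v (mem_chart_source (Rn n) x), zero_mul, add_zero, mul_one]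
    rfl
  · filter_upwards [H.eventually_isMetric] with t ht _
    have hE := isTensor_einsteinTensor ht
    have h1 := integral_tensorInner_hess ht hE (fun d y hy i => divergence_einsteinTensor
      (chartAt (Rn n) d).open_target (ht d) hy i) hf
    have hc1 := (hE.isSmoothFun_tensorInner (isTensor_hess ht hf) ht).continuous
    have hc2 := (isSmoothFun_laplacian ht hf).continuous
    have h2 := integral_sub (integrable_volumeMeasure ht hc1)
      ((integrable_volumeMeasure ht hc2).const_mul (c - n * c / 2))
    rw [integral_const_mul, h1, integral_laplacian ht hf, mul_zero, sub_zero] at h2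
    rw [← h2]
    refine integral_congr_ae (ae_of_all _ fun x => ?_)
    have h3 := Coord.tensorInner_sub_smul (A := ricci (comp (g + t • h) x))
      (B := hess (comp (g + t • h) x) (read f x)) (s := fun y => scalar (comp (g + t • h) x) y / 2)
      (ht x) (mem_chart_target (Rn n) x)
    simp only [atCenter, hFd, laplacian]
    rw [h3, Coord.laplacian_eq]
    ring

end Variations

open Coord

/-! ### Elementary facts about functions -/

section Functions

variable {n : ℕ} {M : Type*} [TopologicalSpace M] [ChartedSpace (Rn n) M] [IsManifold (𝓡 n) ∞ M]
  {g : TensorField n M} {f : M → ℝ}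

theorem Coord.pd_const_mul_fun (i : Fin n) (a : ℝ) (f : Rn n → ℝ) :
    pd i (fun z => a * f z) = fun z => a * pd i f z := by
  funext y
  have h : (fun z => a * f z) = a • f := rfl
  rw [pd, h, fderiv_const_smul_field, Pi.smul_apply, smul_apply]
  rfl

theorem Coord.hess_zero (G : Rn n → Matrix (Fin n) (Fin n) ℝ) : hess G (fun _ => 0) = 0 := by
  have h : ∀ i : Fin n, pd i (fun _ : Rn n => (0 : ℝ)) = fun _ => 0 := fun i =>
    funext fun y => pd_const _ _ _
  funext y
  ext i j
  simp [hess, formDeriv, h]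

omit [IsManifold (𝓡 n) ∞ M] in
theorem laplacian_const_mul (a : ℝ) (x : M) :
    laplacian g (fun x => a * f x) x = a * laplacian g f x := by
  have h : read (n := n) (fun x => a * f x) x = fun z => a * read f x z := rfl
  simp only [laplacian, h, Coord.laplacian, pd_const_mul_fun, Finset.mul_sum]
  refine Finset.sum_congr rfl fun i _ => Finset.sum_congr rfl fun j _ => ?_
  rw [mul_sub, mul_sub, mul_sub, Finset.mul_sum, Finset.mul_sum, Finset.mul_sum]
  congr 1
  · ring
  · exact Finset.sum_congr rfl fun m _ => by ring

omit [IsManifold (𝓡 n) ∞ M] in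
theorem gradSq_const_mul (a : ℝ) (x : M) :
    gradSq g (fun x => a * f x) x = a ^ 2 * gradSq g f x := by
  have h : read (n := n) (fun x => a * f x) x = fun z => a * read f x z := rfl
  simp only [gradSq, h, Coord.gradSq, pd_const_mul_fun, Finset.mul_sum]
  exact Finset.sum_congr rfl fun i _ => Finset.sum_congr rfl fun j _ => by ring

variable [CompactSpace M] [T2Space M] [MeasurableSpace M] [BorelSpace M]

/-- At a given point some cutoff is nonzero, and the open set where it is nonzero has positive
Lebesgue measure in its chart. -/
theorem volumeMeasure_real_univ_pos [Nonempty M] (hg : IsMetric g) :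
    0 < (volumeMeasure g).real Set.univ := by
  have h1 : (volumeMeasure g).real Set.univ = ∫ _, (1 : ℝ) ∂(volumeMeasure g) := by simp
  rw [h1, integral_volumeMeasure hg continuous_const]
  obtain ⟨x⟩ := ‹Nonempty M›
  have hnn : ∀ c : M, ∀ y ∈ (chartAt (Rn n) c).target, 0 ≤ read (chartPartition n M c) c y *
      (read (n := n) (fun _ : M => (1 : ℝ)) c y * density (comp g c) y) := fun c y hy =>
    mul_nonneg ((chartPartition n M).nonneg c _)
      (mul_nonneg zero_le_one ((hg c).density_pos hy).le)
  refine Finset.sum_pos' (fun c _ => setIntegral_nonneg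
    (chartAt (Rn n) c).open_target.measurableSet (hnn c)) ?_
  obtain ⟨c, hc, hne⟩ := Finset.exists_ne_zero_of_sum_ne_zero
    (ne_of_eq_of_ne (sum_chartPartition (n := n) x) one_ne_zero)
  refine ⟨c, hc, ?_⟩
  have hcont : ContinuousOn (fun y => read (n := n) (fun _ : M => (1 : ℝ)) c y *
      density (comp g c) y) (chartAt (Rn n) c).target :=
    continuousOn_const.mul (hg.continuousOn_density c)
  rw [setIntegral_pos_iff_support_of_nonneg_ae
    ((ae_restrict_iff' (chartAt (Rn n) c).open_target.measurableSet).2 (ae_of_all _ (hnn c)))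
    (integrableOn_cut c hcont)]
  have hxs : x ∈ (chartAt (Rn n) c).source := tsupport_chartPartition c (subset_tsupport _ hne)
  have ho : IsOpen ((chartAt (Rn n) c).target ∩
      (chartAt (Rn n) c).symm ⁻¹' Function.support (chartPartition n M c)) :=
    (chartAt (Rn n) c).isOpen_inter_preimage_symm
      ((isSmoothFun_chartPartition c).continuous.isOpen_support)
  refine (ho.measure_pos volume ⟨chartAt (Rn n) c x, (chartAt (Rn n) c).map_source hxs, ?_⟩).trans_le
    (measure_mono fun y hy => ⟨?_, hy.1⟩)
  · rw [Set.mem_preimage, (chartAt (Rn n) c).left_inv hxs]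
    exact hne
  · exact mul_ne_zero hy.2 (mul_ne_zero one_ne_zero ((hg c).density_pos hy.1).ne')

/-- The value at $t=0$ is the same constant at all points, as happens for curvature quotients of an
Einstein metric; hence relative jets integrate to averages. -/
theorem IsSmoothFamily.hasRelJet_integral (hg : IsMetric g) {F : ℝ → M → ℝ}
    (hF : IsSmoothFamily n F) {a : ℝ} {b d : M → ℝ} (h : ∀ x, HasRelJet (fun t => F t x) a (b x) (d x))
    (hV : (volumeMeasure g).real Set.univ ≠ 0) (ha : a ≠ 0) :
    HasRelJet (fun t => ∫ x, F t x ∂(volumeMeasure g)) (a * (volumeMeasure g).real Set.univ)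
      (((volumeMeasure g).real Set.univ)⁻¹ * ∫ x, b x ∂(volumeMeasure g))
      (((volumeMeasure g).real Set.univ)⁻¹ * ∫ x, d x ∂(volumeMeasure g)) := by
  have := isFiniteMeasure_volumeMeasure hg
  refine ⟨mul_ne_zero ha hV, hF.contDiffAt_integral _ 2, ?_, ?_, ?_⟩
  · rw [integral_congr_ae (g := fun _ => a) (ae_of_all _ fun x => (h x).eq), integral_const,
      smul_eq_mul, mul_comm]
  · rw [hF.deriv_integral]
    refine (integral_congr_ae (ae_of_all _ fun x => (h x).deriv_eq)).trans ?_
    rw [integral_const_mul]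
    field_simp
  · rw [hF.deriv_deriv_integral]
    refine (integral_congr_ae (ae_of_all _ fun x => (h x).deriv_deriv_eq)).trans ?_
    rw [integral_const_mul]
    field_simp

theorem integral_linearCombination_six (hg : IsMetric g) {f₁ f₂ f₃ f₄ f₅ f₆ : M → ℝ}
    (h₁ : Continuous f₁) (h₂ : Continuous f₂) (h₃ : Continuous f₃) (h₄ : Continuous f₄)
    (h₅ : Continuous f₅) (h₆ : Continuous f₆) (a₁ a₂ a₃ a₄ a₅ a₆ : ℝ) :
    ∫ x, (a₁ * f₁ x + a₂ * f₂ x + a₃ * f₃ x + a₄ * f₄ x + a₅ * f₅ x + a₆ * f₆ x)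
        ∂(volumeMeasure g) =
      a₁ * ∫ x, f₁ x ∂(volumeMeasure g) + a₂ * ∫ x, f₂ x ∂(volumeMeasure g)
      + a₃ * ∫ x, f₃ x ∂(volumeMeasure g) + a₄ * ∫ x, f₄ x ∂(volumeMeasure g)
      + a₅ * ∫ x, f₅ x ∂(volumeMeasure g) + a₆ * ∫ x, f₆ x ∂(volumeMeasure g) := by
  have h := integral_linearCombination hg ![a₁, a₂, a₃, a₄, a₅, a₆] ![f₁, f₂, f₃, f₄, f₅, f₆]
    fun i => by fin_cases i <;> assumption
  simpa [Fin.sum_univ_six] using h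

theorem integral_linearCombination_four (hg : IsMetric g) {f₁ f₂ f₃ f₄ : M → ℝ}
    (h₁ : Continuous f₁) (h₂ : Continuous f₂) (h₃ : Continuous f₃) (h₄ : Continuous f₄)
    (a₁ a₂ a₃ a₄ : ℝ) :
    ∫ x, (a₁ * f₁ x + a₂ * f₂ x + a₃ * f₃ x + a₄ * f₄ x) ∂(volumeMeasure g) =
      a₁ * ∫ x, f₁ x ∂(volumeMeasure g) + a₂ * ∫ x, f₂ x ∂(volumeMeasure g)
      + a₃ * ∫ x, f₃ x ∂(volumeMeasure g) + a₄ * ∫ x, f₄ x ∂(volumeMeasure g) := by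
  have h := integral_linearCombination hg ![a₁, a₂, a₃, a₄] ![f₁, f₂, f₃, f₄]
    fun i => by fin_cases i <;> assumption
  simpa [Fin.sum_univ_four] using h

end Functions

theorem HasRelJet.congr {f f₁ : ℝ → ℝ} {a b d : ℝ} (h : HasRelJet f a b d)
    (he : f₁ =ᶠ[nhds 0] f) : HasRelJet f₁ a b d where
  ne := h.ne
  contDiff := h.contDiff.congr_of_eventuallyEq he
  eq := he.eq_of_nhds.trans h.eq
  deriv_eq := he.deriv_eq.trans h.deriv_eq
  deriv_deriv_eq := he.deriv.deriv_eq.trans h.deriv_deriv_eq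

/-! ### The second variation -/

section SecondVariation

variable {n : ℕ} {M : Type*} [TopologicalSpace M] [ChartedSpace (Rn n) M] [IsManifold (𝓡 n) ∞ M]
  {g h h₀ : TensorField n M} {v : M → ℝ} {c : ℝ} [CompactSpace M]

/-- `|Hess v|²`. -/
def normSqHess (g : TensorField n M) (v : M → ℝ) : M → ℝ :=
  atCenter fun d => tensorInner (comp g d) (hess (comp g d) (read v d))
    (hess (comp g d) (read v d))

/-- `T · Hess v`, for the coordinate expressions of a 2-tensor `T`. -/
def innerHess (g : TensorField n M) (T : M → Rn n → Matrix (Fin n) (Fin n) ℝ) (v : M → ℝ) : M → ℝ :=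
  atCenter fun d => tensorInner (comp g d) (T d) (hess (comp g d) (read v d))

/-- `|T|²`. -/
def normSq (g T : TensorField n M) : M → ℝ :=
  atCenter fun d => tensorInner (comp g d) (comp T d) (comp T d)

/-- The logarithmic derivative of the scalar curvature of an Einstein metric with Ricci tensor
`c g`, in the direction of `h₀ + v g`, up to the factor `n`. -/
def scalarLogDeriv (g : TensorField n M) (v : M → ℝ) (c : ℝ) (x : M) : ℝ :=
  (-(((n : ℝ) - 1) * laplacian g v x) - n * c * v x) / c

/-- The squared norm of the trace-free part of the derivative of the Ricci endomorphism. -/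
def traceFreeSq (g h₀ : TensorField n M) (v : M → ℝ) (x : M) : ℝ :=
  1 / 4 * normSqEinsteinOp g h₀ x
    + ((n : ℝ) - 2) / 2 * innerHess g (fun d => einsteinOp (comp g d) (comp h₀ d)) v x
    + ((n : ℝ) - 2) ^ 2 / 4 * (normSqHess g v x - laplacian g v x ^ 2 / n)

theorem IsEinsteinVariation.hasRelJet_sigma (H : IsEinsteinVariation g h h₀ v c) (hn : 3 ≤ n)
    (hc : c ≠ 0) {c₀ : ℝ} (hc₀ : c₀ = ((n : ℝ) - 2) / (2 * (n - 1)) * c) (x : M) {k : ℕ}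
    (hk : k ≤ n) :
    HasRelJet (fun t => sigma k (g + t • h) x) (n.choose k * c₀ ^ k)
      (k / n * scalarLogDeriv g v c x)
      (k * (k - 1) / n ^ 2 * scalarLogDeriv g v c x ^ 2
        - k * (k - 1) / (n * (n - 1)) * (traceFreeSq g h₀ v x / c₀ ^ 2)
        + k / n * (scalarSecondDeriv g h x / c)) := by
  have hy := mem_chart_target (Rn n) x
  have hL := H.chart x
  have hR : deriv (fun t => scalar (line (comp g x) (comp h x) t) (chartAt (Rn n) x x)) 0 =
      -(((n : ℝ) - 1) * laplacian g v x) - n * c * v x := by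
    rw [(hL.hasDerivAt_scalar_trace hy).deriv, hL.trace_ricciEndDeriv hy,
      read_apply v (mem_chart_source (Rn n) x)]
    rfl
  refine hL.hasRelJet_sigma hn hc hy hk hc₀ hR rfl ?_
  rw [hL.trace_ricciEndDeriv_sq (by omega) hy, hL.trace_ricciEndDeriv hy,
    read_apply v (mem_chart_source (Rn n) x)]
  rfl

theorem IsEinsteinVariation.continuous_scalarSecondDeriv (H : IsEinsteinVariation g h h₀ v c) :
    Continuous (scalarSecondDeriv g h) :=
  H.isSmoothFamily_scalar.timeDeriv.timeDeriv.eventually_continuous.self_of_nhds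

omit [CompactSpace M] in
theorem IsEinsteinVariation.continuous_laplacian (H : IsEinsteinVariation g h h₀ v c) :
    Continuous (laplacian g v) := (isSmoothFun_laplacian H.metric H.smooth_v).continuous

omit [CompactSpace M] in
theorem IsEinsteinVariation.continuous_gradSq (H : IsEinsteinVariation g h h₀ v c) :
    Continuous (gradSq g v) := (isSmoothFun_gradSq H.metric H.smooth_v).continuous

omit [CompactSpace M] in
theorem IsEinsteinVariation.continuous_normSqHess (H : IsEinsteinVariation g h h₀ v c) :
    Continuous (normSqHess g v) :=
  ((isTensor_hess H.metric H.smooth_v).isSmoothFun_tensorInner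
    (isTensor_hess H.metric H.smooth_v) H.metric).continuous

omit [CompactSpace M] in
theorem IsEinsteinVariation.continuous_innerHess (H : IsEinsteinVariation g h h₀ v c)
    {T : M → Rn n → Matrix (Fin n) (Fin n) ℝ} (hT : IsTensor T) : Continuous (innerHess g T v) :=
  (hT.isSmoothFun_tensorInner (isTensor_hess H.metric H.smooth_v) H.metric).continuous

omit [CompactSpace M] in
theorem IsEinsteinVariation.isTensor_einsteinOp (H : IsEinsteinVariation g h h₀ v c) :
    IsTensor fun d => einsteinOp (comp g d) (comp h₀ d) :=
  H.smooth₀.isTensor.isTensor_einsteinOp H.metric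

omit [CompactSpace M] in
theorem IsEinsteinVariation.continuous_normSq (H : IsEinsteinVariation g h h₀ v c) :
    Continuous (normSq g h₀) :=
  (H.smooth₀.isTensor.isSmoothFun_tensorInner H.smooth₀.isTensor H.metric).continuous

omit [CompactSpace M] in
theorem IsEinsteinVariation.continuous_innerEinsteinOp (H : IsEinsteinVariation g h h₀ v c) :
    Continuous (innerEinsteinOp g h₀) :=
  (H.smooth₀.isTensor.isSmoothFun_tensorInner H.isTensor_einsteinOp H.metric).continuous

omit [CompactSpace M] in
theorem IsEinsteinVariation.continuous_normSqEinsteinOp (H : IsEinsteinVariation g h h₀ v c) :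
    Continuous (normSqEinsteinOp g h₀) :=
  (H.isTensor_einsteinOp.isSmoothFun_tensorInner H.isTensor_einsteinOp H.metric).continuous

omit [CompactSpace M] in
theorem IsEinsteinVariation.continuous_scalarLogDeriv (H : IsEinsteinVariation g h h₀ v c) :
    Continuous (scalarLogDeriv g v c) :=
  ((H.continuous_laplacian.const_mul _).neg.sub (H.smooth_v.continuous.const_mul _)).div_const c

omit [CompactSpace M] in
theorem IsEinsteinVariation.continuous_traceFreeSq (H : IsEinsteinVariation g h h₀ v c) :
    Continuous (traceFreeSq g h₀ v) :=
  ((H.continuous_normSqEinsteinOp.const_mul _).add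
    ((H.continuous_innerHess H.isTensor_einsteinOp).const_mul _)).add
    ((H.continuous_normSqHess.sub ((H.continuous_laplacian.pow 2).div_const _)).const_mul _)

omit [CompactSpace M] in
theorem IsEinsteinVariation.continuous_mul_laplacian (H : IsEinsteinVariation g h h₀ v c) :
    Continuous fun x => v x * laplacian g v x := H.smooth_v.continuous.mul H.continuous_laplacian

omit [CompactSpace M] in
theorem IsEinsteinVariation.continuous_laplacian_sq (H : IsEinsteinVariation g h h₀ v c) :
    Continuous fun x => laplacian g v x ^ 2 := H.continuous_laplacian.pow 2

omit [CompactSpace M] in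
theorem IsEinsteinVariation.continuous_sq (H : IsEinsteinVariation g h h₀ v c) :
    Continuous fun x => v x ^ 2 := H.smooth_v.continuous.pow 2

variable [T2Space M] [MeasurableSpace M] [BorelSpace M]

theorem IsEinsteinVariation.integral_mul_laplacian (H : IsEinsteinVariation g h h₀ v c) :
    ∫ x, v x * laplacian g v x ∂(volumeMeasure g) = -∫ x, gradSq g v x ∂(volumeMeasure g) := by
  rw [← add_eq_zero_iff_eq_neg, ← integral_add
    (integrable_volumeMeasure H.metric H.continuous_mul_laplacian)
    (integrable_volumeMeasure H.metric H.continuous_gradSq)]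
  exact QuotientCurvature.integral_mul_laplacian H.metric H.smooth_v

/-- The linearized identity in the purely transverse traceless direction, where the conformal terms
are absent. -/
theorem IsEinsteinVariation.integral_innerHess_einsteinOp (H : IsEinsteinVariation g h h₀ v c) :
    ∫ x, innerHess g (fun d => einsteinOp (comp g d) (comp h₀ d)) v x ∂(volumeMeasure g) = 0 := by
  have h1 := H.traceless.integral_hess_pairing H.smooth_v
  have h2 : ∀ x : M, laplacian g (fun _ => 0) x = 0 := fun x => by
    have := laplacian_const_mul (g := g) (f := fun _ : M => (0 : ℝ)) 0 x
    simpa only [zero_mul] using this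
  have h3 : ∀ d : M, read (n := n) (fun _ : M => (0 : ℝ)) d = fun _ => 0 := fun _ => rfl
  have h4 : ∀ (x : M) (B : M → Rn n → Matrix (Fin n) (Fin n) ℝ),
      atCenter (fun d => tensorInner (comp g d) 0 (B d)) x = 0 := fun x B => by
    simp [atCenter, tensorInner]
  simp only [h2, h3, Coord.hess_zero, h4, zero_mul, mul_zero, add_zero, sub_zero] at h1
  rw [integral_const_mul] at h1
  -- The remaining factor is the $-\frac12$ in front of $\Delta_E$.
  exact (mul_eq_zero.1 h1).resolve_left (by norm_num)

theorem IsEinsteinVariation.integral_innerHess (H : IsEinsteinVariation g h h₀ v c) :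
    ∫ x, innerHess g (comp h₀) v x ∂(volumeMeasure g) = 0 :=
  integral_tensorInner_hess H.metric H.smooth₀.isTensor H.div₀ H.smooth_v

/-- Bochner's formula, obtained from the linearized identity in the direction $h$ with test function
$v$. The factor $n-2$ is divided out. -/
theorem IsEinsteinVariation.integral_normSqHess (H : IsEinsteinVariation g h h₀ v c)
    (hn : 3 ≤ n) : ∫ x, normSqHess g v x ∂(volumeMeasure g) =
      ∫ x, laplacian g v x ^ 2 ∂(volumeMeasure g) - c * ∫ x, gradSq g v x ∂(volumeMeasure g) := by
  have hn2 : (n : ℝ) - 2 ≠ 0 := by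
    have : (3 : ℝ) ≤ n := by exact_mod_cast hn
    linarith
  have h1 := integral_linearCombination_four H.metric
    (H.continuous_innerHess H.isTensor_einsteinOp) H.continuous_laplacian_sq
    H.continuous_mul_laplacian H.continuous_normSqHess
    (-(1 / 2)) (((n : ℝ) - 2) / 2) (((n : ℝ) - 2) / 2 * c) (-(((n : ℝ) - 2) / 2))
  rw [H.integral_innerHess_einsteinOp, H.integral_mul_laplacian] at h1
  have h2 : (0 : ℝ) = _ := ((H.integral_hess_pairing H.smooth_v).symm.trans
    (integral_congr_ae (ae_of_all _ fun x => by
      simp only [innerHess, normSqHess]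
      ring))).trans h1
  have h3 : ((n : ℝ) - 2) * (∫ x, normSqHess g v x ∂(volumeMeasure g) -
      (∫ x, laplacian g v x ^ 2 ∂(volumeMeasure g) - c * ∫ x, gradSq g v x ∂(volumeMeasure g)))
      = 0 := by linear_combination 2 * h2
  exact sub_eq_zero.1 ((mul_eq_zero.1 h3).resolve_left hn2)

theorem IsEinsteinVariation.integral_traceFreeSq (H : IsEinsteinVariation g h h₀ v c)
    (hn : 3 ≤ n) : ∫ x, traceFreeSq g h₀ v x ∂(volumeMeasure g) =
      1 / 4 * ∫ x, normSqEinsteinOp g h₀ x ∂(volumeMeasure g) + ((n : ℝ) - 2) ^ 2 / 4 *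
        ((1 - 1 / n) * ∫ x, laplacian g v x ^ 2 ∂(volumeMeasure g)
          - c * ∫ x, gradSq g v x ∂(volumeMeasure g)) := by
  have h1 := integral_linearCombination_four H.metric H.continuous_normSqEinsteinOp
    (H.continuous_innerHess H.isTensor_einsteinOp) H.continuous_normSqHess
    H.continuous_laplacian_sq (1 / 4) (((n : ℝ) - 2) / 2) (((n : ℝ) - 2) ^ 2 / 4)
    (-(((n : ℝ) - 2) ^ 2 / 4 * (1 / n)))
  rw [H.integral_innerHess_einsteinOp, H.integral_normSqHess hn] at h1
  refine (integral_congr_ae (ae_of_all _ fun x => ?_)).trans (h1.trans ?_)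
  · simp only [traceFreeSq]
    ring
  · ring

/-- The pairing of $\mathring h$ with $\mathrm{Hess}\,v$ integrates to zero, and $\int v\Delta
v=-\int|\nabla v|^2$. -/
theorem IsEinsteinVariation.integral_scalarSecondDeriv_eq (H : IsEinsteinVariation g h h₀ v c) :
    ∫ x, scalarSecondDeriv g h x ∂(volumeMeasure g) =
      1 / 2 * ∫ x, innerEinsteinOp g h₀ x ∂(volumeMeasure g)
        + c * ∫ x, normSq g h₀ x ∂(volumeMeasure g)
        - ((n : ℝ) - 1) * (1 + n / 2) * ∫ x, gradSq g v x ∂(volumeMeasure g)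
        + 2 * n * c * ∫ x, v x ^ 2 ∂(volumeMeasure g) := by
  have h1 := integral_linearCombination_six H.metric H.continuous_scalarSecondDeriv
    H.continuous_innerEinsteinOp (H.continuous_innerHess H.smooth₀.isTensor)
    H.continuous_mul_laplacian H.continuous_sq
    H.continuous_normSq 1 (-(1 / 2)) (-(((n : ℝ) - 2) / 2)) (-(((n : ℝ) - 1) * (1 + n / 2)))
    (-(2 * n * c)) (-c)
  rw [H.integral_innerHess, H.integral_mul_laplacian] at h1
  have h2 : (0 : ℝ) = _ := (H.integral_scalarSecondDeriv.symm.trans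
    (integral_congr_ae (ae_of_all _ fun x => by
      simp only [innerHess, normSq]
      ring))).trans h1
  linear_combination -h2

/-- The Laplacian integrates to zero, so only the mean of $v$ enters the first variation. -/
theorem IsEinsteinVariation.integral_firstOrder (H : IsEinsteinVariation g h h₀ v c)
    (hc : c ≠ 0) (a b : ℝ) :
    ∫ x, (a * scalarLogDeriv g v c x + b * v x) ∂(volumeMeasure g) =
      (b - n * a) * ∫ x, v x ∂(volumeMeasure g) := by
  have h1 := integral_add
    ((integrable_volumeMeasure H.metric H.continuous_laplacian).const_mul
      (a * (-((n : ℝ) - 1) / c)))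
    ((integrable_volumeMeasure H.metric H.smooth_v.continuous).const_mul (b - n * a))
  rw [integral_const_mul, integral_const_mul, integral_laplacian H.metric H.smooth_v, mul_zero,
    zero_add] at h1
  refine (integral_congr_ae (ae_of_all _ fun x => ?_)).trans h1
  simp only [scalarLogDeriv]
  field_simp
  ring

theorem IsEinsteinVariation.integral_scalarLogDeriv_sq (H : IsEinsteinVariation g h h₀ v c)
    (hc : c ≠ 0) : ∫ x, scalarLogDeriv g v c x ^ 2 ∂(volumeMeasure g) =
      (((n : ℝ) - 1) / c) ^ 2 * ∫ x, laplacian g v x ^ 2 ∂(volumeMeasure g)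
        - 2 * n * (((n : ℝ) - 1) / c) * ∫ x, gradSq g v x ∂(volumeMeasure g)
        + (n : ℝ) ^ 2 * ∫ x, v x ^ 2 ∂(volumeMeasure g) := by
  have h1 := integral_linearCombination_four H.metric H.continuous_laplacian_sq
    H.continuous_mul_laplacian H.continuous_sq
    (continuous_const (y := (0 : ℝ))) ((((n : ℝ) - 1) / c) ^ 2) (2 * n * (((n : ℝ) - 1) / c)) ((n : ℝ) ^ 2) 0
  rw [H.integral_mul_laplacian] at h1
  refine (integral_congr_ae (ae_of_all _ fun x => ?_)).trans (h1.trans ?_)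
  · simp only [scalarLogDeriv]
    field_simp
    ring
  · ring

theorem IsEinsteinVariation.integral_scalarLogDeriv_mul (H : IsEinsteinVariation g h h₀ v c)
    (hc : c ≠ 0) : ∫ x, scalarLogDeriv g v c x * v x ∂(volumeMeasure g) =
      ((n : ℝ) - 1) / c * ∫ x, gradSq g v x ∂(volumeMeasure g)
        - n * ∫ x, v x ^ 2 ∂(volumeMeasure g) := by
  have h1 := integral_linearCombination_four H.metric
    H.continuous_mul_laplacian H.continuous_sq
    (continuous_const (y := (0 : ℝ))) (continuous_const (y := (0 : ℝ))) (-(((n : ℝ) - 1) / c)) (-n) 0 0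
  rw [H.integral_mul_laplacian] at h1
  refine (integral_congr_ae (ae_of_all _ fun x => ?_)).trans (h1.trans ?_)
  · simp only [scalarLogDeriv]
    field_simp
    ring
  · ring

theorem IsEinsteinVariation.integral_secondOrder (H : IsEinsteinVariation g h h₀ v c)
    (a₁ a₂ a₃ a₄ a₅ a₆ : ℝ) :
    ∫ x, (a₁ * scalarLogDeriv g v c x ^ 2 + a₂ * traceFreeSq g h₀ v x
        + a₃ * scalarSecondDeriv g h x + a₄ * (scalarLogDeriv g v c x * v x) + a₅ * v x ^ 2
        + a₆ * normSq g h₀ x) ∂(volumeMeasure g) =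
      a₁ * ∫ x, scalarLogDeriv g v c x ^ 2 ∂(volumeMeasure g)
        + a₂ * ∫ x, traceFreeSq g h₀ v x ∂(volumeMeasure g)
        + a₃ * ∫ x, scalarSecondDeriv g h x ∂(volumeMeasure g)
        + a₄ * ∫ x, scalarLogDeriv g v c x * v x ∂(volumeMeasure g)
        + a₅ * ∫ x, v x ^ 2 ∂(volumeMeasure g) + a₆ * ∫ x, normSq g h₀ x ∂(volumeMeasure g) :=
  integral_linearCombination_six H.metric (f₁ := fun x => scalarLogDeriv g v c x ^ 2)
    (H.continuous_scalarLogDeriv.pow 2)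
    H.continuous_traceFreeSq H.continuous_scalarSecondDeriv
    (f₄ := fun x => scalarLogDeriv g v c x * v x)
    (H.continuous_scalarLogDeriv.mul H.smooth_v.continuous) H.continuous_sq
    H.continuous_normSq a₁ a₂ a₃ a₄ a₅ a₆

end SecondVariation

open Coord

/-! ### The quotient functionals -/

section Quotients

variable {n : ℕ} {M : Type*} [TopologicalSpace M] [ChartedSpace (Rn n) M] [IsManifold (𝓡 n) ∞ M]
  {g h h₀ : TensorField n M} {v : M → ℝ} {c c₀ : ℝ} [CompactSpace M]

theorem HasRelJet.of_eq {f : ℝ → ℝ} {a b d b' d' : ℝ} (h : HasRelJet f a b d) (hb : b = b')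
    (hd : d = d') : HasRelJet f a b' d' := hb ▸ hd ▸ h

/-- In the quotient the coefficient of $(R'/c)^2$ becomes $(k-l)(k-l-1)/n^2$, as if the quotient
were a pure power of degree $k-l$. The trace-free term has $k(k-1)-l(l-1)=(k-l)(k+l-1)$ and records
the departure from this. -/
theorem IsEinsteinVariation.hasRelJet_quotient (H : IsEinsteinVariation g h h₀ v c) (hn : 3 ≤ n)
    (hc : c ≠ 0) (hc₀ : c₀ = ((n : ℝ) - 2) / (2 * (n - 1)) * c) (x : M) {k l : ℕ}
    (hk : k ≤ n) (hl : l ≤ n) :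
    HasRelJet (fun t => sigma k (g + t • h) x / sigma l (g + t • h) x)
      (n.choose k * c₀ ^ k / (n.choose l * c₀ ^ l)) (((k : ℝ) - l) / n * scalarLogDeriv g v c x)
      (((k : ℝ) - l) * (k - l - 1) / n ^ 2 * scalarLogDeriv g v c x ^ 2
        + -(((k : ℝ) - l) * (k + l - 1) / (n * (n - 1) * c₀ ^ 2)) * traceFreeSq g h₀ v x
        + ((k : ℝ) - l) / (n * c) * scalarSecondDeriv g h x) := by
  refine ((H.hasRelJet_sigma hn hc hc₀ x hk).div (H.hasRelJet_sigma hn hc hc₀ x hl)).of_eq ?_ ?_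
  · ring
  · simp only [div_eq_mul_inv, mul_inv]
    ring

theorem IsEinsteinVariation.isSmoothFamily_quotient (H : IsEinsteinVariation g h h₀ v c)
    (hn : 3 ≤ n) (hc : c ≠ 0) (hc₀ : c₀ = ((n : ℝ) - 2) / (2 * (n - 1)) * c) (k : ℕ) {l : ℕ}
    (hl : l ≤ n) :
    IsSmoothFamily n fun t x => sigma (M := M) k (g + t • h) x / sigma l (g + t • h) x :=
  (H.isSmoothFamily_sigma k).div (H.isSmoothFamily_sigma l) fun x => by
    have h1 := H.hasRelJet_sigma hn hc hc₀ x hl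
    rw [h1.eq]
    exact h1.ne

variable [T2Space M] [MeasurableSpace M] [BorelSpace M] [Nonempty M]

theorem IsEinsteinVariation.hasRelJet_integral_quotient (H : IsEinsteinVariation g h h₀ v c)
    (hn : 3 ≤ n) (hc : c ≠ 0) (hc₀ : c₀ = ((n : ℝ) - 2) / (2 * (n - 1)) * c) {k l : ℕ}
    (hk : k ≤ n) (hl : l ≤ n) :
    HasRelJet (fun t => ∫ x, sigma k (g + t • h) x / sigma l (g + t • h) x ∂(volumeMeasure g))
      (n.choose k * c₀ ^ k / (n.choose l * c₀ ^ l) * (volumeMeasure g).real Set.univ)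
      (((volumeMeasure g).real Set.univ)⁻¹ * (-((k : ℝ) - l) * ∫ x, v x ∂(volumeMeasure g)))
      (((volumeMeasure g).real Set.univ)⁻¹ *
        (((k : ℝ) - l) * (k - l - 1) / n ^ 2 * ∫ x, scalarLogDeriv g v c x ^ 2 ∂(volumeMeasure g)
        + -(((k : ℝ) - l) * (k + l - 1) / (n * (n - 1) * c₀ ^ 2)) *
          ∫ x, traceFreeSq g h₀ v x ∂(volumeMeasure g)
        + ((k : ℝ) - l) / (n * c) * ∫ x, scalarSecondDeriv g h x ∂(volumeMeasure g))) := by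
  have hn0 : (n : ℝ) ≠ 0 := by
    have : n ≠ 0 := by omega
    exact_mod_cast this
  have h0 := fun x => H.hasRelJet_quotient hn hc hc₀ x hk hl
  refine ((H.isSmoothFamily_quotient hn hc hc₀ k hl).hasRelJet_integral H.metric h0
    (volumeMeasure_real_univ_pos H.metric).ne' (h0 (Classical.arbitrary M)).ne).of_eq ?_ ?_
  · have h1 := H.integral_firstOrder hc (((k : ℝ) - l) / n) 0
    simp only [zero_mul, add_zero, zero_sub] at h1
    rw [h1]
    field_simp
  · have h1 := H.integral_secondOrder (((k : ℝ) - l) * (k - l - 1) / n ^ 2)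
      (-(((k : ℝ) - l) * (k + l - 1) / (n * (n - 1) * c₀ ^ 2))) (((k : ℝ) - l) / (n * c)) 0 0 0
    simp only [zero_mul, add_zero] at h1
    rw [h1]

/-- The varying volume is handled by multiplying with the density ratio, whose relative jet adds
$\frac n2v$ at first order and the cross term and $|\mathring h|^2$ at second order. -/
theorem IsEinsteinVariation.hasRelJet_integral_quotient_volume
    (H : IsEinsteinVariation g h h₀ v c) (hn : 3 ≤ n) (hc : c ≠ 0)
    (hc₀ : c₀ = ((n : ℝ) - 2) / (2 * (n - 1)) * c) {k l : ℕ} (hk : k ≤ n) (hl : l ≤ n) :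
    HasRelJet (fun t => ∫ x, sigma k (g + t • h) x / sigma l (g + t • h) x
        ∂(volumeMeasure (g + t • h)))
      (n.choose k * c₀ ^ k / (n.choose l * c₀ ^ l) * (volumeMeasure g).real Set.univ)
      (((volumeMeasure g).real Set.univ)⁻¹ * ((n / 2 - ((k : ℝ) - l)) *
        ∫ x, v x ∂(volumeMeasure g)))
      (((volumeMeasure g).real Set.univ)⁻¹ *
        (((k : ℝ) - l) * (k - l - 1) / n ^ 2 * ∫ x, scalarLogDeriv g v c x ^ 2 ∂(volumeMeasure g)
        + -(((k : ℝ) - l) * (k + l - 1) / (n * (n - 1) * c₀ ^ 2)) *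
          ∫ x, traceFreeSq g h₀ v x ∂(volumeMeasure g)
        + ((k : ℝ) - l) / (n * c) * ∫ x, scalarSecondDeriv g h x ∂(volumeMeasure g)
        + ((k : ℝ) - l) * ∫ x, scalarLogDeriv g v c x * v x ∂(volumeMeasure g)
        + ((n : ℝ) ^ 2 / 4 - n / 2) * ∫ x, v x ^ 2 ∂(volumeMeasure g)
        + -(1 / 2) * ∫ x, normSq g h₀ x ∂(volumeMeasure g))) := by
  have hn0 : (n : ℝ) ≠ 0 := by
    have : n ≠ 0 := by omega
    exact_mod_cast this
  have h0 := fun x => (H.hasRelJet_quotient hn hc hc₀ x hk hl).mul (H.hasRelJet_densityRatio x)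
  simp only [mul_one] at h0
  have hF := H.isSmoothFamily_quotient hn hc hc₀ k hl
  refine (((hF.mul H.isSmoothFamily_densityRatio).hasRelJet_integral H.metric h0
    (volumeMeasure_real_univ_pos H.metric).ne' (h0 (Classical.arbitrary M)).ne).congr ?_).of_eq ?_ ?_
  · filter_upwards [H.eventually_isMetric, hF.eventually_continuous] with t ht hct
    exact integral_volumeMeasure_eq H.metric ht hct
  · have h1 := H.integral_firstOrder hc (((k : ℝ) - l) / n) (n / 2)
    rw [mul_div_cancel₀ _ hn0] at h1
    rw [← h1]
    congr 1
    refine integral_congr_ae (ae_of_all _ fun x => ?_)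
    beta_reduce
    ring
  · rw [← H.integral_secondOrder]
    congr 1
    refine integral_congr_ae (ae_of_all _ fun x => ?_)
    simp only [normSq]
    field_simp
    ring

end Quotients

/-! ### Conclusion: from transverse traceless data to the final identity -/

section

variable {n : ℕ} {M : Type*} [TopologicalSpace M] [ChartedSpace (Rn n) M] [IsManifold (𝓡 n) ∞ M]

omit [IsManifold (𝓡 n) ∞ M] in
theorem add_zero_smul (g h : TensorField n M) : g + (0 : ℝ) • h = g := by
  funext x
  refine ContinuousLinearMap.ext fun a => ContinuousLinearMap.ext fun b => ?_
  show form g x a b + 0 * form h x a b = form g x a b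
  ring

/-- The variation of an Einstein metric in the direction of a conformal plus a transverse
traceless tensor. -/
theorem isEinsteinVariation_of_isTT
    {gbar : Bundle.ContMDiffRiemannianMetric (𝓡 n) ∞ (Rn n) (fun x : M ↦ TangentSpace (𝓡 n) x)}
    {lam : ℝ} (hE : IsEinstein gbar.inner lam) {h h₀ : TensorField n M} (hh : IsSmoothSymm h)
    (hTT : IsTT gbar.inner h₀)
    (hdecomp : ∀ x : M, h x = h₀ x + (tr gbar.inner h x / (n : ℝ)) • gbar.inner x) :
    IsEinsteinVariation gbar.inner h h₀ (fun x => (n : ℝ)⁻¹ * tr gbar.inner h x)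
      (((n : ℝ) - 1) * lam) where
  smooth_g := isSmoothSymm_inner gbar
  metric := isMetric_inner gbar
  ricci_eq := hE
  smooth₀ := hTT.smoothSymm
  smooth_h := hh
  trace₀ d y hy := by
    rw [← (hTT.smoothSymm.isTensor.isScalar_trace (isMetric_inner gbar)).atCenter_symm hy]
    exact hTT.trace_eq_zero _
  div₀ := hTT.divergence_eq_zero
  smooth_v d y hy := contDiffAt_const.mul
    (hh.isTensor.isSmoothFun_trace (isMetric_inner gbar) d y hy)
  eq x a b := by
    have h1 := congrArg (fun L : Rn n →L[ℝ] Rn n →L[ℝ] ℝ => L a b) (hdecomp x)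
    rw [inv_mul_eq_div]
    exact h1

end

/-- Here $I_1,\dots,I_7$ stand for the integrals of $(\Delta u)^2$, $|\nabla u|^2$, $u^2$, $u$,
$|\Delta_E\mathring h|^2$, $\mathring h\cdot\Delta_E\mathring h$ and $|\mathring h|^2$. The powers
of $n^{-1}$ come from $v=u/n$. The coefficient of $I_7$ is
$\alpha(\frac{p-q}n-\frac12)+\beta\frac{k-l}n=0$. -/
theorem secondVariation_identity {n k l p q lam V I₁ I₂ I₃ I₄ I₅ I₆ I₇ : ℝ} (hn0 : n ≠ 0)
    (hn1 : n - 1 ≠ 0) (hn2 : n - 2 ≠ 0) (hlam : lam ≠ 0) (hV : V ≠ 0) :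
    (2 * (k - l) * (2 * (k - l) - 1) * (V⁻¹ * ((n / 2 - (p - q)) * (n⁻¹ * I₄))) ^ 2 +
      2 * (k - l) * (V⁻¹ *
        ((p - q) * (p - q - 1) / n ^ 2 * (((n - 1) / ((n - 1) * lam)) ^ 2 * (n⁻¹ ^ 2 * I₁) -
            2 * n * ((n - 1) / ((n - 1) * lam)) * (n⁻¹ ^ 2 * I₂) + n ^ 2 * (n⁻¹ ^ 2 * I₃)) +
          -((p - q) * (p + q - 1) / (n * (n - 1) * ((n - 2) * lam / 2) ^ 2)) *
            (1 / 4 * I₅ + (n - 2) ^ 2 / 4 *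
              ((1 - 1 / n) * (n⁻¹ ^ 2 * I₁) - (n - 1) * lam * (n⁻¹ ^ 2 * I₂))) +
          (p - q) / (n * ((n - 1) * lam)) *
            (1 / 2 * I₆ + (n - 1) * lam * I₇ - (n - 1) * (1 + n / 2) * (n⁻¹ ^ 2 * I₂) +
              2 * n * ((n - 1) * lam) * (n⁻¹ ^ 2 * I₃)) +
          (p - q) * ((n - 1) / ((n - 1) * lam) * (n⁻¹ ^ 2 * I₂) - n * (n⁻¹ ^ 2 * I₃)) +
          (n ^ 2 / 4 - n / 2) * (n⁻¹ ^ 2 * I₃) + -(1 / 2) * I₇)) +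
      2 * (2 * (k - l) * (V⁻¹ * ((n / 2 - (p - q)) * (n⁻¹ * I₄)))) *
        ((n - 2 * (p - q)) * (V⁻¹ * (-(k - l) * (n⁻¹ * I₄)))) +
      ((n - 2 * (p - q)) * (n - 2 * (p - q) - 1) * (V⁻¹ * (-(k - l) * (n⁻¹ * I₄))) ^ 2 +
        (n - 2 * (p - q)) * (V⁻¹ *
          ((k - l) * (k - l - 1) / n ^ 2 * (((n - 1) / ((n - 1) * lam)) ^ 2 * (n⁻¹ ^ 2 * I₁) -
              2 * n * ((n - 1) / ((n - 1) * lam)) * (n⁻¹ ^ 2 * I₂) + n ^ 2 * (n⁻¹ ^ 2 * I₃)) +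
            -((k - l) * (k + l - 1) / (n * (n - 1) * ((n - 2) * lam / 2) ^ 2)) *
              (1 / 4 * I₅ + (n - 2) ^ 2 / 4 *
                ((1 - 1 / n) * (n⁻¹ ^ 2 * I₁) - (n - 1) * lam * (n⁻¹ ^ 2 * I₂))) +
            (k - l) / (n * ((n - 1) * lam)) *
              (1 / 2 * I₆ + (n - 1) * lam * I₇ - (n - 1) * (1 + n / 2) * (n⁻¹ ^ 2 * I₂) +
                2 * n * ((n - 1) * lam) * (n⁻¹ ^ 2 * I₃)))))) * V =
    -(2 * (k - l) * ((n - 2 * (p - q)) * (k + l) + 2 * (p ^ 2 - q ^ 2) - n) /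
          (2 * n * (n - 1) * (n - 2) ^ 2 * lam ^ 2)) * I₅ +
        2 * (k - l) / (4 * (n - 1) * lam) * I₆ -
      2 * (k - l) * (2 * (p - q) * (q - l) + n * l) / (n ^ 4 * lam ^ 2) * (I₁ - n * lam * I₂) -
      2 * (k - l) * (n - 2 * (p - q)) * (2 * (k - l) + (n - 2 * (p - q))) / (4 * n ^ 3 * lam) *
        (I₂ - n * lam * (I₃ - 2 * (V⁻¹ * I₄) * I₄ + (V⁻¹ * I₄) ^ 2 * V)) := by
  field_simp
  ring

end QuotientCurvature

end

theorem mainTheorem5 {n : ℕ} (hn : 3 ≤ n)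
    {M : Type*} [TopologicalSpace M] [ChartedSpace (QuotientCurvature.Rn n) M]
    [IsManifold (𝓡 n) ∞ M] [CompactSpace M] [T2Space M] [Nonempty M]
    [MeasurableSpace M] [BorelSpace M]
    (k l p q : ℕ) (hlk : l < k) (hk : k ≤ n) (hp : p ≤ n) (hq : q ≤ n)
    (gbar : Bundle.ContMDiffRiemannianMetric (𝓡 n) ∞ (QuotientCurvature.Rn n)
      (fun x : M ↦ TangentSpace (𝓡 n) x))
    (lam : ℝ) (hlam : lam ≠ 0)
    (hEinstein : QuotientCurvature.IsEinstein gbar.inner lam)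
    (h h₀ : QuotientCurvature.TensorField n M)
    (hh : QuotientCurvature.IsSmoothSymm h)
    (hTT : QuotientCurvature.IsTT gbar.inner h₀)
    (hdecomp : ∀ x : M,
      h x = h₀ x + (QuotientCurvature.tr gbar.inner h x / (n : ℝ)) • gbar.inner x) :
    let H : QuotientCurvature.TensorField n M → ℝ :=
      QuotientCurvature.functionalH k l p q gbar.inner
    let dv : MeasureTheory.Measure M := QuotientCurvature.volumeMeasure gbar.inner
    let Vol : ℝ := dv.real Set.univ
    let α : ℝ := 2 * ((k : ℝ) - l)
    let β : ℝ := n - 2 * ((p : ℝ) - q)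
    let u : M → ℝ := QuotientCurvature.tr gbar.inner h
    let ubar : ℝ := Vol⁻¹ * ∫ x, u x ∂dv
    H gbar.inner ≠ 0 ∧
    ContDiffAt ℝ 2 (fun t : ℝ ↦ H (gbar.inner + t • h)) 0 ∧
    (H gbar.inner)⁻¹ * Vol * iteratedDeriv 2 (fun t : ℝ ↦ H (gbar.inner + t • h)) 0 =
      - (α * (β * (k + l) + 2 * ((p : ℝ) ^ 2 - (q : ℝ) ^ 2) - n)
          / (2 * n * (n - 1) * (n - 2) ^ 2 * lam ^ 2))
          * (∫ x, QuotientCurvature.normSqEinsteinOp gbar.inner h₀ x ∂dv)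
      + α / (4 * (n - 1) * lam)
          * (∫ x, QuotientCurvature.innerEinsteinOp gbar.inner h₀ x ∂dv)
      - α * (2 * ((p : ℝ) - q) * ((q : ℝ) - l) + n * l) / (n ^ 4 * lam ^ 2)
          * (∫ x, ((QuotientCurvature.laplacian gbar.inner u x) ^ 2
              - n * lam * QuotientCurvature.gradSq gbar.inner u x) ∂dv)
      - α * β * (α + β) / (4 * n ^ 3 * lam)
          * (∫ x, (QuotientCurvature.gradSq gbar.inner u x
              - n * lam * (u x - ubar) ^ 2) ∂dv) := by
  intro H dv Vol α β u ubar
  have hn3 : (3 : ℝ) ≤ n := by exact_mod_cast hn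
  have hn0 : (n : ℝ) ≠ 0 := by linarith
  have hn1 : (n : ℝ) - 1 ≠ 0 := by linarith
  have hn2 : (n : ℝ) - 2 ≠ 0 := by linarith
  have hV := QuotientCurvature.isEinsteinVariation_of_isTT hEinstein hh hTT hdecomp
  have hc : ((n : ℝ) - 1) * lam ≠ 0 := mul_ne_zero hn1 hlam
  have hc₀ : ((n : ℝ) - 2) * lam / 2 = ((n : ℝ) - 2) / (2 * (n - 1)) * (((n : ℝ) - 1) * lam) := by
    field_simp
  have hVol : Vol ≠ 0 := (QuotientCurvature.volumeMeasure_real_univ_pos hV.metric).ne'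
  -- Only the first factor integrates against the varying volume; the second keeps the fixed measure
  -- of the background metric.
  have hJ := ((hV.hasRelJet_integral_quotient_volume hn hc hc₀ hp hq).zpow (2 * ((k : ℤ) - l))).mul
    ((hV.hasRelJet_integral_quotient hn hc hc₀ hk (hlk.le.trans hk)).zpow
      ((n : ℤ) - 2 * ((p : ℤ) - q)))
  have hHe : (fun t : ℝ => H (gbar.inner + t • h)) = fun t =>
      (∫ x, QuotientCurvature.sigma p (gbar.inner + t • h) x /
        QuotientCurvature.sigma q (gbar.inner + t • h) x
        ∂(QuotientCurvature.volumeMeasure (gbar.inner + t • h))) ^ (2 * ((k : ℤ) - l)) *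
      (∫ x, QuotientCurvature.sigma k (gbar.inner + t • h) x /
        QuotientCurvature.sigma l (gbar.inner + t • h) x
        ∂(QuotientCurvature.volumeMeasure gbar.inner)) ^ ((n : ℤ) - 2 * ((p : ℤ) - q)) := rfl
  rw [← hHe] at hJ
  have hH0 := hJ.eq
  rw [QuotientCurvature.add_zero_smul] at hH0
  have hHne : H gbar.inner ≠ 0 := by
    rw [hH0]
    exact hJ.ne
  refine ⟨hHne, hJ.contDiff, ?_⟩
  -- In relative form the second derivative is the value of the functional times the coefficient, so
  -- dividing by the nonzero value leaves just that coefficient.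
  rw [iteratedDeriv_succ, iteratedDeriv_one, hJ.deriv_deriv_eq, ← hH0, mul_right_comm,
    inv_mul_cancel_left₀ hHne]
  have hg := hV.metric
  have hus : QuotientCurvature.IsSmoothFun (n := n) u := hh.isTensor.isSmoothFun_trace hg
  have huc : Continuous u := hus.continuous
  have hlc := (QuotientCurvature.isSmoothFun_laplacian hg hus).continuous
  have hgc := (QuotientCurvature.isSmoothFun_gradSq hg hus).continuous
  -- The variation was computed with $v=u/n$; these identities rewrite its integrals in terms of
  -- $u$, and those of the claim in terms of the same basic integrals.
  have e₁ : ∫ x, QuotientCurvature.laplacian gbar.inner (fun x => (n : ℝ)⁻¹ * u x) x ^ 2 ∂dv =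
      ((n : ℝ)⁻¹) ^ 2 * ∫ x, QuotientCurvature.laplacian gbar.inner u x ^ 2 ∂dv := by
    rw [← integral_const_mul]
    exact integral_congr_ae (ae_of_all _ fun x => by
      beta_reduce
      rw [QuotientCurvature.laplacian_const_mul, mul_pow])
  have e₂ : ∫ x, QuotientCurvature.gradSq gbar.inner (fun x => (n : ℝ)⁻¹ * u x) x ∂dv =
      ((n : ℝ)⁻¹) ^ 2 * ∫ x, QuotientCurvature.gradSq gbar.inner u x ∂dv := by
    rw [← integral_const_mul]
    exact integral_congr_ae (ae_of_all _ fun x => QuotientCurvature.gradSq_const_mul _ x)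
  have e₃ : ∫ x, ((n : ℝ)⁻¹ * u x) ^ 2 ∂dv = ((n : ℝ)⁻¹) ^ 2 * ∫ x, u x ^ 2 ∂dv := by
    rw [← integral_const_mul]
    exact integral_congr_ae (ae_of_all _ fun x => mul_pow _ _ _)
  have e₄ : ∫ x, (n : ℝ)⁻¹ * u x ∂dv = (n : ℝ)⁻¹ * ∫ x, u x ∂dv := integral_const_mul _ _
  have e₅ : ∫ x, ((QuotientCurvature.laplacian gbar.inner u x) ^ 2
      - n * lam * QuotientCurvature.gradSq gbar.inner u x) ∂dv =
      ∫ x, QuotientCurvature.laplacian gbar.inner u x ^ 2 ∂dv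
        - n * lam * ∫ x, QuotientCurvature.gradSq gbar.inner u x ∂dv := by
    refine (integral_sub (QuotientCurvature.integrable_volumeMeasure hg (hlc.pow 2))
      ((QuotientCurvature.integrable_volumeMeasure hg hgc).const_mul (n * lam))).trans ?_
    rw [integral_const_mul]
    rfl
  have e₆ : ∫ x, (QuotientCurvature.gradSq gbar.inner u x - n * lam * (u x - ubar) ^ 2) ∂dv =
      ∫ x, QuotientCurvature.gradSq gbar.inner u x ∂dv
        - n * lam * (∫ x, u x ^ 2 ∂dv - 2 * ubar * ∫ x, u x ∂dv + ubar ^ 2 * Vol) := by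
    have h1 := QuotientCurvature.integral_linearCombination_four hg hgc
      (f₂ := fun x => u x ^ 2) (huc.pow 2) huc (continuous_const (y := (1 : ℝ)))
      1 (-(n * lam)) (n * lam * (2 * ubar)) (-(n * lam * ubar ^ 2))
    have h2 : ∫ _, (1 : ℝ) ∂dv = Vol := by
      rw [integral_const, smul_eq_mul, mul_one]
    refine (integral_congr_ae (ae_of_all _ fun x => ?_)).trans (h1.trans ?_)
    · ring
    · rw [h2]
      ring
  rw [hV.integral_scalarLogDeriv_sq hc, hV.integral_scalarLogDeriv_mul hc,
    hV.integral_traceFreeSq hn, hV.integral_scalarSecondDeriv_eq]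
  rw [e₁, e₂, e₃, e₄, e₅, e₆]
  -- With the integrals replaced by independent real variables, what is left is a rational identity.
  generalize (∫ x, QuotientCurvature.laplacian gbar.inner u x ^ 2 ∂dv) = I₁
  generalize (∫ x, QuotientCurvature.gradSq gbar.inner u x ∂dv) = I₂
  generalize (∫ x, u x ^ 2 ∂dv) = I₃
  generalize hI₄ : (∫ x, u x ∂dv) = I₄
  generalize (∫ x, QuotientCurvature.normSqEinsteinOp gbar.inner h₀ x ∂dv) = I₅
  generalize (∫ x, QuotientCurvature.innerEinsteinOp gbar.inner h₀ x ∂dv) = I₆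
  generalize (∫ x, QuotientCurvature.normSq gbar.inner h₀ x ∂dv) = I₇
  have hubar : ubar = Vol⁻¹ * I₄ := by rw [← hI₄]
  rw [hubar]
  push_cast
  exact QuotientCurvature.secondVariation_identity hn0 hn1 hn2 hlam hVol
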